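/- Let $k,m,n\ge 0$ and let $\mathfrak N\subset\mathbb C^{k+m}$ be a smooth ($\mathcal C^\infty$) generic submanifold of CR dimension $k$, i.e. an embedded submanifold of real dimension $2k+m$ whose tangent spaces span $\mathbb C^{k+m}$ over $\mathbb C$. Let $h:\mathfrak N\to\mathbb C^n$ be a smooth CR map and let $N=\{(p',h(p')):p'\in\mathfrak N\}\subset\mathbb C^{k+m+n}$ be its graph. Fix $p_0'\in\mathfrak N$ and put $p_0=(p_0',h(p_0'))$. Distributions on $N$ and on $\mathfrak N$ are identified through the projection $N\to\mathfrak N$, and are written in a local parametrization of $\mathfrak N$ near $p_0'$, with Lebesgue measure $dx$ in the parameters. *Definitions.* Let $S$ be a parametrized submanifold of $\mathbb C^d$ (an open piece of $\mathfrak N$ or of $N$). A wedge with edge $S$ is a set $\mathcal W=\{x+y: x\in S,\ y\in\Gamma,\ |y|<\varepsilon\}$ with $\varepsilon>0$ and $\Gamma\subset\mathbb C^d$ a nonempty open convex cone; it is of direction $v$ if $v\in\Gamma$. A function $F\in\mathcal O(\mathcal W)$ has slow growth if $|F(z)|\,\mathrm{dist}(z,S)^{\ell}\le C$ on $\mathcal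 W$ for some $C$ and some integer $\ell\ge1$. A distribution $u$ on $S$ is the boundary value of $F$ if $\lim_{t\to0^+}\int_S F(x+ty)\varphi(x)\,dx=\langle u,\varphi\rangle$ for every test function $\varphi$ on $S$ and every $y\in\Gamma$. A distribution $u$ on $\mathfrak N$ (or on $N$) is decomposable at $p_0'$ (resp. $p_0$) if, in a neighborhood of $p_0'$ in $\mathfrak N$, it is a finite sum of CR distributions, each of which is the boundary value of a holomorphic function of slow growth on some wedge in $\mathbb C^{k+m}$ whose edge is that neighborhood. **Theorem.** Assume that each component of $h$ is decomposable at $p_0'$. Let $v\in\mathbb C^{k+m+n}$ be complex transversal to $N$ at $p_0$, i.e. $v\notin\operatorname{span}_{\mathbb C}T_{p_0}N$, and let $f$ be a CR distribution on $N$ that is decomposable at $p_0$. Then there is a wedge $\mathcal W$ of direction $v$ in $\mathbb C^{k+m+n}$, whose edge is a neighborhood of $p_0$ in $N$, such that: 1. there is $F\in\mathcal O(\mathcal W)$, of slow growth, whose boundary value is $f$ on the edge of $\mathcal W$; 2. there are $F_1,\dots,F_n\in\mathcal O(\mathcal W)$ with $dF_1\wedge\dots\wedge dF_n\neq0$ at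 every point of $\mathcal W$, each of which vanishes to order one on the edge: at every point of the edge, $F_\ell$ tends to $0$ and $dF_\ell$ has a nonzero limit along $\mathcal W$. -/

import Mathlib

open Set Filter Topology TopologicalSpace MeasureTheory
open scoped ContDiff Distributions

noncomputable section

/-- Parameter space `ℝ^d` for a real `d`-dimensional submanifold. -/
abbrev RSpace (d : ℕ) : Type := EuclideanSpace ℝ (Fin d)

/-- The complex space `ℂ^N`. -/
abbrev CSpace (N : ℕ) : Type := EuclideanSpace ℂ (Fin N)

variable {d : ℕ} {V : Type*} [NormedAddCommGroup V] [NormedSpace ℂ V]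

/-! ### Submanifolds of a complex vector space, tangent spaces, CR maps -/

/-- `γ : Ω → M` is a smooth local parametrization of `M ⊆ V`, i.e. a smooth immersion which is a
homeomorphism from the open set `Ω ⊆ ℝ^d` onto a relatively open subset of `M`.
Only the values of `γ` on `Ω` matter. -/
structure IsLocalParam (M : Set V) (Ω : Opens (RSpace d)) (γ : RSpace d → V) : Prop where
  smooth : ContDiffOn ℝ ∞ γ Ω
  immersion : ∀ x ∈ Ω, Function.Injective (fderiv ℝ γ x)
  embedding : IsEmbedding (fun x : Ω => γ x)
  image_open : ∃ O : Set V, IsOpen O ∧ γ '' Ω = M ∩ O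

/-- The complex linear span of the (real) tangent space at `e x` of the submanifold parametrized
by `e`. -/
def complexTangentSpan (e : RSpace d → V) (x : RSpace d) : Submodule ℂ V :=
  Submodule.span ℂ (range (fderiv ℝ e x))

/-- `M ⊆ ℂ^(k+m)` is a smooth generic submanifold of CR dimension `k`: an embedded submanifold of
real dimension `2k+m` (so of real codimension `m`) whose tangent spaces span `ℂ^(k+m)` over `ℂ`. -/
def IsGenericSubmanifold (k m : ℕ) (M : Set (CSpace (k + m))) : Prop :=
  ∀ p ∈ M, ∃ (Ω : Opens (RSpace (2 * k + m))) (γ : RSpace (2 * k + m) → CSpace (k + m)),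
    IsLocalParam M Ω γ ∧ p ∈ γ '' Ω ∧ ∀ x ∈ Ω, complexTangentSpan γ x = ⊤

/-- The complexified tangent vector `ξ + iη` of the parameter domain, seen through the
parametrization `γ` of a submanifold of `V`, is of type `(0,1)`: it annihilates the
(restrictions of the) holomorphic coordinates of `V`. -/
def IsType01 (γ : RSpace d → V) (x ξ η : RSpace d) : Prop :=
  fderiv ℝ γ x ξ + Complex.I • fderiv ℝ γ x η = 0

/-- `h` is a smooth CR map on the `d`-dimensional submanifold `M`: in every local parametrization it
is smooth and annihilated by all tangent vectors of type `(0,1)`.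
Only the values of `h` on `M` matter. -/
def IsCRMap (d : ℕ) {W : Type*} [NormedAddCommGroup W] [NormedSpace ℂ W]
    (M : Set V) (h : V → W) : Prop :=
  ∀ (Ω : Opens (RSpace d)) (γ : RSpace d → V), IsLocalParam M Ω γ →
    ContDiffOn ℝ ∞ (fun x => h (γ x)) Ω ∧
    ∀ x ∈ Ω, ∀ ξ η : RSpace d, IsType01 γ x ξ η → IsType01 (fun y => h (γ y)) x ξ η

/-- Parametrization `x ↦ (γ x, h (γ x))` of the graph of `h` over the submanifold parametrized
by `γ`. -/
def graphParam {W : Type*} (γ : RSpace d → V) (h : V → W) (x : RSpace d) : V × W :=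
  (γ x, h (γ x))

/-! ### Distributions

A distribution on the piece `γ(Ω)` of a submanifold is a distribution on the parameter domain `Ω`;
functions on the submanifold become distributions through Lebesgue measure in the parameters. -/

/-- Restriction of a distribution to a smaller open set (meaningful for `U ≤ Ω`). -/
def restrictDist {Ω : Opens (RSpace d)} (u : 𝓓'(Ω, ℂ)) (U : Opens (RSpace d)) : 𝓓'(U, ℂ) where
  toFun φ := u (TestFunction.monoCLM ℝ φ : 𝓓(Ω, ℝ))
  map_add' φ ψ := by simp
  map_smul' c φ := by simp
  cont := u.cont.comp (TestFunction.monoCLM ℝ : 𝓓(U, ℝ) →L[ℝ] 𝓓(Ω, ℝ)).continuous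

/-- The distribution `φ ↦ ∫ φ g` given by a locally integrable function `g` on `Ω`. -/
def distOfFun (Ω : Opens (RSpace d)) (g : RSpace d → ℂ) : 𝓓'(Ω, ℂ) where
  toFun φ := TestFunction.integralAgainstBilinCLM (ContinuousLinearMap.lsmul ℝ ℝ) volume g φ
  map_add' φ ψ := by simp only [map_add]
  map_smul' c φ := by simp only [map_smul]; rfl
  cont := (TestFunction.integralAgainstBilinCLM (𝕜 := ℝ) (n := ⊤) (Ω := Ω)
    (ContinuousLinearMap.lsmul ℝ ℝ : ℝ →L[ℝ] ℂ →L[ℝ] ℂ) volume g).continuous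

/-- Divergence of a vector field on the parameter space. -/
def divergence (X : RSpace d → RSpace d) (x : RSpace d) : ℝ :=
  ∑ i, fderiv ℝ X x (EuclideanSpace.single i 1) i

/-- `u` is a CR distribution on the submanifold parametrized by `γ : Ω → V`: `L u = 0` for every
smooth vector field `L = X + iY` of type `(0,1)`. Here `⟨L u, φ⟩ = -u (div (φ X)) - i u (div (φ Y))`;
`ψ₁` and `ψ₂` are the two test functions `div (φ X)` and `div (φ Y)`. -/
def IsCRDistribution {Ω : Opens (RSpace d)} (γ : RSpace d → V) (u : 𝓓'(Ω, ℂ)) : Prop :=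
  ∀ X Y : RSpace d → RSpace d, ContDiffOn ℝ ∞ X Ω → ContDiffOn ℝ ∞ Y Ω →
    (∀ x ∈ Ω, IsType01 γ x (X x) (Y x)) →
    ∀ φ ψ₁ ψ₂ : 𝓓(Ω, ℝ),
      (∀ x, ψ₁ x = divergence (fun y => φ y • X y) x) →
      (∀ x, ψ₂ x = divergence (fun y => φ y • Y y) x) →
      u ψ₁ + Complex.I * u ψ₂ = 0

/-! ### Wedges and boundary values -/

/-- A nonempty open convex cone of directions in `V`. -/
structure IsOpenConvexCone (Γ : Set V) : Prop where
  nonempty : Γ.Nonempty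
  isOpen : IsOpen Γ
  convex : Convex ℝ Γ
  smul_mem : ∀ t : ℝ, 0 < t → ∀ y ∈ Γ, t • y ∈ Γ

/-- The wedge with edge `e(U)`, cone of directions `Γ` and height `ε`. -/
def wedge (e : RSpace d → V) (U : Set (RSpace d)) (Γ : Set V) (ε : ℝ) : Set V :=
  {z | ∃ x ∈ U, ∃ y ∈ Γ, ‖y‖ < ε ∧ z = e x + y}

/-- The distribution `u` on the submanifold piece `e(U)` extends holomorphically to the wedge with
edge `e(U)`, cone `Γ` and height `ε`, the extension being `F`: the function `F` is holomorphic
and of slow growth in the wedge and has boundary value `u`, that is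
`∫ F(e x + t y) φ(x) dx → u φ` as `t → 0⁺`, for every direction `y ∈ Γ` and test function `φ`. -/
structure IsWedgeExtension (e : RSpace d → V) (U : Opens (RSpace d)) (Γ : Set V) (ε : ℝ)
    (u : 𝓓'(U, ℂ)) (F : V → ℂ) : Prop where
  holomorphic : DifferentiableOn ℂ F (wedge e U Γ ε)
  slowGrowth : ∃ (C : ℝ) (l : ℕ), 0 < l ∧
    ∀ z ∈ wedge e U Γ ε, ‖F z‖ * Metric.infDist z (e '' U) ^ l ≤ C
  boundaryValue : ∀ y ∈ Γ, ∀ φ : 𝓓(U, ℝ),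
    Tendsto (fun t : ℝ => ∫ x, φ x • F (e x + t • y)) (𝓝[>] 0) (𝓝 (u φ))

/-- `u` is decomposable at the point `γ x₀` of the submanifold parametrized by `γ`: near this point,
`u` is a finite sum of CR distributions each of which extends holomorphically to some wedge whose
edge is (a neighborhood of the point in) the submanifold. -/
def IsDecomposableAt {Ω : Opens (RSpace d)} (γ : RSpace d → V) (u : 𝓓'(Ω, ℂ))
    (x₀ : RSpace d) : Prop :=
  ∃ U : Opens (RSpace d), U ≤ Ω ∧ x₀ ∈ U ∧
    ∃ (K : ℕ) (u' : Fin K → 𝓓'(U, ℂ)),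
      restrictDist u U = ∑ j, u' j ∧
      ∀ j, IsCRDistribution γ (u' j) ∧
        ∃ (Γ : Set V) (ε : ℝ) (F : V → ℂ), IsOpenConvexCone Γ ∧ 0 < ε ∧
          IsWedgeExtension γ U Γ ε (u' j) F

/-- `G`, holomorphic in `W`, vanishes to order (exactly) one on the subset `S` of the boundary
of `W`: on `S` the function tends to `0` and its differential has a nonzero limit. -/
def VanishesToOrderOne (W S : Set V) (G : V → ℂ) : Prop :=
  ∀ p ∈ S, Tendsto G (𝓝[W] p) (𝓝 0) ∧
    ∃ A : V →L[ℂ] ℂ, A ≠ 0 ∧ Tendsto (fderiv ℂ G) (𝓝[W] p) (𝓝 A)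

end

/-!
The wedge over the graph is reached by a holomorphic change of scale. Since `h` is a CR map, it has
near `x₀` a holomorphic extension to first order `H (z, ζ)`, depending on a complex scale `ζ`
(`exists_isApproxExtension`): near the pairs `(γ x, 0)`, in a region where `‖z - γ x‖` is at most a
small multiple of `‖ζ‖` and `ζ` lies in a narrow sector around the positive reals, `H` is holomorphic with all its
derivatives bounded, and `H (z, ζ) = h (γ x) + O(|ζ|)`,
`dH = A x ∘ dz + O(|ζ|)`, where `A x` is the complex linear map inducing the differential of `h` on
the tangent space. Up to a normalization, `H` is the convolution of the density `frameDet • h` with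
the Gaussian kernel `ζ⁻ᴺ exp (-∑ zᵢ² / ζ²)` on an `N`-dimensional totally real slice of the
submanifold. Integration by parts and the heat equation express the derivatives of such transforms
by transforms of the complex tangential derivatives of `h` (`hasFDerivAt_gaussTransform`,
`hasBddDerivs_gaussTransform`); the CR equations allow one to move the slice, so that the error is
`O(|ζ|)` at all points of the edge (`exists_norm_gaussTransform_sub_smul_le`). No decomposability of
`h` is involved.

If `v = (v', v'')` is complex transversal to the graph at `x₀`, then `v'' ≠ A x₀ v'`, so that
`ℓ (v'' - A x₀ v') = 1` for some complex linear form `ℓ`. The equation `g = Λ ℓ (w - H (z, g))` has a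
unique solution `g (z, w)` close to `Λ s` at the points close to `(γ x, h (γ x)) + s v`, by
contraction, and `g` is holomorphic with bounded derivatives; its derivatives along the edge are
`O(s)` (`IsApproxExtension.exists_scaleFunEstimates`). The components of `w - H (z, g (z, w))` are
`O(s)`, and their differentials tend to those of the components of `w - A x z`: these are the
functions which vanish to order one (`ScaleFunEstimates.vanishesToOrderOne`,
`ScaleFunEstimates.linearIndependent`).

If `f` is near `x₀` a sum of boundary values of functions `F j`, holomorphic in wedges containing the
direction `u j`, then `F (z, w) = ∑ j, F j (z + g (z, w) u j)` is holomorphic in a wedge of direction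
`v`, as `z + g u j = γ x + Λ s (u j + small)` for a large `Λ`
(`ScaleFunEstimates.isWedgeExtension_sum`). It grows slowly, because the direction `u j` may be chosen
transversal to the edge, unless the edge is open and `F j` is holomorphic across it
(`IsWedgeExtension.exists_isWedgeGrowth`). For its boundary value one compares the integrals of `F j`
over the edge translated by `τ u j` with those over the perturbed edges `γ + t y' + g u j`, which are
bounded in `C^∞` uniformly in `t` (`ScaleFunEstimates.tendsto_integral`). Differentiation of the
integrals with respect to `τ` is integration by parts, which does not change the rate of growth; so
with `τ = σ²` each step gains two powers of `σ`, and in the end the integrals are Lipschitz in `σ`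
uniformly in `t`. This permits the interchange of the limits `t → 0` and `σ → 0`
(`IsEdgeFamily.tendsto_integral`).
-/

noncomputable section

/-! ### Families of maps with uniformly bounded derivatives -/

/-- The family `f t` is `r` times differentiable on the sets `D t`, and its derivatives of order at
most `r` are bounded there, uniformly in `t`. The recursion goes through the first derivative, with
a varying target space, so that closure properties are proved by induction on `r`. -/
def HasBddDerivs (𝕜 : Type) [NontriviallyNormedField 𝕜] {T E : Type} [NormedAddCommGroup E]
    [NormedSpace 𝕜 E] (D : T → Set E) :
    ℕ → ∀ {F : Type} [NormedAddCommGroup F] [NormedSpace 𝕜 F], (T → E → F) → Prop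
  | 0, _, _, _, f => ∃ C : ℝ, ∀ t, ∀ x ∈ D t, ‖f t x‖ ≤ C
  | r + 1, F, _, _, f => (∃ C : ℝ, ∀ t, ∀ x ∈ D t, ‖f t x‖ ≤ C) ∧
      ∃ f' : T → E → E →L[𝕜] F, (∀ t, ∀ x ∈ D t, HasFDerivAt (f t) (f' t x) x) ∧
        HasBddDerivs 𝕜 D r f'

namespace HasBddDerivs

variable {𝕜 : Type} [NontriviallyNormedField 𝕜] {T : Type} {E : Type}
  [NormedAddCommGroup E] [NormedSpace 𝕜 E] {D : T → Set E}

theorem bdd {r : ℕ} {F : Type} [NormedAddCommGroup F] [NormedSpace 𝕜 F] {f : T → E → F}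
    (hf : HasBddDerivs 𝕜 D r f) : ∃ C : ℝ, 0 ≤ C ∧ ∀ t, ∀ x ∈ D t, ‖f t x‖ ≤ C := by
  have : ∃ C : ℝ, ∀ t, ∀ x ∈ D t, ‖f t x‖ ≤ C := by
    cases r with
    | zero => exact hf
    | succ r => exact hf.1
  obtain ⟨C, hC⟩ := this
  exact ⟨max C 0, le_max_right _ _, fun t x hx => (hC t x hx).trans (le_max_left _ _)⟩

theorem of_succ {r : ℕ} {F : Type} [NormedAddCommGroup F] [NormedSpace 𝕜 F] {f : T → E → F}
    (hf : HasBddDerivs 𝕜 D (r + 1) f) : HasBddDerivs 𝕜 D r f := by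
  induction r generalizing F with
  | zero => exact hf.1
  | succ r ih =>
    obtain ⟨hb, f', hf', h⟩ := hf
    exact ⟨hb, f', hf', ih h⟩

theorem subset {r : ℕ} {F : Type} [NormedAddCommGroup F] [NormedSpace 𝕜 F] {f : T → E → F}
    {D' : T → Set E} (hf : HasBddDerivs 𝕜 D r f) (h : ∀ t, D' t ⊆ D t) :
    HasBddDerivs 𝕜 D' r f := by
  induction r generalizing F with
  | zero => exact hf.imp fun C hC t x hx => hC t x (h t hx)
  | succ r ih =>
    obtain ⟨hb, f', hf', h'⟩ := hf
    exact ⟨hb.imp fun C hC t x hx => hC t x (h t hx), f', fun t x hx => hf' t x (h t hx), ih h'⟩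

/-- On open sets the derivatives may be taken to be those given by `fderiv`. -/
theorem congr {r : ℕ} {F : Type} [NormedAddCommGroup F] [NormedSpace 𝕜 F] {f g : T → E → F}
    (hf : HasBddDerivs 𝕜 D r f) (hD : ∀ t, IsOpen (D t)) (h : ∀ t, EqOn (g t) (f t) (D t)) :
    HasBddDerivs 𝕜 D r g := by
  cases r with
  | zero => exact hf.imp fun C hC t x hx => by rw [h t hx]; exact hC t x hx
  | succ r =>
    obtain ⟨hb, f', hf', h'⟩ := hf
    exact ⟨hb.imp fun C hC t x hx => by rw [h t hx]; exact hC t x hx, f', fun t x hx =>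
      (hf' t x hx).congr_of_eventuallyEq ((h t).eventuallyEq_of_mem ((hD t).mem_nhds hx)), h'⟩

theorem fderiv {r : ℕ} {F : Type} [NormedAddCommGroup F] [NormedSpace 𝕜 F] {f : T → E → F}
    (hf : HasBddDerivs 𝕜 D (r + 1) f) (hD : ∀ t, IsOpen (D t)) :
    HasBddDerivs 𝕜 D r (fun t => _root_.fderiv 𝕜 (f t)) := by
  obtain ⟨hb, f', hf', h'⟩ := hf
  exact h'.congr hD fun t x hx => (hf' t x hx).fderiv

theorem differentiableAt {r : ℕ} {F : Type} [NormedAddCommGroup F] [NormedSpace 𝕜 F]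
    {f : T → E → F} (hf : HasBddDerivs 𝕜 D (r + 1) f) {t : T} {x : E} (hx : x ∈ D t) :
    DifferentiableAt 𝕜 (f t) x :=
  (hf.2.choose_spec.1 t x hx).differentiableAt

/-- Reindexing the parameter of the family. -/
theorem comp_param {T' : Type} (s : T' → T) {r : ℕ} {F : Type} [NormedAddCommGroup F]
    [NormedSpace 𝕜 F] {f : T → E → F} (hf : HasBddDerivs 𝕜 D r f) :
    HasBddDerivs 𝕜 (fun t => D (s t)) r (fun t => f (s t)) := by
  induction r generalizing F with
  | zero => exact hf.imp fun C hC t x hx => hC _ x hx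
  | succ r ih =>
    obtain ⟨hb, f', hf', h'⟩ := hf
    exact ⟨hb.imp fun C hC t x hx => hC _ x hx, fun t => f' (s t), fun t x hx => hf' _ x hx, ih h'⟩

theorem const {r : ℕ} {F : Type} [NormedAddCommGroup F] [NormedSpace 𝕜 F] {c : T → F}
    (hc : ∃ C : ℝ, ∀ t, (D t).Nonempty → ‖c t‖ ≤ C) :
    HasBddDerivs 𝕜 D r (fun t _ => c t) := by
  induction r generalizing F with
  | zero => exact hc.imp fun C hC t x hx => hC t ⟨x, hx⟩
  | succ r ih =>
    exact ⟨hc.imp fun C hC t x hx => hC t ⟨x, hx⟩, fun _ _ => 0,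
      fun t x _ => hasFDerivAt_const _ _, ih ⟨0, by simp⟩⟩

theorem clm {r : ℕ} {F : Type} [NormedAddCommGroup F] [NormedSpace 𝕜 F] (L : E →L[𝕜] F)
    (hb : ∃ C : ℝ, ∀ t, ∀ x ∈ D t, ‖L x‖ ≤ C) : HasBddDerivs 𝕜 D r (fun _ x => L x) := by
  cases r with
  | zero => exact hb
  | succ r =>
    exact ⟨hb, fun _ _ => L, fun t x _ => L.hasFDerivAt, const ⟨‖L‖, fun _ _ => le_rfl⟩⟩

theorem clm_comp {r : ℕ} {F G : Type} [NormedAddCommGroup F] [NormedSpace 𝕜 F]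
    [NormedAddCommGroup G] [NormedSpace 𝕜 G] {f : T → E → F} (L : F →L[𝕜] G)
    (hf : HasBddDerivs 𝕜 D r f) : HasBddDerivs 𝕜 D r (fun t x => L (f t x)) := by
  have hb : ∃ C : ℝ, ∀ t, ∀ x ∈ D t, ‖L (f t x)‖ ≤ C := by
    obtain ⟨C, _, hC⟩ := hf.bdd
    exact ⟨‖L‖ * C, fun t x hx => L.le_opNorm_of_le (hC t x hx)⟩
  induction r generalizing F G with
  | zero => exact hb
  | succ r ih =>
    obtain ⟨_, f', hf', h'⟩ := hf
    refine ⟨hb, fun t x => L.comp (f' t x), fun t x hx => L.hasFDerivAt.comp x (hf' t x hx), ?_⟩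
    exact ih (ContinuousLinearMap.compL 𝕜 E F G L) h' (by
      obtain ⟨C, _, hC⟩ := h'.bdd
      exact ⟨_, fun t x hx => ContinuousLinearMap.le_opNorm_of_le _ (hC t x hx)⟩)

theorem add {r : ℕ} {F : Type} [NormedAddCommGroup F] [NormedSpace 𝕜 F] {f g : T → E → F}
    (hf : HasBddDerivs 𝕜 D r f) (hg : HasBddDerivs 𝕜 D r g) :
    HasBddDerivs 𝕜 D r (fun t x => f t x + g t x) := by
  have hb : ∃ C : ℝ, ∀ t, ∀ x ∈ D t, ‖f t x + g t x‖ ≤ C := by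
    obtain ⟨C, _, hC⟩ := hf.bdd
    obtain ⟨C', _, hC'⟩ := hg.bdd
    exact ⟨C + C', fun t x hx => norm_add_le_of_le (hC t x hx) (hC' t x hx)⟩
  induction r generalizing F with
  | zero => exact hb
  | succ r ih =>
    obtain ⟨_, f', hf', h1⟩ := hf
    obtain ⟨_, g', hg', h2⟩ := hg
    refine ⟨hb, fun t x => f' t x + g' t x, fun t x hx => (hf' t x hx).add (hg' t x hx), ?_⟩
    obtain ⟨C, _, hC⟩ := h1.bdd
    obtain ⟨C', _, hC'⟩ := h2.bdd
    exact ih h1 h2 ⟨C + C', fun t x hx => norm_add_le_of_le (hC t x hx) (hC' t x hx)⟩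

theorem neg {r : ℕ} {F : Type} [NormedAddCommGroup F] [NormedSpace 𝕜 F] {f : T → E → F}
    (hf : HasBddDerivs 𝕜 D r f) : HasBddDerivs 𝕜 D r (fun t x => - f t x) := by
  simpa using hf.clm_comp (-(ContinuousLinearMap.id 𝕜 F))

theorem sub {r : ℕ} {F : Type} [NormedAddCommGroup F] [NormedSpace 𝕜 F] {f g : T → E → F}
    (hf : HasBddDerivs 𝕜 D r f) (hg : HasBddDerivs 𝕜 D r g) :
    HasBddDerivs 𝕜 D r (fun t x => f t x - g t x) := by
  simpa [sub_eq_add_neg] using hf.add hg.neg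

theorem sum {r : ℕ} {F I : Type} [NormedAddCommGroup F] [NormedSpace 𝕜 F] (s : Finset I)
    {f : I → T → E → F} (hf : ∀ i ∈ s, HasBddDerivs 𝕜 D r (f i)) :
    HasBddDerivs 𝕜 D r (fun t x => ∑ i ∈ s, f i t x) := by
  classical
  induction s using Finset.induction_on with
  | empty => simpa using const ⟨0, by simp⟩
  | insert a s ha ih =>
    simp_rw [Finset.sum_insert ha]
    exact (hf a (Finset.mem_insert_self _ _)).add
      (ih fun i hi => hf i (Finset.mem_insert_of_mem hi))

theorem bilin {r : ℕ} {F G H : Type} [NormedAddCommGroup F] [NormedSpace 𝕜 F]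
    [NormedAddCommGroup G] [NormedSpace 𝕜 G] [NormedAddCommGroup H] [NormedSpace 𝕜 H]
    (B : F →L[𝕜] G →L[𝕜] H) {f : T → E → F} {g : T → E → G}
    (hf : HasBddDerivs 𝕜 D r f) (hg : HasBddDerivs 𝕜 D r g) :
    HasBddDerivs 𝕜 D r (fun t x => B (f t x) (g t x)) := by
  have hb : ∃ C : ℝ, ∀ t, ∀ x ∈ D t, ‖B (f t x) (g t x)‖ ≤ C := by
    obtain ⟨C, h0, hC⟩ := hf.bdd
    obtain ⟨C', h0', hC'⟩ := hg.bdd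
    refine ⟨‖B‖ * C * C', fun t x hx => (B.le_opNorm₂ _ _).trans ?_⟩
    have := hC t x hx
    have := hC' t x hx
    gcongr
  induction r generalizing F G H with
  | zero => exact hb
  | succ r ih =>
    have hf0 := hf.of_succ
    have hg0 := hg.of_succ
    obtain ⟨_, f', hf', h1⟩ := hf
    obtain ⟨_, g', hg', h2⟩ := hg
    have bb : ∀ {F G H : Type} [NormedAddCommGroup F] [NormedSpace 𝕜 F]
        [NormedAddCommGroup G] [NormedSpace 𝕜 G] [NormedAddCommGroup H] [NormedSpace 𝕜 H]
        (B : F →L[𝕜] G →L[𝕜] H) {f : T → E → F} {g : T → E → G}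
        (_ : HasBddDerivs 𝕜 D r f) (_ : HasBddDerivs 𝕜 D r g),
        ∃ C : ℝ, ∀ t, ∀ x ∈ D t, ‖B (f t x) (g t x)‖ ≤ C := by
      intro F G H _ _ _ _ _ _ B f g hf hg
      obtain ⟨C, h0, hC⟩ := hf.bdd
      obtain ⟨C', h0', hC'⟩ := hg.bdd
      refine ⟨‖B‖ * C * C', fun t x hx => (B.le_opNorm₂ _ _).trans ?_⟩
      have := hC t x hx
      have := hC' t x hx
      gcongr
    refine ⟨hb, fun t x => B.precompR E (f t x) (g' t x) + B.precompL E (f' t x) (g t x),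
      fun t x hx => B.hasFDerivAt_of_bilinear (hf' t x hx) (hg' t x hx), ?_⟩
    exact (ih _ hf0 h2 (bb _ hf0 h2)).add (ih _ h1 hg0 (bb _ h1 hg0))

theorem smul {r : ℕ} {F : Type} [NormedAddCommGroup F] [NormedSpace 𝕜 F] {f : T → E → 𝕜}
    {g : T → E → F} (hf : HasBddDerivs 𝕜 D r f) (hg : HasBddDerivs 𝕜 D r g) :
    HasBddDerivs 𝕜 D r (fun t x => f t x • g t x) :=
  hf.bilin (ContinuousLinearMap.lsmul 𝕜 𝕜) hg

theorem prodMk {r : ℕ} {F G : Type} [NormedAddCommGroup F] [NormedSpace 𝕜 F]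
    [NormedAddCommGroup G] [NormedSpace 𝕜 G] {f : T → E → F} {g : T → E → G}
    (hf : HasBddDerivs 𝕜 D r f) (hg : HasBddDerivs 𝕜 D r g) :
    HasBddDerivs 𝕜 D r (fun t x => (f t x, g t x)) := by
  simpa using (hf.clm_comp (ContinuousLinearMap.inl 𝕜 F G)).add
    (hg.clm_comp (ContinuousLinearMap.inr 𝕜 F G))

theorem comp {r : ℕ} {F G : Type} [NormedAddCommGroup F] [NormedSpace 𝕜 F]
    [NormedAddCommGroup G] [NormedSpace 𝕜 G] {D' : T → Set F} {g : T → F → G} {f : T → E → F}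
    (hg : HasBddDerivs 𝕜 D' r g) (hf : HasBddDerivs 𝕜 D r f)
    (hm : ∀ t, MapsTo (f t) (D t) (D' t)) :
    HasBddDerivs 𝕜 D r (fun t x => g t (f t x)) := by
  have hb : ∃ C : ℝ, ∀ t, ∀ x ∈ D t, ‖g t (f t x)‖ ≤ C := by
    obtain ⟨C, _, hC⟩ := hg.bdd
    exact ⟨C, fun t x hx => hC t _ (hm t hx)⟩
  induction r generalizing G with
  | zero => exact hb
  | succ r ih =>
    have hf0 := hf.of_succ
    obtain ⟨_, g', hg', h2⟩ := hg
    obtain ⟨_, f', hf', h1⟩ := hf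
    refine ⟨hb, fun t x => (g' t (f t x)).comp (f' t x),
      fun t x hx => (hg' t _ (hm t hx)).comp x (hf' t x hx), ?_⟩
    obtain ⟨C, _, hC⟩ := h2.bdd
    exact (ih h2 hf0 ⟨C, fun t x hx => hC t _ (hm t hx)⟩).bilin
      (ContinuousLinearMap.compL 𝕜 E F G) h1

/-- Inversion in a Banach algebra, where the inverses are bounded. -/
theorem ringInverse {r : ℕ} {A : Type} [NormedRing A] [NormedAlgebra 𝕜 A] [HasSummableGeomSeries A]
    {f : T → E → A} (hf : HasBddDerivs 𝕜 D r f) (hu : ∀ t, ∀ x ∈ D t, IsUnit (f t x))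
    (hb : ∃ C : ℝ, ∀ t, ∀ x ∈ D t, ‖Ring.inverse (f t x)‖ ≤ C) :
    HasBddDerivs 𝕜 D r (fun t x => Ring.inverse (f t x)) := by
  induction r with
  | zero => exact hb
  | succ r ih =>
    have h0 := ih hf.of_succ
    obtain ⟨_, f', hf', h1⟩ := hf
    refine ⟨hb, fun t x => (-ContinuousLinearMap.mulLeftRight 𝕜 A (Ring.inverse (f t x))
      (Ring.inverse (f t x))).comp (f' t x), fun t x hx => ?_, ?_⟩
    · obtain ⟨u, hu⟩ := hu t x hx
      have := hasFDerivAt_ringInverse (𝕜 := 𝕜) u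
      rw [hu] at this
      have h2 := this.comp x (hf' t x hx)
      rwa [← Ring.inverse_unit, hu] at h2
    · exact (h0.bilin (ContinuousLinearMap.mulLeftRight 𝕜 A) h0).neg.bilin
        (ContinuousLinearMap.compL 𝕜 E A A) h1

theorem restrictScalars {T : Type} {E : Type} [NormedAddCommGroup E] [NormedSpace ℂ E]
    {D : T → Set E} {r : ℕ} {F : Type} [NormedAddCommGroup F] [NormedSpace ℂ F] {f : T → E → F}
    (hf : HasBddDerivs ℂ D r f) : HasBddDerivs ℝ D r f := by
  induction r generalizing F with
  | zero => exact hf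
  | succ r ih =>
    obtain ⟨hb, f', hf', h1⟩ := hf
    exact ⟨hb, fun t x => (f' t x).restrictScalars ℝ, fun t x hx => (hf' t x hx).restrictScalars ℝ,
      (ih h1).clm_comp (ContinuousLinearMap.restrictScalarsL ℂ E F ℝ ℝ)⟩

/-- A smooth map has bounded derivatives on compact subsets of its domain. -/
theorem of_contDiffOn {E : Type} [NormedAddCommGroup E] [NormedSpace ℝ E] {r : ℕ} {F : Type}
    [NormedAddCommGroup F] [NormedSpace ℝ F] {f : E → F} {O K : Set E} (hO : IsOpen O)
    (hf : ContDiffOn ℝ ∞ f O) (hK : IsCompact K) (hKO : K ⊆ O) :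
    HasBddDerivs ℝ (fun _ : T => K) r (fun _ => f) := by
  have hb : ∀ {F : Type} [NormedAddCommGroup F] [NormedSpace ℝ F] {f : E → F}
      (_ : ContDiffOn ℝ ∞ f O), ∃ C : ℝ, ∀ _ : T, ∀ x ∈ K, ‖f x‖ ≤ C := by
    intro F _ _ f hf
    obtain ⟨C, hC⟩ := hK.exists_bound_of_continuousOn (hf.continuousOn.mono hKO)
    exact ⟨C, fun _ x hx => hC x hx⟩
  induction r generalizing F with
  | zero => exact hb hf
  | succ r ih =>
    refine ⟨hb hf, fun _ => _root_.fderiv ℝ f, fun _ x hx => ?_, ih ?_⟩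
    · exact ((hf.differentiableOn (by simp)).differentiableAt
        (hO.mem_nhds (hKO hx))).hasFDerivAt
    · exact hf.fderiv_of_isOpen hO (by simp)

end HasBddDerivs

/-! ### Complexification of tangent maps and the Piola identity -/

theorem two_le_infty : (2 : WithTop ℕ∞) ≤ ∞ := WithTop.coe_le_coe.2 (le_top : (2 : ℕ∞) ≤ ⊤)

section Complexification

variable {d N : ℕ} {W : Type} [NormedAddCommGroup W] [NormedSpace ℂ W]

/-- The standard basis vectors of `ℝ^N`. -/
abbrev stdVec (N : ℕ) (i : Fin N) : RSpace N := EuclideanSpace.single i 1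

/-- The standard basis vectors of `ℂ^N`. -/
abbrev stdCVec (N : ℕ) (i : Fin N) : CSpace N := EuclideanSpace.single i 1

/-- The complex linear extension to `ℂ^N` of the real linear map `L ∘ ι` on `ℝ^N`. -/
def complexify (ι : RSpace N →L[ℝ] RSpace d) :
    (RSpace d →L[ℝ] W) →L[ℝ] (CSpace N →L[ℂ] W) :=
  ∑ i, ((ContinuousLinearMap.smulRightL ℂ (CSpace N) W
    (EuclideanSpace.proj i)).restrictScalars ℝ).comp
      (ContinuousLinearMap.apply ℝ W (ι (stdVec N i)))

variable (ι : RSpace N →L[ℝ] RSpace d)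

theorem complexify_apply (L : RSpace d →L[ℝ] W) (z : CSpace N) :
    complexify ι L z = ∑ i, z i • L (ι (stdVec N i)) := by
  simp [complexify]

theorem complexify_stdCVec (L : RSpace d →L[ℝ] W) (i : Fin N) :
    complexify ι L (stdCVec N i) = L (ι (stdVec N i)) := by
  rw [complexify_apply, Finset.sum_eq_single i]
  · simp
  · intro j _ hj; simp [hj]
  · simp

theorem clm_ext_stdCVec {A B : CSpace N →L[ℂ] W} (h : ∀ i, A (stdCVec N i) = B (stdCVec N i)) :
    A = B := by
  ext z
  have hz : z = ∑ i, z i • stdCVec N i := by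
    ext j; simp [Finset.sum_apply, Pi.single_apply]
  rw [hz]; simp only [map_sum, map_smul, h]

end Complexification

/-- The determinant is differentiated row by row. -/
theorem hasFDerivAt_det {E : Type} [NormedAddCommGroup E] [NormedSpace ℝ E] {N : ℕ}
    {M : E → Matrix (Fin N) (Fin N) ℂ} {M' : Fin N → E →L[ℝ] (Fin N → ℂ)} {x : E}
    (h : ∀ j, HasFDerivAt (fun y => M y j) (M' j) x) :
    ∃ L : E →L[ℝ] ℂ, HasFDerivAt (fun y => (M y).det) L x ∧
      ∀ ξ, L ξ = ∑ j, ((M x).updateRow j (M' j ξ)).det := by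
  let f : ContinuousMultilinearMap ℂ (fun _ : Fin N => (Fin N → ℂ)) ℂ :=
    { (Matrix.detRowAlternating (R := ℂ) (n := Fin N)).toMultilinearMap with
      cont := Continuous.matrix_det continuous_id }
  refine ⟨_, HasFDerivAt.multilinear_comp (f.restrictScalars ℝ) h, fun ξ => ?_⟩
  simp
  rfl

section Frame

variable {d N : ℕ} (ι : RSpace N →L[ℝ] RSpace d)

/-- The complex linear map `ℂ^N → ℂ^N` whose columns are the derivatives of `γ` in the directions of
the image of `ι`. -/
def frame (γ : RSpace d → CSpace N) (x : RSpace d) : CSpace N →L[ℂ] CSpace N :=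
  complexify ι (fderiv ℝ γ x)

/-- The inverse of the frame map (meaningful where the latter is invertible). -/
def coframe (γ : RSpace d → CSpace N) (x : RSpace d) : CSpace N →L[ℂ] CSpace N :=
  Ring.inverse (frame ι γ x)

/-- The determinant of the frame, that is, the density of the holomorphic volume form on the
slices of the submanifold parallel to the image of `ι`. -/
def frameDet (γ : RSpace d → CSpace N) (x : RSpace d) : ℂ :=
  (Matrix.of fun j i => fderiv ℝ γ x (ι (stdVec N j)) i).det

variable {ι} {γ : RSpace d → CSpace N} {x : RSpace d}

theorem frame_coframe (hx : IsUnit (frame ι γ x)) (v : CSpace N) :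
    frame ι γ x (coframe ι γ x v) = v := by
  have := Ring.mul_inverse_cancel _ hx
  exact congrArg (fun A : CSpace N →L[ℂ] CSpace N => A v) this

theorem coframe_frame (hx : IsUnit (frame ι γ x)) (v : CSpace N) :
    coframe ι γ x (frame ι γ x v) = v := by
  have := Ring.inverse_mul_cancel _ hx
  exact congrArg (fun A : CSpace N →L[ℂ] CSpace N => A v) this

theorem sum_coframe_smul (hx : IsUnit (frame ι γ x)) (v : CSpace N) :
    ∑ i, coframe ι γ x v i • fderiv ℝ γ x (ι (stdVec N i)) = v := by
  rw [← complexify_apply]; exact frame_coframe hx v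

theorem coframe_dir (hx : IsUnit (frame ι γ x)) (i : Fin N) :
    coframe ι γ x (fderiv ℝ γ x (ι (stdVec N i))) = stdCVec N i := by
  rw [← complexify_stdCVec]; exact coframe_frame hx _

theorem hasFDerivAt_frame (hγ : ContDiffAt ℝ 2 γ x) :
    HasFDerivAt (frame ι γ) ((complexify ι).comp (fderiv ℝ (fderiv ℝ γ) x)) x := by
  have h1 : DifferentiableAt ℝ (fderiv ℝ γ) x :=
    (hγ.fderiv_right (m := 1) (by norm_num)).differentiableAt (by norm_num)
  exact (complexify ι).hasFDerivAt.comp x h1.hasFDerivAt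

theorem hasFDerivAt_coframe (hγ : ContDiffAt ℝ 2 γ x) (hx : IsUnit (frame ι γ x)) :
    ∃ L : RSpace d →L[ℝ] (CSpace N →L[ℂ] CSpace N), HasFDerivAt (coframe ι γ) L x ∧
      ∀ ξ v, L ξ v = - coframe ι γ x (∑ j, coframe ι γ x v j •
        fderiv ℝ (fderiv ℝ γ) x ξ (ι (stdVec N j))) := by
  obtain ⟨u, hu⟩ := hx
  have h2 := hasFDerivAt_ringInverse (𝕜 := ℝ) u
  rw [hu] at h2
  refine ⟨_, h2.comp x (hasFDerivAt_frame hγ), fun ξ v => ?_⟩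
  have h3 : ((u⁻¹ : (CSpace N →L[ℂ] CSpace N)ˣ) : CSpace N →L[ℂ] CSpace N) = coframe ι γ x := by
    rw [coframe, ← hu, Ring.inverse_unit]
  rw [h3, ← complexify_apply]
  rfl

/-- Jacobi's formula for the logarithmic derivative of the frame determinant. -/
theorem hasFDerivAt_frameDet (hγ : ContDiffAt ℝ 2 γ x) (hx : IsUnit (frame ι γ x)) :
    ∃ L : RSpace d →L[ℝ] ℂ, HasFDerivAt (frameDet ι γ) L x ∧
      ∀ ξ, L ξ = frameDet ι γ x *
        ∑ j, coframe ι γ x (fderiv ℝ (fderiv ℝ γ) x ξ (ι (stdVec N j))) j := by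
  have h1 : DifferentiableAt ℝ (fderiv ℝ γ) x :=
    (hγ.fderiv_right (m := 1) (by norm_num)).differentiableAt (by norm_num)
  have h2 : ∀ j, HasFDerivAt
      (fun y => (Matrix.of fun j i => fderiv ℝ γ y (ι (stdVec N j)) i) j)
      ((((EuclideanSpace.equiv (Fin N) ℂ).toContinuousLinearMap.restrictScalars ℝ).comp
        (ContinuousLinearMap.apply ℝ (CSpace N) (ι (stdVec N j)))).comp
          (fderiv ℝ (fderiv ℝ γ) x)) x := fun j =>
    ((((EuclideanSpace.equiv (Fin N) ℂ).toContinuousLinearMap.restrictScalars ℝ).comp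
        (ContinuousLinearMap.apply ℝ (CSpace N) (ι (stdVec N j)))).hasFDerivAt).comp x
          h1.hasFDerivAt
  obtain ⟨L, hL, hL'⟩ := hasFDerivAt_det h2
  refine ⟨L, hL, fun ξ => ?_⟩
  rw [hL', Finset.mul_sum]
  refine Finset.sum_congr rfl fun j _ => ?_
  set w := fderiv ℝ (fderiv ℝ γ) x ξ (ι (stdVec N j)) with hw
  have h4 : (fun i => w i) = ∑ k, coframe ι γ x w k •
      (Matrix.of fun j i => fderiv ℝ γ x (ι (stdVec N j)) i) k := by
    ext i
    conv_lhs => rw [← sum_coframe_smul hx w]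
    simp [Finset.sum_apply]
  have h5 := Matrix.det_updateRow_sum (Matrix.of fun j i => fderiv ℝ γ x (ι (stdVec N j)) i) j
    (fun k => coframe ι γ x w k)
  rw [← h4, smul_eq_mul, mul_comm] at h5
  exact h5

/-- The **Piola identity**: the divergence, along the slice, of the vector field representing `w`,
weighted by the frame determinant. -/
theorem sum_fderiv_frameDet_mul_coframe {w : RSpace d → CSpace N} (hγ : ContDiffAt ℝ 2 γ x)
    (hx : IsUnit (frame ι γ x)) (hw : DifferentiableAt ℝ w x) :
    ∑ i, fderiv ℝ (fun y => frameDet ι γ y * coframe ι γ y (w y) i) x (ι (stdVec N i)) =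
      frameDet ι γ x * ∑ i, coframe ι γ x (fderiv ℝ w x (ι (stdVec N i))) i := by
  obtain ⟨L, hL, hL'⟩ := hasFDerivAt_coframe hγ hx
  obtain ⟨LJ, hLJ, hLJ'⟩ := hasFDerivAt_frameDet hγ hx
  have ha : HasFDerivAt (fun y => coframe ι γ y (w y)) _ x :=
    (ContinuousLinearMap.restrictScalarsL ℂ (CSpace N) (CSpace N) ℝ ℝ).hasFDerivAt.comp x hL
      |>.clm_apply hw.hasFDerivAt
  have hai : ∀ i, HasFDerivAt (fun y => coframe ι γ y (w y) i) _ x := fun i =>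
    ((EuclideanSpace.proj (𝕜 := ℂ) i).restrictScalars ℝ).hasFDerivAt.comp x ha
  have hsymm : ∀ ξ η, fderiv ℝ (fderiv ℝ γ) x ξ η = fderiv ℝ (fderiv ℝ γ) x η ξ :=
    fun ξ η => (hγ.isSymmSndFDerivAt (by simp)) ξ η
  have key : ∀ i, fderiv ℝ (fun y => frameDet ι γ y * coframe ι γ y (w y) i) x (ι (stdVec N i)) =
      frameDet ι γ x * (coframe ι γ x (fderiv ℝ w x (ι (stdVec N i))) i
        - ∑ j, coframe ι γ x (w x) j *
            coframe ι γ x (fderiv ℝ (fderiv ℝ γ) x (ι (stdVec N i)) (ι (stdVec N j))) i) +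
      ∑ j, frameDet ι γ x * (coframe ι γ x (w x) i *
        coframe ι γ x (fderiv ℝ (fderiv ℝ γ) x (ι (stdVec N i)) (ι (stdVec N j))) j) := by
    intro i
    have h6 : HasFDerivAt (fun y => frameDet ι γ y * coframe ι γ y (w y) i) _ x := hLJ.mul (hai i)
    rw [h6.fderiv]
    simp [hL', hLJ', Finset.mul_sum, mul_sub, ← sub_eq_add_neg]
    exact Finset.sum_congr rfl fun j _ => by ring
  simp_rw [key]
  rw [Finset.sum_add_distrib, Finset.sum_comm (γ := Fin N), ← Finset.mul_sum,
    Finset.sum_sub_distrib, mul_sub]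
  simp_rw [← Finset.mul_sum]
  rw [sub_add, sub_eq_self, ← mul_sub, sub_eq_zero.2, mul_zero]
  refine Finset.sum_congr rfl fun i _ => Finset.sum_congr rfl fun j _ => ?_
  rw [hsymm]

theorem contDiff_frame (hγ : ContDiff ℝ ∞ γ) : ContDiff ℝ ∞ (frame ι γ) :=
  (complexify ι).contDiff.comp (hγ.fderiv_right (by simp))

theorem contDiff_coframe (hγ : ContDiff ℝ ∞ γ) (hu : ∀ x, IsUnit (frame ι γ x)) :
    ContDiff ℝ ∞ (coframe ι γ) := by
  refine contDiff_iff_contDiffAt.2 fun x => ?_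
  obtain ⟨u, hu⟩ := hu x
  refine ContDiffAt.comp (g := Ring.inverse) x ?_ (contDiff_frame hγ).contDiffAt
  rw [← hu]; exact contDiffAt_ringInverse ℝ u

theorem contDiff_frameDet (hγ : ContDiff ℝ ∞ γ) : ContDiff ℝ ∞ (frameDet ι γ) := by
  let f : ContinuousMultilinearMap ℂ (fun _ : Fin N => (Fin N → ℂ)) ℂ :=
    { (Matrix.detRowAlternating (R := ℂ) (n := Fin N)).toMultilinearMap with
      cont := Continuous.matrix_det continuous_id }
  refine (f.restrictScalars ℝ).contDiff.comp (contDiff_pi.2 fun j => contDiff_pi.2 fun i => ?_)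
  exact ((((EuclideanSpace.proj (𝕜 := ℂ) i).restrictScalars ℝ).comp
    (ContinuousLinearMap.apply ℝ (CSpace N) (ι (stdVec N j)))).contDiff).comp
      (hγ.fderiv_right (by simp))

/-- The derivative, in the sense of complex tangential calculus, of a function `h` on the
submanifold parametrized by `γ`: the complex linear map on `ℂ^N` which agrees with the differential
of `h` on the slice directions. -/
def crDeriv {W : Type} [NormedAddCommGroup W] [NormedSpace ℂ W] (ι : RSpace N →L[ℝ] RSpace d)
    (γ : RSpace d → CSpace N) (h : RSpace d → W) (x : RSpace d) : CSpace N →L[ℂ] W :=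
  (complexify ι (fderiv ℝ h x)).comp (coframe ι γ x)

/-- `h` is smooth, and on `O` its differential is the restriction of a complex linear map, so that
`h` is a CR function there. -/
structure IsCRSmoothOn {W : Type} [NormedAddCommGroup W] [NormedSpace ℂ W]
    (ι : RSpace N →L[ℝ] RSpace d) (γ : RSpace d → CSpace N) (O : Set (RSpace d))
    (h : RSpace d → W) : Prop where
  smooth : ContDiff ℝ ∞ h
  cr : ∀ x ∈ O, ∀ ξ, fderiv ℝ h x ξ = crDeriv ι γ h x (fderiv ℝ γ x ξ)

section CR

variable {W : Type} [NormedAddCommGroup W] [NormedSpace ℂ W] {h : RSpace d → W}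
  {O : Set (RSpace d)}

theorem crDeriv_apply (v : CSpace N) :
    crDeriv ι γ h x v = ∑ i, coframe ι γ x v i • fderiv ℝ h x (ι (stdVec N i)) := by
  rw [crDeriv, ContinuousLinearMap.comp_apply, complexify_apply]

theorem contDiff_crDeriv (hγ : ContDiff ℝ ∞ γ) (hu : ∀ x, IsUnit (frame ι γ x))
    (hh : ContDiff ℝ ∞ h) : ContDiff ℝ ∞ (crDeriv ι γ h) := by
  have h1 : ContDiff ℝ ∞ (fun x => complexify ι (fderiv ℝ h x)) :=
    (complexify ι).contDiff.comp (hh.fderiv_right (by simp))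
  have h2 : IsBoundedBilinearMap ℝ
      (fun p : (CSpace N →L[ℂ] W) × (CSpace N →L[ℂ] CSpace N) => p.1.comp p.2) :=
    ((ContinuousLinearMap.compL ℂ (CSpace N) (CSpace N) W).bilinearRestrictScalars
      ℝ).isBoundedBilinearMap
  exact h2.contDiff.comp (h1.prodMk (contDiff_coframe hγ hu))

/-- The complex tangential derivative of a CR function is again a CR function. -/
theorem IsCRSmoothOn.crDeriv (hγ : ContDiff ℝ ∞ γ) (hu : ∀ x, IsUnit (frame ι γ x))
    (hO : IsOpen O) (hh : IsCRSmoothOn ι γ O h) : IsCRSmoothOn ι γ O (crDeriv ι γ h) := by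
  refine ⟨contDiff_crDeriv hγ hu hh.smooth, fun x hx ξ => ?_⟩
  set A := _root_.crDeriv ι γ h with hA
  have hA' : HasFDerivAt A (fderiv ℝ A x) x :=
    ((contDiff_crDeriv hγ hu hh.smooth).differentiable (by simp) x).hasFDerivAt
  have hg' : HasFDerivAt (fderiv ℝ γ) (fderiv ℝ (fderiv ℝ γ) x) x :=
    (((hγ.fderiv_right (m := ∞) (by simp)).differentiable (by simp)) x).hasFDerivAt
  have hh' : HasFDerivAt (fderiv ℝ h) (fderiv ℝ (fderiv ℝ h) x) x :=
    (((hh.smooth.fderiv_right (m := ∞) (by simp)).differentiable (by simp)) x).hasFDerivAt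
  -- Differentiating the CR equation shows that `A' ξ (γ' η)` is symmetric in `ξ` and `η`.
  have key : ∀ ξ η, fderiv ℝ A x ξ (fderiv ℝ γ x η) + A x (fderiv ℝ (fderiv ℝ γ) x ξ η) =
      fderiv ℝ (fderiv ℝ h) x ξ η := by
    intro ξ η
    have h1 : HasFDerivAt (fun y => A y (fderiv ℝ γ y η)) _ x :=
      ((ContinuousLinearMap.restrictScalarsL ℂ (CSpace N) W ℝ ℝ).hasFDerivAt.comp x hA').clm_apply
        (hg'.clm_apply (hasFDerivAt_const η x))
    have h2 : HasFDerivAt (fun y => fderiv ℝ h y η) _ x := hh'.clm_apply (hasFDerivAt_const η x)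
    have h3 : (fun y => fderiv ℝ h y η) =ᶠ[𝓝 x] fun y => A y (fderiv ℝ γ y η) :=
      eventually_of_mem (hO.mem_nhds hx) fun y hy => hh.cr y hy η
    have h4 := congrArg (fun L : RSpace d →L[ℝ] W => L ξ) ((h1.congr_of_eventuallyEq h3).unique h2)
    simp at h4
    rw [← h4, add_comm]
  have hsymγ : ∀ ξ η, fderiv ℝ (fderiv ℝ γ) x ξ η = fderiv ℝ (fderiv ℝ γ) x η ξ :=
    fun ξ η => (hγ.contDiffAt.isSymmSndFDerivAt (by simpa using two_le_infty)) ξ η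
  have hsymh : ∀ ξ η, fderiv ℝ (fderiv ℝ h) x ξ η = fderiv ℝ (fderiv ℝ h) x η ξ :=
    fun ξ η => (hh.smooth.contDiffAt.isSymmSndFDerivAt (by simpa using two_le_infty)) ξ η
  have sym : ∀ ξ η, fderiv ℝ A x ξ (fderiv ℝ γ x η) = fderiv ℝ A x η (fderiv ℝ γ x ξ) := by
    intro ξ η
    have := (key ξ η).trans ((hsymh ξ η).trans (key η ξ).symm)
    rw [hsymγ] at this
    exact add_right_cancel this
  have expand : ∀ (B : CSpace N →L[ℂ] W) v,
      B v = ∑ i, coframe ι γ x v i • B (fderiv ℝ γ x (ι (stdVec N i))) := by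
    intro B v
    conv_lhs => rw [← sum_coframe_smul (hu x) v]
    simp
  rw [crDeriv_apply]
  ext v
  rw [expand]
  simp_rw [sym ξ]
  have h5 : ∀ i, fderiv ℝ A x (ι (stdVec N i)) (fderiv ℝ γ x ξ) =
      ∑ j, coframe ι γ x (fderiv ℝ γ x ξ) j •
        fderiv ℝ A x (ι (stdVec N j)) (fderiv ℝ γ x (ι (stdVec N i))) := by
    intro i
    rw [expand]
    simp_rw [sym (ι (stdVec N i))]
  simp_rw [h5, Finset.smul_sum]
  rw [Finset.sum_comm]
  simp only [_root_.sum_apply, _root_.smul_apply]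
  refine Finset.sum_congr rfl fun j _ => ?_
  rw [expand, Finset.smul_sum]
  exact Finset.sum_congr rfl fun i _ => smul_comm _ _ _

end CR

end Frame

/-! ### Differentiation under the integral sign and integration by parts on slices -/

/-- Differentiation under the integral sign for integrands supported in a fixed compact set. -/
theorem hasFDerivAt_integral_of_compact {𝕜 H G : Type} [RCLike 𝕜] [NormedAddCommGroup H]
    [NormedSpace 𝕜 H] [LocallyCompactSpace H] [NormedAddCommGroup G] [NormedSpace ℝ G]
    [NormedSpace 𝕜 G] {d : ℕ} {k : H → RSpace d → G} {k' : H → RSpace d → H →L[𝕜] G}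
    {s : Set H} {K : Set (RSpace d)} {p₀ : H} (hs : IsOpen s) (hp : p₀ ∈ s) (hK : IsCompact K)
    (hk : ∀ p ∈ s, Continuous (k p)) (hk0 : ∀ p ∈ s, ∀ u ∉ K, k p u = 0)
    (hk' : ContinuousOn (fun q : H × RSpace d => k' q.1 q.2) (s ×ˢ univ))
    (hk'0 : ∀ p ∈ s, ∀ u ∉ K, k' p u = 0)
    (hd : ∀ p ∈ s, ∀ u, HasFDerivAt (fun p => k p u) (k' p u) p) :
    HasFDerivAt (fun p => ∫ u, k p u) (∫ u, k' p₀ u) p₀ ∧ Integrable (k' p₀) := by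
  obtain ⟨C, hC, hCp, hCs⟩ := exists_compact_subset hs hp
  obtain ⟨B, hB⟩ := (hC.prod hK).exists_bound_of_continuousOn
    (hk'.mono (prod_mono hCs (subset_univ _)))
  have hcont : Continuous (k' p₀) := by
    have : ContinuousOn (fun u => k' p₀ u) univ :=
      hk'.comp (f := fun u => (p₀, u)) (by fun_prop) fun u _ => ⟨hp, mem_univ _⟩
    exact continuousOn_univ.1 this
  have hCn : C ∈ 𝓝 p₀ := mem_interior_iff_mem_nhds.1 hCp
  refine ⟨hasFDerivAt_integral_of_dominated_of_fderiv_le (s := C)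
    (bound := K.indicator fun _ => max B 0) hCn ?_ ?_ hcont.aestronglyMeasurable ?_ ?_ ?_,
    hcont.integrable_of_hasCompactSupport (HasCompactSupport.intro hK (hk'0 p₀ hp))⟩
  · filter_upwards [hs.mem_nhds hp] with p hp
    exact (hk p hp).aestronglyMeasurable
  · exact (hk p₀ hp).integrable_of_hasCompactSupport (HasCompactSupport.intro hK (hk0 p₀ hp))
  · refine Eventually.of_forall fun u p hpC => ?_
    by_cases hu : u ∈ K
    · rw [indicator_of_mem hu]
      exact (hB (p, u) ⟨hpC, hu⟩).trans (le_max_left _ _)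
    · rw [indicator_of_notMem hu, hk'0 p (hCs hpC) u hu, norm_zero]
  · exact (integrable_indicator_iff hK.measurableSet).2
      (integrableOn_const hK.measure_lt_top.ne)
  · exact Eventually.of_forall fun u p hpC => hd p (hCs hpC) u

theorem integral_fderiv_smul_of_compact {W : Type} [NormedAddCommGroup W] [NormedSpace ℂ W]
    {d : ℕ} {f : RSpace d → ℂ} {g : RSpace d → W} (hf : ContDiff ℝ 1 f) (hg : ContDiff ℝ 1 g)
    (hc : HasCompactSupport g) (v : RSpace d) :
    ∫ u, fderiv ℝ f u v • g u = - ∫ u, f u • fderiv ℝ g u v := by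
  have h1 : Continuous fun u => fderiv ℝ f u v :=
    (hf.continuous_fderiv (by simp)).clm_apply continuous_const
  have h2 : Continuous fun u => fderiv ℝ g u v :=
    (hg.continuous_fderiv (by simp)).clm_apply continuous_const
  have hc2 : HasCompactSupport fun u => fderiv ℝ g u v :=
    (hc.fderiv (𝕜 := ℝ)).comp_left (g := fun L : RSpace d →L[ℝ] W => L v) (by simp)
  rw [integral_smul_fderiv_eq_neg_fderiv_smul_of_integrable (f := f) (g := g), neg_neg]
  · exact (h1.smul hg.continuous).integrable_of_hasCompactSupport hc.smul_left
  · exact (hf.continuous.smul h2).integrable_of_hasCompactSupport hc2.smul_left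
  · exact (hf.continuous.smul hg.continuous).integrable_of_hasCompactSupport hc.smul_left
  · exact fun x _ => hf.differentiable (by simp) x
  · exact fun x _ => hg.differentiable (by simp) x

theorem integral_smul_fderiv_of_compact {W : Type} [NormedAddCommGroup W] [NormedSpace ℂ W]
    {d : ℕ} {f : RSpace d → ℂ} {g : RSpace d → W} (hf : ContDiff ℝ 1 f) (hg : ContDiff ℝ 1 g)
    (hc : HasCompactSupport f) (v : RSpace d) :
    ∫ u, f u • fderiv ℝ g u v = - ∫ u, fderiv ℝ f u v • g u := by
  have h1 : Continuous fun u => fderiv ℝ f u v :=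
    (hf.continuous_fderiv (by simp)).clm_apply continuous_const
  have h2 : Continuous fun u => fderiv ℝ g u v :=
    (hg.continuous_fderiv (by simp)).clm_apply continuous_const
  have hc2 : HasCompactSupport fun u => fderiv ℝ f u v :=
    (hc.fderiv (𝕜 := ℝ)).comp_left (g := fun L : RSpace d →L[ℝ] ℂ => L v) (by simp)
  rw [integral_smul_fderiv_eq_neg_fderiv_smul_of_integrable (f := f) (g := g)]
  · exact (h1.smul hg.continuous).integrable_of_hasCompactSupport hc2.smul_right
  · exact (hf.continuous.smul h2).integrable_of_hasCompactSupport hc.smul_right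
  · exact (hf.continuous.smul hg.continuous).integrable_of_hasCompactSupport hc.smul_right
  · exact fun x _ => hf.differentiable (by simp) x
  · exact fun x _ => hg.differentiable (by simp) x

section Slices

variable {d N : ℕ} {ι : RSpace N →L[ℝ] RSpace d} {γ : RSpace d → CSpace N}
  {W : Type} [NormedAddCommGroup W] [NormedSpace ℂ W]

/-- Divergence, along the slice directions, of the vector field representing `w` times a density
`frameDet • φ`. -/
theorem sum_fderiv_density {w : RSpace d → CSpace N} {φ : RSpace d → W} {x : RSpace d}
    (hγ : ContDiff ℝ ∞ γ) (hu : ∀ x, IsUnit (frame ι γ x))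
    (hw : ContDiff ℝ ∞ w) (hφ : DifferentiableAt ℝ φ x) :
    ∑ i, fderiv ℝ (fun y => coframe ι γ y (w y) i • frameDet ι γ y • φ y) x (ι (stdVec N i)) =
      (frameDet ι γ x * ∑ i, coframe ι γ x (fderiv ℝ w x (ι (stdVec N i))) i) • φ x +
        frameDet ι γ x • crDeriv ι γ φ x (w x) := by
  have hc : ContDiff ℝ ∞ fun y => coframe ι γ y (w y) :=
    ((ContinuousLinearMap.restrictScalarsL ℂ (CSpace N) (CSpace N) ℝ ℝ).contDiff.comp
      (contDiff_coframe hγ hu)).clm_apply hw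
  have hp : ∀ i, DifferentiableAt ℝ (fun y => frameDet ι γ y * coframe ι γ y (w y) i) x :=
    fun i => ((contDiff_frameDet hγ).mul
      (((EuclideanSpace.proj (𝕜 := ℂ) i).restrictScalars ℝ).contDiff.comp hc)).differentiable
        (by simp) x
  rw [← sum_fderiv_frameDet_mul_coframe (hγ.contDiffAt.of_le two_le_infty) (hu x)
    (hw.differentiable (by simp) x), Finset.sum_smul, crDeriv_apply, Finset.smul_sum,
    ← Finset.sum_add_distrib]
  refine Finset.sum_congr rfl fun i _ => ?_
  simp_rw [smul_smul, mul_comm (coframe ι γ _ _ i)]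
  rw [((hp i).hasFDerivAt.fun_smul hφ.hasFDerivAt).fderiv]
  simp [add_comm]

/-- A CR function times the frame determinant satisfies a conservation law: its derivative in any
direction is a divergence along the slices. -/
theorem fderiv_density_eq_sum {O : Set (RSpace d)} {φ : RSpace d → W} {x : RSpace d}
    (hγ : ContDiff ℝ ∞ γ) (hu : ∀ x, IsUnit (frame ι γ x)) (hφ : IsCRSmoothOn ι γ O φ)
    (hx : x ∈ O) (ξ : RSpace d) :
    fderiv ℝ (fun y => frameDet ι γ y • φ y) x ξ =
      ∑ i, fderiv ℝ (fun y => coframe ι γ y (fderiv ℝ γ y ξ) i • frameDet ι γ y • φ y) x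
        (ι (stdVec N i)) := by
  have hd := hφ.smooth.differentiable (by simp) x
  have hγ' : ContDiff ℝ ∞ (fderiv ℝ γ) := hγ.fderiv_right (by simp)
  rw [sum_fderiv_density (w := fun y => fderiv ℝ γ y ξ) hγ hu (hγ'.clm_apply contDiff_const) hd]
  obtain ⟨L, hL, hL'⟩ := hasFDerivAt_frameDet (ι := ι) (hγ.contDiffAt.of_le two_le_infty) (hu x)
  rw [(hL.fun_smul hd.hasFDerivAt).fderiv, ← hφ.cr x hx]
  have hs : ∀ i, fderiv ℝ (fun y => fderiv ℝ γ y ξ) x (ι (stdVec N i)) =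
      fderiv ℝ (fderiv ℝ γ) x ξ (ι (stdVec N i)) := by
    intro i
    rw [((hγ'.differentiable (by simp) x).hasFDerivAt.clm_apply (hasFDerivAt_const ξ x)).fderiv,
      (hγ.contDiffAt.isSymmSndFDerivAt (by simpa using two_le_infty)) ξ (ι (stdVec N i))]
    simp
  simp_rw [hs, ← hL']
  simp [add_comm]

/-- The formal adjoint, up to sign, of complex differentiation along the slice through `x`: in the
direction `v` it is the divergence of the vector field representing `v`, times `b`. -/
def sliceAdjoint (ι : RSpace N →L[ℝ] RSpace d) (γ : RSpace d → CSpace N) (x : RSpace d)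
    (b : RSpace N → W) (u : RSpace N) : CSpace N →L[ℂ] W :=
  ∑ i, fderiv ℝ (fun u' =>
    ((EuclideanSpace.proj i).comp (coframe ι γ (x + ι u'))).smulRight (b u')) u (stdVec N i)

theorem contDiff_slice (x : RSpace d) : ContDiff ℝ ∞ fun u => x + ι u :=
  contDiff_const.add ι.contDiff

theorem contDiff_sliceAdjoint_aux (hγ : ContDiff ℝ ∞ γ) (hu : ∀ x, IsUnit (frame ι γ x))
    (x : RSpace d) {b : RSpace N → W} (hb : ContDiff ℝ ∞ b) (i : Fin N) :
    ContDiff ℝ ∞ fun u' =>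
      ((EuclideanSpace.proj i).comp (coframe ι γ (x + ι u'))).smulRight (b u') := by
  have h1 : ContDiff ℝ ∞ fun u' => coframe ι γ (x + ι u') :=
    (contDiff_coframe hγ hu).comp (contDiff_slice x)
  have h2 := (((ContinuousLinearMap.compL ℂ (CSpace N) (CSpace N) ℂ
    (EuclideanSpace.proj i)).restrictScalars ℝ).contDiff (n := ∞)).comp h1
  exact (((ContinuousLinearMap.smulRightL ℂ (CSpace N) W).bilinearRestrictScalars
      ℝ).isBoundedBilinearMap.contDiff).comp (h2.prodMk hb)

theorem contDiff_sliceAdjoint (hγ : ContDiff ℝ ∞ γ) (hu : ∀ x, IsUnit (frame ι γ x))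
    (x : RSpace d) {b : RSpace N → W} (hb : ContDiff ℝ ∞ b) :
    ContDiff ℝ ∞ (sliceAdjoint ι γ x b) :=
  ContDiff.sum fun i _ =>
    ((contDiff_sliceAdjoint_aux hγ hu x hb i).fderiv_right (m := ∞) (by simp)).clm_apply
      contDiff_const

theorem sliceAdjoint_eq_zero {x : RSpace d} {b : RSpace N → W} {u : RSpace N} (hu : u ∉ tsupport b) :
    sliceAdjoint ι γ x b u = 0 := by
  refine Finset.sum_eq_zero fun i _ => ?_
  have h0 : b =ᶠ[𝓝 u] 0 := notMem_tsupport_iff_eventuallyEq.1 hu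
  have : (fun u' => ((EuclideanSpace.proj i).comp (coframe ι γ (x + ι u'))).smulRight (b u'))
      =ᶠ[𝓝 u] fun _ => 0 := by
    filter_upwards [h0] with y hy
    simp [hy]
  rw [this.fderiv_eq]
  simp

theorem sliceAdjoint_apply (hγ : ContDiff ℝ ∞ γ) (hu : ∀ x, IsUnit (frame ι γ x))
    {x : RSpace d} {b : RSpace N → W} (hb : ContDiff ℝ ∞ b) (u : RSpace N) (v : CSpace N) :
    sliceAdjoint ι γ x b u v =
      ∑ i, fderiv ℝ (fun u' => coframe ι γ (x + ι u') v i • b u') u (stdVec N i) := by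
  rw [sliceAdjoint, _root_.sum_apply]
  refine Finset.sum_congr rfl fun i _ => ?_
  have h1 := ((contDiff_sliceAdjoint_aux hγ hu x hb i).differentiable (by simp) u).hasFDerivAt
  have h2 : HasFDerivAt (fun u' => coframe ι γ (x + ι u') v i • b u') _ u :=
    ((ContinuousLinearMap.apply ℂ W v).restrictScalars ℝ).hasFDerivAt.comp u h1
  rw [h2.fderiv]
  rfl

/-- Integration by parts on a slice. -/
theorem integral_fderiv_comp_sub_smul (hγ : ContDiff ℝ ∞ γ) (hu : ∀ x, IsUnit (frame ι γ x))
    {x : RSpace d} {b : RSpace N → W} (hb : ContDiff ℝ ∞ b) (hc : HasCompactSupport b)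
    {κ : CSpace N → ℂ} (hκ : ContDiff ℂ 1 κ) (z v : CSpace N) :
    ∫ u, fderiv ℂ κ (z - γ (x + ι u)) v • b u =
      ∫ u, κ (z - γ (x + ι u)) • sliceAdjoint ι γ x b u v := by
  have hg : ∀ i, ContDiff ℝ ∞ fun u' => coframe ι γ (x + ι u') v i • b u' := fun i =>
    ((((EuclideanSpace.proj (𝕜 := ℂ) i).restrictScalars ℝ).comp
      ((ContinuousLinearMap.apply ℂ (CSpace N) v).restrictScalars ℝ)).contDiff.comp
        ((contDiff_coframe hγ hu).comp (contDiff_slice x))).smul hb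
  have hgc : ∀ i, HasCompactSupport fun u' => coframe ι γ (x + ι u') v i • b u' :=
    fun i => hc.smul_left
  have hf : ContDiff ℝ 1 fun u => κ (z - γ (x + ι u)) :=
    (hκ.restrict_scalars ℝ).comp (contDiff_const.sub
      ((hγ.comp (contDiff_slice x)).of_le (by simp)))
  have hderiv : ∀ u i, fderiv ℝ (fun u => κ (z - γ (x + ι u))) u (stdVec N i) =
      - fderiv ℂ κ (z - γ (x + ι u)) (fderiv ℝ γ (x + ι u) (ι (stdVec N i))) := by
    intro u i
    have h1 : HasFDerivAt (fun u => z - γ (x + ι u)) _ u :=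
      ((hγ.differentiable (by simp) (x + ι u)).hasFDerivAt.comp u
        (ι.hasFDerivAt.const_add x)).const_sub z
    have h2 : HasFDerivAt (fun u => κ (z - γ (x + ι u))) _ u :=
      ((hκ.differentiable (by simp) _).hasFDerivAt.restrictScalars ℝ).comp u h1
    rw [h2.fderiv]
    simp
  have hint : ∀ i, Integrable fun u => κ (z - γ (x + ι u)) •
      fderiv ℝ (fun u' => coframe ι γ (x + ι u') v i • b u') u (stdVec N i) := fun i =>
    (hf.continuous.smul (((hg i).continuous_fderiv (by simp)).clm_apply
      continuous_const)).integrable_of_hasCompactSupport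
      (((hgc i).fderiv (𝕜 := ℝ)).comp_left
        (g := fun L : RSpace N →L[ℝ] W => L (stdVec N i)) (by simp)).smul_left
  have hint2 : ∀ i, Integrable fun u =>
      fderiv ℝ (fun u => κ (z - γ (x + ι u))) u (stdVec N i) •
        (coframe ι γ (x + ι u) v i • b u) := fun i =>
    (((hf.continuous_fderiv (by simp)).clm_apply continuous_const).smul
      (hg i).continuous).integrable_of_hasCompactSupport (hgc i).smul_left
  simp_rw [sliceAdjoint_apply hγ hu hb, Finset.smul_sum]
  rw [integral_finsetSum _ fun i _ => hint i]
  have h3 := fun i => integral_fderiv_smul_of_compact hf ((hg i).of_le (by simp)) (hgc i)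
    (stdVec N i)
  simp_rw [fun i => (neg_eq_iff_eq_neg.2 (h3 i)).symm]
  rw [Finset.sum_neg_distrib, ← integral_finsetSum _ fun i _ => hint2 i, ← integral_neg]
  congr 1
  ext u
  simp_rw [hderiv, neg_smul, Finset.sum_neg_distrib, neg_neg]
  conv_lhs => rw [← sum_coframe_smul (hu (x + ι u)) v]
  rw [map_sum, Finset.sum_smul]
  refine Finset.sum_congr rfl fun i _ => ?_
  rw [map_smul, smul_smul, smul_eq_mul, mul_comm]

theorem crDeriv_eq_of_fderiv {φ : RSpace d → W} {x : RSpace d} (hx : IsUnit (frame ι γ x))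
    {A : CSpace N →L[ℂ] W} (hA : ∀ ξ, fderiv ℝ φ x ξ = A (fderiv ℝ γ x ξ)) :
    crDeriv ι γ φ x = A := by
  ext v
  rw [crDeriv_apply]
  simp_rw [hA]
  conv_rhs => rw [← sum_coframe_smul hx v]
  simp

theorem IsCRSmoothOn.of_fderiv {O : Set (RSpace d)} {φ : RSpace d → W}
    (hu : ∀ x, IsUnit (frame ι γ x)) (hφ : ContDiff ℝ ∞ φ)
    (hA : ∀ x ∈ O, ∃ A : CSpace N →L[ℂ] W, ∀ ξ, fderiv ℝ φ x ξ = A (fderiv ℝ γ x ξ)) :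
    IsCRSmoothOn ι γ O φ := by
  refine ⟨hφ, fun x hx ξ => ?_⟩
  obtain ⟨A, hA⟩ := hA x hx
  rw [crDeriv_eq_of_fderiv (hu x) hA, hA]

theorem IsCRSmoothOn.const (hu : ∀ x, IsUnit (frame ι γ x)) (O : Set (RSpace d)) (c : W) :
    IsCRSmoothOn ι γ O fun _ => c :=
  .of_fderiv hu contDiff_const fun x _ => ⟨0, by simp⟩

/-- The product of a CR function with the restriction of a holomorphic function. -/
theorem IsCRSmoothOn.holomorphic_smul {O : Set (RSpace d)} {φ : RSpace d → W} {κ : CSpace N → ℂ}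
    (hγ : ContDiff ℝ ∞ γ) (hu : ∀ x, IsUnit (frame ι γ x)) (hφ : IsCRSmoothOn ι γ O φ)
    (hκ : ContDiff ℂ ∞ κ) (z : CSpace N) :
    IsCRSmoothOn ι γ O fun y => κ (z - γ y) • φ y := by
  refine .of_fderiv hu (((hκ.restrict_scalars ℝ).comp (contDiff_const.sub hγ)).smul hφ.smooth)
    fun x hx => ⟨κ (z - γ x) • _root_.crDeriv ι γ φ x - (fderiv ℂ κ (z - γ x)).smulRight (φ x),
      fun ξ => ?_⟩
  have h1 : HasFDerivAt (fun y => κ (z - γ y)) _ x :=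
    ((hκ.differentiable (by simp) _).hasFDerivAt.restrictScalars ℝ).comp x
      ((hγ.differentiable (by simp) x).hasFDerivAt.const_sub z)
  rw [(h1.fun_smul (hφ.smooth.differentiable (by simp) x).hasFDerivAt).fderiv]
  simp [hφ.cr x hx, sub_eq_add_neg]

theorem hasFDerivAt_slice_comp {G : Type} [NormedAddCommGroup G] [NormedSpace ℝ G]
    {g : RSpace d → G} (hg : ContDiff ℝ ∞ g) (x : RSpace d) (u : RSpace N) :
    HasFDerivAt (fun u => g (x + ι u)) ((fderiv ℝ g (x + ι u)).comp ι) u :=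
  (hg.differentiable (by simp) (x + ι u)).hasFDerivAt.comp u (ι.hasFDerivAt.const_add x)

theorem contDiff_coframe_apply_smul (hγ : ContDiff ℝ ∞ γ) (hu : ∀ x, IsUnit (frame ι γ x))
    {w : RSpace d → CSpace N} (hw : ContDiff ℝ ∞ w) {φ : RSpace d → W} (hφ : ContDiff ℝ ∞ φ)
    (i : Fin N) : ContDiff ℝ ∞ fun y => coframe ι γ y (w y) i • frameDet ι γ y • φ y :=
  (((EuclideanSpace.proj (𝕜 := ℂ) i).restrictScalars ℝ).contDiff.comp
    (((ContinuousLinearMap.restrictScalarsL ℂ (CSpace N) (CSpace N) ℝ ℝ).contDiff.comp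
      (contDiff_coframe hγ hu)).clm_apply hw)).smul ((contDiff_frameDet hγ).smul hφ)

/-- The adjoint turns the density of a function into the density of its complex tangential
derivative. -/
theorem sliceAdjoint_density (hγ : ContDiff ℝ ∞ γ) (hu : ∀ x, IsUnit (frame ι γ x))
    {x : RSpace d} {b : RSpace N → W} (hb : ContDiff ℝ ∞ b) {φ : RSpace d → W}
    (hφ : ContDiff ℝ ∞ φ) {u : RSpace N}
    (h : b =ᶠ[𝓝 u] fun u => frameDet ι γ (x + ι u) • φ (x + ι u)) :
    sliceAdjoint ι γ x b u = frameDet ι γ (x + ι u) • crDeriv ι γ φ (x + ι u) := by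
  ext v
  have h1 := sum_fderiv_density (ι := ι) (w := fun _ => v) (x := x + ι u) hγ hu contDiff_const
    (hφ.differentiable (by simp) _)
  rw [sliceAdjoint_apply hγ hu hb, _root_.smul_apply]
  simp only [fderiv_fun_const, Pi.zero_apply, _root_.zero_apply, map_zero, PiLp.zero_apply,
    Finset.sum_const_zero, mul_zero, zero_smul, zero_add] at h1
  rw [← h1]
  refine Finset.sum_congr rfl fun i _ => ?_
  have h2 : (fun u' => coframe ι γ (x + ι u') v i • b u') =ᶠ[𝓝 u]
      fun u' => coframe ι γ (x + ι u') v i • frameDet ι γ (x + ι u') • φ (x + ι u') := by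
    filter_upwards [h] with y hy
    rw [hy]
  rw [h2.fderiv_eq, (hasFDerivAt_slice_comp (g := fun y => coframe ι γ y v i • frameDet ι γ y • φ y)
    (contDiff_coframe_apply_smul hγ hu contDiff_const hφ i) x u).fderiv]
  rfl

/-- Moving the slice: the derivative of an integral over slices of a CR density with a holomorphic
kernel only involves the derivatives of the cutoff `χ`. -/
theorem hasDerivAt_integral_slice (hγ : ContDiff ℝ ∞ γ) (hu : ∀ x, IsUnit (frame ι γ x))
    {O : Set (RSpace d)} {φ : RSpace d → W} (hφ : IsCRSmoothOn ι γ O φ) {κ : CSpace N → ℂ}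
    (hκ : ContDiff ℂ ∞ κ) (z : CSpace N) {χ : RSpace N → ℂ} (hχ : ContDiff ℝ ∞ χ)
    (hχc : HasCompactSupport χ) (x₀ ξ : RSpace d) (r : ℝ)
    (hO : ∀ u ∈ tsupport χ, x₀ + r • ξ + ι u ∈ O) :
    HasDerivAt (fun r : ℝ => ∫ u, χ u • κ (z - γ (x₀ + r • ξ + ι u)) •
        frameDet ι γ (x₀ + r • ξ + ι u) • φ (x₀ + r • ξ + ι u))
      (- ∫ u, κ (z - γ (x₀ + r • ξ + ι u)) • ∑ i, fderiv ℝ χ u (stdVec N i) •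
        coframe ι γ (x₀ + r • ξ + ι u) (fderiv ℝ γ (x₀ + r • ξ + ι u) ξ) i •
          frameDet ι γ (x₀ + r • ξ + ι u) • φ (x₀ + r • ξ + ι u)) r := by
  have hΦ := hφ.holomorphic_smul hγ hu hκ z
  set Φ := fun y => κ (z - γ y) • φ y with hΦd
  have hγ' : ContDiff ℝ ∞ (fderiv ℝ γ) := hγ.fderiv_right (by simp)
  have hJΦ : ContDiff ℝ ∞ fun y => frameDet ι γ y • Φ y := (contDiff_frameDet hγ).smul hΦ.smooth
  have hd : ∀ p u, HasDerivAt (fun r : ℝ => χ u • frameDet ι γ (x₀ + r • ξ + ι u) •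
      Φ (x₀ + r • ξ + ι u))
      (χ u • fderiv ℝ (fun y => frameDet ι γ y • Φ y) (x₀ + p • ξ + ι u) ξ) p := by
    intro p u
    have h1 : HasDerivAt (fun r : ℝ => x₀ + r • ξ + ι u) ξ p := by
      simpa using (((hasDerivAt_id p).smul_const ξ).const_add x₀).add_const (ι u)
    exact ((hJΦ.differentiable (by simp) _).hasFDerivAt.comp_hasDerivAt p h1).const_smul (χ u)
  have hcJ := hJΦ.continuous
  have hcJ' := (hJΦ.continuous_fderiv (by simp))
  have key := (hasFDerivAt_integral_of_compact (𝕜 := ℝ) (s := univ) (K := tsupport χ) (p₀ := r)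
    (k := fun r u => χ u • frameDet ι γ (x₀ + r • ξ + ι u) • Φ (x₀ + r • ξ + ι u))
    (k' := fun p u => ContinuousLinearMap.toSpanSingleton ℝ
      (χ u • fderiv ℝ (fun y => frameDet ι γ y • Φ y) (x₀ + p • ξ + ι u) ξ))
    isOpen_univ (mem_univ _) hχc (fun p _ => hχ.continuous.smul (hcJ.comp (by fun_prop)))
    (fun p _ u hu => by simp [image_eq_zero_of_notMem_tsupport hu]) (by
      refine Continuous.continuousOn ?_
      have : Continuous fun q : ℝ × RSpace N => χ q.2 • fderiv ℝ (fun y => frameDet ι γ y • Φ y)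
          (x₀ + q.1 • ξ + ι q.2) ξ :=
        (hχ.continuous.comp continuous_snd).smul ((hcJ'.comp (by fun_prop)).clm_apply
          continuous_const)
      exact (ContinuousLinearMap.toSpanSingletonCLE (𝕜 := ℝ)).continuous.comp this)
    (fun p _ u hu => by simp [image_eq_zero_of_notMem_tsupport hu])
    (fun p _ u => (hd p u).hasFDerivAt))
  have h2 := key.1.hasDerivAt
  rw [ContinuousLinearMap.integral_apply key.2] at h2
  simp only [ContinuousLinearMap.toSpanSingleton_apply, one_smul] at h2
  have hcomm : ∀ y, frameDet ι γ y • Φ y = κ (z - γ y) • frameDet ι γ y • φ y :=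
    fun y => smul_comm _ _ _
  have hgs : ∀ i, ContDiff ℝ ∞ fun y => coframe ι γ y (fderiv ℝ γ y ξ) i • frameDet ι γ y • Φ y :=
    contDiff_coframe_apply_smul hγ hu (hγ'.clm_apply contDiff_const) hΦ.smooth
  have hgsl : ∀ i, ContDiff ℝ ∞ fun u => coframe ι γ (x₀ + r • ξ + ι u)
      (fderiv ℝ γ (x₀ + r • ξ + ι u) ξ) i • frameDet ι γ (x₀ + r • ξ + ι u) •
        Φ (x₀ + r • ξ + ι u) := fun i => (hgs i).comp (contDiff_slice (x₀ + r • ξ))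
  have hI1 : ∀ i, Integrable fun u => χ u • fderiv ℝ (fun u => coframe ι γ (x₀ + r • ξ + ι u)
      (fderiv ℝ γ (x₀ + r • ξ + ι u) ξ) i • frameDet ι γ (x₀ + r • ξ + ι u) •
        Φ (x₀ + r • ξ + ι u)) u (stdVec N i) := fun i =>
    (hχ.continuous.smul (((hgsl i).continuous_fderiv (by simp)).clm_apply
      continuous_const)).integrable_of_hasCompactSupport hχc.smul_right
  have hI2 : ∀ i, Integrable fun u => fderiv ℝ χ u (stdVec N i) • coframe ι γ (x₀ + r • ξ + ι u)
      (fderiv ℝ γ (x₀ + r • ξ + ι u) ξ) i • frameDet ι γ (x₀ + r • ξ + ι u) •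
        Φ (x₀ + r • ξ + ι u) := fun i =>
    (((hχ.continuous_fderiv (by simp)).clm_apply continuous_const).smul
      (hgsl i).continuous).integrable_of_hasCompactSupport
      ((hχc.fderiv (𝕜 := ℝ)).comp_left (g := fun L : RSpace N →L[ℝ] ℂ => L (stdVec N i))
        (by simp)).smul_right
  convert h2 using 1
  · ext p
    simp_rw [hcomm]
  · have h3 : ∀ u, χ u • fderiv ℝ (fun y => frameDet ι γ y • Φ y) (x₀ + r • ξ + ι u) ξ =
        ∑ i, χ u • fderiv ℝ (fun u => coframe ι γ (x₀ + r • ξ + ι u)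
          (fderiv ℝ γ (x₀ + r • ξ + ι u) ξ) i • frameDet ι γ (x₀ + r • ξ + ι u) •
            Φ (x₀ + r • ξ + ι u)) u (stdVec N i) := by
      intro u
      by_cases hus : u ∈ tsupport χ
      · rw [fderiv_density_eq_sum hγ hu hΦ (hO u hus), Finset.smul_sum]
        refine Finset.sum_congr rfl fun i _ => ?_
        rw [(hasFDerivAt_slice_comp (hgs i) (x₀ + r • ξ) u).fderiv]
        rfl
      · simp [image_eq_zero_of_notMem_tsupport hus]
    simp_rw [h3]
    rw [integral_finsetSum _ fun i _ => hI1 i]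
    simp_rw [fun i => integral_smul_fderiv_of_compact (hχ.of_le (by simp))
      ((hgsl i).of_le (by simp)) hχc (stdVec N i)]
    rw [Finset.sum_neg_distrib, ← integral_finsetSum _ fun i _ => hI2 i]
    congr 2
    ext u
    rw [Finset.smul_sum]
    refine Finset.sum_congr rfl fun i _ => ?_
    rw [hcomm]
    simp only [smul_smul]
    congr 1
    ring

end Slices

/-! ### The Gaussian kernel of complex width -/

/-- The Gaussian kernel on `ℂ^N` of complex width `ζ`; as a function of `(z, ζ)` it is holomorphic
and satisfies a heat equation for `ζ ≠ 0`. -/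
def gaussKer (N : ℕ) (p : CSpace N × ℂ) : ℂ :=
  (p.2 ^ N)⁻¹ * Complex.exp (-(∑ i, p.1 i ^ 2) / p.2 ^ 2)

section Kernel

variable {N : ℕ}

theorem contDiffOn_gaussKer : ContDiffOn ℂ ∞ (gaussKer N) {p | p.2 ≠ 0} := by
  intro p hp
  have hp' : p.2 ≠ 0 := hp
  have h1 : ContDiff ℂ ∞ fun p : CSpace N × ℂ => ∑ i, p.1 i ^ 2 :=
    ContDiff.sum fun i _ => ((EuclideanSpace.proj (𝕜 := ℂ) i).contDiff.comp contDiff_fst).pow 2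
  refine ContDiffAt.contDiffWithinAt (ContDiffAt.mul ?_ (ContDiffAt.cexp ?_))
  · exact (contDiff_snd.pow N).contDiffAt.inv (pow_ne_zero _ hp')
  · exact h1.neg.contDiffAt.div (contDiff_snd.pow 2).contDiffAt (pow_ne_zero _ hp')

theorem contDiff_gaussKer_left (ζ : ℂ) : ContDiff ℂ ∞ fun z => gaussKer N (z, ζ) := by
  have h1 : ContDiff ℂ ∞ fun z : CSpace N => ∑ i, z i ^ 2 :=
    ContDiff.sum fun i _ => ((EuclideanSpace.proj (𝕜 := ℂ) i).contDiff).pow 2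
  exact (contDiff_const (c := (ζ ^ N)⁻¹)).mul (h1.neg.div_const (ζ ^ 2)).cexp

theorem fderiv_gaussKer_left (ζ : ℂ) (z v : CSpace N) :
    fderiv ℂ (fun z => gaussKer N (z, ζ)) z v =
      gaussKer N (z, ζ) * (-2 / ζ ^ 2 * ∑ i, z i * v i) := by
  have h1 : HasFDerivAt (fun z : CSpace N => ∑ i, z i ^ 2)
      (∑ i, (2 * z i) • (EuclideanSpace.proj i : CSpace N →L[ℂ] ℂ)) z := by
    refine HasFDerivAt.fun_sum fun i _ => ?_
    simpa using ((EuclideanSpace.proj (𝕜 := ℂ) i : CSpace N →L[ℂ] ℂ).hasFDerivAt (x := z)).pow 2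
  have h2 : HasFDerivAt (fun z => gaussKer N (z, ζ)) _ z :=
    ((h1.fun_neg.mul_const ((ζ ^ 2)⁻¹)).cexp.const_mul ((ζ ^ N)⁻¹))
  rw [h2.fderiv]
  have hpr : ∀ i, (EuclideanSpace.proj i : CSpace N →L[ℂ] ℂ) v = v i := fun i => rfl
  simp only [gaussKer, _root_.smul_apply, _root_.neg_apply, _root_.sum_apply, smul_eq_mul,
    hpr, mul_assoc, ← Finset.mul_sum, div_eq_mul_inv]
  ring

theorem fderiv_fderiv_gaussKer_left (ζ : ℂ) (z : CSpace N) (i : Fin N) :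
    fderiv ℂ (fun z => fderiv ℂ (fun z => gaussKer N (z, ζ)) z (stdCVec N i)) z (stdCVec N i) =
      gaussKer N (z, ζ) * ((-2 / ζ ^ 2 * z i) ^ 2 - 2 / ζ ^ 2) := by
  have h0 : (fun z => fderiv ℂ (fun z => gaussKer N (z, ζ)) z (stdCVec N i)) =
      fun z => gaussKer N (z, ζ) * (-2 / ζ ^ 2 * z i) := by
    ext z
    rw [fderiv_gaussKer_left, Finset.sum_eq_single i]
    · simp
    · intro j _ hj; simp [hj]
    · simp
  have h1 : HasFDerivAt (fun z => gaussKer N (z, ζ)) _ z :=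
    ((contDiff_gaussKer_left ζ).differentiable (by simp) z).hasFDerivAt
  have h2 : HasFDerivAt (fun z : CSpace N => -2 / ζ ^ 2 * z i) _ z :=
    ((EuclideanSpace.proj (𝕜 := ℂ) i : CSpace N →L[ℂ] ℂ).hasFDerivAt (x := z)).const_mul _
  have h3 := congrFun h0 z
  rw [h0, (h1.fun_mul h2).fderiv]
  simp only [_root_.add_apply, _root_.smul_apply, smul_eq_mul]
  rw [h3]
  simp
  ring

/-- The heat equation satisfied by the Gaussian kernel. -/
theorem hasDerivAt_gaussKer_right {ζ : ℂ} (hζ : ζ ≠ 0) (z : CSpace N) :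
    HasDerivAt (fun ζ => gaussKer N (z, ζ))
      (ζ / 2 * ∑ i, fderiv ℂ (fun z => fderiv ℂ (fun z => gaussKer N (z, ζ)) z (stdCVec N i)) z
        (stdCVec N i)) ζ := by
  simp_rw [fderiv_fderiv_gaussKer_left]
  rw [← Finset.mul_sum, Finset.sum_sub_distrib]
  simp_rw [mul_pow]
  rw [← Finset.mul_sum]
  have h1 : HasDerivAt (fun ζ : ℂ => (ζ ^ N)⁻¹) (-(N * ζ ^ (N - 1)) / (ζ ^ N) ^ 2) ζ :=
    (hasDerivAt_pow N ζ).inv (pow_ne_zero _ hζ)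
  have h2 : HasDerivAt (fun ζ : ℂ => -(∑ i, z i ^ 2) / ζ ^ 2) _ ζ :=
    (hasDerivAt_const ζ (-(∑ i, z i ^ 2))).div (hasDerivAt_pow 2 ζ) (pow_ne_zero _ hζ)
  have h3 : HasDerivAt (fun ζ => gaussKer N (z, ζ)) _ ζ := h1.mul h2.cexp
  convert h3 using 1
  have h4 : (N : ℂ) * ζ ^ (N - 1) = N * ζ ^ N / ζ := by
    rcases N with _ | N
    · simp
    · rw [Nat.add_sub_cancel, pow_succ]; field_simp
  rw [h4, gaussKer]
  have h5 : ζ ^ N ≠ 0 := pow_ne_zero _ hζ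
  simp only [Finset.sum_const, Finset.card_univ, Fintype.card_fin, nsmul_eq_mul]
  field_simp
  ring

/-- The real vector `u` seen as a complex vector. -/
def ofRealVec (u : RSpace N) : CSpace N := WithLp.toLp 2 fun i => (u i : ℂ)

@[simp] theorem norm_ofRealVec (u : RSpace N) : ‖ofRealVec u‖ = ‖u‖ := by
  simp [EuclideanSpace.norm_eq, ofRealVec]

/-- For a width in a narrow sector, and at a point close to the real vector `-u`, the kernel is
controlled by a real Gaussian in `u`. -/
theorem norm_gaussKer_le {ρ : ℝ} (hρ : 0 < ρ) {ζ : ℂ} (hζ : ‖ζ - ρ‖ ≤ ρ / 20) {z : CSpace N}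
    {u : RSpace N} (hz : ‖z + ofRealVec u‖ ≤ ‖u‖ / 5 + ρ / 20) :
    ‖gaussKer N (z, ζ)‖ ≤ 2 ^ N * (ρ ^ N)⁻¹ * Real.exp (1 - ‖u‖ ^ 2 / (4 * ρ ^ 2)) := by
  set ε := z + ofRealVec u with hε
  have hq : ∑ i, z i ^ 2 = (‖u‖ ^ 2 : ℝ) + (∑ i, ε i ^ 2 - 2 * ∑ i, ε i * u i) := by
    have : ∀ i, z i = ε i - u i := fun i => by simp [hε, ofRealVec]
    simp_rw [this, EuclideanSpace.real_norm_sq_eq, Complex.ofReal_sum, Finset.mul_sum]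
    rw [← Finset.sum_sub_distrib, ← Finset.sum_add_distrib]
    refine Finset.sum_congr rfl fun i _ => ?_
    push_cast; ring
  have h1 : ‖∑ i, ε i ^ 2‖ ≤ ‖ε‖ ^ 2 := by
    rw [EuclideanSpace.norm_sq_eq]
    exact (norm_sum_le _ _).trans (le_of_eq (Finset.sum_congr rfl fun i _ => norm_pow _ _))
  have h2 : ‖∑ i, ε i * u i‖ ≤ ‖ε‖ * ‖u‖ := by
    have h := norm_inner_le_norm (𝕜 := ℂ) (ofRealVec u) ε
    rw [norm_ofRealVec, mul_comm] at h
    have e : ∑ i, ε i * u i = inner ℂ (ofRealVec u) ε := by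
      rw [PiLp.inner_apply]
      exact Finset.sum_congr rfl fun i _ => by simp [ofRealVec]
    rw [e]; exact h
  set η := ∑ i, ε i ^ 2 - 2 * ∑ i, ε i * u i with hη
  have h3 : ‖η‖ ≤ ‖u‖ ^ 2 / 2 + 13 / 100 * ρ ^ 2 := by
    have : ‖η‖ ≤ ‖ε‖ ^ 2 + 2 * (‖ε‖ * ‖u‖) := by
      refine (norm_sub_le _ _).trans (add_le_add h1 ?_)
      rw [norm_mul]; simpa using h2
    have h0 := norm_nonneg u
    have h0' := norm_nonneg ε
    have e1 : ‖ε‖ ^ 2 ≤ (‖u‖ / 5 + ρ / 20) ^ 2 := pow_le_pow_left₀ h0' hz 2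
    have e2 : ‖ε‖ * ‖u‖ ≤ (‖u‖ / 5 + ρ / 20) * ‖u‖ := mul_le_mul_of_nonneg_right hz h0
    nlinarith [sq_nonneg (‖u‖ - ρ)]
  have hρ' : (ρ : ℂ) ≠ 0 := by exact_mod_cast hρ.ne'
  set σ : ℂ := ζ / ρ with hσ
  have hζσ : ζ = ρ * σ := by rw [hσ]; field_simp
  have hσ1 : ‖σ - 1‖ ≤ 1 / 20 := by
    have : σ - 1 = (ζ - ρ) / ρ := by rw [hσ]; field_simp
    rw [this, norm_div, Complex.norm_real, Real.norm_of_nonneg hρ.le, div_le_iff₀ hρ]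
    linarith
  have hσ2 : 19 / 20 ≤ ‖σ‖ := by
    have := norm_sub_norm_le (1 : ℂ) (1 - σ)
    rw [sub_sub_cancel, norm_one, norm_sub_rev] at this
    linarith
  have hσ3 : σ ≠ 0 := norm_pos_iff.1 (by linarith)
  have hθ : ‖(σ ^ 2)⁻¹ - 1‖ ≤ 12 / 100 := by
    have e : (σ ^ 2)⁻¹ - 1 = (1 - σ) * (2 + (σ - 1)) / σ ^ 2 := by field_simp; ring
    have e2 : ‖(2 : ℂ) + (σ - 1)‖ ≤ 2 + 1 / 20 := by
      refine (norm_add_le _ _).trans (add_le_add (by simp) hσ1)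
    rw [e, norm_div, norm_mul, norm_pow, div_le_iff₀ (by positivity), norm_sub_rev 1]
    have e3 : (19 / 20 : ℝ) ^ 2 ≤ ‖σ‖ ^ 2 := pow_le_pow_left₀ (by norm_num) hσ2 2
    have e4 : ‖σ - 1‖ * ‖(2 : ℂ) + (σ - 1)‖ ≤ 1 / 20 * (2 + 1 / 20) := by gcongr
    linarith
  set θ := (σ ^ 2)⁻¹ - 1 with hθd
  have hexp : -(∑ i, z i ^ 2) / ζ ^ 2 =
      ((-(‖u‖ ^ 2 / ρ ^ 2) : ℝ) : ℂ) - (η + ((‖u‖ ^ 2 : ℝ) + η) * θ) / ρ ^ 2 := by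
    rw [hq, hζσ, hθd]
    push_cast
    field_simp
    ring
  have hU := sq_nonneg ‖u‖
  have hr : ‖(η + ((‖u‖ ^ 2 : ℝ) + η) * θ) / (ρ : ℂ) ^ 2‖ ≤ 1 + 3 / 4 * (‖u‖ ^ 2 / ρ ^ 2) := by
    rw [norm_div, norm_pow, Complex.norm_real, Real.norm_of_nonneg hρ.le,
      div_le_iff₀ (by positivity)]
    have e1 : ‖((‖u‖ ^ 2 : ℝ) : ℂ) + η‖ ≤ ‖u‖ ^ 2 + ‖η‖ := by
      refine (norm_add_le _ _).trans (le_of_eq ?_)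
      rw [Complex.norm_real, Real.norm_of_nonneg hU]
    have e2 : ‖((‖u‖ ^ 2 : ℝ) + η) * θ‖ ≤ (‖u‖ ^ 2 + ‖η‖) * (12 / 100) := by
      rw [norm_mul]; gcongr
    have e3 : (1 + 3 / 4 * (‖u‖ ^ 2 / ρ ^ 2)) * ρ ^ 2 = ρ ^ 2 + 3 / 4 * ‖u‖ ^ 2 := by
      field_simp
    rw [e3]
    refine (norm_add_le _ _).trans ?_
    nlinarith [sq_nonneg ρ]
  rw [gaussKer, norm_mul, Complex.norm_exp]
  have hre : (-(∑ i, z i ^ 2) / ζ ^ 2).re ≤ 1 - ‖u‖ ^ 2 / (4 * ρ ^ 2) := by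
    have := (abs_le.1 (Complex.abs_re_le_norm
      ((η + ((‖u‖ ^ 2 : ℝ) + η) * θ) / (ρ : ℂ) ^ 2))).1
    rw [hexp, Complex.sub_re, Complex.ofReal_re]
    have e4 : ‖u‖ ^ 2 / (4 * ρ ^ 2) = 1 / 4 * (‖u‖ ^ 2 / ρ ^ 2) := by field_simp
    rw [e4]
    linarith
  have hinv : ‖(ζ ^ N)⁻¹‖ ≤ 2 ^ N * (ρ ^ N)⁻¹ := by
    rw [norm_inv, norm_pow, hζσ, norm_mul, Complex.norm_real, Real.norm_of_nonneg hρ.le, mul_pow,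
      mul_inv, mul_comm]
    gcongr
    rw [inv_le_comm₀ (by positivity) (by positivity), ← inv_pow]
    exact pow_le_pow_left₀ (by norm_num) (by linarith) N
  gcongr

/-- First moment bound for the Gaussian kernel: a density which vanishes to first order at the
origin of the slice contributes `O(ρ)`. -/
theorem exists_norm_integral_gaussKer_le (N : ℕ) : ∃ M : ℝ, 0 ≤ M ∧
    ∀ {W : Type} [NormedAddCommGroup W] [NormedSpace ℂ W] {b : RSpace N → W} {z : RSpace N → CSpace N}
      {C ρ : ℝ} {ζ : ℂ}, 0 < ρ → 0 ≤ C → ‖ζ - ρ‖ ≤ ρ / 20 → (∀ u, ‖b u‖ ≤ C * ‖u‖) →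
      (∀ u, b u ≠ 0 → ‖z u + ofRealVec u‖ ≤ ‖u‖ / 5 + ρ / 20) →
      ‖∫ u, gaussKer N (z u, ζ) • b u‖ ≤ C * M * ρ := by
  set g : RSpace N → ℝ := fun u => 2 ^ N * (2 * Real.exp 1) * Real.exp (-(1 / 8) * ‖u‖ ^ 2) with hg
  have hgi : Integrable g := by
    refine Integrable.const_mul ?_ _
    have := (GaussianFourier.integrable_cexp_neg_mul_sq_norm_add (V := RSpace N) (b := 1 / 8)
      (by norm_num) 0 0).norm
    refine this.congr (Eventually.of_forall fun u => ?_)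
    simp only [Complex.norm_exp]
    norm_cast
    simp [-Complex.ofReal_pow]
  refine ⟨∫ u, g u, integral_nonneg fun u => by positivity, ?_⟩
  intro W _ _ b z C ρ ζ hρ hC hζ hb hz
  have hbound : ∀ u, ‖gaussKer N (z u, ζ) • b u‖ ≤ C * ρ * (ρ ^ N)⁻¹ * g (ρ⁻¹ • u) := by
    intro u
    by_cases h0 : b u = 0
    · rw [h0]; simp; positivity
    have h1 := norm_gaussKer_le hρ hζ (hz u h0)
    set s := ‖u‖ / ρ with hs
    have hs0 : 0 ≤ s := by positivity
    have hus : ‖u‖ = ρ * s := by rw [hs]; field_simp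
    have h2 : ‖ρ⁻¹ • u‖ = s := by
      rw [norm_smul, norm_inv, Real.norm_of_nonneg hρ.le, hs]; field_simp
    have h3 : s ≤ 2 * Real.exp (s ^ 2 / 8) := by
      have := Real.add_one_le_exp (s ^ 2 / 8)
      nlinarith [sq_nonneg (s - 4)]
    rw [norm_smul]
    calc _ ≤ 2 ^ N * (ρ ^ N)⁻¹ * Real.exp (1 - ‖u‖ ^ 2 / (4 * ρ ^ 2)) * (C * ‖u‖) := by
          gcongr; exact hb u
      _ = 2 ^ N * (ρ ^ N)⁻¹ * (C * ρ) * (Real.exp 1 * Real.exp (-s ^ 2 / 4) * s) := by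
          rw [← Real.exp_add, hus]
          have : 1 - (ρ * s) ^ 2 / (4 * ρ ^ 2) = 1 + -s ^ 2 / 4 := by field_simp; ring
          rw [this]; ring
      _ ≤ 2 ^ N * (ρ ^ N)⁻¹ * (C * ρ) *
            (Real.exp 1 * Real.exp (-s ^ 2 / 4) * (2 * Real.exp (s ^ 2 / 8))) := by
          gcongr
      _ = _ := by
          rw [hg]
          simp only [h2]
          have : Real.exp (-(1 / 8) * s ^ 2) = Real.exp (-s ^ 2 / 4) * Real.exp (s ^ 2 / 8) := by
            rw [← Real.exp_add]; ring_nf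
          rw [this]; ring
  have hint : Integrable fun u => C * ρ * (ρ ^ N)⁻¹ * g (ρ⁻¹ • u) :=
    ((integrable_comp_smul_iff volume g (inv_ne_zero hρ.ne')).2 hgi).const_mul _
  refine (norm_integral_le_of_norm_le hint (Eventually.of_forall hbound)).trans (le_of_eq ?_)
  rw [integral_const_mul, Measure.integral_comp_inv_smul, finrank_euclideanSpace, Fintype.card_fin,
    abs_of_pos (by positivity), smul_eq_mul]
  field_simp

end Kernel

/-! ### The Gaussian transform of a density on a slice -/

section Transform

variable {d N : ℕ} {ι : RSpace N →L[ℝ] RSpace d} {γ : RSpace d → CSpace N} {x₀ : RSpace d}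
  {W : Type} [NormedAddCommGroup W] [NormedSpace ℂ W]

/-- The Gaussian transform of the density `b` on the slice through `x₀`: the average of `b` at the
complex scale `ζ` around the point `z`. -/
def gaussTransform (ι : RSpace N →L[ℝ] RSpace d) (γ : RSpace d → CSpace N) (x₀ : RSpace d)
    (b : RSpace N → W) (p : CSpace N × ℂ) : W :=
  ∫ u, gaussKer N (p.1 - γ (x₀ + ι u), p.2) • b u

theorem sliceAdjoint_clm {W' : Type} [NormedAddCommGroup W'] [NormedSpace ℂ W']
    (hγ : ContDiff ℝ ∞ γ) (hu : ∀ x, IsUnit (frame ι γ x))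
    {b : RSpace N → W} (hb : ContDiff ℝ ∞ b) (L : W →L[ℂ] W') (u : RSpace N) (v : CSpace N) :
    sliceAdjoint ι γ x₀ (fun u => L (b u)) u v = L (sliceAdjoint ι γ x₀ b u v) := by
  have hLb : ContDiff ℝ ∞ fun u => L (b u) := (L.restrictScalars ℝ).contDiff.comp hb
  rw [sliceAdjoint_apply hγ hu hLb, sliceAdjoint_apply hγ hu hb,
    map_sum]
  refine Finset.sum_congr rfl fun i _ => ?_
  have h1 : ContDiff ℝ ∞ fun u' => coframe ι γ (x₀ + ι u') v i • b u' :=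
    ((((EuclideanSpace.proj (𝕜 := ℂ) i).restrictScalars ℝ).comp
      ((ContinuousLinearMap.apply ℂ (CSpace N) v).restrictScalars ℝ)).contDiff.comp
        ((contDiff_coframe hγ hu).comp (contDiff_slice x₀))).smul hb
  have h2 : HasFDerivAt (fun u' => L (coframe ι γ (x₀ + ι u') v i • b u')) _ u :=
    (L.restrictScalars ℝ).hasFDerivAt.comp u (h1.differentiable (by simp) u).hasFDerivAt
  simp_rw [map_smul] at h2
  rw [h2.fderiv]
  rfl

theorem hasCompactSupport_sliceAdjoint {b : RSpace N → W} (hc : HasCompactSupport b) :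
    HasCompactSupport (sliceAdjoint ι γ x₀ b) :=
  HasCompactSupport.intro hc fun _ hu => sliceAdjoint_eq_zero hu

/-- The sum of the diagonal entries of a vector valued bilinear form on `ℂ^N`. -/
def diagSum (N : ℕ) (W : Type) [NormedAddCommGroup W] [NormedSpace ℂ W] :
    (CSpace N →L[ℂ] CSpace N →L[ℂ] W) →L[ℂ] W :=
  ∑ i, (ContinuousLinearMap.apply ℂ W (stdCVec N i)).comp
    (ContinuousLinearMap.apply ℂ (CSpace N →L[ℂ] W) (stdCVec N i))

theorem integrable_gaussKer_smul (hγ : ContDiff ℝ ∞ γ) {b : RSpace N → W} (hb : ContDiff ℝ ∞ b)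
    (hc : HasCompactSupport b) (p : CSpace N × ℂ) :
    Integrable fun u => gaussKer N (p.1 - γ (x₀ + ι u), p.2) • b u :=
  (((contDiff_gaussKer_left p.2).continuous.comp (continuous_const.sub
    (hγ.continuous.comp (contDiff_slice x₀).continuous))).smul
      hb.continuous).integrable_of_hasCompactSupport hc.smul_left

theorem contDiff_complex_clm_apply {E V' W' : Type} [NormedAddCommGroup E] [NormedSpace ℝ E]
    [NormedAddCommGroup V'] [NormedSpace ℂ V'] [NormedAddCommGroup W'] [NormedSpace ℂ W']
    {n : WithTop ℕ∞} {f : E → V' →L[ℂ] W'} (hf : ContDiff ℝ n f) (v : V') :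
    ContDiff ℝ n fun x => f x v :=
  ((ContinuousLinearMap.apply ℂ W' v).restrictScalars ℝ).contDiff.comp hf

/-- The complex case of `hasFDerivAt_integral_of_compact`. -/
theorem hasFDerivAt_integral_of_compact_complex {H G : Type} [NormedAddCommGroup H]
    [NormedSpace ℂ H] [LocallyCompactSpace H] [NormedAddCommGroup G]
    [NormedSpace ℂ G] {d : ℕ} {k : H → RSpace d → G} {k' : H → RSpace d → H →L[ℂ] G}
    {s : Set H} {K : Set (RSpace d)} {p₀ : H} (hs : IsOpen s) (hp : p₀ ∈ s) (hK : IsCompact K)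
    (hk : ∀ p ∈ s, Continuous (k p)) (hk0 : ∀ p ∈ s, ∀ u ∉ K, k p u = 0)
    (hk' : ContinuousOn (fun q : H × RSpace d => k' q.1 q.2) (s ×ˢ univ))
    (hk'0 : ∀ p ∈ s, ∀ u ∉ K, k' p u = 0)
    (hd : ∀ p ∈ s, ∀ u, HasFDerivAt (fun p => k p u) (k' p u) p) :
    HasFDerivAt (fun p => ∫ u, k p u) (∫ u, k' p₀ u) p₀ ∧ Integrable (k' p₀) :=
  hasFDerivAt_integral_of_compact hs hp hK hk hk0 hk' hk'0 hd

theorem continuousOn_fderiv_gaussKer :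
    ContinuousOn (fderiv ℂ (gaussKer N)) {p | p.2 ≠ 0} :=
  contDiffOn_gaussKer.continuousOn_fderiv_of_isOpen
    (isOpen_ne_fun continuous_snd continuous_const) (by simp)

theorem differentiableAt_gaussKer {p : CSpace N × ℂ} (hp : p.2 ≠ 0) :
    DifferentiableAt ℂ (gaussKer N) p :=
  (contDiffOn_gaussKer.contDiffAt ((isOpen_ne_fun continuous_snd continuous_const).mem_nhds
    hp)).differentiableAt (by simp)

theorem hasFDerivAt_gaussKer_sub (a : CSpace N) (w : W) {p : CSpace N × ℂ} (hp : p.2 ≠ 0) :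
    HasFDerivAt (fun p => gaussKer N (p.1 - a, p.2) • w)
      ((fderiv ℂ (gaussKer N) (p.1 - a, p.2)).smulRight w) p := by
  have h2 : HasFDerivAt (gaussKer N) (fderiv ℂ (gaussKer N) (p - (a, 0))) (p - (a, 0)) :=
    (differentiableAt_gaussKer (by simpa using hp)).hasFDerivAt
  have h3 : HasFDerivAt (fun p => gaussKer N (p - (a, 0)))
      (fderiv ℂ (gaussKer N) (p - (a, 0))) p :=
    HasFDerivAt.comp (g := gaussKer N) (f := fun p => p - (a, 0)) p h2
      ((hasFDerivAt_id p).sub_const (a, 0))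
  have e : ∀ p : CSpace N × ℂ, p - (a, 0) = (p.1 - a, p.2) := fun p => by
    ext <;> simp
  simp_rw [e] at h3
  exact h3.smul_const w

theorem hasFDerivAt_gaussTransform_integral (hγ : ContDiff ℝ ∞ γ)
    {b : RSpace N → W} (hb : ContDiff ℝ ∞ b) (hc : HasCompactSupport b) {p : CSpace N × ℂ}
    (hp : p.2 ≠ 0) :
    HasFDerivAt (gaussTransform ι γ x₀ b)
        (∫ u, (fderiv ℂ (gaussKer N) (p.1 - γ (x₀ + ι u), p.2)).smulRight (b u)) p ∧
      Integrable fun u => (fderiv ℂ (gaussKer N) (p.1 - γ (x₀ + ι u), p.2)).smulRight (b u) := by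
  have hsl : Continuous fun u => γ (x₀ + ι u) := hγ.continuous.comp (contDiff_slice x₀).continuous
  have hs : IsOpen {p : CSpace N × ℂ | p.2 ≠ 0} := isOpen_ne_fun continuous_snd continuous_const
  have h1 : ContinuousOn (fun q : (CSpace N × ℂ) × RSpace N =>
      fderiv ℂ (gaussKer N) (q.1.1 - γ (x₀ + ι q.2), q.1.2))
      ({p : CSpace N × ℂ | p.2 ≠ 0} ×ˢ univ) :=
    continuousOn_fderiv_gaussKer.comp (Continuous.continuousOn (by fun_prop)) fun q hq => hq.1
  have h2 : ContinuousOn (fun q : (CSpace N × ℂ) × RSpace N => b q.2)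
      ({p : CSpace N × ℂ | p.2 ≠ 0} ×ˢ univ) :=
    (hb.continuous.comp continuous_snd).continuousOn
  have h3 : Continuous fun a : ((CSpace N × ℂ) →L[ℂ] ℂ) × W => a.1.smulRight a.2 :=
    (ContinuousLinearMap.smulRightL ℂ (CSpace N × ℂ) W).continuous₂
  have h4 := h3.comp_continuousOn (h1.prodMk h2)
  have h5 : ∀ p : CSpace N × ℂ, Continuous fun u => gaussKer N (p.1 - γ (x₀ + ι u), p.2) • b u :=
    fun p => ((contDiff_gaussKer_left p.2).continuous.comp (continuous_const.sub hsl)).smul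
      hb.continuous
  have h6 := fun (p : CSpace N × ℂ) hp u => hasFDerivAt_gaussKer_sub (γ (x₀ + ι u)) (b u) (p := p) hp
  have h7 := hasFDerivAt_integral_of_compact_complex
    (k := fun (p : CSpace N × ℂ) u => gaussKer N (p.1 - γ (x₀ + ι u), p.2) • b u)
    (k' := fun p u => (fderiv ℂ (gaussKer N) (p.1 - γ (x₀ + ι u), p.2)).smulRight (b u)) hs hp hc
    (fun p _ => h5 p) (fun p _ u hu => by rw [image_eq_zero_of_notMem_tsupport hu, smul_zero]) h4
  exact h7 (fun p _ u hu => ContinuousLinearMap.ext fun q => by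
    rw [image_eq_zero_of_notMem_tsupport hu, ContinuousLinearMap.smulRight_apply, smul_zero]
    rfl) h6

/-- The derivative of the kernel in `ζ` is replaced, by the heat equation, by second derivatives in
`z`. -/
theorem fderiv_gaussKer_apply {p : CSpace N × ℂ} (hp : p.2 ≠ 0) (q : CSpace N × ℂ) :
    fderiv ℂ (gaussKer N) p q = fderiv ℂ (fun z => gaussKer N (z, p.2)) p.1 q.1 +
      q.2 * (p.2 / 2 * ∑ i, fderiv ℂ (fun z => fderiv ℂ (fun z => gaussKer N (z, p.2)) z
        (stdCVec N i)) p.1 (stdCVec N i)) := by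
  have h := (differentiableAt_gaussKer hp).hasFDerivAt
  have h1 : HasFDerivAt (fun z => gaussKer N (z, p.2)) _ p.1 :=
    HasFDerivAt.comp (g := gaussKer N) (f := fun z => (z, p.2)) p.1 h (hasFDerivAt_prodMk_left _ _)
  have h2 : HasFDerivAt (fun ζ => gaussKer N (p.1, ζ)) _ p.2 :=
    HasFDerivAt.comp (g := gaussKer N) (f := fun ζ => (p.1, ζ)) p.2 h (hasFDerivAt_prodMk_right _ _)
  have h3 := (hasDerivAt_gaussKer_right hp p.1).hasFDerivAt.unique h2
  rw [h1.fderiv]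
  have h4 := congrArg (fun L : ℂ →L[ℂ] ℂ => L q.2) h3
  simp only [ContinuousLinearMap.toSpanSingleton_apply, smul_eq_mul] at h4
  rw [h4, ContinuousLinearMap.comp_apply, ContinuousLinearMap.comp_apply, ← map_add]
  simp

/-- Two integrations by parts on the slice. -/
theorem integral_fderiv_fderiv_gaussKer (hγ : ContDiff ℝ ∞ γ)
    (hu : ∀ x, IsUnit (frame ι γ x)) {b : RSpace N → W} (hb : ContDiff ℝ ∞ b)
    (hc : HasCompactSupport b) (z v : CSpace N) (ζ : ℂ) :
    ∫ u, fderiv ℂ (fun z => fderiv ℂ (fun z => gaussKer N (z, ζ)) z v) (z - γ (x₀ + ι u)) v • b u =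
      ∫ u, gaussKer N (z - γ (x₀ + ι u), ζ) •
        sliceAdjoint ι γ x₀ (sliceAdjoint ι γ x₀ b) u v v := by
  have hκ : ContDiff ℂ 1 fun z => fderiv ℂ (fun z => gaussKer N (z, ζ)) z v :=
    (((contDiff_gaussKer_left ζ).fderiv_right (m := ∞) (by simp)).clm_apply
      contDiff_const).of_le (by simp)
  have hb1 := contDiff_sliceAdjoint (ι := ι) hγ hu x₀ hb
  have hb1v : ContDiff ℝ ∞ fun u => sliceAdjoint ι γ x₀ b u v :=
    ((ContinuousLinearMap.apply ℂ W v).restrictScalars ℝ).contDiff.comp hb1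
  have hc1v : HasCompactSupport fun u => sliceAdjoint ι γ x₀ b u v :=
    (hasCompactSupport_sliceAdjoint hc).comp_left (g := fun L : CSpace N →L[ℂ] W => L v) (by simp)
  rw [integral_fderiv_comp_sub_smul hγ hu hb hc hκ,
    integral_fderiv_comp_sub_smul hγ hu hb1v hc1v ((contDiff_gaussKer_left ζ).of_le (by simp))]
  congr 1
  ext u
  rw [← ContinuousLinearMap.apply_apply v (sliceAdjoint ι γ x₀ (sliceAdjoint ι γ x₀ b) u v),
    ← sliceAdjoint_clm hγ hu hb1]
  rfl

theorem gaussTransform_apply [CompleteSpace W] (hγ : ContDiff ℝ ∞ γ)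
    {b : RSpace N → CSpace N →L[ℂ] W} (hb : ContDiff ℝ ∞ b) (hc : HasCompactSupport b)
    (p : CSpace N × ℂ) (v : CSpace N) :
    gaussTransform ι γ x₀ b p v = gaussTransform ι γ x₀ (fun u => b u v) p := by
  rw [gaussTransform, ContinuousLinearMap.integral_apply (integrable_gaussKer_smul hγ hb hc p)]
  rfl

/-- The derivative of a Gaussian transform is given by Gaussian transforms: integration by parts in
the first variable and the heat equation in the second one. -/
theorem hasFDerivAt_gaussTransform [CompleteSpace W] (hγ : ContDiff ℝ ∞ γ)
    (hu : ∀ x, IsUnit (frame ι γ x)) {b : RSpace N → W} (hb : ContDiff ℝ ∞ b)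
    (hc : HasCompactSupport b) {p : CSpace N × ℂ} (hp : p.2 ≠ 0) :
    HasFDerivAt (gaussTransform ι γ x₀ b)
      ((gaussTransform ι γ x₀ (sliceAdjoint ι γ x₀ b) p).comp (ContinuousLinearMap.fst ℂ _ _) +
        (ContinuousLinearMap.snd ℂ (CSpace N) ℂ).smulRight ((p.2 / 2) • diagSum N W
          (gaussTransform ι γ x₀ (sliceAdjoint ι γ x₀ (sliceAdjoint ι γ x₀ b)) p))) p := by
  obtain ⟨key, hint⟩ := hasFDerivAt_gaussTransform_integral (ι := ι) (x₀ := x₀) hγ hb hc hp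
  refine key.congr_fderiv ?_
  have hb1 := contDiff_sliceAdjoint (ι := ι) hγ hu x₀ hb
  have hb2 := contDiff_sliceAdjoint (ι := ι) hγ hu x₀ hb1
  have hc1 := hasCompactSupport_sliceAdjoint (ι := ι) (γ := γ) (x₀ := x₀) hc
  have hc2 := hasCompactSupport_sliceAdjoint (ι := ι) (γ := γ) (x₀ := x₀) hc1
  have hb2v : ∀ v, ContDiff ℝ ∞ fun u => sliceAdjoint ι γ x₀ (sliceAdjoint ι γ x₀ b) u v :=
    fun v => contDiff_complex_clm_apply hb2 v
  have hc2v : ∀ v, HasCompactSupport fun u =>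
      sliceAdjoint ι γ x₀ (sliceAdjoint ι γ x₀ b) u v := fun v =>
    hc2.comp_left (g := fun L : CSpace N →L[ℂ] CSpace N →L[ℂ] W => L v) (by simp)
  have hcont : Continuous fun u => p.1 - γ (x₀ + ι u) :=
    continuous_const.sub (hγ.continuous.comp (contDiff_slice x₀).continuous)
  have hκ := contDiff_gaussKer_left (N := N) p.2
  refine ContinuousLinearMap.ext fun q => ?_
  rw [ContinuousLinearMap.integral_apply hint]
  have e : ∀ u, (fderiv ℂ (gaussKer N) (p.1 - γ (x₀ + ι u), p.2)).smulRight (b u) q =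
      fderiv ℂ (fun z => gaussKer N (z, p.2)) (p.1 - γ (x₀ + ι u)) q.1 • b u +
      (q.2 * (p.2 / 2)) • ∑ i, fderiv ℂ (fun z => fderiv ℂ (fun z => gaussKer N (z, p.2)) z
        (stdCVec N i)) (p.1 - γ (x₀ + ι u)) (stdCVec N i) • b u := by
    intro u
    rw [ContinuousLinearMap.smulRight_apply, fderiv_gaussKer_apply (by exact hp), add_smul,
      ← Finset.sum_smul, smul_smul, mul_assoc]
  have i1 : Integrable fun u =>
      fderiv ℂ (fun z => gaussKer N (z, p.2)) (p.1 - γ (x₀ + ι u)) q.1 • b u :=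
    (((hκ.continuous_fderiv (by simp)).clm_apply continuous_const).comp hcont |>.smul
      hb.continuous).integrable_of_hasCompactSupport hc.smul_left
  have i2 : ∀ i ∈ Finset.univ, Integrable fun u =>
      fderiv ℂ (fun z => fderiv ℂ (fun z => gaussKer N (z, p.2)) z
        (stdCVec N i)) (p.1 - γ (x₀ + ι u)) (stdCVec N i) • b u := fun i _ =>
    ((((((hκ.fderiv_right (m := ∞) (by simp)).clm_apply contDiff_const).continuous_fderiv
      (by simp)).clm_apply continuous_const).comp hcont).smul
      hb.continuous).integrable_of_hasCompactSupport hc.smul_left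
  have i3 : Integrable fun u => (q.2 * (p.2 / 2)) • ∑ i,
      fderiv ℂ (fun z => fderiv ℂ (fun z => gaussKer N (z, p.2)) z
        (stdCVec N i)) (p.1 - γ (x₀ + ι u)) (stdCVec N i) • b u :=
    (integrable_finsetSum _ i2).smul _
  simp_rw [e]
  rw [integral_add i1 i3, integral_smul,
    integral_finsetSum _ i2, integral_fderiv_comp_sub_smul hγ hu hb hc (hκ.of_le (by simp))]
  simp_rw [integral_fderiv_fderiv_gaussKer hγ hu hb hc]
  simp only [_root_.add_apply, ContinuousLinearMap.comp_apply, ContinuousLinearMap.smulRight_apply,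
    diagSum, _root_.sum_apply, ContinuousLinearMap.apply_apply, ContinuousLinearMap.coe_fst',
    ContinuousLinearMap.coe_snd', smul_smul]
  simp_rw [gaussTransform_apply hγ hb2 hc2, gaussTransform_apply hγ (hb2v _) (hc2v _),
    gaussTransform_apply hγ hb1 hc1]
  rfl

end Transform

/-! ### Boundary behaviour of Gaussian transforms of CR densities -/

/-- Geometric data for Gaussian transforms near `x₀`: at the scale `R` the slices through the points
of `ball x₀ δ` are close to the real subspace `ℝ^N` of `ℂ^N`, close to one another, and contained
in `O`. -/
structure SliceData {d N : ℕ} (ι : RSpace N →L[ℝ] RSpace d) (γ : RSpace d → CSpace N)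
    (x₀ : RSpace d) (O : Set (RSpace d)) (R δ : ℝ) : Prop where
  smooth : ContDiff ℝ ∞ γ
  isUnit : ∀ x, IsUnit (frame ι γ x)
  isOpen : IsOpen O
  R_pos : 0 < R
  δ_pos : 0 < δ
  close : ∀ x ∈ Metric.ball x₀ δ, ∀ u, ‖u‖ ≤ R → ‖γ (x + ι u) - γ x - ofRealVec u‖ ≤ ‖u‖ / 10
  small : ∀ x ∈ Metric.ball x₀ δ, ∀ x' ∈ Metric.ball x₀ δ, ‖γ x - γ x'‖ ≤ R / 20
  mem : ∀ x ∈ Metric.ball x₀ δ, ∀ u, ‖u‖ ≤ R → x + ι u ∈ O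
  frame_one : frame ι γ x₀ = 1

/-- The density `b` on the slice through `x₀` is supported in the ball of radius `R`, and in the ball
of radius `R / 2` it is the density of the CR function `φ`. -/
structure IsDensityOf {d N : ℕ} {W : Type} [NormedAddCommGroup W] [NormedSpace ℂ W]
    (ι : RSpace N →L[ℝ] RSpace d) (γ : RSpace d → CSpace N) (x₀ : RSpace d) (O : Set (RSpace d))
    (R : ℝ) (b : RSpace N → W) (φ : RSpace d → W) : Prop where
  smooth : ContDiff ℝ ∞ b
  supp : tsupport b ⊆ Metric.closedBall 0 R
  cr : IsCRSmoothOn ι γ O φ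
  eq : ∀ u, ‖u‖ < R / 2 → b u = frameDet ι γ (x₀ + ι u) • φ (x₀ + ι u)

section Estimates

variable {d N : ℕ} {ι : RSpace N →L[ℝ] RSpace d} {γ : RSpace d → CSpace N} {x₀ : RSpace d}
  {O : Set (RSpace d)} {R δ : ℝ} {W : Type} [NormedAddCommGroup W] [NormedSpace ℂ W]

theorem IsDensityOf.hasCompactSupport {b : RSpace N → W} {φ : RSpace d → W}
    (h : IsDensityOf ι γ x₀ O R b φ) : HasCompactSupport b :=
  (isCompact_closedBall _ _).of_isClosed_subset (isClosed_tsupport _) h.supp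

theorem IsDensityOf.eq_zero {b : RSpace N → W} {φ : RSpace d → W}
    (h : IsDensityOf ι γ x₀ O R b φ) {u : RSpace N} (hu : R < ‖u‖) : b u = 0 :=
  image_eq_zero_of_notMem_tsupport fun h' => by
    have := h.supp h'
    rw [mem_closedBall_zero_iff] at this
    linarith

theorem IsDensityOf.sliceAdjoint (hS : SliceData ι γ x₀ O R δ) {b : RSpace N → W}
    {φ : RSpace d → W} (h : IsDensityOf ι γ x₀ O R b φ) :
    IsDensityOf ι γ x₀ O R (sliceAdjoint ι γ x₀ b) (crDeriv ι γ φ) where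
  smooth := contDiff_sliceAdjoint hS.smooth hS.isUnit x₀ h.smooth
  supp := by
    refine (closure_minimal (fun u hu => ?_) (isClosed_tsupport _)).trans h.supp
    by_contra h'
    exact hu (sliceAdjoint_eq_zero h')
  cr := h.cr.crDeriv hS.smooth hS.isUnit hS.isOpen
  eq u hu := sliceAdjoint_density hS.smooth hS.isUnit h.smooth h.cr.smooth
    (eventually_of_mem (Metric.isOpen_ball.mem_nhds (mem_ball_zero_iff.2 hu)) fun u' hu' =>
      h.eq u' (mem_ball_zero_iff.1 hu'))

/-- The point `z` is within `κ ρ` of `γ x`, and the complex scale `ζ` within `κ ρ` of `ρ`. For small `κ`,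
this puts `ζ` in a narrow sector around the positive reals. -/
structure NearEdge (γ : RSpace d → CSpace N) (x : RSpace d) (κ ρ : ℝ) (p : CSpace N × ℂ) : Prop where
  fst : ‖p.1 - γ x‖ < κ * ρ
  snd : ‖p.2 - ρ‖ < κ * ρ

theorem NearEdge.snd_ne_zero {x : RSpace d} {κ ρ : ℝ} {p : CSpace N × ℂ}
    (h : NearEdge γ x κ ρ p) (hκ : κ ≤ 1) (hρ : 0 < ρ) : p.2 ≠ 0 := by
  intro h0
  have := h.snd
  rw [h0, zero_sub, norm_neg, Complex.norm_real, Real.norm_of_nonneg hρ.le] at this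
  nlinarith

/-- On the slice through `x'`, the argument of the kernel is close to a real vector, as required in
`norm_gaussKer_le`, if `z` lies over the same point of the edge or `u` is not small. -/
theorem SliceData.norm_sub_add_le (hS : SliceData ι γ x₀ O R δ) {x x' : RSpace d}
    (hx : x ∈ Metric.ball x₀ δ) (hx' : x' ∈ Metric.ball x₀ δ) {ρ : ℝ} {p : CSpace N × ℂ}
    (hp : NearEdge γ x (1 / 20) ρ p) {u : RSpace N} (hu : ‖u‖ ≤ R) (h : x = x' ∨ R / 2 ≤ ‖u‖) :
    ‖p.1 - γ (x' + ι u) + ofRealVec u‖ ≤ ‖u‖ / 5 + ρ / 20 := by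
  have h1 := hS.close x' hx' u hu
  have h2 : ‖γ x - γ x'‖ ≤ ‖u‖ / 10 := by
    rcases h with rfl | h
    · simp; positivity
    · exact (hS.small x hx x' hx').trans (by linarith)
  have e : p.1 - γ (x' + ι u) + ofRealVec u =
      (p.1 - γ x) + (γ x - γ x') - (γ (x' + ι u) - γ x' - ofRealVec u) := by abel
  rw [e]
  have h3 := hp.fst
  have h4 := norm_sub_le ((p.1 - γ x) + (γ x - γ x')) (γ (x' + ι u) - γ x' - ofRealVec u)
  have h5 := norm_add_le (p.1 - γ x) (γ x - γ x')
  linarith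

/-- A density which vanishes near the origin of the slice contributes `O(ρ)`. -/
theorem norm_integral_le_of_eq_zero_near (N : ℕ) : ∃ M : ℝ, 0 ≤ M ∧
    ∀ {d : ℕ} {ι : RSpace N →L[ℝ] RSpace d} {γ : RSpace d → CSpace N} {x₀ : RSpace d}
      {O : Set (RSpace d)} {R δ : ℝ} {W : Type} [NormedAddCommGroup W] [NormedSpace ℂ W]
      (_ : SliceData ι γ x₀ O R δ) {x x' : RSpace d}
      (_ : x ∈ Metric.ball x₀ δ) (_ : x' ∈ Metric.ball x₀ δ) {ρ : ℝ} (_ : 0 < ρ)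
      {p : CSpace N × ℂ} (_ : NearEdge γ x (1 / 20) ρ p) {b : RSpace N → W} {B : ℝ}
      (_ : ∀ u, ‖b u‖ ≤ B) (_ : ∀ u, b u ≠ 0 → R / 2 ≤ ‖u‖ ∧ ‖u‖ ≤ R),
      ‖gaussTransform ι γ x' b p‖ ≤ 2 * B / R * M * ρ := by
  obtain ⟨M, hM, h⟩ := exists_norm_integral_gaussKer_le N
  refine ⟨M, hM, ?_⟩
  intro d ι γ x₀ O R δ W _ _ hS x x' hx hx' ρ hρ p hp b B hB hb
  have hB0 : 0 ≤ B := (norm_nonneg _).trans (hB 0)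
  have hR := hS.R_pos
  refine h hρ (by positivity) ?_ (fun u => ?_) fun u hu => ?_
  · linarith [hp.snd]
  · by_cases hu : b u = 0
    · rw [hu, norm_zero]; positivity
    · refine (hB u).trans ?_
      rw [div_mul_eq_mul_div, le_div_iff₀ hR]
      nlinarith [(hb u hu).1]
  · exact hS.norm_sub_add_le hx hx' hp (hb u hu).2 (Or.inr (hb u hu).1)

/-- A smooth cutoff function on `ℝ^N` which is `1` on the ball of radius `R / 2` and supported in
the ball of radius `R`. -/
def sliceBump (N : ℕ) {R : ℝ} (hR : 0 < R) : ContDiffBump (0 : RSpace N) :=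
  ⟨R / 2, R, by positivity, by linarith⟩

/-- The density of `φ` on the slice through `x`, cut off at the scale `R`. -/
def cutDensity (ι : RSpace N →L[ℝ] RSpace d) (γ : RSpace d → CSpace N) (hR : 0 < R)
    (φ : RSpace d → W) (x : RSpace d) (u : RSpace N) : W :=
  ((sliceBump N hR u : ℝ) : ℂ) • frameDet ι γ (x + ι u) • φ (x + ι u)

theorem isDensityOf_cutDensity (hS : SliceData ι γ x₀ O R δ) {φ : RSpace d → W}
    (hφ : IsCRSmoothOn ι γ O φ) : IsDensityOf ι γ x₀ O R (cutDensity ι γ hS.R_pos φ x₀) φ where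
  smooth := (Complex.ofRealCLM.contDiff.comp (sliceBump N hS.R_pos).contDiff).smul
    (((contDiff_frameDet hS.smooth).smul hφ.smooth).comp (contDiff_slice x₀))
  supp := by
    have e : tsupport (sliceBump N hS.R_pos) = Metric.closedBall 0 R :=
      (sliceBump N hS.R_pos).tsupport_eq
    rw [← e]
    refine closure_mono fun u hu => ?_
    rw [Function.mem_support] at hu ⊢
    intro h
    exact hu (by simp [cutDensity, h])
  cr := hφ
  eq u hu := by
    have : sliceBump N hS.R_pos u = 1 :=
      (sliceBump N hS.R_pos).one_of_mem_closedBall (mem_closedBall_zero_iff.2 hu.le)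
    simp [cutDensity, this]

theorem continuous_cutDensity (hS : SliceData ι γ x₀ O R δ) {φ : RSpace d → W}
    (hφ : ContDiff ℝ ∞ φ) (x : RSpace d) : Continuous (cutDensity ι γ hS.R_pos φ x) :=
  (Complex.continuous_ofReal.comp (sliceBump N hS.R_pos).continuous).smul
    (((contDiff_frameDet hS.smooth).continuous.smul hφ.continuous).comp
      (contDiff_slice x).continuous)

theorem cutDensity_eq_zero (hR : 0 < R) {φ : RSpace d → W} {x : RSpace d} {u : RSpace N}
    (hu : R ≤ ‖u‖) : cutDensity ι γ hR φ x u = 0 := by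
  have : sliceBump N hR u = 0 := (sliceBump N hR).zero_of_le_dist (by rw [dist_zero_right]; exact hu)
  simp [cutDensity, this]

/-- Gaussian transforms of the densities of a CR function on neighbouring slices agree up to
`O(ρ)`. -/
theorem exists_norm_gaussTransform_sub_le (hS : SliceData ι γ x₀ O R δ) {φ : RSpace d → W}
    (hφ : IsCRSmoothOn ι γ O φ) : ∃ C : ℝ, ∀ x ∈ Metric.ball x₀ δ, ∀ ρ : ℝ, 0 < ρ →
      ∀ p, NearEdge γ x (1 / 20) ρ p →
        ‖gaussTransform ι γ x (cutDensity ι γ hS.R_pos φ x) p -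
          gaussTransform ι γ x₀ (cutDensity ι γ hS.R_pos φ x₀) p‖ ≤ C * ρ := by
  obtain ⟨M, hM, h⟩ := norm_integral_le_of_eq_zero_near N
  set χ : RSpace N → ℂ := fun u => ((sliceBump N hS.R_pos u : ℝ) : ℂ) with hχ
  have hχs : ContDiff ℝ ∞ χ := Complex.ofRealCLM.contDiff.comp (sliceBump N hS.R_pos).contDiff
  have hχt : tsupport χ ⊆ Metric.closedBall 0 R := by
    have e : tsupport (sliceBump N hS.R_pos) = Metric.closedBall 0 R :=
      (sliceBump N hS.R_pos).tsupport_eq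
    rw [← e]
    refine closure_mono fun u hu => ?_
    rw [Function.mem_support] at hu ⊢
    intro h
    exact hu (by simp [hχ, h])
  have hχc : HasCompactSupport χ :=
    (isCompact_closedBall _ _).of_isClosed_subset (isClosed_tsupport _) hχt
  -- The density produced by differentiating the cutoff, as a function of all parameters.
  set g : RSpace d × RSpace d × RSpace N → W := fun q => ∑ i, fderiv ℝ χ q.2.2 (stdVec N i) •
    coframe ι γ (q.1 + ι q.2.2) (fderiv ℝ γ (q.1 + ι q.2.2) q.2.1) i •
      frameDet ι γ (q.1 + ι q.2.2) • φ (q.1 + ι q.2.2) with hg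
  have hgc : Continuous g := by
    have c1 : Continuous fun q : RSpace d × RSpace d × RSpace N => q.1 + ι q.2.2 := by fun_prop
    have c2 : Continuous fun q : RSpace d × RSpace d × RSpace N =>
        fderiv ℝ γ (q.1 + ι q.2.2) q.2.1 :=
      ((hS.smooth.continuous_fderiv (by simp)).comp c1).clm_apply (by fun_prop)
    have c3 := ((contDiff_coframe hS.smooth hS.isUnit).continuous.comp c1).clm_apply c2
    refine continuous_finsetSum _ fun i _ => ?_
    exact (((hχs.continuous_fderiv (by simp)).comp
      (continuous_snd.comp continuous_snd)).clm_apply continuous_const).smul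
      (((EuclideanSpace.proj (𝕜 := ℂ) i).continuous.comp c3).smul
        (((contDiff_frameDet hS.smooth).continuous.smul hφ.smooth.continuous).comp c1))
  obtain ⟨B, hB⟩ := ((isCompact_closedBall x₀ δ).prod ((isCompact_closedBall (0 : RSpace d) δ).prod
    (isCompact_closedBall (0 : RSpace N) R))).exists_bound_of_continuousOn hgc.continuousOn
  have hg0 : ∀ a ξ u, g (a, ξ, u) ≠ 0 → R / 2 ≤ ‖u‖ ∧ ‖u‖ ≤ R := by
    intro a ξ u hu
    have hne : fderiv ℝ χ u ≠ 0 := by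
      intro h0
      refine hu (Finset.sum_eq_zero fun i _ => ?_)
      rw [show (a, ξ, u).2.2 = u from rfl, h0]
      simp
    constructor
    · by_contra! hlt
      have : χ =ᶠ[𝓝 u] fun _ => 1 := by
        refine eventually_of_mem (Metric.isOpen_ball.mem_nhds (mem_ball_zero_iff.2 hlt))
          fun u' hu' => ?_
        have : sliceBump N hS.R_pos u' = 1 := (sliceBump N hS.R_pos).one_of_mem_closedBall
          (mem_closedBall_zero_iff.2 (mem_ball_zero_iff.1 hu').le)
        simp [hχ, this]
      exact hne (by rw [this.fderiv_eq]; simp)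
    · exact mem_closedBall_zero_iff.1 (hχt (support_fderiv_subset ℝ hne))
  refine ⟨2 * max B 0 / R * M, fun x hx ρ hρ p hp => ?_⟩
  set ξ := x - x₀ with hξ
  have hseg : ∀ r ∈ Icc (0 : ℝ) 1, x₀ + r • ξ ∈ Metric.ball x₀ δ := by
    intro r hr
    have h1 : ‖ξ‖ < δ := by rw [hξ, ← dist_eq_norm]; exact hx
    rw [mem_ball_iff_norm, add_sub_cancel_left, norm_smul, Real.norm_of_nonneg hr.1]
    exact (mul_le_of_le_one_left (norm_nonneg _) hr.2).trans_lt h1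
  have hder : ∀ r ∈ Icc (0 : ℝ) 1, HasDerivAt
      (fun r : ℝ => gaussTransform ι γ (x₀ + r • ξ) (cutDensity ι γ hS.R_pos φ (x₀ + r • ξ)) p)
      (- gaussTransform ι γ (x₀ + r • ξ) (fun u => g (x₀ + r • ξ, ξ, u)) p) r := by
    intro r hr
    have := hasDerivAt_integral_slice hS.smooth hS.isUnit hφ (contDiff_gaussKer_left p.2) p.1 hχs
      hχc x₀ ξ r fun u hu => hS.mem _ (hseg r hr) u (mem_closedBall_zero_iff.1 (hχt hu))
    convert this using 1
    · ext r
      refine integral_congr_ae (Eventually.of_forall fun u => ?_)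
      simp only [cutDensity, hχ]
      rw [smul_comm]
    · rfl
  have := norm_image_sub_le_of_norm_deriv_le_segment_01' (C := 2 * max B 0 / R * M * ρ)
    (fun r hr => (hder r hr).hasDerivWithinAt) fun r hr => by
      rw [norm_neg]
      refine h hS hx (hseg r (Ico_subset_Icc_self hr)) hρ hp (fun u => ?_) (hg0 _ _)
      by_cases hu : g (x₀ + r • ξ, ξ, u) = 0
      · rw [hu, norm_zero]; exact le_max_right _ _
      · refine (hB (x₀ + r • ξ, ξ, u) ⟨Metric.ball_subset_closedBall
          (hseg r (Ico_subset_Icc_self hr)), ?_, ?_⟩).trans (le_max_left _ _)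
        · rw [mem_closedBall_zero_iff, hξ, ← dist_eq_norm]; exact (Metric.mem_ball.1 hx).le
        · exact mem_closedBall_zero_iff.2 (hg0 _ _ _ hu).2
  simpa [hξ] using this

end Estimates

section Estimates

variable {d N : ℕ} {ι : RSpace N →L[ℝ] RSpace d} {γ : RSpace d → CSpace N} {x₀ : RSpace d}
  {O : Set (RSpace d)} {R δ : ℝ} {W : Type} [NormedAddCommGroup W] [NormedSpace ℂ W]

/-- The total mass of the Gaussian kernel at scale `1`. -/
def gaussMass (N : ℕ) : ℂ := ∫ u : RSpace N, gaussKer N (ofRealVec u, 1)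

theorem gaussMass_ne_zero (N : ℕ) : gaussMass N ≠ 0 := by
  have h : ∀ u : RSpace N, gaussKer N (ofRealVec u, 1) = (Real.exp (-1 * ‖u‖ ^ 2) : ℝ) := by
    intro u
    rw [EuclideanSpace.real_norm_sq_eq]
    simp [gaussKer, ofRealVec]
  rw [gaussMass]
  simp_rw [h]
  rw [integral_complex_ofReal, GaussianFourier.integral_rexp_neg_mul_sq_norm one_pos]
  norm_cast
  positivity

theorem gaussKer_smul {ρ : ℝ} (hρ : ρ ≠ 0) (z : CSpace N) :
    gaussKer N (ρ • z, ρ) = ((ρ ^ N : ℝ) : ℂ)⁻¹ * gaussKer N (z, 1) := by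
  have h : ∀ i, ((ρ • z : CSpace N) i) ^ 2 = (ρ : ℂ) ^ 2 * z i ^ 2 := fun i => by
    simp [mul_pow]
  have hρ' : (ρ : ℂ) ≠ 0 := by exact_mod_cast hρ
  simp only [gaussKer, h, ← Finset.mul_sum]
  have : -((ρ : ℂ) ^ 2 * ∑ i, z i ^ 2) / (ρ : ℂ) ^ 2 = - ∑ i, z i ^ 2 := by
    field_simp
  simp [neg_div] at this ⊢
  simp [this]

theorem abs_sliceBump_le (hR : 0 < R) (u : RSpace N) : ‖((sliceBump N hR u : ℝ) : ℂ)‖ ≤ 1 := by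
  rw [Complex.norm_real, Real.norm_of_nonneg (sliceBump N hR).nonneg]
  exact (sliceBump N hR).le_one

/-- Continuous functions are bounded on the slices of size `R` through the points of `ball x₀ δ`. -/
theorem exists_bound_slice {G : Type} [NormedAddCommGroup G] {g : RSpace d → G} (hg : Continuous g)
    (ι : RSpace N →L[ℝ] RSpace d) (x₀ : RSpace d) (R δ : ℝ) : ∃ C : ℝ, 0 ≤ C ∧
      ∀ x ∈ Metric.ball x₀ δ, ∀ u : RSpace N, ‖u‖ ≤ R → ‖g (x + ι u)‖ ≤ C := by
  have hc : Continuous fun q : RSpace d × RSpace N => g (q.1 + ι q.2) := hg.comp (by fun_prop)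
  obtain ⟨C, hC⟩ := ((isCompact_closedBall x₀ δ).prod
    (isCompact_closedBall (0 : RSpace N) R)).exists_bound_of_continuousOn hc.continuousOn
  exact ⟨max C 0, le_max_right _ _, fun x hx u hu => (hC (x, u)
    ⟨Metric.ball_subset_closedBall hx, mem_closedBall_zero_iff.2 hu⟩).trans (le_max_left _ _)⟩

/-- On a slice, a smooth function may be replaced by its value at the centre, up to `O(ρ)`. -/
theorem exists_norm_gaussTransform_cutDensity_sub_le [CompleteSpace W] (hS : SliceData ι γ x₀ O R δ)
    {φ : RSpace d → W} (hφ : ContDiff ℝ ∞ φ) : ∃ C : ℝ, ∀ x ∈ Metric.ball x₀ δ, ∀ ρ : ℝ, 0 < ρ →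
      ∀ p, NearEdge γ x (1 / 20) ρ p →
        ‖gaussTransform ι γ x (cutDensity ι γ hS.R_pos φ x) p -
          gaussTransform ι γ x (cutDensity ι γ hS.R_pos (fun _ => (1 : ℂ)) x) p • φ x‖ ≤ C * ρ := by
  obtain ⟨M, hM, h⟩ := exists_norm_integral_gaussKer_le N
  obtain ⟨C₁, hC₁, h₁⟩ := exists_bound_slice (contDiff_frameDet (ι := ι) hS.smooth).continuous ι x₀ R δ
  obtain ⟨C₂, hC₂, h₂⟩ := exists_bound_slice (hφ.continuous_fderiv (by simp)) ι x₀ R δ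
  refine ⟨C₁ * (C₂ * ‖ι‖) * M, fun x hx ρ hρ p hp => ?_⟩
  have hcont := continuous_cutDensity hS hφ x
  have hcont1 := continuous_cutDensity hS (contDiff_const (c := (1 : ℂ))) x
  have hK : Continuous fun u => gaussKer N (p.1 - γ (x + ι u), p.2) :=
    (contDiff_gaussKer_left p.2).continuous.comp (continuous_const.sub
      (hS.smooth.continuous.comp (contDiff_slice x).continuous))
  have hcs : ∀ {W' : Type} [NormedAddCommGroup W'] [NormedSpace ℂ W'] (ψ : RSpace d → W'),
      HasCompactSupport (cutDensity ι γ hS.R_pos ψ x) := fun ψ =>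
    HasCompactSupport.intro (isCompact_closedBall 0 R) fun u hu =>
      cutDensity_eq_zero _ (by rw [mem_closedBall_zero_iff, not_le] at hu; exact hu.le)
  have i1 : Integrable fun u => gaussKer N (p.1 - γ (x + ι u), p.2) •
      cutDensity ι γ hS.R_pos φ x u :=
    (hK.smul hcont).integrable_of_hasCompactSupport (hcs φ).smul_left
  have i2 : Integrable fun u => gaussKer N (p.1 - γ (x + ι u), p.2) •
      cutDensity ι γ hS.R_pos (fun _ => (1 : ℂ)) x u :=
    (hK.smul hcont1).integrable_of_hasCompactSupport (hcs _).smul_left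
  rw [gaussTransform, gaussTransform, ← integral_smul_const, ← integral_sub i1 (i2.smul_const _)]
  simp_rw [smul_assoc, ← smul_sub]
  refine h hρ (by positivity) (by linarith [hp.snd]) (fun u => ?_) fun u hu => ?_
  · rcases le_or_gt R ‖u‖ with hu | hu
    · rw [cutDensity_eq_zero _ hu, cutDensity_eq_zero _ hu]
      simp; positivity
    · have e : cutDensity ι γ hS.R_pos φ x u - cutDensity ι γ hS.R_pos (fun _ => (1 : ℂ)) x u • φ x =
          ((sliceBump N hS.R_pos u : ℝ) : ℂ) • frameDet ι γ (x + ι u) • (φ (x + ι u) - φ x) := by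
        simp [cutDensity, smul_sub, smul_smul]
      have h3 : ‖φ (x + ι u) - φ x‖ ≤ C₂ * ‖x + ι u - x‖ := by
        refine (convex_segment x (x + ι u)).norm_image_sub_le_of_norm_fderiv_le (𝕜 := ℝ)
          (fun y _ => hφ.differentiable (by simp) y) (fun y hy => ?_) (left_mem_segment _ _ _)
          (right_mem_segment _ _ _)
        obtain ⟨t, ht, rfl⟩ := (segment_eq_image' ℝ x (x + ι u)).subset hy
        have := h₂ x hx (t • u) (by
          rw [norm_smul, Real.norm_of_nonneg ht.1]
          exact (mul_le_of_le_one_left (norm_nonneg _) ht.2).trans hu.le)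
        simpa using this
      rw [e, norm_smul, norm_smul]
      have h4 := abs_sliceBump_le hS.R_pos u
      have h5 := h₁ x hx u hu.le
      rw [add_sub_cancel_left] at h3
      have h6 := h3.trans (mul_le_mul_of_nonneg_left (ι.le_opNorm u) hC₂)
      calc _ ≤ 1 * (C₁ * (C₂ * (‖ι‖ * ‖u‖))) := by gcongr
        _ = _ := by ring
  · have hu' : ‖u‖ ≤ R := by
      by_contra! hlt
      exact hu (by rw [cutDensity_eq_zero _ hlt.le, cutDensity_eq_zero _ hlt.le]; simp)
    exact hS.norm_sub_add_le hx hx hp hu' (Or.inl rfl)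

/-- The Gaussian transforms of the cut off constant function `1` converge to the mass of the Gaussian
kernel at the base point. -/
theorem tendsto_gaussTransform_one (hS : SliceData ι γ x₀ O R δ) :
    Tendsto (fun ρ : ℝ => gaussTransform ι γ x₀ (cutDensity ι γ hS.R_pos (fun _ => (1 : ℂ)) x₀)
      (γ x₀, ρ)) (𝓝[>] 0) (𝓝 (gaussMass N)) := by
  obtain ⟨C₁, hC₁, h₁⟩ := exists_bound_slice (contDiff_frameDet (ι := ι) hS.smooth).continuous ι x₀ R δ
  have hx₀ : x₀ ∈ Metric.ball x₀ δ := Metric.mem_ball_self hS.δ_pos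
  set b := cutDensity ι γ hS.R_pos (fun _ => (1 : ℂ)) x₀ with hb
  have hbc : Continuous b := continuous_cutDensity hS (contDiff_const (c := (1 : ℂ))) x₀
  have hb0 : b 0 = 1 := by
    have h0 : sliceBump N hS.R_pos 0 = 1 := (sliceBump N hS.R_pos).one_of_mem_closedBall
      (mem_closedBall_zero_iff.2 (by
        rw [norm_zero]; exact (sliceBump N hS.R_pos).rIn_pos.le))
    have h1 : frameDet ι γ x₀ = 1 := by
      have : (Matrix.of fun j i => fderiv ℝ γ x₀ (ι (stdVec N j)) i) = (1 : Matrix _ _ ℂ) := by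
        ext j i
        have := hS.frame_one
        have h2 : fderiv ℝ γ x₀ (ι (stdVec N j)) = stdCVec N j := by
          rw [← complexify_stdCVec]
          exact congrArg (fun A : CSpace N →L[ℂ] CSpace N => A (stdCVec N j)) hS.frame_one
        rw [Matrix.of_apply, h2, Matrix.one_apply]
        simp [eq_comm]
      rw [frameDet, this, Matrix.det_one]
    simp [hb, cutDensity, h0, h1]
  have hbB : ∀ u, ‖b u‖ ≤ C₁ := by
    intro u
    rcases le_or_gt R ‖u‖ with hu | hu
    · rw [hb, cutDensity_eq_zero _ hu, norm_zero]; exact hC₁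
    · rw [hb, cutDensity, norm_smul, smul_eq_mul, mul_one]
      have h4 := abs_sliceBump_le hS.R_pos u
      have h5 := h₁ x₀ hx₀ u hu.le
      calc _ ≤ 1 * C₁ := by gcongr
        _ = _ := one_mul _
  have hK := contDiff_gaussKer_left (N := N) 1
  -- Rescaling the slice by `ρ`.
  have hscale : ∀ ρ : ℝ, 0 < ρ → gaussTransform ι γ x₀ b (γ x₀, ρ) =
      ∫ y, gaussKer N (ρ⁻¹ • (γ x₀ - γ (x₀ + ι (ρ • y))), 1) * b (ρ • y) := by
    intro ρ hρ
    have h2 := Measure.integral_comp_smul (volume : Measure (RSpace N))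
      (fun u => gaussKer N (ρ⁻¹ • (γ x₀ - γ (x₀ + ι u)), 1) * b u) ρ
    rw [finrank_euclideanSpace, Fintype.card_fin, abs_of_pos (by positivity)] at h2
    rw [h2, gaussTransform, ← integral_smul]
    congr 1
    ext u
    have h3 := gaussKer_smul hρ.ne' (ρ⁻¹ • (γ x₀ - γ (x₀ + ι u)))
    rw [smul_inv_smul₀ hρ.ne'] at h3
    simp only [h3, smul_eq_mul, Complex.real_smul, Complex.ofReal_inv]
    ring
  have hlim : Tendsto (fun ρ : ℝ => ∫ y, gaussKer N (ρ⁻¹ • (γ x₀ - γ (x₀ + ι (ρ • y))), 1) *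
      b (ρ • y)) (𝓝[>] 0) (𝓝 (∫ y, gaussKer N (ofRealVec y, 1))) := by
    refine tendsto_integral_filter_of_dominated_convergence
      (fun y => C₁ * (2 ^ N * Real.exp 1) * Real.exp (-(1 / 4) * ‖y‖ ^ 2)) ?_ ?_ ?_ ?_
    · refine Eventually.of_forall fun ρ => Continuous.aestronglyMeasurable ?_
      refine (hK.continuous.comp ?_).mul (hbc.comp (continuous_const_smul ρ))
      have : Continuous fun y => γ (x₀ + ι (ρ • y)) := hS.smooth.continuous.comp (by fun_prop)
      exact (continuous_const.sub this).const_smul ρ⁻¹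
    · filter_upwards [self_mem_nhdsWithin] with ρ hρ
      refine Eventually.of_forall fun y => ?_
      rw [mem_Ioi] at hρ
      by_cases h0 : b (ρ • y) = 0
      · rw [h0, mul_zero, norm_zero]; positivity
      have hu : ‖ρ • y‖ ≤ R := by
        by_contra! hlt
        exact h0 (cutDensity_eq_zero _ hlt.le)
      have h2 := hS.close x₀ hx₀ _ hu
      have h3 := norm_gaussKer_le (N := N) one_pos (ζ := 1) (by simp)
        (z := ρ⁻¹ • (γ x₀ - γ (x₀ + ι (ρ • y)))) (u := y) (by
          have e : ρ⁻¹ • (γ x₀ - γ (x₀ + ι (ρ • y))) + ofRealVec y =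
              -(ρ⁻¹ • (γ (x₀ + ι (ρ • y)) - γ x₀ - ofRealVec (ρ • y))) := by
            have : ofRealVec (ρ • y) = ρ • ofRealVec y := by
              ext i; simp [ofRealVec]
            rw [this, smul_sub, smul_sub, smul_sub, inv_smul_smul₀ hρ.ne']
            abel
          rw [e, norm_neg, norm_smul, norm_inv, Real.norm_of_nonneg hρ.le]
          calc _ ≤ ρ⁻¹ * (‖ρ • y‖ / 10) := by gcongr
            _ = ‖y‖ / 10 := by rw [norm_smul, Real.norm_of_nonneg hρ.le]; field_simp
            _ ≤ _ := by linarith [norm_nonneg y])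
      rw [norm_mul]
      calc _ ≤ (2 ^ N * ((1 : ℝ) ^ N)⁻¹ * Real.exp (1 - ‖y‖ ^ 2 / (4 * 1 ^ 2))) * C₁ := by
            gcongr
            exact hbB _
        _ = C₁ * (2 ^ N * (Real.exp 1 * Real.exp (-(1 / 4) * ‖y‖ ^ 2))) := by
            rw [← Real.exp_add]
            simp only [one_pow, inv_one, mul_one]
            have : 1 - ‖y‖ ^ 2 / 4 = 1 + -(1 / 4) * ‖y‖ ^ 2 := by ring
            rw [this]; ring
        _ = _ := by ring
    · refine Integrable.const_mul ?_ _
      have := (GaussianFourier.integrable_cexp_neg_mul_sq_norm_add (V := RSpace N) (b := 1 / 4)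
        (by norm_num) 0 0).norm
      refine this.congr (Eventually.of_forall fun u => ?_)
      simp only [Complex.norm_exp]
      norm_cast
      simp [-Complex.ofReal_pow]
    · refine Eventually.of_forall fun y => ?_
      have hd : fderiv ℝ γ x₀ (ι y) = ofRealVec y := by
        have h2 : complexify ι (fderiv ℝ γ x₀) (ofRealVec y) = ofRealVec y := by
          exact congrArg (fun A : CSpace N →L[ℂ] CSpace N => A (ofRealVec y)) hS.frame_one
        rw [complexify_apply] at h2
        rw [← h2]
        conv_lhs => rw [← (EuclideanSpace.basisFun (Fin N) ℝ).sum_repr y]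
        simp [map_sum, ofRealVec]
      have h2 : HasDerivAt (fun ρ : ℝ => γ (x₀ + ι (ρ • y))) (ofRealVec y) 0 := by
        have h3 : HasDerivAt (fun ρ : ℝ => x₀ + ι (ρ • y)) (ι y) 0 := by
          have := ((hasDerivAt_id (0 : ℝ)).smul_const (ι y)).const_add x₀
          simpa using this
        have h4 : HasFDerivAt γ (fderiv ℝ γ x₀) (x₀ + ι ((0 : ℝ) • y)) := by
          simpa using (hS.smooth.differentiable (by simp) x₀).hasFDerivAt
        rw [← hd]
        exact h4.comp_hasDerivAt 0 h3
      have h3 : Tendsto (fun ρ : ℝ => ρ⁻¹ • (γ x₀ - γ (x₀ + ι (ρ • y)))) (𝓝[>] 0)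
          (𝓝 (-ofRealVec y)) := by
        have h4 := (h2.tendsto_slope_zero_right).neg
        simpa [← smul_neg] using h4
      have h4 : Tendsto (fun ρ : ℝ => b (ρ • y)) (𝓝[>] 0) (𝓝 1) := by
        have : Continuous fun ρ : ℝ => b (ρ • y) := hbc.comp (by fun_prop)
        have h5 := (this.tendsto 0).mono_left (nhdsWithin_le_nhds (s := Ioi 0))
        rwa [zero_smul, hb0] at h5
      have h5 := ((hK.continuous.tendsto (-ofRealVec y)).comp h3).mul h4
      have h6 : gaussKer N (-ofRealVec y, 1) = gaussKer N (ofRealVec y, 1) := by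
        simp [gaussKer]
      rw [mul_one, h6] at h5
      exact h5
  refine hlim.congr' ?_
  filter_upwards [self_mem_nhdsWithin] with ρ hρ
  exact (hscale ρ hρ).symm

theorem norm_comp_fst_add_smulRight_le (A : CSpace N →L[ℂ] W) (w : W) :
    ‖A.comp (ContinuousLinearMap.fst ℂ (CSpace N) ℂ) +
      (ContinuousLinearMap.snd ℂ (CSpace N) ℂ).smulRight w‖ ≤ ‖A‖ + ‖w‖ := by
  refine ContinuousLinearMap.opNorm_le_bound _ (by positivity) fun q => ?_
  have h1 := A.le_opNorm_of_le (norm_fst_le q)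
  have h2 := mul_le_mul_of_nonneg_right (norm_snd_le q) (norm_nonneg w)
  have h3 := norm_add_le (A q.1) (q.2 • w)
  rw [norm_smul] at h3
  calc _ ≤ _ := h3
    _ ≤ _ := by nlinarith

theorem exists_norm_clm_le {𝕜 F G : Type} [NontriviallyNormedField 𝕜] [NormedAddCommGroup F]
    [NormedSpace 𝕜 F] [NormedAddCommGroup G] [NormedSpace 𝕜 G] (L : F →L[𝕜] G) :
    ∃ D : ℝ, 0 ≤ D ∧ ∀ B, ‖L B‖ ≤ D * ‖B‖ :=
  ⟨‖L‖, norm_nonneg _, L.le_opNorm⟩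

theorem exists_norm_diagSum_le (N : ℕ) (W : Type) [NormedAddCommGroup W] [NormedSpace ℂ W] :
    ∃ D : ℝ, 0 ≤ D ∧ ∀ B, ‖diagSum N W B‖ ≤ D * ‖B‖ :=
  exists_norm_clm_le (𝕜 := ℂ) (F := CSpace N →L[ℂ] CSpace N →L[ℂ] W) (G := W) (diagSum N W)

theorem nearEdge_self {x : RSpace d} {ρ : ℝ} (hρ : 0 < ρ) : NearEdge γ x (1 / 20) ρ (γ x, ρ) := by
  constructor <;> simp [hρ]

/-- The Gaussian transforms of the cut off constant function `1` are close to the mass of the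
Gaussian kernel: their derivatives are small, since the derivative of `1` vanishes. -/
theorem exists_norm_gaussTransform_one_sub_le (hS : SliceData ι γ x₀ O R δ) :
    ∃ C : ℝ, ∀ x ∈ Metric.ball x₀ δ, ∀ ρ ∈ Ioo (0 : ℝ) 1, ∀ p, NearEdge γ x (1 / 20) ρ p →
      ‖gaussTransform ι γ x₀ (cutDensity ι γ hS.R_pos (fun _ => (1 : ℂ)) x₀) p -
        gaussMass N‖ ≤ C * ρ := by
  obtain ⟨M, hM, h⟩ := norm_integral_le_of_eq_zero_near N
  have hx₀ : x₀ ∈ Metric.ball x₀ δ := Metric.mem_ball_self hS.δ_pos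
  have hR := hS.R_pos
  set b := cutDensity ι γ hS.R_pos (fun _ => (1 : ℂ)) x₀ with hb
  have hb0 : IsDensityOf ι γ x₀ O R b (fun _ => (1 : ℂ)) :=
    isDensityOf_cutDensity hS (IsCRSmoothOn.const hS.isUnit O 1)
  have hb1 := hb0.sliceAdjoint hS
  have hb2 := hb1.sliceAdjoint hS
  have hcr0 : crDeriv ι γ (fun _ => (1 : ℂ)) = fun _ => 0 :=
    funext fun x => crDeriv_eq_of_fderiv (hS.isUnit x) (by simp)
  have hcr1 : crDeriv ι γ (crDeriv ι γ (fun _ => (1 : ℂ))) = fun _ => 0 :=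
    funext fun x => crDeriv_eq_of_fderiv (hS.isUnit x) (by rw [hcr0]; simp)
  rw [hcr1] at hb2
  rw [hcr0] at hb1
  have hz : ∀ {W : Type} [NormedAddCommGroup W] [NormedSpace ℂ W] {b : RSpace N → W},
      IsDensityOf ι γ x₀ O R b (fun _ => 0) → ∀ u, b u ≠ 0 → R / 2 ≤ ‖u‖ ∧ ‖u‖ ≤ R := by
    intro W _ _ b hb u hu
    constructor
    · by_contra! hlt
      exact hu (by rw [hb.eq u hlt, smul_zero])
    · by_contra! hlt
      exact hu (hb.eq_zero hlt)
  obtain ⟨B₁, hB₁⟩ := hb1.hasCompactSupport.exists_bound_of_continuous hb1.smooth.continuous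
  obtain ⟨B₂, hB₂⟩ := hb2.hasCompactSupport.exists_bound_of_continuous hb2.smooth.continuous
  have hB₁0 : 0 ≤ B₁ := (norm_nonneg _).trans (hB₁ 0)
  have hB₂0 : 0 ≤ B₂ := (norm_nonneg _).trans (hB₂ 0)
  obtain ⟨D, hD0, hD⟩ := exists_norm_diagSum_le N ℂ
  set C := 2 * B₁ / R * M + D * (2 * B₂ / R * M) with hC
  have hC0 : 0 ≤ C := by positivity
  have hder : ∀ x ∈ Metric.ball x₀ δ, ∀ ρ ∈ Ioo (0 : ℝ) 1, ∀ p, NearEdge γ x (1 / 20) ρ p →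
      DifferentiableAt ℂ (gaussTransform ι γ x₀ b) p ∧
        ‖fderiv ℂ (gaussTransform ι γ x₀ b) p‖ ≤ C * ρ := by
    intro x hx ρ hρ p hp
    have h1 := hasFDerivAt_gaussTransform (x₀ := x₀) hS.smooth hS.isUnit hb0.smooth
      hb0.hasCompactSupport (hp.snd_ne_zero (by norm_num) hρ.1)
    refine ⟨h1.differentiableAt, ?_⟩
    rw [h1.fderiv]
    refine (norm_comp_fst_add_smulRight_le _ _).trans ?_
    have h2 := h hS hx hx₀ hρ.1 hp hB₁ (hz hb1)
    have h3 := h hS hx hx₀ hρ.1 hp hB₂ (hz hb2)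
    have h4 : ‖p.2 / 2‖ ≤ 1 := by
      have h5 := norm_le_norm_add_norm_sub' p.2 ρ
      have h6 := hp.snd
      rw [Complex.norm_real, Real.norm_of_nonneg hρ.1.le] at h5
      rw [norm_div, Complex.norm_ofNat]
      linarith [hρ.2]
    rw [hC, add_mul]
    refine add_le_add h2 ?_
    rw [norm_smul]
    refine (mul_le_of_le_one_left (norm_nonneg _) h4).trans ?_
    refine (hD _).trans ?_
    rw [mul_assoc]
    gcongr
  obtain ⟨L, hL0, hL⟩ := exists_bound_slice (hS.smooth.continuous_fderiv (by simp)) ι x₀ R δ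
  have hL' : ∀ x ∈ Metric.ball x₀ δ, ‖γ x - γ x₀‖ ≤ L * ‖x - x₀‖ := fun x hx =>
    (convex_ball x₀ δ).norm_image_sub_le_of_norm_fderiv_le (𝕜 := ℝ)
      (fun y _ => hS.smooth.differentiable (by simp) y)
      (fun y hy => by simpa using hL y hy 0 (by simpa using hR.le)) hx₀ hx
  refine ⟨2 * C, fun x hx ρ hρ p hp => ?_⟩
  -- At fixed scale, moving to the point of the edge.
  have e1 : ‖gaussTransform ι γ x₀ b p - gaussTransform ι γ x₀ b (γ x, ρ)‖ ≤ C * ρ := by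
    have hconv : Convex ℝ {p | NearEdge γ x (1 / 20) ρ p} := by
      have : {p | NearEdge γ x (1 / 20) ρ p} =
          Metric.ball (γ x) (1 / 20 * ρ) ×ˢ Metric.ball (ρ : ℂ) (1 / 20 * ρ) := by
        ext q
        simp only [mem_ofPred_eq, mem_prod, mem_ball_iff_norm]
        exact ⟨fun h => ⟨h.fst, h.snd⟩, fun h => ⟨h.1, h.2⟩⟩
      rw [this]
      exact (convex_ball _ _).prod (convex_ball _ _)
    refine (hconv.norm_image_sub_le_of_norm_fderiv_le (𝕜 := ℂ)
      (fun q hq => (hder x hx ρ hρ q hq).1) (fun q hq => (hder x hx ρ hρ q hq).2)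
      (nearEdge_self hρ.1) hp).trans ?_
    refine mul_le_of_le_one_right (mul_nonneg hC0 hρ.1.le) ?_
    rw [Prod.norm_def]
    refine max_le ?_ ?_
    · exact (hp.fst.trans_le (by linarith [hρ.2])).le
    · exact (hp.snd.trans_le (by linarith [hρ.2])).le
  -- Decreasing the scale.
  have e2 : ∀ σ ∈ Ioo (0 : ℝ) ρ,
      ‖gaussTransform ι γ x₀ b (γ x, ρ) - gaussTransform ι γ x₀ b (γ x, σ)‖ ≤ C * ρ := by
    intro σ hσ
    have hq : ∀ r ∈ Icc σ ρ, HasDerivWithinAt (fun r : ℝ => gaussTransform ι γ x₀ b (γ x, r))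
        (fderiv ℂ (gaussTransform ι γ x₀ b) (γ x, r) (0, 1)) (Icc σ ρ) r := by
      intro r hr
      have h1 := (hder x hx r ⟨hσ.1.trans_le hr.1, hr.2.trans_lt hρ.2⟩ _
        (nearEdge_self (hσ.1.trans_le hr.1))).1.hasFDerivAt.restrictScalars ℝ
      have h2 : HasDerivAt (fun r : ℝ => (γ x, (r : ℂ))) (0, 1) r :=
        (hasDerivAt_const r (γ x)).prodMk Complex.ofRealCLM.hasDerivAt
      exact (h1.comp_hasDerivAt r h2).hasDerivWithinAt
    have := norm_image_sub_le_of_norm_deriv_le_segment' (C := C) hq (fun r hr => by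
      have h1 := (hder x hx r ⟨hσ.1.trans_le hr.1, hr.2.trans hρ.2⟩ _
        (nearEdge_self (hσ.1.trans_le hr.1))).2
      refine (ContinuousLinearMap.le_of_opNorm_le _ h1 _).trans ?_
      have h2 : ‖((0 : CSpace N), (1 : ℂ))‖ ≤ 1 := by simp [Prod.norm_def]
      refine (mul_le_of_le_one_right (mul_nonneg hC0 (hσ.1.trans_le hr.1).le) h2).trans ?_
      exact mul_le_of_le_one_right hC0 (hr.2.trans hρ.2).le) ρ ⟨hσ.2.le, le_rfl⟩
    refine this.trans ?_
    gcongr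
    linarith [hσ.1]
  -- At small scales the point of the edge may be moved to the base point.
  have e3 : ∀ σ ∈ Ioo (0 : ℝ) ρ,
      ‖gaussTransform ι γ x₀ b (γ x, σ) - gaussTransform ι γ x₀ b (γ x₀, σ)‖ ≤
        C * σ * L * ‖x - x₀‖ := by
    intro σ hσ
    have hσ1 : σ < 1 := hσ.2.trans hρ.2
    have hseg : ∀ r ∈ Icc (0 : ℝ) 1, x₀ + r • (x - x₀) ∈ Metric.ball x₀ δ := fun r hr =>
      (convex_ball x₀ δ).add_smul_sub_mem hx₀ hx hr
    have hq : ∀ r ∈ Icc (0 : ℝ) 1, HasDerivWithinAt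
        (fun r : ℝ => gaussTransform ι γ x₀ b (γ (x₀ + r • (x - x₀)), σ))
        (fderiv ℂ (gaussTransform ι γ x₀ b) (γ (x₀ + r • (x - x₀)), σ)
          (fderiv ℝ γ (x₀ + r • (x - x₀)) (x - x₀), 0)) (Icc 0 1) r := by
      intro r hr
      have h1 := (hder _ (hseg r hr) σ ⟨hσ.1, hσ1⟩ _
        (nearEdge_self hσ.1)).1.hasFDerivAt.restrictScalars ℝ
      have h0 : HasDerivAt (fun r : ℝ => x₀ + r • (x - x₀)) (x - x₀) r := by
        simpa using ((hasDerivAt_id r).smul_const (x - x₀)).const_add x₀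
      have h2 : HasDerivAt (fun r : ℝ => (γ (x₀ + r • (x - x₀)), (σ : ℂ)))
          (fderiv ℝ γ (x₀ + r • (x - x₀)) (x - x₀), 0) r :=
        ((hS.smooth.differentiable (by simp) _).hasFDerivAt.comp_hasDerivAt r h0).prodMk
          (hasDerivAt_const r _)
      exact (h1.comp_hasDerivAt r h2).hasDerivWithinAt
    have := norm_image_sub_le_of_norm_deriv_le_segment_01' (C := C * σ * L * ‖x - x₀‖) hq
      fun r hr => by
        have hr' := hseg r (Ico_subset_Icc_self hr)
        have h1 := (hder _ hr' σ ⟨hσ.1, hσ1⟩ _ (nearEdge_self hσ.1)).2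
        refine (ContinuousLinearMap.le_of_opNorm_le _ h1 _).trans ?_
        have h2 : ‖(fderiv ℝ γ (x₀ + r • (x - x₀)) (x - x₀), (0 : ℂ))‖ ≤ L * ‖x - x₀‖ := by
          rw [Prod.norm_def, norm_zero, max_eq_left (norm_nonneg _)]
          exact ContinuousLinearMap.le_of_opNorm_le _ (by simpa using hL _ hr' 0 (by simpa using hR.le)) _
        rw [mul_assoc (C * σ)]
        exact mul_le_mul_of_nonneg_left h2 (mul_nonneg hC0 hσ.1.le)
    simpa using this
  have e4 : ‖gaussTransform ι γ x₀ b (γ x, ρ) - gaussMass N‖ ≤ C * ρ := by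
    have t1 : Tendsto (fun σ : ℝ => ‖gaussTransform ι γ x₀ b (γ x, ρ) -
        gaussTransform ι γ x₀ b (γ x₀, σ)‖) (𝓝[>] 0)
        (𝓝 ‖gaussTransform ι γ x₀ b (γ x, ρ) - gaussMass N‖) :=
      ((tendsto_gaussTransform_one hS).const_sub _).norm
    have t2 : Tendsto (fun σ : ℝ => C * ρ + C * σ * L * ‖x - x₀‖) (𝓝[>] 0) (𝓝 (C * ρ)) := by
      have : Continuous fun σ : ℝ => C * ρ + C * σ * L * ‖x - x₀‖ := by fun_prop
      simpa using (this.tendsto 0).mono_left (nhdsWithin_le_nhds (s := Ioi 0))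
    refine le_of_tendsto_of_tendsto t1 t2 ?_
    filter_upwards [Ioo_mem_nhdsGT hρ.1] with σ hσ
    calc _ ≤ _ := norm_sub_le_norm_sub_add_norm_sub _ (gaussTransform ι γ x₀ b (γ x, σ)) _
      _ ≤ _ := add_le_add (e2 σ hσ) (e3 σ hσ)
  calc _ ≤ _ := norm_sub_le_norm_sub_add_norm_sub _ (gaussTransform ι γ x₀ b (γ x, ρ)) _
    _ ≤ C * ρ + C * ρ := add_le_add e1 e4
    _ = _ := by ring

/-- Near the edge the Gaussian transform of the density of a CR function is close to this function,
up to the mass of the kernel. -/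
theorem exists_norm_gaussTransform_sub_smul_le [CompleteSpace W] (hS : SliceData ι γ x₀ O R δ)
    {b : RSpace N → W} {φ : RSpace d → W} (hb : IsDensityOf ι γ x₀ O R b φ) :
    ∃ C : ℝ, ∀ x ∈ Metric.ball x₀ δ, ∀ ρ ∈ Ioo (0 : ℝ) 1, ∀ p, NearEdge γ x (1 / 20) ρ p →
      ‖gaussTransform ι γ x₀ b p - gaussMass N • φ x‖ ≤ C * ρ := by
  obtain ⟨M, hM, h⟩ := norm_integral_le_of_eq_zero_near N
  have hx₀ : x₀ ∈ Metric.ball x₀ δ := Metric.mem_ball_self hS.δ_pos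
  have hone := IsCRSmoothOn.const hS.isUnit O (1 : ℂ)
  have hcut := isDensityOf_cutDensity hS hb.cr
  -- Near the origin of the slice only the CR function matters.
  have s1 : ∃ C : ℝ, ∀ x ∈ Metric.ball x₀ δ, ∀ ρ : ℝ, 0 < ρ → ∀ p, NearEdge γ x (1 / 20) ρ p →
      ‖gaussTransform ι γ x₀ b p -
        gaussTransform ι γ x₀ (cutDensity ι γ hS.R_pos φ x₀) p‖ ≤ C * ρ := by
    obtain ⟨B, hB⟩ := hb.hasCompactSupport.exists_bound_of_continuous hb.smooth.continuous
    obtain ⟨B', hB'⟩ := hcut.hasCompactSupport.exists_bound_of_continuous hcut.smooth.continuous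
    refine ⟨2 * (B + B') / R * M, fun x hx ρ hρ p hp => ?_⟩
    have i1 := integrable_gaussKer_smul (ι := ι) (x₀ := x₀) hS.smooth hb.smooth
      hb.hasCompactSupport p
    have i2 := integrable_gaussKer_smul (ι := ι) (x₀ := x₀) hS.smooth hcut.smooth
      hcut.hasCompactSupport p
    have e : gaussTransform ι γ x₀ b p - gaussTransform ι γ x₀ (cutDensity ι γ hS.R_pos φ x₀) p =
        gaussTransform ι γ x₀ (fun u => b u - cutDensity ι γ hS.R_pos φ x₀ u) p := by
      simp only [gaussTransform]
      rw [← integral_sub i1 i2]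
      simp_rw [smul_sub]
    rw [e]
    refine h hS hx hx₀ hρ hp (fun u => norm_sub_le_of_le (hB u) (hB' u)) fun u hu => ?_
    constructor
    · by_contra! hlt
      exact hu (by rw [hb.eq u hlt, hcut.eq u hlt, sub_self])
    · by_contra! hlt
      exact hu (by rw [hb.eq_zero hlt, hcut.eq_zero hlt, sub_self])
  obtain ⟨C₁, h₁⟩ := s1
  obtain ⟨C₂, h₂⟩ := exists_norm_gaussTransform_sub_le hS hb.cr
  obtain ⟨C₃, h₃⟩ := exists_norm_gaussTransform_cutDensity_sub_le hS hb.cr.smooth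
  obtain ⟨C₄, h₄⟩ := exists_norm_gaussTransform_sub_le hS hone
  obtain ⟨C₅, h₅⟩ := exists_norm_gaussTransform_one_sub_le hS
  obtain ⟨L, hL0, hL⟩ := exists_bound_slice hb.cr.smooth.continuous ι x₀ R δ
  refine ⟨C₁ + C₂ + C₃ + |C₄ + C₅| * L, fun x hx ρ hρ p hp => ?_⟩
  have h1 := h₁ x hx ρ hρ.1 p hp
  have h2 := h₂ x hx ρ hρ.1 p hp
  have h3 := h₃ x hx ρ hρ.1 p hp
  have h4 := h₄ x hx ρ hρ.1 p hp
  have h5 := h₅ x hx ρ hρ p hp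
  have hφ : ‖φ x‖ ≤ L := by simpa using hL x hx 0 (by simpa using hS.R_pos.le)
  set a := gaussTransform ι γ x₀ b p
  set a₁ := gaussTransform ι γ x₀ (cutDensity ι γ hS.R_pos φ x₀) p
  set a₂ := gaussTransform ι γ x (cutDensity ι γ hS.R_pos φ x) p
  set c₁ := gaussTransform ι γ x (cutDensity ι γ hS.R_pos (fun _ => (1 : ℂ)) x) p
  set c₂ := gaussTransform ι γ x₀ (cutDensity ι γ hS.R_pos (fun _ => (1 : ℂ)) x₀) p
  have h6 : ‖c₁ - gaussMass N‖ ≤ |C₄ + C₅| * ρ := by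
    calc _ ≤ _ := norm_sub_le_norm_sub_add_norm_sub _ c₂ _
      _ ≤ (C₄ + C₅) * ρ := by linarith
      _ ≤ _ := mul_le_mul_of_nonneg_right (le_abs_self _) hρ.1.le
  have e : a - gaussMass N • φ x =
      (a - a₁) - (a₂ - a₁) + (a₂ - c₁ • φ x) + (c₁ - gaussMass N) • φ x := by
    rw [sub_smul]; abel
  have h7 : ‖(c₁ - gaussMass N) • φ x‖ ≤ |C₄ + C₅| * ρ * L := by
    rw [norm_smul]
    exact mul_le_mul h6 hφ (norm_nonneg _) (mul_nonneg (abs_nonneg _) hρ.1.le)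
  rw [e]
  calc _ ≤ ‖a - a₁‖ + ‖a₂ - a₁‖ + ‖a₂ - c₁ • φ x‖ + ‖(c₁ - gaussMass N) • φ x‖ := by
        refine (norm_add_le _ _).trans ?_
        gcongr
        refine (norm_add_le _ _).trans ?_
        gcongr
        exact norm_sub_le _ _
    _ ≤ _ := by linarith

/-- The pairs `(z, ζ)` of a point and a complex scale, the point lying near the edge, at a distance
which is small compared with the scale. -/
def edgeDomain (γ : RSpace d → CSpace N) (x₀ : RSpace d) (δ κ : ℝ) : Set (CSpace N × ℂ) :=
  {p | ∃ x ∈ Metric.ball x₀ δ, ∃ ρ ∈ Ioo (0 : ℝ) 1, NearEdge γ x κ ρ p}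

theorem isOpen_edgeDomain (γ : RSpace d → CSpace N) (x₀ : RSpace d) (δ κ : ℝ) :
    IsOpen (edgeDomain γ x₀ δ κ) := by
  have : edgeDomain γ x₀ δ κ = ⋃ x ∈ Metric.ball x₀ δ, ⋃ ρ ∈ Ioo (0 : ℝ) 1,
      Metric.ball (γ x) (κ * ρ) ×ˢ Metric.ball (ρ : ℂ) (κ * ρ) := by
    ext q
    simp only [edgeDomain, mem_ofPred_eq, mem_iUnion, mem_prod, mem_ball_iff_norm, exists_prop]
    exact exists_congr fun x => and_congr_right fun _ => exists_congr fun ρ =>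
      and_congr_right fun _ => ⟨fun h => ⟨h.fst, h.snd⟩, fun h => ⟨h.1, h.2⟩⟩
  rw [this]
  exact isOpen_biUnion fun x _ => isOpen_biUnion fun ρ _ =>
    Metric.isOpen_ball.prod Metric.isOpen_ball

theorem exists_bound_gaussTransform [CompleteSpace W] (hS : SliceData ι γ x₀ O R δ)
    {b : RSpace N → W} {φ : RSpace d → W} (hb : IsDensityOf ι γ x₀ O R b φ) :
    ∃ C : ℝ, ∀ _ : Unit, ∀ p ∈ edgeDomain γ x₀ δ (1 / 20), ‖gaussTransform ι γ x₀ b p‖ ≤ C := by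
  obtain ⟨C, hC⟩ := exists_norm_gaussTransform_sub_smul_le hS hb
  obtain ⟨L, hL0, hL⟩ := exists_bound_slice hb.cr.smooth.continuous ι x₀ R δ
  refine ⟨|C| + ‖gaussMass N‖ * L, ?_⟩
  rintro - p ⟨x, hx, ρ, hρ, hp⟩
  have h1 := hC x hx ρ hρ p hp
  have hφ : ‖φ x‖ ≤ L := by simpa using hL x hx 0 (by simpa using hS.R_pos.le)
  have h2 : C * ρ ≤ |C| := (mul_le_mul_of_nonneg_right (le_abs_self C) hρ.1.le).trans
    (mul_le_of_le_one_right (abs_nonneg _) hρ.2.le)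
  have h3 : ‖gaussMass N • φ x‖ ≤ ‖gaussMass N‖ * L := by rw [norm_smul]; gcongr
  linarith [norm_le_norm_add_norm_sub' (gaussTransform ι γ x₀ b p) (gaussMass N • φ x)]

theorem HasBddDerivs.comp_fst_add_smulRight {T E V : Type} [NormedAddCommGroup E] [NormedSpace ℂ E]
    [NormedAddCommGroup V] [NormedSpace ℂ V] {D : T → Set E} {r : ℕ} {f : T → E → V →L[ℂ] W}
    {g : T → E → W} (hf : HasBddDerivs ℂ D r f) (hg : HasBddDerivs ℂ D r g) :
    HasBddDerivs ℂ D r (fun t x => (f t x).comp (ContinuousLinearMap.fst ℂ V ℂ) +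
      (ContinuousLinearMap.snd ℂ V ℂ).smulRight (g t x)) :=
  (hf.clm_comp ((ContinuousLinearMap.compL ℂ (V × ℂ) V W).flip
    (ContinuousLinearMap.fst ℂ V ℂ))).add
    (hg.clm_comp (ContinuousLinearMap.smulRightL ℂ (V × ℂ) W (ContinuousLinearMap.snd ℂ V ℂ)))

/-- All the derivatives of the Gaussian transform of the density of a CR function are bounded near
the edge, as they are given by Gaussian transforms of such densities. -/
theorem hasBddDerivs_gaussTransform (hS : SliceData ι γ x₀ O R δ) (r : ℕ) {W : Type}
    [NormedAddCommGroup W] [NormedSpace ℂ W] [CompleteSpace W]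
    {b : RSpace N → W} {φ : RSpace d → W} (hb : IsDensityOf ι γ x₀ O R b φ) :
    HasBddDerivs ℂ (fun _ : Unit => edgeDomain γ x₀ δ (1 / 20)) r
      (fun _ => gaussTransform ι γ x₀ b) := by
  induction r generalizing W with
  | zero => exact exists_bound_gaussTransform hS hb
  | succ r ih =>
    have hb1 := hb.sliceAdjoint hS
    have hb2 := hb1.sliceAdjoint hS
    have hdb : ∃ C : ℝ, ∀ _ : Unit, ∀ p ∈ edgeDomain γ x₀ δ (1 / 20),
        ‖((1 / 2 : ℂ) • ContinuousLinearMap.snd ℂ (CSpace N) ℂ) p‖ ≤ C := by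
      refine ⟨2, ?_⟩
      rintro - p ⟨x, hx, ρ, hρ, hp⟩
      have h5 := norm_le_norm_add_norm_sub' p.2 ρ
      have h6 := hp.snd
      rw [Complex.norm_real, Real.norm_of_nonneg hρ.1.le] at h5
      rw [_root_.smul_apply, ContinuousLinearMap.coe_snd', norm_smul]
      norm_num
      linarith [hρ.2]
    have h1 := ih hb1
    have h2 := ih hb2
    have h3 := (HasBddDerivs.clm (r := r) _ hdb).smul (h2.clm_comp (diagSum N W))
    refine ⟨exists_bound_gaussTransform hS hb, _, ?_, h1.comp_fst_add_smulRight h3⟩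
    rintro - p ⟨x, hx, ρ, hρ, hp⟩
    have h4 := hasFDerivAt_gaussTransform (x₀ := x₀) hS.smooth hS.isUnit hb.smooth
      hb.hasCompactSupport (hp.snd_ne_zero (by norm_num) hρ.1)
    have e : ((1 / 2 : ℂ) • ContinuousLinearMap.snd ℂ (CSpace N) ℂ) p = p.2 / 2 := by
      simp; ring
    rw [e]
    exact h4

end Estimates

/-! ### Holomorphic extensions up to first order of CR functions -/

section Globalize

/-- A smooth map may be modified away from a point so that it becomes globally smooth, with a
derivative which is everywhere close to the derivative at that point. -/
theorem exists_contDiff_fderiv_close {d : ℕ} {F : Type} [NormedAddCommGroup F] [NormedSpace ℝ F]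
    {Ω : Set (RSpace d)} (hΩ : IsOpen Ω) {f : RSpace d → F} (hf : ContDiffOn ℝ ∞ f Ω)
    {x₀ : RSpace d} (hx₀ : x₀ ∈ Ω) {η : ℝ} (hη : 0 < η) :
    ∃ g : RSpace d → F, ContDiff ℝ ∞ g ∧ g =ᶠ[𝓝 x₀] f ∧
      ∀ x, ‖fderiv ℝ g x - fderiv ℝ f x₀‖ ≤ η := by
  set χ : ContDiffBump (0 : RSpace d) := ⟨1, 2, one_pos, by norm_num⟩
  have hχ : ContDiff ℝ ∞ χ := χ.contDiff
  obtain ⟨C, hC⟩ := (χ.hasCompactSupport.fderiv (𝕜 := ℝ)).exists_bound_of_continuous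
    (hχ.continuous_fderiv (by simp))
  have hC0 : 0 ≤ C := (norm_nonneg _).trans (hC 0)
  set ε := η / (1 + 2 * C) with hε
  have hε0 : 0 < ε := by positivity
  have hd : ∀ x ∈ Ω, DifferentiableAt ℝ f x := fun x hx =>
    (hf.contDiffAt (hΩ.mem_nhds hx)).differentiableAt (by simp)
  set L := fderiv ℝ f x₀ with hL
  have hcont : ContinuousAt (fderiv ℝ f) x₀ :=
    (hf.continuousOn_fderiv_of_isOpen hΩ (by simp)).continuousAt (hΩ.mem_nhds hx₀)
  have hev : ∀ᶠ x in 𝓝 x₀, x ∈ Ω ∧ ‖fderiv ℝ f x - L‖ ≤ ε := by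
    filter_upwards [hΩ.mem_nhds hx₀, Metric.tendsto_nhds.1 hcont.tendsto ε hε0] with x hx hx'
    rw [dist_eq_norm] at hx'
    exact ⟨hx, hx'.le⟩
  obtain ⟨r', hr', hball⟩ := Metric.eventually_nhds_iff_ball.1 hev
  set r := r' / 3 with hr
  have hr0 : 0 < r := by positivity
  set g₀ : RSpace d → F := fun x => f x - f x₀ - L (x - x₀) with hg₀
  have hg₀d : ∀ x ∈ Ω, HasFDerivAt g₀ (fderiv ℝ f x - L) x := fun x hx =>
    ((hd x hx).hasFDerivAt.sub_const _).fun_sub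
      (L.hasFDerivAt.comp x ((hasFDerivAt_id x).sub_const x₀))
  have hg₀b : ∀ x ∈ Metric.closedBall x₀ (2 * r), ‖g₀ x‖ ≤ ε * (2 * r) := by
    intro x hx
    have hsub : Metric.closedBall x₀ (2 * r) ⊆ Metric.ball x₀ r' :=
      Metric.closedBall_subset_ball (by linarith)
    have := (convex_closedBall x₀ (2 * r)).norm_image_sub_le_of_norm_hasFDerivWithin_le
      (fun y hy => (hg₀d y (hball y (hsub hy)).1).hasFDerivWithinAt)
      (fun y hy => (hball y (hsub hy)).2)
      (Metric.mem_closedBall_self (by positivity)) hx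
    have h0 : g₀ x₀ = 0 := by simp [hg₀]
    rw [h0, sub_zero] at this
    refine this.trans ?_
    gcongr
    rw [← dist_eq_norm]; exact hx
  set χr : RSpace d → ℝ := fun x => χ (r⁻¹ • (x - x₀)) with hχr
  have hχrs : ContDiff ℝ ∞ χr := hχ.comp ((contDiff_id.sub contDiff_const).const_smul r⁻¹)
  have hχrd : ∀ x, ‖fderiv ℝ χr x‖ ≤ C * r⁻¹ := by
    intro x
    have h1 : HasFDerivAt (fun x : RSpace d => r⁻¹ • (x - x₀)) (r⁻¹ • ContinuousLinearMap.id ℝ _) x :=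
      ((hasFDerivAt_id x).sub_const x₀).const_smul r⁻¹
    have h2 : HasFDerivAt χr _ x :=
      HasFDerivAt.comp (g := (χ : RSpace d → ℝ)) x
        (hχ.differentiable (by simp) (r⁻¹ • (x - x₀))).hasFDerivAt h1
    rw [h2.fderiv]
    refine (ContinuousLinearMap.opNorm_comp_le _ _).trans ?_
    refine mul_le_mul (hC _) ?_ (norm_nonneg _) hC0
    rw [norm_smul, norm_inv, Real.norm_of_nonneg hr0.le]
    exact mul_le_of_le_one_right (by positivity) ContinuousLinearMap.norm_id_le
  have hχ0 : ∀ x, 2 * r ≤ dist x x₀ → χr x = 0 := by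
    intro x hx
    refine χ.zero_of_le_dist ?_
    rw [dist_zero_right, norm_smul, norm_inv, Real.norm_of_nonneg hr0.le, ← dist_eq_norm,
      inv_mul_eq_div, le_div_iff₀ hr0]
    exact hx
  have hlin : ContDiff ℝ ∞ fun x => f x₀ + L (x - x₀) :=
    contDiff_const.add (L.contDiff.comp (contDiff_id.sub contDiff_const))
  have hlind : ∀ x, HasFDerivAt (fun x => f x₀ + L (x - x₀)) L x := fun x => by
    simpa using (L.hasFDerivAt.comp x ((hasFDerivAt_id x).sub_const x₀)).const_add (f x₀)
  have hout : ∀ x, 2 * r < dist x x₀ → (fun x => f x₀ + L (x - x₀) + χr x • g₀ x) =ᶠ[𝓝 x]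
      fun x => f x₀ + L (x - x₀) := by
    intro x hx
    have : ∀ᶠ y in 𝓝 x, 2 * r < dist y x₀ :=
      (continuous_id.dist continuous_const).continuousAt.eventually_const_lt hx
    filter_upwards [this] with y hy
    rw [hχ0 y hy.le, zero_smul, add_zero]
  have hin : ∀ x, dist x x₀ ≤ 2 * r → x ∈ Ω ∧ ‖fderiv ℝ f x - L‖ ≤ ε := fun x hx =>
    hball x (by rw [Metric.mem_ball]; linarith)
  refine ⟨fun x => f x₀ + L (x - x₀) + χr x • g₀ x, ?_, ?_, fun x => ?_⟩
  · refine contDiff_iff_contDiffAt.2 fun x => ?_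
    rcases le_or_gt (dist x x₀) (2 * r) with hx | hx
    · have h1 : ContDiffAt ℝ ∞ g₀ x := by
        refine ((hf.contDiffAt (hΩ.mem_nhds (hin x hx).1)).sub contDiffAt_const).sub ?_
        exact (L.contDiff.comp (contDiff_id.sub contDiff_const)).contDiffAt
      exact hlin.contDiffAt.add (hχrs.contDiffAt.smul h1)
    · exact hlin.contDiffAt.congr_of_eventuallyEq (hout x hx)
  · filter_upwards [Metric.closedBall_mem_nhds x₀ hr0] with x hx
    have : χr x = 1 := by
      refine χ.one_of_mem_closedBall ?_
      rw [mem_closedBall_zero_iff, norm_smul, norm_inv, Real.norm_of_nonneg hr0.le, ← dist_eq_norm,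
        inv_mul_eq_div, div_le_iff₀ hr0, one_mul]
      exact hx
    rw [this, one_smul, hg₀]
    simp
  · rcases le_or_gt (dist x x₀) (2 * r) with hx | hx
    · have h1 := (hlind x).fun_add
        ((hχrs.differentiable (by simp) x).hasFDerivAt.fun_smul (hg₀d x (hin x hx).1))
      rw [h1.fderiv, add_sub_cancel_left]
      have h2 : ‖χr x‖ ≤ 1 := by
        rw [Real.norm_of_nonneg χ.nonneg]; exact χ.le_one
      have h3 := hg₀b x hx
      refine (norm_add_le _ _).trans ?_
      rw [norm_smul, ContinuousLinearMap.norm_smulRight_apply]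
      calc _ ≤ 1 * ε + C * r⁻¹ * (ε * (2 * r)) := by
            gcongr
            · exact (hin x hx).2
            · exact hχrd x
        _ = ε * (1 + 2 * C) := by field_simp
        _ = η := by rw [hε]; field_simp
        _ ≤ η := le_rfl
    · rw [(hout x hx).fderiv_eq, (hlind x).fderiv, sub_self, norm_zero]
      exact hη.le

end Globalize

section Slices

variable {d N : ℕ} {ι : RSpace N →L[ℝ] RSpace d} {γ : RSpace d → CSpace N} {x₀ : RSpace d}

/-- In coordinates with frame `1`, the slice is tangent to the real subspace. -/
theorem fderiv_apply_eq_ofRealVec (h : frame ι γ x₀ = 1) (u : RSpace N) :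
    fderiv ℝ γ x₀ (ι u) = ofRealVec u := by
  have h2 : complexify ι (fderiv ℝ γ x₀) (ofRealVec u) = ofRealVec u :=
    congrArg (fun A : CSpace N →L[ℂ] CSpace N => A (ofRealVec u)) h
  rw [complexify_apply] at h2
  rw [← h2]
  conv_lhs => rw [← (EuclideanSpace.basisFun (Fin N) ℝ).sum_repr u]
  simp [map_sum, ofRealVec]

/-- If the complex span of the tangent space is everything, then some slice has an invertible
frame. -/
theorem exists_isUnit_frame (h : complexTangentSpan γ x₀ = ⊤) :
    ∃ ι : RSpace N →L[ℝ] RSpace d, IsUnit (frame ι γ x₀) := by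
  set B := Module.Basis.ofSpan (K := ℂ) (s := range (fderiv ℝ γ x₀)) (by
    rw [complexTangentSpan] at h; exact h.ge)
  have hB : ∀ i, B i ∈ range (fderiv ℝ γ x₀) := fun i =>
    Module.Basis.ofSpan_subset _ (mem_range_self i)
  have : Finite _ := Module.Finite.finite_basis B
  have := Fintype.ofFinite ((linearIndepOn_empty ℂ id).extend
    (empty_subset (range (fderiv ℝ γ x₀))))
  have hcard := Module.finrank_eq_card_basis B
  rw [finrank_euclideanSpace, Fintype.card_fin] at hcard
  set B' := B.reindex (Fintype.equivFinOfCardEq hcard.symm) with hB'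
  have hB'm : ∀ i, ∃ w, fderiv ℝ γ x₀ w = B' i := fun i => by
    rw [hB', Module.Basis.reindex_apply]; exact hB _
  choose w hw using hB'm
  set ι : RSpace N →L[ℝ] RSpace d := ∑ i, (EuclideanSpace.proj (𝕜 := ℝ) i).smulRight (w i)
  have hι : ∀ i, ι (stdVec N i) = w i := fun i => by
    simp [ι]
  have hfr : ∀ z, frame ι γ x₀ z = ∑ i, z i • B' i := fun z => by
    rw [frame, complexify_apply]
    simp_rw [hι, hw]
  refine ⟨ι, (ContinuousLinearMap.isUnit_iff_bijective).2 ?_⟩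
  have hinj : Function.Injective (frame ι γ x₀) := by
    refine (injective_iff_map_eq_zero _).2 fun z hz => ?_
    rw [hfr] at hz
    ext i
    exact Fintype.linearIndependent_iff.1 B'.linearIndependent _ hz i
  exact ⟨hinj, (LinearMap.injective_iff_surjective (f := (frame ι γ x₀ : CSpace N →ₗ[ℂ] CSpace N))).1 hinj⟩

/-- Where the frame is invertible, a map annihilated by the tangent vectors of type `(0,1)` has a
differential which is complex linear in the ambient space. -/
theorem fderiv_eq_crDeriv_of_isType01 {W : Type} [NormedAddCommGroup W] [NormedSpace ℂ W]
    {φ : RSpace d → W} {x : RSpace d} (hu : IsUnit (frame ι γ x))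
    (h : ∀ ξ η : RSpace d, IsType01 γ x ξ η → IsType01 φ x ξ η) (ξ : RSpace d) :
    fderiv ℝ φ x ξ = crDeriv ι γ φ x (fderiv ℝ γ x ξ) := by
  have key : ∀ {G : Type} [NormedAddCommGroup G] [NormedSpace ℂ G] (g : RSpace d →L[ℝ] G)
      (c : CSpace N), g (ξ - ∑ i, (c i).re • ι (stdVec N i)) +
        Complex.I • g (-∑ i, (c i).im • ι (stdVec N i)) = g ξ - ∑ i, c i • g (ι (stdVec N i)) := by
    intro G _ _ g c
    have : ∀ i, c i • g (ι (stdVec N i)) = (c i).re • g (ι (stdVec N i)) +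
        Complex.I • (c i).im • g (ι (stdVec N i)) := by
      intro i
      conv_lhs => rw [← Complex.re_add_im (c i)]
      rw [add_smul, mul_comm, mul_smul, Complex.coe_smul, Complex.coe_smul]
    simp_rw [this]
    simp [Finset.sum_add_distrib, Finset.smul_sum]
    abel
  have h1 := h (ξ - ∑ i, (coframe ι γ x (fderiv ℝ γ x ξ) i).re • ι (stdVec N i))
    (-∑ i, (coframe ι γ x (fderiv ℝ γ x ξ) i).im • ι (stdVec N i))
  rw [IsType01, IsType01, key, key, sum_coframe_smul hu, sub_self] at h1
  rw [crDeriv_apply]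
  exact sub_eq_zero.1 (h1 rfl)

end Slices

/-- The holomorphic function `H` of a point and a complex scale has bounded derivatives near the
edge, and to first order it extends the CR function `φ`, whose complex differential is `A`. -/
structure IsApproxExtension {d N : ℕ} {W : Type} [NormedAddCommGroup W] [NormedSpace ℂ W]
    (γ : RSpace d → CSpace N) (φ : RSpace d → W) (x₀ : RSpace d) (δ κ : ℝ)
    (H : CSpace N × ℂ → W) (A : RSpace d → CSpace N →L[ℂ] W) : Prop where
  bdd : ∀ r, HasBddDerivs ℂ (fun _ : Unit => edgeDomain γ x₀ δ κ) r (fun _ => H)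
  approx : ∃ C : ℝ, 0 ≤ C ∧ ∀ x ∈ Metric.ball x₀ δ, ∀ ρ ∈ Ioo (0 : ℝ) 1, ∀ p, NearEdge γ x κ ρ p →
    ‖H p - φ x‖ ≤ C * ρ ∧
      ‖fderiv ℂ H p - (A x).comp (ContinuousLinearMap.fst ℂ (CSpace N) ℂ)‖ ≤ C * ρ
  continuousOn : ContinuousOn A (Metric.ball x₀ δ)
  tangent : ∀ x ∈ Metric.ball x₀ δ, ∀ ξ, fderiv ℝ φ x ξ = A x (fderiv ℝ γ x ξ)

section Approx

variable {d N : ℕ} {ι : RSpace N →L[ℝ] RSpace d} {γ γ' : RSpace d → CSpace N} {x₀ : RSpace d}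
  {O : Set (RSpace d)} {R δ κ : ℝ} {W : Type} [NormedAddCommGroup W] [NormedSpace ℂ W]
  {φ φ' : RSpace d → W} {H : CSpace N × ℂ → W} {A : RSpace d → CSpace N →L[ℂ] W}

theorem IsApproxExtension.congr (h : IsApproxExtension γ φ x₀ δ κ H A)
    (hγ : EqOn γ' γ (Metric.ball x₀ δ)) (hφ : EqOn φ' φ (Metric.ball x₀ δ)) :
    IsApproxExtension γ' φ' x₀ δ κ H A where
  bdd r := by
    refine (h.bdd r).subset fun _ => ?_
    rintro p ⟨x, hx, ρ, hρ, hp⟩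
    exact ⟨x, hx, ρ, hρ, ⟨by rw [← hγ hx]; exact hp.fst, hp.snd⟩⟩
  approx := by
    obtain ⟨C, hC0, hC⟩ := h.approx
    refine ⟨C, hC0, fun x hx ρ hρ p hp => ?_⟩
    rw [hφ hx]
    exact hC x hx ρ hρ p ⟨by rw [← hγ hx]; exact hp.fst, hp.snd⟩
  continuousOn := h.continuousOn
  tangent x hx ξ := by
    have hnh := Metric.isOpen_ball.mem_nhds hx
    rw [(hγ.eventuallyEq_of_mem hnh).fderiv_eq, (hφ.eventuallyEq_of_mem hnh).fderiv_eq]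
    exact h.tangent x hx ξ

/-- Linear changes of coordinates. -/
theorem IsApproxExtension.comp_clm (L : CSpace N →L[ℂ] CSpace N)
    (h : IsApproxExtension (fun x => L (γ x)) φ x₀ δ κ H A)
    (hγ : ∀ x ∈ Metric.ball x₀ δ, DifferentiableAt ℝ γ x)
    (hγb : ∃ C : ℝ, ∀ x ∈ Metric.ball x₀ δ, ‖γ x‖ ≤ C) {κ' : ℝ} (h1 : κ' ≤ κ)
    (h2 : ‖L‖ * κ' ≤ κ) (hκ' : 0 < κ') :
    IsApproxExtension γ φ x₀ δ κ' (fun p => H (L p.1, p.2)) (fun x => (A x).comp L) := by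
  set L' : CSpace N × ℂ →L[ℂ] CSpace N × ℂ := L.prodMap (ContinuousLinearMap.id ℂ ℂ) with hL'
  have hnear : ∀ {x ρ p}, 0 < ρ → NearEdge γ x κ' ρ p →
      NearEdge (fun x => L (γ x)) x κ ρ (L' p) := by
    intro x ρ p hρ hp
    constructor
    · have e : (L' p).1 - L (γ x) = L (p.1 - γ x) := by simp [hL']
      rw [e]
      have h3 := hp.fst
      by_cases hL0 : ‖L‖ = 0
      · have := L.le_opNorm (p.1 - γ x)
        rw [hL0, zero_mul] at this
        exact this.trans_lt (mul_pos (hκ'.trans_le h1) hρ)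
      · have hL0' : 0 < ‖L‖ := lt_of_le_of_ne (norm_nonneg _) (Ne.symm hL0)
        calc _ ≤ ‖L‖ * ‖p.1 - γ x‖ := L.le_opNorm _
          _ < ‖L‖ * (κ' * ρ) := by gcongr
          _ = (‖L‖ * κ') * ρ := by ring
          _ ≤ κ * ρ := by gcongr
    · exact hp.snd.trans_le (by gcongr)
  have hmap : MapsTo L' (edgeDomain γ x₀ δ κ') (edgeDomain (fun x => L (γ x)) x₀ δ κ) := by
    rintro p ⟨x, hx, ρ, hρ, hp⟩
    exact ⟨x, hx, ρ, hρ, hnear hρ.1 hp⟩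
  have hL'd : ∀ p, HasFDerivAt L' L' p := fun p => L'.hasFDerivAt
  have hbL : ∃ C : ℝ, ∀ _ : Unit, ∀ p ∈ edgeDomain γ x₀ δ κ', ‖L' p‖ ≤ C := by
    obtain ⟨C, hC⟩ := hγb
    refine ⟨‖L'‖ * (|C| + κ' + 1), ?_⟩
    rintro - p ⟨x, hx, ρ, hρ, hp⟩
    refine L'.le_opNorm_of_le ?_
    have h3 := norm_le_norm_add_norm_sub' p.1 (γ x)
    have h4 := norm_le_norm_add_norm_sub' p.2 ρ
    rw [Complex.norm_real, Real.norm_of_nonneg hρ.1.le] at h4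
    have h5 := hp.fst
    have h6 := hp.snd
    have h7 : κ' * ρ ≤ κ' := mul_le_of_le_one_right hκ'.le hρ.2.le
    have h8 := (hC x hx).trans (le_abs_self C)
    rw [Prod.norm_def]
    exact max_le (by linarith) (by linarith [hρ.2, abs_nonneg C])
  have hLk : ∀ r, HasBddDerivs ℂ (fun _ : Unit => edgeDomain γ x₀ δ κ') r (fun _ p => H (L' p)) :=
    fun r => (h.bdd r).comp (HasBddDerivs.clm L' hbL) fun _ => hmap
  obtain ⟨C, hC0, hC⟩ := h.approx
  refine ⟨hLk, ⟨C * (1 + ‖L'‖), by positivity, fun x hx ρ hρ p hp => ?_⟩, ?_, fun x hx ξ => ?_⟩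
  · obtain ⟨h3, h4⟩ := hC x hx ρ hρ _ (hnear hρ.1 hp)
    constructor
    · refine h3.trans ?_
      have : 0 ≤ C * ρ * ‖L'‖ := mul_nonneg (mul_nonneg hC0 hρ.1.le) (norm_nonneg _)
      linarith
    · have h5 : DifferentiableAt ℂ H (L' p) :=
        (h.bdd 1).differentiableAt (t := ()) ⟨x, hx, ρ, hρ, hnear hρ.1 hp⟩
      have h6 : HasFDerivAt (fun p => H (L' p)) ((fderiv ℂ H (L' p)).comp L') p :=
        h5.hasFDerivAt.comp p (hL'd p)
      have h7 : fderiv ℂ (fun p : CSpace N × ℂ => H (L p.1, p.2)) p =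
          (fderiv ℂ H (L' p)).comp L' := h6.fderiv
      have e : (fderiv ℂ H (L' p)).comp L' -
          ((A x).comp L).comp (ContinuousLinearMap.fst ℂ (CSpace N) ℂ) =
          (fderiv ℂ H (L' p) - (A x).comp (ContinuousLinearMap.fst ℂ (CSpace N) ℂ)).comp L' := by
        ext q <;> simp [hL']
      rw [h7, e]
      refine (ContinuousLinearMap.opNorm_comp_le _ _).trans ?_
      have := mul_le_mul_of_nonneg_right h4 (norm_nonneg L')
      have : 0 ≤ C * ρ := mul_nonneg hC0 hρ.1.le
      linarith
  · exact h.continuousOn.clm_comp continuousOn_const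
  · have h3 := h.tangent x hx ξ
    have h4 : HasFDerivAt (fun x => L (γ x)) _ x :=
      (L.restrictScalars ℝ).hasFDerivAt.comp x (hγ x hx).hasFDerivAt
    rw [h4.fderiv] at h3
    exact h3

/-- In normalized coordinates the Gaussian transform, divided by the mass of the Gaussian kernel, is
a holomorphic extension to first order. -/
theorem SliceData.exists_isApproxExtension [CompleteSpace W] (hS : SliceData ι γ x₀ O R δ)
    (hφ : IsCRSmoothOn ι γ O φ) :
    ∃ H, IsApproxExtension γ φ x₀ δ (1 / 20) H (crDeriv ι γ φ) := by
  set b := cutDensity ι γ hS.R_pos φ x₀ with hb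
  have hb0 : IsDensityOf ι γ x₀ O R b φ := isDensityOf_cutDensity hS hφ
  have hb1 := hb0.sliceAdjoint hS
  have hb2 := hb1.sliceAdjoint hS
  obtain ⟨C₀, h₀⟩ := exists_norm_gaussTransform_sub_smul_le hS hb0
  obtain ⟨C₁, h₁⟩ := exists_norm_gaussTransform_sub_smul_le hS hb1
  obtain ⟨C₂, h₂⟩ := exists_bound_gaussTransform hS hb2
  obtain ⟨D, hD0, hD⟩ := exists_norm_diagSum_le N W
  have hmass := gaussMass_ne_zero N
  have hI : 0 ≤ ‖(gaussMass N)⁻¹‖ := norm_nonneg _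
  refine ⟨fun p => (gaussMass N)⁻¹ • gaussTransform ι γ x₀ b p,
    fun r => (HasBddDerivs.const ⟨‖(gaussMass N)⁻¹‖, fun _ _ => le_rfl⟩).smul
      (hasBddDerivs_gaussTransform hS r hb0),
    ⟨‖(gaussMass N)⁻¹‖ * (|C₀| + |C₁| + D * |C₂|), by positivity, fun x hx ρ hρ p hp => ⟨?_, ?_⟩⟩,
    (contDiff_crDeriv hS.smooth hS.isUnit hφ.smooth).continuous.continuousOn,
    fun x hx => hφ.cr x (by simpa using hS.mem x hx 0 (by simpa using hS.R_pos.le))⟩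
  · have e : (gaussMass N)⁻¹ • gaussTransform ι γ x₀ b p - φ x =
        (gaussMass N)⁻¹ • (gaussTransform ι γ x₀ b p - gaussMass N • φ x) := by
      rw [smul_sub, inv_smul_smul₀ hmass]
    rw [e, norm_smul, mul_assoc]
    refine mul_le_mul_of_nonneg_left ((h₀ x hx ρ hρ p hp).trans ?_) hI
    refine mul_le_mul_of_nonneg_right ?_ hρ.1.le
    have := le_abs_self C₀
    have := abs_nonneg C₁
    have : 0 ≤ D * |C₂| := by positivity
    linarith
  · have h3 := hasFDerivAt_gaussTransform (x₀ := x₀) hS.smooth hS.isUnit hb0.smooth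
      hb0.hasCompactSupport (hp.snd_ne_zero (by norm_num) hρ.1)
    have h4 := h3.const_smul (gaussMass N)⁻¹
    have h5 := h4.fderiv
    have h6 : fderiv ℂ (fun p => (gaussMass N)⁻¹ • gaussTransform ι γ x₀ b p) p = _ := h5
    set T₁ := gaussTransform ι γ x₀ (_root_.sliceAdjoint ι γ x₀ b) p with hT₁
    set T₂ := gaussTransform ι γ x₀ (_root_.sliceAdjoint ι γ x₀ (_root_.sliceAdjoint ι γ x₀ b)) p
      with hT₂
    have e : (gaussMass N)⁻¹ • (T₁.comp (ContinuousLinearMap.fst ℂ (CSpace N) ℂ) +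
        (ContinuousLinearMap.snd ℂ (CSpace N) ℂ).smulRight ((p.2 / 2) • diagSum N W T₂)) -
        (crDeriv ι γ φ x).comp (ContinuousLinearMap.fst ℂ (CSpace N) ℂ) =
        (gaussMass N)⁻¹ • ((T₁ - gaussMass N • crDeriv ι γ φ x).comp
          (ContinuousLinearMap.fst ℂ (CSpace N) ℂ) +
        (ContinuousLinearMap.snd ℂ (CSpace N) ℂ).smulRight ((p.2 / 2) • diagSum N W T₂)) := by
      rw [ContinuousLinearMap.sub_comp, ContinuousLinearMap.smul_comp, smul_add, smul_add, smul_sub,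
        inv_smul_smul₀ hmass]
      abel
    rw [h6, e, norm_smul, mul_assoc]
    refine mul_le_mul_of_nonneg_left ((norm_comp_fst_add_smulRight_le _ _).trans ?_) hI
    have h7 := h₁ x hx ρ hρ p hp
    have h8 : ‖T₂‖ ≤ |C₂| := (h₂ () p ⟨x, hx, ρ, hρ, hp⟩).trans (le_abs_self _)
    have h9 : ‖p.2 / 2‖ ≤ ρ := by
      have h5 := norm_le_norm_add_norm_sub' p.2 ρ
      have h6 := hp.snd
      rw [Complex.norm_real, Real.norm_of_nonneg hρ.1.le] at h5
      rw [norm_div, Complex.norm_ofNat]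
      linarith [hρ.1]
    have h10 : ‖(p.2 / 2) • diagSum N W T₂‖ ≤ ρ * (D * |C₂|) := by
      rw [norm_smul]
      refine mul_le_mul h9 ((hD _).trans ?_) (norm_nonneg _) hρ.1.le
      exact mul_le_mul_of_nonneg_left h8 hD0
    have h11 : C₁ * ρ ≤ |C₁| * ρ := mul_le_mul_of_nonneg_right (le_abs_self _) hρ.1.le
    have h12 : 0 ≤ |C₀| * ρ := mul_nonneg (abs_nonneg _) hρ.1.le
    calc _ ≤ C₁ * ρ + ρ * (D * |C₂|) := add_le_add h7 h10
      _ ≤ _ := by linarith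

/-- Smooth CR functions on a generic submanifold have holomorphic extensions to first order, in the
sense of `IsApproxExtension`. -/
theorem exists_isApproxExtension [CompleteSpace W] {Ω : Set (RSpace d)} (hΩ : IsOpen Ω)
    (hγ : ContDiffOn ℝ ∞ γ Ω) (hφ : ContDiffOn ℝ ∞ φ Ω) (hx₀ : x₀ ∈ Ω)
    (hspan : complexTangentSpan γ x₀ = ⊤)
    (hCR : ∀ x ∈ Ω, ∀ ξ η : RSpace d, IsType01 γ x ξ η → IsType01 φ x ξ η) :
    ∃ δ > 0, ∃ κ > 0, κ ≤ 1 / 20 ∧ Metric.ball x₀ δ ⊆ Ω ∧ ∃ H A, IsApproxExtension γ φ x₀ δ κ H A := by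
  obtain ⟨ι, hι⟩ := exists_isUnit_frame hspan
  set L := coframe ι γ x₀ with hL
  have hγd : ∀ x ∈ Ω, DifferentiableAt ℝ γ x := fun x hx =>
    (hγ.contDiffAt (hΩ.mem_nhds hx)).differentiableAt (by simp)
  have hγ₁ : ContDiffOn ℝ ∞ (fun x => L (γ x)) Ω := (L.restrictScalars ℝ).contDiff.comp_contDiffOn hγ
  have hγ₁d : ∀ x ∈ Ω, fderiv ℝ (fun x => L (γ x)) x = (L.restrictScalars ℝ).comp (fderiv ℝ γ x) :=
    fun x hx => ((L.restrictScalars ℝ).hasFDerivAt.comp x (hγd x hx).hasFDerivAt).fderiv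
  have hfr : frame ι (fun x => L (γ x)) x₀ = 1 := by
    rw [frame, hγ₁d x₀ hx₀]
    refine clm_ext_stdCVec fun i => ?_
    rw [complexify_stdCVec]
    exact coframe_dir hι i
  obtain ⟨D, hD0, hD⟩ : ∃ D : ℝ, 0 ≤ D ∧ ∀ B : RSpace d →L[ℝ] CSpace N, ‖complexify ι B‖ ≤ D * ‖B‖ :=
    exists_norm_clm_le (𝕜 := ℝ) (F := RSpace d →L[ℝ] CSpace N) (G := CSpace N →L[ℂ] CSpace N)
      (complexify ι)
  set η : ℝ := 1 / (10 * (1 + ‖ι‖ + D)) with hη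
  have hη0 : 0 < η := by positivity
  have hηι : η * ‖ι‖ ≤ 1 / 10 := by
    rw [hη, div_mul_eq_mul_div, one_mul, div_le_div_iff₀ (by positivity) (by norm_num)]
    linarith
  have hηD : D * η < 1 := by
    rw [hη, mul_one_div, div_lt_one (by positivity)]
    linarith [norm_nonneg ι]
  obtain ⟨g, hg, hge, hgc⟩ := exists_contDiff_fderiv_close hΩ hγ₁ hx₀ hη0
  obtain ⟨ψ, hψ, hψe, -⟩ := exists_contDiff_fderiv_close hΩ hφ hx₀ one_pos
  obtain ⟨r, hr, hball⟩ := Metric.eventually_nhds_iff_ball.1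
    ((hge.and hψe).and (hΩ.mem_nhds hx₀ : ∀ᶠ x in 𝓝 x₀, x ∈ Ω))
  have hfr0 : frame ι g x₀ = 1 := by rw [frame, hge.fderiv_eq]; exact hfr
  have hunit : ∀ x, IsUnit (frame ι g x) := by
    intro x
    have h1 : ‖1 - frame ι g x‖ < 1 := by
      rw [norm_sub_rev, ← hfr, frame, frame, ← map_sub]
      exact ((hD _).trans (mul_le_mul_of_nonneg_left (hgc x) hD0)).trans_lt hηD
    have := isUnit_one_sub_of_norm_lt_one h1
    rwa [sub_sub_cancel] at this
  have hclose : ∀ x u, ‖g (x + ι u) - g x - ofRealVec u‖ ≤ ‖u‖ / 10 := by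
    intro x u
    have h1 := convex_univ.norm_image_sub_le_of_norm_hasFDerivWithin_le (𝕜 := ℝ)
      (f := fun y => g y - fderiv ℝ (fun x => L (γ x)) x₀ y)
      (fun y _ => ((hg.differentiable (by simp) y).hasFDerivAt.fun_sub
        (fderiv ℝ (fun x => L (γ x)) x₀).hasFDerivAt).hasFDerivWithinAt)
      (fun y _ => hgc y) (mem_univ x) (mem_univ (x + ι u))
    have e : g (x + ι u) - fderiv ℝ (fun x => L (γ x)) x₀ (x + ι u) -
        (g x - fderiv ℝ (fun x => L (γ x)) x₀ x) = g (x + ι u) - g x - ofRealVec u := by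
      rw [map_add, fderiv_apply_eq_ofRealVec hfr]
      abel
    rw [e, add_sub_cancel_left] at h1
    have h2 := mul_le_mul_of_nonneg_left (ι.le_opNorm u) hη0.le
    have h3 := mul_le_mul_of_nonneg_right hηι (norm_nonneg u)
    linarith
  set R := r / (2 * (1 + ‖ι‖)) with hR
  have hR0 : 0 < R := by positivity
  have hRι : ‖ι‖ * R ≤ r / 2 := by
    rw [hR, mul_div_assoc', div_le_div_iff₀ (by positivity) (by norm_num)]
    nlinarith [norm_nonneg ι]
  obtain ⟨δ₁, hδ₁, hsmall⟩ := Metric.continuousAt_iff.1 hg.continuous.continuousAt (R / 40)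
    (by positivity : 0 < R / 40)
  set δ := min (r / 2) δ₁ with hδ
  have hδ0 : 0 < δ := lt_min (by positivity) hδ₁
  have hδr : Metric.ball x₀ δ ⊆ Metric.ball x₀ r :=
    Metric.ball_subset_ball ((min_le_left _ _).trans (by linarith))
  have hS : SliceData ι g x₀ (Metric.ball x₀ r) R δ :=
    { smooth := hg
      isUnit := hunit
      isOpen := Metric.isOpen_ball
      R_pos := hR0
      δ_pos := hδ0
      close := fun x _ u _ => hclose x u
      small := fun x hx x' hx' => by
        have h1 := hsmall ((Metric.mem_ball.1 hx).trans_le (min_le_right _ _))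
        have h2 := hsmall ((Metric.mem_ball.1 hx').trans_le (min_le_right _ _))
        rw [← dist_eq_norm]
        linarith [dist_triangle_right (g x) (g x') (g x₀)]
      mem := fun x hx u hu => by
        have h1 := (Metric.mem_ball.1 hx).trans_le (min_le_left _ _)
        have h2 := (ι.le_opNorm u).trans (mul_le_mul_of_nonneg_left hu (norm_nonneg ι))
        rw [Metric.mem_ball]
        have h3 := dist_triangle (x + ι u) x x₀
        rw [dist_eq_norm (x + ι u) x, add_sub_cancel_left] at h3
        linarith
      frame_one := hfr0 }
  have hψcr : IsCRSmoothOn ι g (Metric.ball x₀ r) ψ := by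
    refine ⟨hψ, fun x hx => fderiv_eq_crDeriv_of_isType01 (hunit x) fun ξ η h => ?_⟩
    have hnh := Metric.isOpen_ball.mem_nhds hx
    have e1 : fderiv ℝ g x = (L.restrictScalars ℝ).comp (fderiv ℝ γ x) := by
      rw [← hγ₁d x (hball x hx).2]
      exact EventuallyEq.fderiv_eq (eventually_of_mem hnh fun y hy => (hball y hy).1.1)
    have e2 : fderiv ℝ ψ x = fderiv ℝ φ x :=
      EventuallyEq.fderiv_eq (eventually_of_mem hnh fun y hy => (hball y hy).1.2)
    have h1 : IsType01 γ x ξ η := by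
      rw [IsType01, e1] at h
      have h2 : L (fderiv ℝ γ x ξ + Complex.I • fderiv ℝ γ x η) = 0 := by
        rw [map_add, map_smul]; exact h
      have h3 := congrArg (frame ι γ x₀) h2
      rwa [hL, frame_coframe hι, map_zero] at h3
    have h4 := hCR x (hball x hx).2 ξ η h1
    rw [IsType01] at h4 ⊢
    rw [e2]
    exact h4
  obtain ⟨H, hH⟩ := hS.exists_isApproxExtension hψcr
  have hH' : IsApproxExtension (fun x => L (γ x)) φ x₀ δ (1 / 20) H (crDeriv ι g ψ) :=
    hH.congr (fun x hx => ((hball x (hδr hx)).1.1).symm) fun x hx => ((hball x (hδr hx)).1.2).symm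
  have hγb : ∃ C : ℝ, ∀ x ∈ Metric.ball x₀ δ, ‖γ x‖ ≤ C := by
    have hsub : Metric.closedBall x₀ δ ⊆ Ω := fun x hx =>
      (hball x (Metric.closedBall_subset_ball
        ((min_le_left _ _).trans_lt (by linarith : r / 2 < r)) hx)).2
    obtain ⟨C, hC⟩ := (isCompact_closedBall x₀ δ).exists_bound_of_continuousOn
      (hγ.continuousOn.mono hsub)
    exact ⟨C, fun x hx => hC x (Metric.ball_subset_closedBall hx)⟩
  have h1L : 0 < 1 + ‖L‖ := by positivity
  refine ⟨δ, hδ0, 1 / 20 / (1 + ‖L‖), by positivity, ?_, fun x hx => (hball x (hδr hx)).2, _, _,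
    hH'.comp_clm L (fun x hx => hγd x (hball x (hδr hx)).2) hγb ?_ ?_ (by positivity)⟩
  · exact div_le_self (by norm_num) (by linarith [norm_nonneg L])
  · exact div_le_self (by norm_num) (by linarith [norm_nonneg L])
  · rw [mul_div_assoc', div_le_iff₀ h1L]
    linarith

end Approx

/-! ### The holomorphic scale function -/

section Scale

variable {d N : ℕ} {γ : RSpace d → CSpace N} {x₀ : RSpace d}
  {δ κ : ℝ} {W : Type} [NormedAddCommGroup W] [NormedSpace ℂ W]
  {φ : RSpace d → W} {H : CSpace N × ℂ → W} {A : RSpace d → CSpace N →L[ℂ] W}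

theorem IsApproxExtension.differentiableAt (h : IsApproxExtension γ φ x₀ δ κ H A)
    {p : CSpace N × ℂ} (hp : p ∈ edgeDomain γ x₀ δ κ) : DifferentiableAt ℂ H p :=
  (h.bdd 1).differentiableAt (t := ()) hp

theorem IsApproxExtension.hasStrictFDerivAt (h : IsApproxExtension γ φ x₀ δ κ H A)
    {p : CSpace N × ℂ} (hp : p ∈ edgeDomain γ x₀ δ κ) : HasStrictFDerivAt H (fderiv ℂ H p) p := by
  have hO := isOpen_edgeDomain γ x₀ δ κ
  have h1 := ((h.bdd 2).fderiv fun _ => hO).differentiableAt (t := ()) hp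
  exact hasStrictFDerivAt_of_hasFDerivAt_of_continuousAt
    (eventually_of_mem (hO.mem_nhds hp) fun q hq => (h.differentiableAt hq).hasFDerivAt)
    h1.continuousAt

/-- Integrating the first order information from the edge. -/
theorem IsApproxExtension.exists_norm_sub_sub_le (h : IsApproxExtension γ φ x₀ δ κ H A)
    (hκ : κ ≤ 1) : ∃ C : ℝ, 0 ≤ C ∧ ∀ x ∈ Metric.ball x₀ δ, ∀ ρ ∈ Ioo (0 : ℝ) 1, ∀ p,
      NearEdge γ x κ ρ p → ‖H p - φ x - A x (p.1 - γ x)‖ ≤ C * ρ ^ 2 := by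
  obtain ⟨C, hC0, hC⟩ := h.approx
  refine ⟨2 * C, by positivity, fun x hx ρ hρ p hp => ?_⟩
  have hnear : ∀ t ∈ Ioc (0 : ℝ) 1,
      NearEdge γ x κ (t * ρ) (γ x + t • (p.1 - γ x), t • p.2) := by
    intro t ht
    constructor
    · rw [add_sub_cancel_left, norm_smul, Real.norm_of_nonneg ht.1.le, mul_left_comm]
      exact mul_lt_mul_of_pos_left hp.fst ht.1
    · have : (t • p.2 : ℂ) - ((t * ρ : ℝ) : ℂ) = t • (p.2 - ρ) := by
        simp [mul_sub]
      simp only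
      rw [this, norm_smul, Real.norm_of_nonneg ht.1.le, mul_left_comm]
      exact mul_lt_mul_of_pos_left hp.snd ht.1
  have htρ : ∀ t ∈ Ioc (0 : ℝ) 1, t * ρ ∈ Ioo (0 : ℝ) 1 := fun t ht =>
    ⟨mul_pos ht.1 hρ.1, (mul_le_of_le_one_left hρ.1.le ht.2).trans_lt hρ.2⟩
  set c : ℝ → CSpace N × ℂ := fun t => (γ x + t • (p.1 - γ x), t • p.2) with hc
  have hcd : ∀ t, HasDerivAt c (p.1 - γ x, p.2) t := by
    intro t
    have h1 : HasDerivAt (fun t : ℝ => γ x + t • (p.1 - γ x)) (p.1 - γ x) t := by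
      simpa using ((hasDerivAt_id t).smul_const (p.1 - γ x)).const_add (γ x)
    have h2 : HasDerivAt (fun t : ℝ => t • p.2) p.2 t := by
      simpa using (hasDerivAt_id t).smul_const p.2
    exact h1.prodMk h2
  have hv : ‖(p.1 - γ x, p.2)‖ ≤ 2 * ρ := by
    have h1 := hp.fst
    have h2 := hp.snd
    have h3 := norm_le_norm_add_norm_sub' p.2 ρ
    rw [Complex.norm_real, Real.norm_of_nonneg hρ.1.le] at h3
    have h4 : κ * ρ ≤ ρ := mul_le_of_le_one_left hρ.1.le hκ
    rw [Prod.norm_def]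
    exact max_le (by simp only; linarith [hρ.1]) (by simp only; linarith)
  have hfd : ∀ t ∈ Ioc (0 : ℝ) 1, HasDerivAt (fun t => H (c t) - t • A x (p.1 - γ x))
      (fderiv ℂ H (c t) (p.1 - γ x, p.2) - A x (p.1 - γ x)) t := by
    intro t ht
    have h1 := (h.differentiableAt ⟨x, hx, t * ρ, htρ t ht, hnear t ht⟩).hasFDerivAt.restrictScalars ℝ
    refine (h1.comp_hasDerivAt t (hcd t)).fun_sub ?_
    simpa using (hasDerivAt_id t).smul_const (A x (p.1 - γ x))
  have hbound : ∀ t ∈ Ioc (0 : ℝ) 1,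
      ‖fderiv ℂ H (c t) (p.1 - γ x, p.2) - A x (p.1 - γ x)‖ ≤ 2 * C * ρ ^ 2 := by
    intro t ht
    have h1 := (hC x hx _ (htρ t ht) _ (hnear t ht)).2
    have h2 := ContinuousLinearMap.le_of_opNorm_le _ h1 (p.1 - γ x, p.2)
    refine h2.trans ?_
    have h3 : C * (t * ρ) ≤ C * ρ :=
      mul_le_mul_of_nonneg_left (mul_le_of_le_one_left hρ.1.le ht.2) hC0
    calc _ ≤ (C * ρ) * (2 * ρ) :=
          mul_le_mul h3 hv (norm_nonneg _) (mul_nonneg hC0 hρ.1.le)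
      _ = _ := by ring
  have hstep : ∀ t ∈ Ioo (0 : ℝ) 1,
      ‖H p - φ x - A x (p.1 - γ x)‖ ≤ 2 * C * ρ ^ 2 + C * (t * ρ) + t * ‖A x (p.1 - γ x)‖ := by
    intro t ht
    have hsub : ∀ r ∈ Icc t 1, r ∈ Ioc (0 : ℝ) 1 := fun r hr => ⟨ht.1.trans_le hr.1, hr.2⟩
    have h1 := norm_image_sub_le_of_norm_deriv_le_segment' (C := 2 * C * ρ ^ 2)
      (fun r hr => (hfd r (hsub r hr)).hasDerivWithinAt)
      (fun r hr => hbound r (hsub r (Ico_subset_Icc_self hr))) 1 ⟨ht.2.le, le_rfl⟩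
    have h2 := (hC x hx _ (htρ t ⟨ht.1, ht.2.le⟩) _ (hnear t ⟨ht.1, ht.2.le⟩)).1
    have e1 : c 1 = p := by simp [hc]
    rw [e1, one_smul] at h1
    have h3 : 2 * C * ρ ^ 2 * (1 - t) ≤ 2 * C * ρ ^ 2 :=
      mul_le_of_le_one_right (by positivity) (by linarith [ht.1])
    have e : H p - φ x - A x (p.1 - γ x) = (H p - A x (p.1 - γ x) -
        (H (c t) - t • A x (p.1 - γ x))) + (H (c t) - φ x) - t • A x (p.1 - γ x) := by abel
    rw [e]
    refine (norm_sub_le _ _).trans ?_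
    rw [norm_smul, Real.norm_of_nonneg ht.1.le]
    refine add_le_add ((norm_add_le _ _).trans (add_le_add (h1.trans h3) h2)) le_rfl
  have hlim : Tendsto (fun t : ℝ => 2 * C * ρ ^ 2 + C * (t * ρ) + t * ‖A x (p.1 - γ x)‖) (𝓝[>] 0)
      (𝓝 (2 * C * ρ ^ 2)) := by
    have : Continuous fun t : ℝ => 2 * C * ρ ^ 2 + C * (t * ρ) + t * ‖A x (p.1 - γ x)‖ := by fun_prop
    simpa using (this.tendsto 0).mono_left (nhdsWithin_le_nhds (s := Ioi 0))
  exact ge_of_tendsto hlim (eventually_of_mem (Ioo_mem_nhdsGT one_pos) hstep)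

/-- Differentiability of a function defined by a holomorphic fixed point equation. -/
theorem hasFDerivAt_of_fixedPoint {E : Type} [NormedAddCommGroup E] [NormedSpace ℂ E]
    [CompleteSpace E] {Ψ : E × ℂ → ℂ} {Ψ' : E × ℂ →L[ℂ] ℂ} {g : E → ℂ} {p₀ : E}
    (hΨ : HasStrictFDerivAt Ψ Ψ' (p₀, g p₀)) (h1 : 1 - Ψ' (0, 1) ≠ 0) (h0 : Ψ (p₀, g p₀) = g p₀)
    (huniq : ∀ᶠ q in 𝓝 (p₀, g p₀), Ψ q = q.2 → q.2 = g q.1) :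
    HasFDerivAt g ((1 - Ψ' (0, 1))⁻¹ • Ψ'.comp (ContinuousLinearMap.inl ℂ E ℂ)) p₀ := by
  set f' : E × ℂ →L[ℂ] ℂ := ContinuousLinearMap.snd ℂ E ℂ - Ψ' with hf'
  have hf : HasStrictFDerivAt (fun q => q.2 - Ψ q) f' (p₀, g p₀) := hasStrictFDerivAt_snd.sub hΨ
  have hinv : (f' ∘L .inr ℂ E ℂ).IsInvertible := by
    refine ⟨ContinuousLinearEquiv.unitsEquivAut ℂ (Units.mk0 _ h1), ?_⟩
    ext
    simp [hf']
  set ψ := hf.implicitFunctionOfProdDomain hinv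
  have ht : Tendsto (fun p => (p, ψ p)) (𝓝 p₀) (𝓝 (p₀, g p₀)) :=
    tendsto_id.prodMk_nhds (hf.tendsto_implicitFunctionOfProdDomain hinv)
  have hev : ∀ᶠ p in 𝓝 p₀, Ψ (p, ψ p) = ψ p ∧ ψ p = g p := by
    filter_upwards [hf.eventually_apply_implicitFunctionOfProdDomain hinv, ht.eventually huniq]
      with p hp hp'
    have h2 : Ψ (p, ψ p) = ψ p := by
      have h3 : ψ p - Ψ (p, ψ p) = g p₀ - Ψ (p₀, g p₀) := hp
      rw [h0, sub_self, sub_eq_zero] at h3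
      exact h3.symm
    exact ⟨h2, hp' h2⟩
  have hg : HasFDerivAt g _ p₀ :=
    ((hf.hasStrictFDerivAt_implicitFunctionOfProdDomain hinv).hasFDerivAt).congr_of_eventuallyEq
      (hev.mono fun p hp => hp.2.symm)
  set g' := fderiv ℂ g p₀
  have hg' : HasFDerivAt g g' p₀ := hg.differentiableAt.hasFDerivAt
  have hc : HasFDerivAt (fun p => Ψ (p, g p)) (Ψ'.comp ((ContinuousLinearMap.id ℂ E).prod g')) p₀ :=
    hΨ.hasFDerivAt.comp p₀ ((hasFDerivAt_id p₀).prodMk hg')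
  have hfix : (fun p => Ψ (p, g p)) =ᶠ[𝓝 p₀] g := by
    filter_upwards [hev] with p hp
    rw [← hp.2, hp.1]
  have e := (hg'.congr_of_eventuallyEq hfix).unique hc
  refine hg'.congr_fderiv ?_
  ext q
  have h2 : g' q = Ψ' (q, g' q) := congrArg (fun L : E →L[ℂ] ℂ => L q) e
  have h3 : Ψ' (q, g' q) = Ψ' (q, 0) + g' q * Ψ' (0, 1) := by
    rw [← smul_eq_mul, ← map_smul, ← map_add]
    simp
  rw [_root_.smul_apply, ContinuousLinearMap.comp_apply, ContinuousLinearMap.inl_apply,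
    smul_eq_mul, eq_inv_mul_iff_mul_eq₀ h1]
  rw [h3] at h2
  linear_combination h2

/-- The points of `E` which lie over the edge `e (ball x₀ δ)` in directions close to `v`, at
distance comparable with some `s < ε`. -/
def thinWedge {E : Type} [NormedAddCommGroup E] [NormedSpace ℝ E] (e : RSpace d → E)
    (x₀ : RSpace d) (δ : ℝ) (v : E) (a ε : ℝ) : Set E :=
  {p | ∃ x ∈ Metric.ball x₀ δ, ∃ s ∈ Ioo 0 ε, ‖p - e x - s • v‖ < a * s}

/-- The map whose fixed point in the last variable is the scale at a point. -/
def scaleMap (Λ : ℝ) (ℓ : W →L[ℂ] ℂ) (H : CSpace N × ℂ → W) (q : (CSpace N × W) × ℂ) : ℂ :=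
  Λ • ℓ (q.1.2 - H (q.1.1, q.2))

/-- The solution, among the admissible scales, of the fixed point equation of `scaleMap`. -/
def scaleFun (γ : RSpace d → CSpace N) (x₀ : RSpace d) (δ κ ρ₀ : ℝ) (Λ : ℝ) (ℓ : W →L[ℂ] ℂ)
    (H : CSpace N × ℂ → W) (p : CSpace N × W) : ℂ :=
  Classical.epsilon fun ζ => (∃ x ∈ Metric.ball x₀ δ, ∃ ρ ∈ Ioo (0 : ℝ) ρ₀,
    NearEdge γ x κ ρ (p.1, ζ)) ∧ scaleMap Λ ℓ H (p, ζ) = ζ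

/-- Uniqueness of the scale: the admissible scales at a point form a convex set, on which the
fixed point map is a contraction. -/
theorem IsApproxExtension.eq_of_scaleMap (h : IsApproxExtension γ φ x₀ δ κ H A) {C₁ ρ₀ Λ : ℝ}
    {ℓ : W →L[ℂ] ℂ} (hC₁0 : 0 ≤ C₁)
    (hC₁ : ∀ x ∈ Metric.ball x₀ δ, ∀ ρ ∈ Ioo (0 : ℝ) 1, ∀ p, NearEdge γ x κ ρ p →
      ‖fderiv ℂ H p (0, 1)‖ ≤ C₁ * ρ) (hκ : 0 < κ)
    (hρ₀ : ρ₀ ≤ 1) (hΛ : 0 < Λ) (hsmall : Λ * ‖ℓ‖ * C₁ * ρ₀ ≤ 1 / 2) {p : CSpace N × W} {ζ₁ ζ₂ : ℂ}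
    (h₁ : ∃ x ∈ Metric.ball x₀ δ, ∃ ρ ∈ Ioo (0 : ℝ) ρ₀, NearEdge γ x κ ρ (p.1, ζ₁))
    (h₂ : ∃ x ∈ Metric.ball x₀ δ, ∃ ρ ∈ Ioo (0 : ℝ) ρ₀, NearEdge γ x κ ρ (p.1, ζ₂))
    (e₁ : scaleMap Λ ℓ H (p, ζ₁) = ζ₁) (e₂ : scaleMap Λ ℓ H (p, ζ₂) = ζ₂) : ζ₁ = ζ₂ := by
  set S : Set ℂ := {ζ | ∃ x ∈ Metric.ball x₀ δ, ∃ ρ ∈ Ioo (0 : ℝ) ρ₀, NearEdge γ x κ ρ (p.1, ζ)}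
  have hS : Convex ℝ S := by
    rintro ζ ⟨x, hx, ρ, hρ, hn⟩ ζ' ⟨x', hx', ρ', hρ', hn'⟩ α β hα hβ hαβ
    have hsnd : ‖α • ζ + β • ζ' - ((α * ρ + β * ρ' : ℝ) : ℂ)‖ < κ * (α * ρ + β * ρ') := by
      have e : α • ζ + β • ζ' - ((α * ρ + β * ρ' : ℝ) : ℂ) = α • (ζ - ρ) + β • (ζ' - ρ') := by
        simp; ring
      rw [e]
      refine (norm_add_le _ _).trans_lt ?_
      rw [norm_smul, norm_smul, Real.norm_of_nonneg hα, Real.norm_of_nonneg hβ]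
      have h3 := hn.snd
      have h4 := hn'.snd
      simp only at h3 h4
      rcases hα.eq_or_lt with rfl | hα'
      · have : β = 1 := by linarith
        subst this; linarith
      · nlinarith [mul_lt_mul_of_pos_left h3 hα', mul_le_mul_of_nonneg_left h4.le hβ]
    have hm : α * ρ + β * ρ' ∈ Ioo (0 : ℝ) ρ₀ := by
      have := convex_Ioo (𝕜 := ℝ) (0 : ℝ) ρ₀ hρ hρ' hα hβ hαβ
      simpa using this
    rcases le_total ρ ρ' with hle | hle
    · refine ⟨x, hx, _, hm, ⟨hn.fst.trans_le ?_, hsnd⟩⟩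
      refine mul_le_mul_of_nonneg_left ?_ hκ.le
      have : α = 1 - β := by linarith
      subst this; nlinarith
    · refine ⟨x', hx', _, hm, ⟨hn'.fst.trans_le ?_, hsnd⟩⟩
      refine mul_le_mul_of_nonneg_left ?_ hκ.le
      have : β = 1 - α := by linarith
      subst this; nlinarith
  have hd : ∀ ζ ∈ S, HasDerivWithinAt (fun ζ => scaleMap Λ ℓ H (p, ζ))
      (-(Λ • ℓ (fderiv ℂ H (p.1, ζ) (0, 1)))) S ζ := by
    rintro ζ ⟨x, hx, ρ, hρ, hn⟩
    have h3 := (h.differentiableAt ⟨x, hx, ρ, ⟨hρ.1, hρ.2.trans_le hρ₀⟩, hn⟩).hasFDerivAt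
    have h4 : HasDerivAt (fun ζ : ℂ => (p.1, ζ)) (0, 1) ζ :=
      (hasDerivAt_const ζ p.1).prodMk (hasDerivAt_id ζ)
    have h5 := ((h3.comp_hasDerivAt ζ h4).const_sub p.2)
    have h6 := (ℓ.hasFDerivAt.comp_hasDerivAt ζ h5).const_smul Λ
    refine (h6.congr_deriv ?_).hasDerivWithinAt
    simp
  have hb : ∀ ζ ∈ S, ‖-(Λ • ℓ (fderiv ℂ H (p.1, ζ) (0, 1)))‖ ≤ 1 / 2 := by
    rintro ζ ⟨x, hx, ρ, hρ, hn⟩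
    have h3 := hC₁ x hx ρ ⟨hρ.1, hρ.2.trans_le hρ₀⟩ _ hn
    rw [norm_neg, norm_smul, Real.norm_of_nonneg hΛ.le]
    refine le_trans ?_ hsmall
    have h4 := ℓ.le_opNorm_of_le h3
    have h5 : C₁ * ρ ≤ C₁ * ρ₀ := mul_le_mul_of_nonneg_left hρ.2.le hC₁0
    calc _ ≤ Λ * (‖ℓ‖ * (C₁ * ρ₀)) := mul_le_mul_of_nonneg_left
          (h4.trans (mul_le_mul_of_nonneg_left h5 (norm_nonneg _))) hΛ.le
      _ = _ := by ring
  have key := hS.norm_image_sub_le_of_norm_hasDerivWithin_le hd hb h₁ h₂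
  rw [e₁, e₂] at key
  have h0 : ‖ζ₂ - ζ₁‖ = 0 := by linarith [norm_nonneg (ζ₂ - ζ₁)]
  rw [norm_eq_zero, sub_eq_zero] at h0
  exact h0.symm

/-- Existence of the scale over the point `x` of the edge, close to the value which it has to first
order. -/
theorem IsApproxExtension.exists_scaleMap_eq (h : IsApproxExtension γ φ x₀ δ κ H A) {C₁ C₂ ρ₀ Λ : ℝ}
    {ℓ : W →L[ℂ] ℂ} (hC₁0 : 0 ≤ C₁)
    (hC₁ : ∀ x ∈ Metric.ball x₀ δ, ∀ ρ ∈ Ioo (0 : ℝ) 1, ∀ p, NearEdge γ x κ ρ p →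
      ‖fderiv ℂ H p (0, 1)‖ ≤ C₁ * ρ) (hC₂0 : 0 ≤ C₂)
    (hC₂ : ∀ x ∈ Metric.ball x₀ δ, ∀ ρ ∈ Ioo (0 : ℝ) 1, ∀ p, NearEdge γ x κ ρ p →
      ‖H p - φ x - A x (p.1 - γ x)‖ ≤ C₂ * ρ ^ 2)
    (hρ₀ : ρ₀ ≤ 1) (hΛ : 0 < Λ) (hsmall : Λ * ‖ℓ‖ * C₁ * ρ₀ ≤ 1 / 2) {v : CSpace N × W}
    (hℓ : ℓ (v.2 - A x₀ v.1) = 1) (hvΛ : ‖v.1‖ + 1 < κ * Λ) {θ a ε K : ℝ} (hθ : 0 < θ) (hθκ : θ < κ)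
    (ha1 : a ≤ 1) (hε : Λ * ε ≤ ρ₀) {x : RSpace d} (hx : x ∈ Metric.ball x₀ δ)
    (hK : ‖A x‖ ≤ K) (hω : ‖ℓ‖ * (‖A x - A x₀‖ * ‖v.1‖) ≤ θ / 3)
    (ha : ‖ℓ‖ * ((1 + K) * a) ≤ θ / 3) (hεθ : ‖ℓ‖ * (C₂ * (Λ ^ 2 * ε)) ≤ θ / 3)
    {s : ℝ} (hs : s ∈ Ioo 0 ε) {p : CSpace N × W} (hp : ‖p - (γ x, φ x) - s • v‖ < a * s) :
    ∃ ζ, NearEdge γ x κ (Λ * s) (p.1, ζ) ∧ ‖ζ - (Λ * s : ℝ)‖ ≤ θ * (Λ * s) ∧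
      scaleMap Λ ℓ H (p, ζ) = ζ := by
  have hρ : 0 < Λ * s := mul_pos hΛ hs.1
  have hρ₀' : Λ * s < ρ₀ := (mul_lt_mul_of_pos_left hs.2 hΛ).trans_le hε
  have hρ1 : Λ * s ∈ Ioo (0 : ℝ) 1 := ⟨hρ, hρ₀'.trans_le hρ₀⟩
  set y := p - (γ x, φ x) - s • v with hy
  have hy1 : ‖y.1‖ < a * s := (norm_fst_le y).trans_lt hp
  have hy2 : ‖y.2‖ < a * s := (norm_snd_le y).trans_lt hp
  have hp1 : p.1 - γ x = y.1 + s • v.1 := by simp [hy]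
  have hp2 : p.2 - φ x = y.2 + s • v.2 := by simp [hy]
  have hnear1 : ‖p.1 - γ x‖ < κ * (Λ * s) := by
    rw [hp1]
    refine (norm_add_le _ _).trans_lt ?_
    rw [norm_smul, Real.norm_of_nonneg hs.1.le]
    have h1 : a * s ≤ s := mul_le_of_le_one_left hs.1.le ha1
    nlinarith [mul_lt_mul_of_pos_right hvΛ hs.1]
  have hnear : ∀ ζ ∈ Metric.closedBall ((Λ * s : ℝ) : ℂ) (θ * (Λ * s)),
      NearEdge γ x κ (Λ * s) (p.1, ζ) := fun ζ hζ => by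
    refine ⟨hnear1, ?_⟩
    rw [mem_closedBall_iff_norm] at hζ
    exact hζ.trans_lt (mul_lt_mul_of_pos_right hθκ hρ)
  have hmaps : MapsTo (fun ζ => scaleMap Λ ℓ H (p, ζ))
      (Metric.closedBall ((Λ * s : ℝ) : ℂ) (θ * (Λ * s)))
      (Metric.closedBall ((Λ * s : ℝ) : ℂ) (θ * (Λ * s))) := by
    intro ζ hζ
    rw [mem_closedBall_iff_norm]
    have h1 := hC₂ x hx _ hρ1 _ (hnear ζ hζ)
    -- Expanding around the edge.
    have e : scaleMap Λ ℓ H (p, ζ) - (Λ * s : ℝ) = Λ • (s • ℓ ((A x₀ - A x) v.1) +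
        ℓ (y.2 - A x y.1) - ℓ (H (p.1, ζ) - φ x - A x (p.1 - γ x))) := by
      have h2 : p.2 - H (p.1, ζ) = s • (v.2 - A x₀ v.1) + (s • (A x₀ - A x) v.1 + (y.2 - A x y.1) -
          (H (p.1, ζ) - φ x - A x (p.1 - γ x))) := by
        have h3 : p.2 = φ x + (y.2 + s • v.2) := by rw [← hp2]; abel
        rw [hp1, h3, map_add, (A x).map_smul_of_tower, _root_.sub_apply, smul_sub, smul_sub]
        abel
      rw [scaleMap]
      simp only
      rw [h2, map_add, ℓ.map_smul_of_tower, hℓ, map_sub, map_add, ℓ.map_smul_of_tower, smul_add]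
      simp
    rw [e, norm_smul, Real.norm_of_nonneg hΛ.le]
    have t1 : ‖s • ℓ ((A x₀ - A x) v.1)‖ ≤ s * (θ / 3) := by
      rw [norm_smul, Real.norm_of_nonneg hs.1.le]
      refine mul_le_mul_of_nonneg_left ((ℓ.le_opNorm_of_le ((A x₀ - A x).le_opNorm _)).trans ?_) hs.1.le
      rw [norm_sub_rev]; exact hω
    have t2 : ‖ℓ (y.2 - A x y.1)‖ ≤ s * (θ / 3) := by
      have h3 : ‖y.2 - A x y.1‖ ≤ (1 + K) * a * s := by
        refine (norm_sub_le _ _).trans ?_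
        have h4 : ‖A x y.1‖ ≤ K * (a * s) := (A x).le_of_opNorm_le_of_le hK hy1.le
        linarith
      refine (ℓ.le_opNorm_of_le h3).trans ?_
      nlinarith [mul_le_mul_of_nonneg_right ha hs.1.le]
    have t3 : ‖ℓ (H (p.1, ζ) - φ x - A x (p.1 - γ x))‖ ≤ s * (θ / 3) := by
      refine (ℓ.le_opNorm_of_le h1).trans ?_
      have h4 : C₂ * (Λ * s) ^ 2 ≤ C₂ * (Λ ^ 2 * ε) * s := by
        rw [mul_pow, mul_assoc, mul_assoc, sq s]
        have := hs.2.le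
        have := hs.1.le
        gcongr
      calc _ ≤ ‖ℓ‖ * (C₂ * (Λ ^ 2 * ε) * s) := mul_le_mul_of_nonneg_left h4 (norm_nonneg _)
        _ = (‖ℓ‖ * (C₂ * (Λ ^ 2 * ε))) * s := by ring
        _ ≤ _ := by rw [mul_comm s]; exact mul_le_mul_of_nonneg_right hεθ hs.1.le
    calc _ ≤ Λ * (s * (θ / 3) + s * (θ / 3) + s * (θ / 3)) := by
          refine mul_le_mul_of_nonneg_left ?_ hΛ.le
          refine (norm_sub_le _ _).trans (add_le_add ((norm_add_le _ _).trans (add_le_add t1 t2)) t3)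
      _ = _ := by ring
  have hlip : ∀ ζ ∈ Metric.closedBall ((Λ * s : ℝ) : ℂ) (θ * (Λ * s)),
      ∀ ζ' ∈ Metric.closedBall ((Λ * s : ℝ) : ℂ) (θ * (Λ * s)),
      ‖scaleMap Λ ℓ H (p, ζ') - scaleMap Λ ℓ H (p, ζ)‖ ≤ 1 / 2 * ‖ζ' - ζ‖ := by
    intro ζ hζ ζ' hζ'
    refine (convex_closedBall ((Λ * s : ℝ) : ℂ) (θ * (Λ * s))).norm_image_sub_le_of_norm_hasDerivWithin_le
      (f := fun ζ => scaleMap Λ ℓ H (p, ζ)) (f' := fun ζ => -(Λ • ℓ (fderiv ℂ H (p.1, ζ) (0, 1))))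
      (fun ζ hζ => ?_) (fun ζ hζ => ?_) hζ hζ'
    · have h3 := (h.differentiableAt ⟨x, hx, _, hρ1, hnear ζ hζ⟩).hasFDerivAt
      have h4 : HasDerivAt (fun ζ : ℂ => (p.1, ζ)) (0, 1) ζ :=
        (hasDerivAt_const ζ p.1).prodMk (hasDerivAt_id ζ)
      have h5 := ((h3.comp_hasDerivAt ζ h4).const_sub p.2)
      have h6 := (ℓ.hasFDerivAt.comp_hasDerivAt ζ h5).const_smul Λ
      refine (h6.congr_deriv ?_).hasDerivWithinAt
      simp
    · have h3 := hC₁ x hx _ hρ1 _ (hnear ζ hζ)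
      rw [norm_neg, norm_smul, Real.norm_of_nonneg hΛ.le]
      refine le_trans ?_ hsmall
      have h4 := ℓ.le_opNorm_of_le h3
      have h5 : C₁ * (Λ * s) ≤ C₁ * ρ₀ := mul_le_mul_of_nonneg_left hρ₀'.le hC₁0
      calc _ ≤ Λ * (‖ℓ‖ * (C₁ * ρ₀)) := mul_le_mul_of_nonneg_left
            (h4.trans (mul_le_mul_of_nonneg_left h5 (norm_nonneg _))) hΛ.le
        _ = _ := by ring
  have hcontr : ContractingWith (1 / 2) (hmaps.restrict _ _ _) := by
    refine ⟨by rw [← NNReal.coe_lt_coe]; norm_num, LipschitzWith.of_dist_le_mul fun ζ ζ' => ?_⟩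
    have := hlip ζ' ζ'.2 ζ ζ.2
    rw [Subtype.dist_eq, Subtype.dist_eq, dist_eq_norm, dist_eq_norm]
    simpa using this
  obtain ⟨ζ, hζ, hfix, -⟩ := hcontr.exists_fixedPoint' (Metric.isClosed_closedBall.isComplete) hmaps
    (Metric.mem_closedBall_self (mul_nonneg hθ.le hρ.le)) (edist_ne_top _ _)
  exact ⟨ζ, hnear ζ hζ, mem_closedBall_iff_norm.1 hζ, hfix⟩

end Scale

section Scale

variable {d N : ℕ} {γ : RSpace d → CSpace N} {x₀ : RSpace d}
  {δ κ : ℝ} {W : Type} [NormedAddCommGroup W] [NormedSpace ℂ W]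
  {φ : RSpace d → W} {H : CSpace N × ℂ → W} {A : RSpace d → CSpace N →L[ℂ] W}

/-- The derivative of the fixed point map of `scaleMap`. -/
def scaleMapDeriv (Λ : ℝ) (ℓ : W →L[ℂ] ℂ) (M : CSpace N × ℂ →L[ℂ] W) :
    (CSpace N × W) × ℂ →L[ℂ] ℂ :=
  Λ • ℓ.comp ((ContinuousLinearMap.snd ℂ (CSpace N) W).comp
    (ContinuousLinearMap.fst ℂ (CSpace N × W) ℂ) -
    M.comp (((ContinuousLinearMap.fst ℂ (CSpace N) W).comp
      (ContinuousLinearMap.fst ℂ (CSpace N × W) ℂ)).prod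
        (ContinuousLinearMap.snd ℂ (CSpace N × W) ℂ)))

theorem hasStrictFDerivAt_scaleMap {Λ : ℝ} {ℓ : W →L[ℂ] ℂ} {M : CSpace N × ℂ →L[ℂ] W}
    {q : (CSpace N × W) × ℂ} (hM : HasStrictFDerivAt H M (q.1.1, q.2)) :
    HasStrictFDerivAt (scaleMap Λ ℓ H) (scaleMapDeriv Λ ℓ M) q := by
  have h1 : HasStrictFDerivAt (fun q : (CSpace N × W) × ℂ => (q.1.1, q.2)) _ q :=
    ((ContinuousLinearMap.fst ℂ (CSpace N) W).comp
      (ContinuousLinearMap.fst ℂ (CSpace N × W) ℂ)).hasStrictFDerivAt.prodMk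
        (ContinuousLinearMap.snd ℂ (CSpace N × W) ℂ).hasStrictFDerivAt
  have h2 := ((ContinuousLinearMap.snd ℂ (CSpace N) W).comp
    (ContinuousLinearMap.fst ℂ (CSpace N × W) ℂ)).hasStrictFDerivAt (x := q)
  have h3 : HasStrictFDerivAt (fun q : (CSpace N × W) × ℂ => H (q.1.1, q.2)) _ q :=
    HasStrictFDerivAt.comp (g := H) q hM h1
  exact (ℓ.hasStrictFDerivAt.comp q (h2.sub h3)).const_smul Λ

theorem scaleMapDeriv_apply (Λ : ℝ) (ℓ : W →L[ℂ] ℂ) (M : CSpace N × ℂ →L[ℂ] W)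
    (q : (CSpace N × W) × ℂ) : scaleMapDeriv Λ ℓ M q = Λ * ℓ (q.1.2 - M (q.1.1, q.2)) := by
  simp [scaleMapDeriv]

/-- The derivative of a scale function, in terms of the derivative `M` of `H`. -/
def scaleDeriv (Λ : ℝ) (ℓ : W →L[ℂ] ℂ) (M : CSpace N × ℂ →L[ℂ] W) : CSpace N × W →L[ℂ] ℂ :=
  Ring.inverse (1 + (Λ : ℂ) * ℓ (M (0, 1))) • (Λ : ℂ) •
    ℓ.comp (ContinuousLinearMap.snd ℂ (CSpace N) W -
      (M.comp (ContinuousLinearMap.inl ℂ (CSpace N) ℂ)).comp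
        (ContinuousLinearMap.fst ℂ (CSpace N) W))

/-- A scale function `g` on the wedge of direction `v` over the edge: it is comparable with the
distance to the edge and solves the fixed point equation of `scaleMap`. -/
structure IsScaleFun (γ : RSpace d → CSpace N) (φ : RSpace d → W) (x₀ : RSpace d)
    (κ : ℝ) (H : CSpace N × ℂ → W) (v : CSpace N × W) (ℓ : W →L[ℂ] ℂ) (Λ θ δ a ε : ℝ)
    (g : CSpace N × W → ℂ) : Prop where
  near : ∀ x ∈ Metric.ball x₀ δ, ∀ s ∈ Ioo 0 ε, ∀ p : CSpace N × W,
    ‖p - (γ x, φ x) - s • v‖ < a * s →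
      NearEdge γ x κ (Λ * s) (p.1, g p) ∧ ‖g p - (Λ * s : ℝ)‖ ≤ θ * (Λ * s)
  deriv : ∀ p ∈ thinWedge (fun x => (γ x, φ x)) x₀ δ v a ε,
    HasFDerivAt g (scaleDeriv Λ ℓ (fderiv ℂ H (p.1, g p))) p

theorem IsScaleFun.mono {v : CSpace N × W} {ℓ : W →L[ℂ] ℂ} {Λ θ δ a ε : ℝ} {g : CSpace N × W → ℂ}
    (h : IsScaleFun γ φ x₀ κ H v ℓ Λ θ δ a ε g) {δ' ε' : ℝ} (hδ : δ' ≤ δ) (hε : ε' ≤ ε) :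
    IsScaleFun γ φ x₀ κ H v ℓ Λ θ δ' a ε' g where
  near x hx s hs := h.near x (Metric.ball_subset_ball hδ hx) s ⟨hs.1, hs.2.trans_le hε⟩
  deriv p hp := by
    obtain ⟨x, hx, s, hs, hp⟩ := hp
    exact h.deriv p ⟨x, Metric.ball_subset_ball hδ hx, s, ⟨hs.1, hs.2.trans_le hε⟩, hp⟩

/-- Existence of a holomorphic scale function. For `Λ` large, `v'` is small compared with the scale
`Λ s`, so that the points in directions close to `v` are admissible for `H`. -/
theorem IsApproxExtension.exists_isScaleFun [CompleteSpace W]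
    (h : IsApproxExtension γ φ x₀ δ κ H A) (hδ : 0 < δ) (hκ : 0 < κ) (hκ1 : κ ≤ 1)
    {v : CSpace N × W} {ℓ : W →L[ℂ] ℂ} (hℓ : ℓ (v.2 - A x₀ v.1) = 1) {Λ θ : ℝ} (hΛ : 0 < Λ)
    (hvΛ : ‖v.1‖ + 1 < κ * Λ) (hθ : 0 < θ) (hθκ : θ < κ) :
    ∃ δ' ∈ Ioc 0 δ, ∃ a ∈ Ioo (0 : ℝ) 1, ∃ ε ∈ Ioo (0 : ℝ) 1, ∃ g, Λ * ε ≤ 1 ∧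
      (∃ C₁ : ℝ, 0 ≤ C₁ ∧ Λ * ‖ℓ‖ * C₁ * (Λ * ε) ≤ 1 / 2 ∧
        ∀ x ∈ Metric.ball x₀ δ, ∀ ρ ∈ Ioo (0 : ℝ) 1, ∀ p, NearEdge γ x κ ρ p →
          ‖fderiv ℂ H p - (A x).comp (ContinuousLinearMap.fst ℂ (CSpace N) ℂ)‖ ≤ C₁ * ρ) ∧
      IsScaleFun γ φ x₀ κ H v ℓ Λ θ δ' a ε g := by
  obtain ⟨C₁, hC₁0, hC₁'⟩ := h.approx
  obtain ⟨C₂, hC₂0, hC₂⟩ := h.exists_norm_sub_sub_le hκ1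
  have hC₁ : ∀ x ∈ Metric.ball x₀ δ, ∀ ρ ∈ Ioo (0 : ℝ) 1, ∀ p, NearEdge γ x κ ρ p →
      ‖fderiv ℂ H p (0, 1)‖ ≤ C₁ * ρ := by
    intro x hx ρ hρ p hp
    have h1 := ContinuousLinearMap.le_of_opNorm_le _ (hC₁' x hx ρ hρ p hp).2 (0, 1)
    simpa [Prod.norm_def] using h1
  set ρ₀ : ℝ := min 1 (1 / (2 * (Λ * ‖ℓ‖ * C₁ + 1))) with hρ₀
  have hρ₀pos : 0 < ρ₀ := lt_min one_pos (by positivity)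
  have hsmall : Λ * ‖ℓ‖ * C₁ * ρ₀ ≤ 1 / 2 := by
    calc _ ≤ Λ * ‖ℓ‖ * C₁ * (1 / (2 * (Λ * ‖ℓ‖ * C₁ + 1))) :=
          mul_le_mul_of_nonneg_left (min_le_right _ _) (by positivity)
      _ ≤ _ := by
          rw [mul_one_div, div_le_div_iff₀ (by positivity) (by norm_num)]
          linarith
  set K := ‖A x₀‖ + 1 with hK
  have hx₀ : x₀ ∈ Metric.ball x₀ δ := Metric.mem_ball_self hδ
  have hcA : ContinuousAt A x₀ := h.continuousOn.continuousAt (Metric.ball_mem_nhds x₀ hδ)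
  set τ := min 1 (θ / (3 * (‖ℓ‖ * ‖v.1‖ + 1))) with hτ
  obtain ⟨δ₁, hδ₁, hA⟩ := Metric.continuousAt_iff.1 hcA τ (lt_min one_pos (by positivity))
  set a := min (1 / 2) (θ / (3 * (‖ℓ‖ * (1 + K) + 1))) with ha
  have ha0 : 0 < a := lt_min (by norm_num) (by positivity)
  set ε := min (1 / 2) (min (ρ₀ / Λ) (θ / (3 * (‖ℓ‖ * (C₂ * Λ ^ 2) + 1)))) with hε
  have hε0 : 0 < ε := lt_min (by norm_num) (lt_min (by positivity) (by positivity))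
  have hεΛ : Λ * ε ≤ ρ₀ := by
    have : ε ≤ ρ₀ / Λ := (min_le_right _ _).trans (min_le_left _ _)
    rw [mul_comm]
    exact (le_div_iff₀ hΛ).1 this
  have hquot : ∀ c b : ℝ, 0 ≤ b → c ≤ θ / (3 * (b + 1)) → b * c ≤ θ / 3 := by
    intro c b hb hc
    calc b * c ≤ b * (θ / (3 * (b + 1))) := mul_le_mul_of_nonneg_left hc hb
      _ ≤ θ / 3 := by
          rw [mul_div_assoc', div_le_div_iff₀ (by positivity) (by norm_num)]
          nlinarith
  set g := scaleFun γ x₀ δ κ ρ₀ Λ ℓ H with hg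
  have hexists : ∀ x ∈ Metric.ball x₀ (min δ δ₁), ∀ s ∈ Ioo 0 ε, ∀ p : CSpace N × W,
      ‖p - (γ x, φ x) - s • v‖ < a * s →
        ∃ ζ, NearEdge γ x κ (Λ * s) (p.1, ζ) ∧ ‖ζ - (Λ * s : ℝ)‖ ≤ θ * (Λ * s) ∧
          scaleMap Λ ℓ H (p, ζ) = ζ := by
    intro x hx s hs p hp
    have hAx : ‖A x - A x₀‖ ≤ τ := by
      rw [← dist_eq_norm]
      exact (hA ((Metric.mem_ball.1 hx).trans_le (min_le_right _ _))).le
    refine h.exists_scaleMap_eq (K := K) hC₁0 hC₁ hC₂0 hC₂ (min_le_left _ _) hΛ hsmall hℓ hvΛ hθ hθκ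
      ((min_le_left _ _).trans (by norm_num)) hεΛ (Metric.ball_subset_ball (min_le_left _ _) hx)
      ?_ ?_ ?_ ?_ hs hp
    · have h1 := norm_le_norm_add_norm_sub' (A x) (A x₀)
      have h2 : τ ≤ 1 := min_le_left _ _
      linarith
    · have := hquot _ (‖ℓ‖ * ‖v.1‖) (by positivity) (hAx.trans (min_le_right _ _))
      linarith
    · have := hquot a (‖ℓ‖ * (1 + K)) (by positivity) (min_le_right _ _)
      linarith
    · have := hquot ε (‖ℓ‖ * (C₂ * Λ ^ 2)) (by positivity)
        ((min_le_right _ _).trans (min_le_right _ _))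
      linarith
  -- The scale function is the unique solution among the admissible scales.
  have hspec : ∀ p, ∀ ζ, (∃ x ∈ Metric.ball x₀ δ, ∃ ρ ∈ Ioo (0 : ℝ) ρ₀, NearEdge γ x κ ρ (p.1, ζ)) →
      scaleMap Λ ℓ H (p, ζ) = ζ → ζ = g p := by
    intro p ζ h1 h2
    have h3 := Classical.epsilon_spec (p := fun ζ => (∃ x ∈ Metric.ball x₀ δ,
      ∃ ρ ∈ Ioo (0 : ℝ) ρ₀, NearEdge γ x κ ρ (p.1, ζ)) ∧ scaleMap Λ ℓ H (p, ζ) = ζ) ⟨ζ, h1, h2⟩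
    exact h.eq_of_scaleMap hC₁0 hC₁ hκ (min_le_left _ _) hΛ hsmall h1 h3.1 h2 h3.2
  have hval : ∀ x ∈ Metric.ball x₀ (min δ δ₁), ∀ s ∈ Ioo 0 ε, ∀ p : CSpace N × W,
      ‖p - (γ x, φ x) - s • v‖ < a * s →
        NearEdge γ x κ (Λ * s) (p.1, g p) ∧ ‖g p - (Λ * s : ℝ)‖ ≤ θ * (Λ * s) ∧
          scaleMap Λ ℓ H (p, g p) = g p := by
    intro x hx s hs p hp
    obtain ⟨ζ, h1, h2, h3⟩ := hexists x hx s hs p hp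
    have e := hspec p ζ ⟨x, Metric.ball_subset_ball (min_le_left _ _) hx, Λ * s,
      ⟨mul_pos hΛ hs.1, (mul_lt_mul_of_pos_left hs.2 hΛ).trans_le hεΛ⟩, h1⟩ h3
    subst e
    exact ⟨h1, h2, h3⟩
  refine ⟨min δ δ₁, ⟨lt_min hδ hδ₁, min_le_left _ _⟩, a, ⟨ha0, (min_le_left _ _).trans_lt (by norm_num)⟩,
    ε, ⟨hε0, (min_le_left _ _).trans_lt (by norm_num)⟩, g, hεΛ.trans (min_le_left _ _),
    ⟨C₁, hC₁0, ?_, fun x hx ρ hρ p hp => (hC₁' x hx ρ hρ p hp).2⟩,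
    ⟨fun x hx s hs p hp => ⟨(hval x hx s hs p hp).1, (hval x hx s hs p hp).2.1⟩, ?_⟩⟩
  · exact (mul_le_mul_of_nonneg_left hεΛ (by positivity)).trans hsmall
  rintro p ⟨x, hx, s, hs, hp⟩
  obtain ⟨h1, h2, h3⟩ := hval x hx s hs p hp
  have hρ : Λ * s ∈ Ioo (0 : ℝ) ρ₀ :=
    ⟨mul_pos hΛ hs.1, (mul_lt_mul_of_pos_left hs.2 hΛ).trans_le hεΛ⟩
  have hρ1 : Λ * s ∈ Ioo (0 : ℝ) 1 := ⟨hρ.1, hρ.2.trans_le (min_le_left _ _)⟩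
  have hxδ := Metric.ball_subset_ball (min_le_left δ δ₁) hx
  have hΨ := hasStrictFDerivAt_scaleMap (Λ := Λ) (ℓ := ℓ) (q := (p, g p))
    (h.hasStrictFDerivAt ⟨x, hxδ, _, hρ1, h1⟩)
  have e1 : 1 - scaleMapDeriv Λ ℓ (fderiv ℂ H (p.1, g p)) ((0, 0), 1) =
      1 + (Λ : ℂ) * ℓ (fderiv ℂ H (p.1, g p) (0, 1)) := by
    rw [scaleMapDeriv_apply]
    simp
  have hne : 1 + (Λ : ℂ) * ℓ (fderiv ℂ H (p.1, g p) (0, 1)) ≠ 0 := by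
    intro h0
    have h4 : ‖(Λ : ℂ) * ℓ (fderiv ℂ H (p.1, g p) (0, 1))‖ ≤ 1 / 2 := by
      rw [norm_mul, Complex.norm_real, Real.norm_of_nonneg hΛ.le]
      refine le_trans ?_ hsmall
      have h5 := ℓ.le_opNorm_of_le (hC₁ x hxδ _ hρ1 _ h1)
      calc _ ≤ Λ * (‖ℓ‖ * (C₁ * ρ₀)) := mul_le_mul_of_nonneg_left (h5.trans
            (mul_le_mul_of_nonneg_left (mul_le_mul_of_nonneg_left hρ.2.le hC₁0) (norm_nonneg _))) hΛ.le
        _ = _ := by ring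
    rw [eq_neg_of_add_eq_zero_right h0, norm_neg, norm_one] at h4
    norm_num at h4
  have huniq : ∀ᶠ q in 𝓝 (p, g p), scaleMap Λ ℓ H q = q.2 → q.2 = g q.1 := by
    have hcont : ContinuousAt (fun q : (CSpace N × W) × ℂ => (q.1.1, q.2)) (p, g p) := by fun_prop
    have hO : ∀ᶠ q in 𝓝 (p.1, g p), NearEdge γ x κ (Λ * s) q := by
      have : {q | NearEdge γ x κ (Λ * s) q} = Metric.ball (γ x) (κ * (Λ * s)) ×ˢ
          Metric.ball ((Λ * s : ℝ) : ℂ) (κ * (Λ * s)) := by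
        ext q
        simp only [mem_ofPred_eq, mem_prod, mem_ball_iff_norm]
        exact ⟨fun h => ⟨h.fst, h.snd⟩, fun h => ⟨h.1, h.2⟩⟩
      refine IsOpen.mem_nhds (s := {q | NearEdge γ x κ (Λ * s) q}) ?_ h1
      rw [this]
      exact Metric.isOpen_ball.prod Metric.isOpen_ball
    filter_upwards [hcont.eventually hO] with q hq hfix
    exact hspec q.1 q.2 ⟨x, hxδ, _, hρ, hq⟩ hfix
  have key := hasFDerivAt_of_fixedPoint hΨ (by
    change 1 - scaleMapDeriv Λ ℓ (fderiv ℂ H (p.1, g p)) ((0, 0), 1) ≠ 0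
    rw [e1]; exact hne) h3 huniq
  refine key.congr_fderiv ?_
  have e1' : 1 - scaleMapDeriv Λ ℓ (fderiv ℂ H ((p, g p).1.1, (p, g p).2)) (0, 1) = _ := e1
  rw [e1', scaleDeriv, Ring.inverse_eq_inv']
  congr 1

/-- The properties of the scale function `g`, and of the map `(z, w) ↦ w - H (z, g (z, w))`, which
vanishes to first order on the edge. -/
structure ScaleFunEstimates (γ : RSpace d → CSpace N) (φ : RSpace d → W) (x₀ : RSpace d)
    (H : CSpace N × ℂ → W) (A : RSpace d → CSpace N →L[ℂ] W) (v : CSpace N × W)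
    (Λ θ δ a ε C : ℝ) (g : CSpace N × W → ℂ) : Prop where
  near : ∀ x ∈ Metric.ball x₀ δ, ∀ s ∈ Ioo 0 ε, ∀ p : CSpace N × W,
    ‖p - (γ x, φ x) - s • v‖ < a * s → ‖g p - (Λ * s : ℝ)‖ ≤ θ * (Λ * s)
  bdd : ∀ r, HasBddDerivs ℂ (fun _ : Unit => thinWedge (fun x => (γ x, φ x)) x₀ δ v a ε) r
    (fun _ => g)
  tangential : ∀ x ∈ Metric.ball x₀ δ, ∀ s ∈ Ioo 0 ε, ∀ p : CSpace N × W,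
    ‖p - (γ x, φ x) - s • v‖ < a * s →
      ‖(fderiv ℂ g p).comp ((ContinuousLinearMap.id ℂ (CSpace N)).prod (A x))‖ ≤ C * s
  differentiableAt : ∀ p ∈ thinWedge (fun x => (γ x, φ x)) x₀ δ v a ε,
    DifferentiableAt ℂ (fun p : CSpace N × W => p.2 - H (p.1, g p)) p
  norm_le : ∀ x ∈ Metric.ball x₀ δ, ∀ s ∈ Ioo 0 ε, ∀ p : CSpace N × W,
    ‖p - (γ x, φ x) - s • v‖ < a * s → ‖p.2 - H (p.1, g p)‖ ≤ C * s
  fderiv_sub_le : ∀ x ∈ Metric.ball x₀ δ, ∀ s ∈ Ioo 0 ε, ∀ p : CSpace N × W,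
    ‖p - (γ x, φ x) - s • v‖ < a * s →
      ‖fderiv ℂ (fun p : CSpace N × W => p.2 - H (p.1, g p)) p -
        (ContinuousLinearMap.snd ℂ (CSpace N) W -
          (A x).comp (ContinuousLinearMap.fst ℂ (CSpace N) W))‖ ≤ C * s

theorem norm_inverse_one_add_le {z : ℂ} (h : ‖z‖ ≤ 1 / 2) :
    1 + z ≠ 0 ∧ ‖Ring.inverse (1 + z)‖ ≤ 2 := by
  have h1 : 1 / 2 ≤ ‖1 + z‖ := by
    have := norm_sub_norm_le (1 : ℂ) (-z)
    rw [norm_neg, norm_one, sub_neg_eq_add] at this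
    linarith
  have h2 : 1 + z ≠ 0 := fun h0 => by rw [h0, norm_zero] at h1; norm_num at h1
  refine ⟨h2, ?_⟩
  rw [Ring.inverse_eq_inv', norm_inv, inv_le_comm₀ (by linarith) two_pos]
  linarith

theorem HasBddDerivs.scaleDeriv {T E : Type} [NormedAddCommGroup E] [NormedSpace ℂ E] {D : T → Set E}
    {r : ℕ} {f : T → E → CSpace N × ℂ →L[ℂ] W} (hf : HasBddDerivs ℂ D r f) {Λ : ℝ} {ℓ : W →L[ℂ] ℂ}
    (hsm : ∀ t, ∀ x ∈ D t, ‖(Λ : ℂ) * ℓ (f t x (0, 1))‖ ≤ 1 / 2) :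
    HasBddDerivs ℂ D r (fun t x => scaleDeriv Λ ℓ (f t x)) := by
  have h1 : HasBddDerivs ℂ D r (fun t x => 1 + (Λ : ℂ) * ℓ (f t x (0, 1))) :=
    (HasBddDerivs.const ⟨‖(1 : ℂ)‖, fun _ _ => le_rfl⟩).add
      (hf.clm_comp ((Λ : ℂ) • ℓ.comp (ContinuousLinearMap.apply ℂ W ((0 : CSpace N), (1 : ℂ)))))
  have h2 := h1.ringInverse (fun t x hx => (norm_inverse_one_add_le (hsm t x hx)).1.isUnit)
    ⟨2, fun t x hx => (norm_inverse_one_add_le (hsm t x hx)).2⟩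
  have h3 : HasBddDerivs ℂ D r (fun t x => ContinuousLinearMap.snd ℂ (CSpace N) W -
      ((f t x).comp (ContinuousLinearMap.inl ℂ (CSpace N) ℂ)).comp
        (ContinuousLinearMap.fst ℂ (CSpace N) W)) :=
    (HasBddDerivs.const ⟨‖ContinuousLinearMap.snd ℂ (CSpace N) W‖, fun _ _ => le_rfl⟩).sub
      (hf.clm_comp (((ContinuousLinearMap.compL ℂ (CSpace N × W) (CSpace N) W).flip
        (ContinuousLinearMap.fst ℂ (CSpace N) W)).comp
        ((ContinuousLinearMap.compL ℂ (CSpace N) (CSpace N × ℂ) W).flip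
        (ContinuousLinearMap.inl ℂ (CSpace N) ℂ))))
  have h4 := h3.clm_comp ((Λ : ℂ) • ContinuousLinearMap.compL ℂ (CSpace N × W) W ℂ ℓ)
  exact h2.smul h4

/-- First order information on the scale function. Along the edge, the derivative of `w - H (z, ζ)`
vanishes up to `O(s)`, hence so does that of `g`, by the equation which defines it. -/
theorem IsApproxExtension.exists_scaleFunEstimates [CompleteSpace W]
    (h : IsApproxExtension γ φ x₀ δ κ H A) (hδ : 0 < δ) (hκ : 0 < κ) (hκ1 : κ ≤ 1)
    (hγb : ∃ B : ℝ, ∀ x ∈ Metric.ball x₀ δ, ‖γ x‖ ≤ B)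
    {v : CSpace N × W} {ℓ : W →L[ℂ] ℂ} (hℓ : ℓ (v.2 - A x₀ v.1) = 1) {Λ θ : ℝ} (hΛ : 0 < Λ)
    (hvΛ : ‖v.1‖ + 1 < κ * Λ) (hθ : 0 < θ) (hθκ : θ < κ) :
    ∃ δ' ∈ Ioc 0 δ, ∃ a ∈ Ioo (0 : ℝ) 1, ∃ ε ∈ Ioo (0 : ℝ) 1, ∃ C > 0, ∃ g,
      ScaleFunEstimates γ φ x₀ H A v Λ θ δ' a ε C g := by
  obtain ⟨δ₁, hδ₁, a, ha, ε, hε, g, hεΛ, ⟨C₁, hC₁0, hsmall, hC₁⟩, hg⟩ :=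
    h.exists_isScaleFun hδ hκ hκ1 hℓ hΛ hvΛ hθ hθκ
  obtain ⟨C₂, hC₂0, hC₂⟩ := h.exists_norm_sub_sub_le hκ1
  obtain ⟨δ₂, hδ₂, hA⟩ := Metric.continuousAt_iff.1
    (h.continuousOn.continuousAt (Metric.ball_mem_nhds x₀ hδ)) 1 one_pos
  set K := ‖A x₀‖ + 1 with hK
  have hAK : ∀ x ∈ Metric.ball x₀ δ₂, ‖A x‖ ≤ K := by
    intro x hx
    have h1 := hA (Metric.mem_ball.1 hx)
    rw [dist_eq_norm] at h1
    linarith [norm_le_norm_add_norm_sub' (A x) (A x₀)]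
  set δ' := min δ₁ δ₂ with hδ'
  have hδ'0 : 0 < δ' := lt_min hδ₁.1 hδ₂
  have hsub : Metric.ball x₀ δ' ⊆ Metric.ball x₀ δ :=
    Metric.ball_subset_ball ((min_le_left _ _).trans hδ₁.2)
  have hg' := hg.mono (min_le_left δ₁ δ₂) (le_refl ε)
  have hρ : ∀ s ∈ Ioo 0 ε, Λ * s ∈ Ioo (0 : ℝ) 1 := fun s hs =>
    ⟨mul_pos hΛ hs.1, (mul_lt_mul_of_pos_left hs.2 hΛ).trans_le hεΛ⟩
  have hmaps : ∀ p ∈ thinWedge (fun x => (γ x, φ x)) x₀ δ' v a ε,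
      (p.1, g p) ∈ edgeDomain γ x₀ δ κ := by
    rintro p ⟨x, hx, s, hs, hp⟩
    exact ⟨x, hsub hx, _, hρ s hs, (hg'.near x hx s hs p hp).1⟩
  have hDH : ∀ x ∈ Metric.ball x₀ δ', ∀ s ∈ Ioo 0 ε, ∀ p : CSpace N × W,
      ‖p - (γ x, φ x) - s • v‖ < a * s → ‖fderiv ℂ H (p.1, g p) -
        (A x).comp (ContinuousLinearMap.fst ℂ (CSpace N) ℂ)‖ ≤ C₁ * (Λ * s) := fun x hx s hs p hp =>
    hC₁ x (hsub hx) _ (hρ s hs) _ (hg'.near x hx s hs p hp).1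
  have hsm : ∀ p ∈ thinWedge (fun x => (γ x, φ x)) x₀ δ' v a ε,
      ‖(Λ : ℂ) * ℓ (fderiv ℂ H (p.1, g p) (0, 1))‖ ≤ 1 / 2 := by
    rintro p ⟨x, hx, s, hs, hp⟩
    have h1 : ‖fderiv ℂ H (p.1, g p) (0, 1)‖ ≤ C₁ * (Λ * s) := by
      have := ContinuousLinearMap.le_of_opNorm_le _ (hDH x hx s hs p hp) (0, 1)
      simpa [Prod.norm_def] using this
    rw [norm_mul, Complex.norm_real, Real.norm_of_nonneg hΛ.le]
    refine le_trans ?_ hsmall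
    have h2 : C₁ * (Λ * s) ≤ C₁ * (Λ * ε) :=
      mul_le_mul_of_nonneg_left (mul_le_mul_of_nonneg_left hs.2.le hΛ.le) hC₁0
    calc _ ≤ Λ * (‖ℓ‖ * (C₁ * (Λ * ε))) := mul_le_mul_of_nonneg_left ((ℓ.le_opNorm_of_le h1).trans
          (mul_le_mul_of_nonneg_left h2 (norm_nonneg _))) hΛ.le
      _ = _ := by ring
  have hfst : ∃ C : ℝ, ∀ _ : Unit, ∀ p ∈ thinWedge (fun x => (γ x, φ x)) x₀ δ' v a ε,
      ‖ContinuousLinearMap.fst ℂ (CSpace N) W p‖ ≤ C := by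
    obtain ⟨B, hB⟩ := hγb
    refine ⟨B + κ, ?_⟩
    rintro - p ⟨x, hx, s, hs, hp⟩
    have h1 := (hg'.near x hx s hs p hp).1.fst
    have h2 := norm_le_norm_add_norm_sub' p.1 (γ x)
    have h3 := hB x (hsub hx)
    have h4 : κ * (Λ * s) ≤ κ := mul_le_of_le_one_right hκ.le (hρ s hs).2.le
    rw [ContinuousLinearMap.coe_fst']
    simp only at h1
    linarith
  have hgb : ∃ C : ℝ, ∀ _ : Unit, ∀ p ∈ thinWedge (fun x => (γ x, φ x)) x₀ δ' v a ε, ‖g p‖ ≤ C := by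
    refine ⟨1 + θ, ?_⟩
    rintro - p ⟨x, hx, s, hs, hp⟩
    have h1 := (hg'.near x hx s hs p hp).2
    have h2 := norm_le_norm_add_norm_sub' (g p) ((Λ * s : ℝ) : ℂ)
    have h3 := hρ s hs
    rw [Complex.norm_real, Real.norm_of_nonneg h3.1.le] at h2
    have h4 : θ * (Λ * s) ≤ θ := mul_le_of_le_one_right hθ.le h3.2.le
    linarith [h3.2]
  have hbdd : ∀ r, HasBddDerivs ℂ (fun _ : Unit => thinWedge (fun x => (γ x, φ x)) x₀ δ' v a ε) r
      (fun _ => g) := by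
    intro r
    induction r with
    | zero => exact hgb
    | succ r ih =>
      refine ⟨hgb, fun _ p => scaleDeriv Λ ℓ (fderiv ℂ H (p.1, g p)), fun _ => hg'.deriv, ?_⟩
      have h1 := (HasBddDerivs.clm (r := r) _ hfst).prodMk ih
      have h2 := ((h.bdd (r + 1)).fderiv fun _ => isOpen_edgeDomain γ x₀ δ κ).comp h1
        fun _ p hp => hmaps p hp
      exact h2.scaleDeriv fun _ => hsm
  obtain ⟨Kg, hKg0, hKg⟩ := (hbdd 1).2.choose_spec.2.bdd
  have hKg' : ∀ p ∈ thinWedge (fun x => (γ x, φ x)) x₀ δ' v a ε, ‖fderiv ℂ g p‖ ≤ Kg := by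
    intro p hp
    rw [((hbdd 1).2.choose_spec.1 () p hp).fderiv]
    exact hKg () p hp
  have hgd : ∀ p ∈ thinWedge (fun x => (γ x, φ x)) x₀ δ' v a ε,
      HasFDerivAt (fun p : CSpace N × W => p.2 - H (p.1, g p))
        (ContinuousLinearMap.snd ℂ (CSpace N) W - (fderiv ℂ H (p.1, g p)).comp
          ((ContinuousLinearMap.fst ℂ (CSpace N) W).prod (fderiv ℂ g p))) p := by
    intro p hp
    have h1 := (h.differentiableAt (hmaps p hp)).hasFDerivAt
    have h2 : HasFDerivAt (fun p : CSpace N × W => (p.1, g p)) _ p :=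
      hasFDerivAt_fst.prodMk (hg'.deriv p hp).differentiableAt.hasFDerivAt
    exact hasFDerivAt_snd.fun_sub (HasFDerivAt.comp (g := H) p h1 h2)
  have hN : 0 ≤ 2 * Λ * ‖ℓ‖ * C₁ * Λ := by positivity
  have hN2 : 0 ≤ C₂ * Λ ^ 2 + (1 + K) * (‖v‖ + 1) := by positivity
  have hN3 : 0 ≤ C₁ * Λ * (1 + Kg) := by positivity
  set C := 2 * Λ * ‖ℓ‖ * C₁ * Λ + (C₂ * Λ ^ 2 + (1 + K) * (‖v‖ + 1)) + C₁ * Λ * (1 + Kg) + 1 with hC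
  refine ⟨δ', ⟨hδ'0, (min_le_left _ _).trans hδ₁.2⟩, a, ha, ε, hε, C, by positivity, g,
    fun x hx s hs p hp => (hg'.near x hx s hs p hp).2, hbdd, fun x hx s hs p hp => ?_,
    fun p hp => (hgd p hp).differentiableAt, fun x hx s hs p hp => ?_, fun x hx s hs p hp => ?_⟩
  · have hpw : p ∈ thinWedge (fun x => (γ x, φ x)) x₀ δ' v a ε := ⟨x, hx, s, hs, hp⟩
    rw [(hg'.deriv p hpw).fderiv]
    refine ContinuousLinearMap.opNorm_le_bound _ (mul_nonneg (by positivity) hs.1.le) fun z => ?_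
    have e : (scaleDeriv Λ ℓ (fderiv ℂ H (p.1, g p))).comp
        ((ContinuousLinearMap.id ℂ (CSpace N)).prod (A x)) z =
        Ring.inverse (1 + (Λ : ℂ) * ℓ (fderiv ℂ H (p.1, g p) (0, 1))) * ((Λ : ℂ) *
          ℓ (-(fderiv ℂ H (p.1, g p) -
            (A x).comp (ContinuousLinearMap.fst ℂ (CSpace N) ℂ)) (z, 0))) := by
      simp [scaleDeriv]
    rw [e, norm_mul, norm_mul, Complex.norm_real, Real.norm_of_nonneg hΛ.le]
    have h1 := (norm_inverse_one_add_le (hsm p hpw)).2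
    have h2 : ‖-(fderiv ℂ H (p.1, g p) - (A x).comp (ContinuousLinearMap.fst ℂ (CSpace N) ℂ)) (z, 0)‖ ≤
        C₁ * (Λ * s) * ‖z‖ := by
      rw [norm_neg]
      have := ContinuousLinearMap.le_of_opNorm_le _ (hDH x hx s hs p hp) (z, 0)
      simpa [Prod.norm_def] using this
    have h3 := ℓ.le_opNorm_of_le h2
    calc _ ≤ 2 * (Λ * (‖ℓ‖ * (C₁ * (Λ * s) * ‖z‖))) :=
          mul_le_mul h1 (mul_le_mul_of_nonneg_left h3 hΛ.le) (by positivity) (by norm_num)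
      _ = (2 * Λ * ‖ℓ‖ * C₁ * Λ) * s * ‖z‖ := by ring
      _ ≤ C * s * ‖z‖ := by
          refine mul_le_mul_of_nonneg_right (mul_le_mul_of_nonneg_right ?_ hs.1.le) (norm_nonneg _)
          linarith
  · have h1 := hC₂ x (hsub hx) _ (hρ s hs) _ (hg'.near x hx s hs p hp).1
    simp only at h1
    have hAx := hAK x (Metric.ball_subset_ball (min_le_right _ _) hx)
    have hpe : ‖p - (γ x, φ x)‖ ≤ (‖v‖ + 1) * s := by
      have h2 := norm_le_norm_add_norm_sub' (p - (γ x, φ x)) (s • v)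
      rw [norm_smul, Real.norm_of_nonneg hs.1.le] at h2
      have h3 : a * s ≤ s := mul_le_of_le_one_left hs.1.le ha.2.le
      linarith
    have h2 : ‖p.1 - γ x‖ ≤ (‖v‖ + 1) * s := (norm_fst_le (p - (γ x, φ x))).trans hpe
    have h3 : ‖p.2 - φ x‖ ≤ (‖v‖ + 1) * s := (norm_snd_le (p - (γ x, φ x))).trans hpe
    have h4 : ‖A x (p.1 - γ x)‖ ≤ K * ((‖v‖ + 1) * s) := (A x).le_of_opNorm_le_of_le hAx h2
    have e : p.2 - H (p.1, g p) = (p.2 - φ x) - A x (p.1 - γ x) -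
        (H (p.1, g p) - φ x - A x (p.1 - γ x)) := by abel
    rw [e]
    have h5 := norm_sub_le ((p.2 - φ x) - A x (p.1 - γ x)) (H (p.1, g p) - φ x - A x (p.1 - γ x))
    have h6 := norm_sub_le (p.2 - φ x) (A x (p.1 - γ x))
    have h7 : C₂ * (Λ * s) ^ 2 ≤ C₂ * Λ ^ 2 * s := by
      have : s ^ 2 ≤ s := by nlinarith [hs.1, hs.2, hε.2]
      calc _ = C₂ * Λ ^ 2 * s ^ 2 := by ring
        _ ≤ _ := mul_le_mul_of_nonneg_left this (by positivity)
    calc _ ≤ (C₂ * Λ ^ 2 + (1 + K) * (‖v‖ + 1)) * s := by linarith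
      _ ≤ C * s := mul_le_mul_of_nonneg_right (by linarith) hs.1.le
  · have hpw : p ∈ thinWedge (fun x => (γ x, φ x)) x₀ δ' v a ε := ⟨x, hx, s, hs, hp⟩
    rw [(hgd p hpw).fderiv]
    have e : ContinuousLinearMap.snd ℂ (CSpace N) W - (fderiv ℂ H (p.1, g p)).comp
          ((ContinuousLinearMap.fst ℂ (CSpace N) W).prod (fderiv ℂ g p)) -
        (ContinuousLinearMap.snd ℂ (CSpace N) W -
          (A x).comp (ContinuousLinearMap.fst ℂ (CSpace N) W)) =
        -((fderiv ℂ H (p.1, g p) - (A x).comp (ContinuousLinearMap.fst ℂ (CSpace N) ℂ)).comp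
          ((ContinuousLinearMap.fst ℂ (CSpace N) W).prod (fderiv ℂ g p))) := by
      refine ContinuousLinearMap.ext fun q => ?_
      simp
    rw [e, norm_neg]
    have h1 : ‖(ContinuousLinearMap.fst ℂ (CSpace N) W).prod (fderiv ℂ g p)‖ ≤ 1 + Kg := by
      refine ContinuousLinearMap.opNorm_le_bound _ (by positivity) fun q => ?_
      have h2 := norm_fst_le q
      have h3 := ContinuousLinearMap.le_of_opNorm_le _ (hKg' p hpw) q
      have h4 : 0 ≤ Kg * ‖q‖ := by positivity
      rw [ContinuousLinearMap.prod_apply, Prod.norm_def]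
      refine max_le ?_ ?_
      · simp only [ContinuousLinearMap.coe_fst']; linarith
      · simp only; linarith [norm_nonneg q]
    refine (ContinuousLinearMap.opNorm_comp_le _ _).trans ?_
    calc _ ≤ C₁ * (Λ * s) * (1 + Kg) :=
          mul_le_mul (hDH x hx s hs p hp) h1 (norm_nonneg _)
            (mul_nonneg hC₁0 (mul_nonneg hΛ.le hs.1.le))
      _ = (C₁ * Λ * (1 + Kg)) * s := by ring
      _ ≤ C * s := mul_le_mul_of_nonneg_right (by linarith) hs.1.le

end Scale

/-! ### Boundary values along perturbed edges -/

section Holomorphic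

variable {V : Type} [NormedAddCommGroup V] [NormedSpace ℂ V] [FiniteDimensional ℂ V]

/-- Holomorphic functions of several variables are continuously differentiable, by Cauchy's estimate
on complex lines. -/
theorem continuousOn_fderiv_of_holomorphic {F : V → ℂ} {D : Set V} (hD : IsOpen D)
    (hF : DifferentiableOn ℂ F D) : ContinuousOn (fderiv ℂ F) D := by
  have : ProperSpace V := FiniteDimensional.proper ℂ V
  refine continuousOn_clm_apply.2 fun v p hp => ContinuousAt.continuousWithinAt ?_
  obtain ⟨R, hR, hball⟩ := Metric.isOpen_iff.1 hD p hp
  -- A polydisc-like neighbourhood: complex lines in direction `v` through points near `p`.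
  set r := R / (3 * (1 + ‖v‖)) with hr
  have hr0 : 0 < r := by positivity
  have hrv : r * ‖v‖ ≤ R / 3 := by
    rw [hr, div_mul_eq_mul_div, div_le_div_iff₀ (by positivity) (by norm_num)]
    nlinarith [norm_nonneg v]
  have hK : Metric.closedBall p (2 * R / 3) ⊆ D :=
    (Metric.closedBall_subset_ball (by linarith)).trans hball
  have hunif := (isCompact_closedBall p (2 * R / 3)).uniformContinuousOn_of_continuous
    (hF.continuousOn.mono hK)
  rw [Metric.uniformContinuousOn_iff] at hunif
  have hline : ∀ q ∈ Metric.ball p (R / 3), ∀ z ∈ Metric.closedBall (0 : ℂ) r,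
      q + z • v ∈ Metric.closedBall p (2 * R / 3) := by
    intro q hq z hz
    rw [mem_ball_iff_norm] at hq
    rw [mem_closedBall_zero_iff] at hz
    rw [mem_closedBall_iff_norm, show q + z • v - p = (q - p) + z • v by abel]
    refine (norm_add_le _ _).trans ?_
    rw [norm_smul]
    have := mul_le_mul_of_nonneg_right hz (norm_nonneg v)
    linarith
  have hder : ∀ q ∈ Metric.ball p (R / 3), ∀ z ∈ Metric.closedBall (0 : ℂ) r,
      HasDerivAt (fun z : ℂ => F (q + z • v)) (fderiv ℂ F (q + z • v) v) z := by
    intro q hq z hz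
    have h1 := (hF.differentiableAt (hD.mem_nhds (hK (hline q hq z hz)))).hasFDerivAt
    have h2 : HasDerivAt (fun z : ℂ => q + z • v) v z := by
      simpa using ((hasDerivAt_id z).smul_const v).const_add q
    exact h1.comp_hasDerivAt z h2
  refine Metric.continuousAt_iff.2 fun ε hε => ?_
  obtain ⟨η, hη, hη'⟩ := hunif (ε / 2 * r) (by positivity)
  refine ⟨min η (R / 3), lt_min hη (by positivity), fun {q} hq => ?_⟩
  have hq1 : q ∈ Metric.ball p (R / 3) := hq.trans_le (min_le_right _ _)
  have hp1 : p ∈ Metric.ball p (R / 3) := Metric.mem_ball_self (by positivity)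
  have h0 : (0 : ℂ) ∈ Metric.closedBall (0 : ℂ) r := Metric.mem_closedBall_self hr0.le
  have hd : ∀ z ∈ Metric.closedBall (0 : ℂ) r,
      HasDerivAt (fun z : ℂ => F (q + z • v) - F (p + z • v))
      (fderiv ℂ F (q + z • v) v - fderiv ℂ F (p + z • v) v) z := fun z hz =>
    (hder q hq1 z hz).fun_sub (hder p hp1 z hz)
  have hdc : DiffContOnCl ℂ (fun z : ℂ => F (q + z • v) - F (p + z • v)) (Metric.ball 0 r) := by
    refine DifferentiableOn.diffContOnCl ?_
    rw [closure_ball _ hr0.ne']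
    exact fun z hz => (hd z hz).differentiableAt.differentiableWithinAt
  have hsph : ∀ z ∈ Metric.sphere (0 : ℂ) r, ‖F (q + z • v) - F (p + z • v)‖ ≤ ε / 2 * r := by
    intro z hz
    have hz' := Metric.sphere_subset_closedBall hz
    rw [← dist_eq_norm]
    refine (hη' _ (hline q hq1 z hz') _ (hline p hp1 z hz') ?_).le
    rw [dist_add_right]
    exact hq.trans_le (min_le_left _ _)
  have := Complex.norm_deriv_le_of_forall_mem_sphere_norm_le hr0 hdc hsph
  rw [(hd 0 h0).deriv, mul_div_assoc, div_self hr0.ne', mul_one] at this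
  simp only [zero_smul, add_zero] at this
  rw [dist_eq_norm]
  linarith

theorem contDiffAt_one_of_holomorphic {F : V → ℂ} {D : Set V} (hD : IsOpen D)
    (hF : DifferentiableOn ℂ F D) {p : V} (hp : p ∈ D) : ContDiffAt ℂ 1 F p :=
  contDiffAt_one_iff.2 ⟨fderiv ℂ F, D, hD.mem_nhds hp, continuousOn_fderiv_of_holomorphic hD hF,
    fun _ hq => (hF.differentiableAt (hD.mem_nhds hq)).hasFDerivAt⟩

end Holomorphic

theorem HasBddDerivs.contDiffAt_one {𝕜 : Type} [NontriviallyNormedField 𝕜] {T E F : Type}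
    [NormedAddCommGroup E] [NormedSpace 𝕜 E] [NormedAddCommGroup F] [NormedSpace 𝕜 F] {D : T → Set E}
    {f : T → E → F} (hf : HasBddDerivs 𝕜 D 2 f) {t : T} (hD : IsOpen (D t)) {x : E} (hx : x ∈ D t) :
    ContDiffAt 𝕜 1 (f t) x := by
  obtain ⟨f', hf', h⟩ := hf.2
  exact contDiffAt_one_iff.2 ⟨f' t, D t, hD.mem_nhds hx, fun y hy =>
    (h.differentiableAt hy).continuousAt.continuousWithinAt, hf' t⟩

/-- A family of edges `e t`, with uniformly bounded derivatives and uniformly invertible frames, from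
which a holomorphic function `F` may be reached in the direction `v`, with uniformly slow growth. -/
structure IsEdgeFamily {d N : ℕ} {T : Type} (B : Set (RSpace d)) (ι : RSpace N →L[ℝ] RSpace d)
    (e : T → RSpace d → CSpace N) (v : CSpace N) (D : Set (CSpace N)) (F : CSpace N → ℂ) (τ₀ C : ℝ)
    (l : ℕ) : Prop where
  isOpen : IsOpen B
  bdd : ∀ r, HasBddDerivs ℝ (fun _ : T => B) r e
  isUnit : ∀ t, ∀ x ∈ B, IsUnit (frame ι (e t) x)
  bdd_coframe : ∃ C : ℝ, ∀ t, ∀ x ∈ B, ‖coframe ι (e t) x‖ ≤ C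
  isOpen_dom : IsOpen D
  holomorphic : DifferentiableOn ℂ F D
  mem : ∀ t, ∀ x ∈ B, ∀ τ ∈ Ioo 0 τ₀, e t x + τ • v ∈ D
  growth : ∀ t, ∀ x ∈ B, ∀ τ ∈ Ioo 0 τ₀, ‖F (e t x + τ • v)‖ ≤ C * (τ ^ l)⁻¹

/-- A family of functions with uniformly bounded derivatives, supported in the compact set `K`. -/
structure IsTestFamily {d : ℕ} {T : Type} (B K : Set (RSpace d)) (ψ : T → RSpace d → ℂ) : Prop where
  bdd : ∀ r, HasBddDerivs ℝ (fun _ : T => B) r ψ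
  supp : ∀ t, ∀ x ∉ K, ψ t x = 0

/-- The adjoint of differentiation in the direction `v`, transported to the parameter space. -/
def edgeAdjoint {d N : ℕ} {T : Type} (ι : RSpace N →L[ℝ] RSpace d) (e : T → RSpace d → CSpace N)
    (v : CSpace N) (ψ : T → RSpace d → ℂ) (t : T) (x : RSpace d) : ℂ :=
  -∑ i, fderiv ℝ (fun y => coframe ι (e t) y v i * ψ t y) x (ι (stdVec N i))

section Family

variable {d N : ℕ} {T : Type} {B K : Set (RSpace d)} {ι : RSpace N →L[ℝ] RSpace d}
  {e : T → RSpace d → CSpace N} {v : CSpace N} {D : Set (CSpace N)} {F : CSpace N → ℂ} {τ₀ C : ℝ}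
  {l : ℕ} {ψ : T → RSpace d → ℂ}

theorem IsEdgeFamily.bdd_coframe_mul (h : IsEdgeFamily B ι e v D F τ₀ C l) (hψ : IsTestFamily B K ψ)
    (i : Fin N) (r : ℕ) :
    HasBddDerivs ℝ (fun _ : T => B) r (fun t y => coframe ι (e t) y v i * ψ t y) := by
  have h1 := ((h.bdd (r + 1)).fderiv fun _ => h.isOpen).clm_comp (complexify ι)
  have h2 := h1.ringInverse (fun t x hx => h.isUnit t x hx) h.bdd_coframe
  have h3 := (h2.clm_comp ((ContinuousLinearMap.apply ℂ (CSpace N) v).restrictScalars ℝ)).clm_comp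
    ((EuclideanSpace.proj (𝕜 := ℂ) i).restrictScalars ℝ)
  exact h3.bilin (ContinuousLinearMap.mul ℝ ℂ) (hψ.bdd r)

theorem IsTestFamily.edgeAdjoint (h : IsEdgeFamily B ι e v D F τ₀ C l) (hK : IsCompact K)
    (hψ : IsTestFamily B K ψ) : IsTestFamily B K (edgeAdjoint ι e v ψ) where
  bdd r := (HasBddDerivs.sum Finset.univ fun i _ => ((h.bdd_coframe_mul hψ i (r + 1)).fderiv
    fun _ => h.isOpen).clm_comp (ContinuousLinearMap.apply ℝ ℂ (ι (stdVec N i)))).neg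
  supp t x hx := by
    rw [_root_.edgeAdjoint, neg_eq_zero]
    refine Finset.sum_eq_zero fun i _ => ?_
    have : (fun y => coframe ι (e t) y v i * ψ t y) =ᶠ[𝓝 x] fun _ => 0 :=
      eventually_of_mem (hK.isClosed.isOpen_compl.mem_nhds hx) fun y hy => by
        beta_reduce; rw [hψ.supp t y hy, mul_zero]
    rw [this.fderiv_eq]
    simp

/-- The pairing of a test function with the boundary values of `F` on the edge pushed by `τ v`. -/
def edgePairing (e : T → RSpace d → CSpace N) (v : CSpace N) (F : CSpace N → ℂ)
    (ψ : T → RSpace d → ℂ) (t : T) (τ : ℝ) : ℂ :=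
  ∫ x, ψ t x * F (e t x + τ • v)

/-- The derivative of the pairing in the height `τ` is the pairing with the adjoint test family, since
`v` is a complex combination of tangent vectors and `F` is holomorphic. -/
theorem IsEdgeFamily.hasDerivAt_edgePairing (h : IsEdgeFamily B ι e v D F τ₀ C l) (hK : IsCompact K)
    (hKB : K ⊆ B) (hψ : IsTestFamily B K ψ) (t : T) {τ : ℝ} (hτ : τ ∈ Ioo 0 τ₀) :
    HasDerivAt (edgePairing e v F ψ t) (edgePairing e v F (edgeAdjoint ι e v ψ) t τ) τ := by
  have hec : ContinuousOn (e t) B := fun x hx =>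
    ((h.bdd 1).differentiableAt hx).continuousAt.continuousWithinAt
  have hψc : ContinuousOn (ψ t) B := fun x hx =>
    ((hψ.bdd 1).differentiableAt hx).continuousAt.continuousWithinAt
  have hcl := hK.isClosed.isOpen_compl
  -- Functions of this kind, defined near `K` and vanishing outside of it, are continuous.
  have hext : ∀ {G : Type} [TopologicalSpace G] [Zero G] (k : ℝ → RSpace d → G),
      ContinuousOn (fun q : ℝ × RSpace d => k q.1 q.2) (Ioo 0 τ₀ ×ˢ B) →
      (∀ τ, ∀ x ∉ K, k τ x = 0) →
      ContinuousOn (fun q : ℝ × RSpace d => k q.1 q.2) (Ioo 0 τ₀ ×ˢ univ) := by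
    intro G _ _ k hk hk0 q hq
    refine ContinuousAt.continuousWithinAt ?_
    by_cases hqB : q.2 ∈ B
    · exact hk.continuousAt ((isOpen_Ioo.prod h.isOpen).mem_nhds ⟨hq.1, hqB⟩)
    · have hqK : q.2 ∈ Kᶜ := fun h' => hqB (hKB h')
      have : (fun q : ℝ × RSpace d => k q.1 q.2) =ᶠ[𝓝 q] fun _ => 0 :=
        eventually_of_mem ((isOpen_univ.prod hcl).mem_nhds ⟨mem_univ _, hqK⟩) fun q' hq' =>
          hk0 _ _ hq'.2
      exact continuousAt_const.congr this.symm
  have hmaps : MapsTo (fun q : ℝ × RSpace d => e t q.2 + q.1 • v) (Ioo 0 τ₀ ×ˢ B) D :=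
    fun q hq => h.mem t q.2 hq.2 q.1 hq.1
  have hcmap : ContinuousOn (fun q : ℝ × RSpace d => e t q.2 + q.1 • v) (Ioo 0 τ₀ ×ˢ B) :=
    (hec.comp continuousOn_snd fun q hq => hq.2).add (continuousOn_fst.smul continuousOn_const)
  have hψc2 : ContinuousOn (fun q : ℝ × RSpace d => ψ t q.2) (Ioo 0 τ₀ ×ˢ B) :=
    hψc.comp continuousOn_snd fun q hq => hq.2
  have hk := hext (fun τ x => ψ t x * F (e t x + τ • v))
    (hψc2.mul (h.holomorphic.continuousOn.comp hcmap hmaps))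
    fun τ x hx => by rw [hψ.supp t x hx, zero_mul]
  have hDF := continuousOn_fderiv_of_holomorphic h.isOpen_dom h.holomorphic
  have hk' := hext (fun τ x => ContinuousLinearMap.toSpanSingleton ℝ
      (ψ t x * fderiv ℂ F (e t x + τ • v) v))
    ((ContinuousLinearMap.toSpanSingletonCLE (𝕜 := ℝ) (E := ℂ)).continuous.comp_continuousOn
      (hψc2.mul ((hDF.comp hcmap hmaps).clm_apply continuousOn_const)))
    fun τ x hx => by rw [hψ.supp t x hx, zero_mul, ContinuousLinearMap.toSpanSingleton_zero]
  have key := hasFDerivAt_integral_of_compact (𝕜 := ℝ) (p₀ := τ) isOpen_Ioo hτ hK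
    (k := fun τ x => ψ t x * F (e t x + τ • v))
    (k' := fun τ x => ContinuousLinearMap.toSpanSingleton ℝ
      (ψ t x * fderiv ℂ F (e t x + τ • v) v))
    (fun p hp => continuousOn_univ.1 (hk.comp (f := fun x => (p, x)) (by fun_prop)
      fun x _ => ⟨hp, mem_univ _⟩))
    (fun p _ x hx => by rw [hψ.supp t x hx, zero_mul]) hk'
    (fun p _ x hx => by rw [hψ.supp t x hx, zero_mul, ContinuousLinearMap.toSpanSingleton_zero])
    (fun p hp x => by
      by_cases hx : x ∈ B
      · have h1 := ((h.holomorphic.differentiableAt (h.isOpen_dom.mem_nhds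
          (h.mem t x hx p hp))).hasFDerivAt.restrictScalars ℝ)
        have h2 : HasDerivAt (fun τ : ℝ => e t x + τ • v) v p := by
          simpa using ((hasDerivAt_id p).smul_const v).const_add (e t x)
        exact ((h1.comp_hasDerivAt p h2).const_mul (ψ t x)).hasFDerivAt
      · simp_rw [hψ.supp t x fun h' => hx (hKB h'), zero_mul, ContinuousLinearMap.toSpanSingleton_zero]
        exact hasFDerivAt_const _ _)
  have h2 := key.1.hasDerivAt
  rw [ContinuousLinearMap.integral_apply key.2] at h2
  simp only [ContinuousLinearMap.toSpanSingleton_apply, one_smul] at h2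
  refine h2.congr_deriv ?_
  -- Integration by parts in the parameter space.
  set G : RSpace d → ℂ := fun x => F (e t x + τ • v) with hG
  set c : Fin N → RSpace d → ℂ := fun i y => coframe ι (e t) y v i * ψ t y with hc
  have hc0 : ∀ i, ∀ x ∉ K, c i x = 0 := fun i x hx => by
    simp only [hc]; rw [hψ.supp t x hx, mul_zero]
  have hcB : ∀ i, ∀ x ∈ B, ContDiffAt ℝ 1 (c i) x := fun i x hx =>
    (h.bdd_coframe_mul hψ i 2).contDiffAt_one (t := t) h.isOpen hx
  have hed : ∀ x ∈ B, HasFDerivAt (fun x => e t x + τ • v) (fderiv ℝ (e t) x) x := fun x hx =>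
    ((h.bdd 1).differentiableAt (t := t) hx).hasFDerivAt.add_const _
  have hGB : ∀ x ∈ B, ContDiffAt ℝ 1 G x := fun x hx =>
    ContDiffAt.comp (g := F) x ((contDiffAt_one_of_holomorphic h.isOpen_dom h.holomorphic
      (h.mem t x hx τ hτ)).restrict_scalars ℝ)
      (((h.bdd 2).contDiffAt_one (t := t) h.isOpen hx).add contDiffAt_const)
  have hGd : ∀ x ∈ B, HasFDerivAt G (((fderiv ℂ F (e t x + τ • v)).restrictScalars ℝ).comp
      (fderiv ℝ (e t) x)) x := fun x hx =>
    HasFDerivAt.comp (g := F) x ((h.holomorphic.differentiableAt (h.isOpen_dom.mem_nhds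
          (h.mem t x hx τ hτ))).hasFDerivAt.restrictScalars ℝ) (hed x hx)
  have hΘ : ∀ i, ContDiff ℝ 1 fun x => c i x * G x := by
    refine fun i => contDiff_iff_contDiffAt.2 fun x => ?_
    by_cases hx : x ∈ B
    · exact (hcB i x hx).mul (hGB x hx)
    · have : (fun x => c i x * G x) =ᶠ[𝓝 x] fun _ => 0 :=
        eventually_of_mem (hcl.mem_nhds fun h' => hx (hKB h')) fun y hy => by
          beta_reduce; rw [hc0 i y hy, zero_mul]
      exact contDiffAt_const.congr_of_eventuallyEq this
  have hΘc : ∀ i, HasCompactSupport fun x => c i x * G x := fun i =>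
    HasCompactSupport.intro hK fun x hx => by rw [hc0 i x hx, zero_mul]
  have hint0 : ∀ i, ∫ x, fderiv ℝ (fun x => c i x * G x) x (ι (stdVec N i)) = 0 := by
    intro i
    have := integral_fderiv_smul_of_compact (contDiff_const (c := (1 : ℂ))) (hΘ i) (hΘc i)
      (ι (stdVec N i))
    simpa using this.symm
  have hintΘ : ∀ i, Integrable fun x => fderiv ℝ (fun x => c i x * G x) x (ι (stdVec N i)) := fun i =>
    (((hΘ i).continuous_fderiv (by simp)).clm_apply continuous_const).integrable_of_hasCompactSupport
      (((hΘc i).fderiv (𝕜 := ℝ)).comp_left (g := fun L : RSpace d →L[ℝ] ℂ => L (ι (stdVec N i)))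
        (by simp))
  have hpt : ∀ x, ψ t x * fderiv ℂ F (e t x + τ • v) v =
      _root_.edgeAdjoint ι e v ψ t x * G x +
        ∑ i, fderiv ℝ (fun x => c i x * G x) x (ι (stdVec N i)) := by
    intro x
    by_cases hx : x ∈ B
    · have h3 : ∀ i, fderiv ℝ (fun x => c i x * G x) x (ι (stdVec N i)) =
          c i x * fderiv ℂ F (e t x + τ • v) (fderiv ℝ (e t) x (ι (stdVec N i))) +
            fderiv ℝ (c i) x (ι (stdVec N i)) * G x := by
        intro i
        rw [(((hcB i x hx).differentiableAt (by simp)).hasFDerivAt.fun_mul (hGd x hx)).fderiv]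
        simp [mul_comm]
      simp_rw [h3]
      rw [Finset.sum_add_distrib, _root_.edgeAdjoint, ← Finset.sum_mul]
      have hv := congrArg (fderiv ℂ F (e t x + τ • v)) (sum_coframe_smul (h.isUnit t x hx) v)
      rw [map_sum] at hv
      rw [← hv, Finset.mul_sum]
      simp only [hc, map_smul, smul_eq_mul, neg_mul]
      rw [add_comm (∑ i, _) (_ * _), neg_add_cancel_left]
      exact Finset.sum_congr rfl fun i _ => by ring
    · have hxK : x ∉ K := fun h' => hx (hKB h')
      have : ∀ i, (fun x => c i x * G x) =ᶠ[𝓝 x] fun _ => 0 := fun i =>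
        eventually_of_mem (hcl.mem_nhds hxK) fun y hy => by
          beta_reduce; rw [hc0 i y hy, zero_mul]
      have h0 : ∀ i, fderiv ℝ (fun x => c i x * G x) x = 0 := fun i => by
        rw [(this i).fderiv_eq]; simp
      rw [hψ.supp t x hxK, (hψ.edgeAdjoint h hK).supp t x hxK]
      simp [h0]
  have hM := hψ.edgeAdjoint h hK
  have hMc : ContinuousOn (_root_.edgeAdjoint ι e v ψ t) B := fun x hx =>
    ((hM.bdd 1).differentiableAt hx).continuousAt.continuousWithinAt
  have hkM := hext (fun τ x => _root_.edgeAdjoint ι e v ψ t x * F (e t x + τ • v))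
    ((hMc.comp continuousOn_snd fun q hq => hq.2).mul
      (h.holomorphic.continuousOn.comp hcmap hmaps))
    fun τ x hx => by rw [hM.supp t x hx, zero_mul]
  have hkMi : Integrable fun x => _root_.edgeAdjoint ι e v ψ t x * G x :=
    (continuousOn_univ.1 (hkM.comp (f := fun x => (τ, x)) (by fun_prop)
      fun x _ => ⟨hτ, mem_univ _⟩)).integrable_of_hasCompactSupport
      (HasCompactSupport.intro hK fun x hx => by
        show _root_.edgeAdjoint ι e v ψ t x * F (e t x + τ • v) = 0
        rw [hM.supp t x hx, zero_mul])
  simp_rw [hpt]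
  rw [integral_add hkMi (integrable_finsetSum _ fun i _ => hintΘ i),
    integral_finsetSum _ fun i _ => hintΘ i]
  rw [Finset.sum_eq_zero fun i _ => hint0 i, add_zero]
  rfl

end Family

section Family

variable {d N : ℕ} {T : Type} {B K : Set (RSpace d)} {ι : RSpace N →L[ℝ] RSpace d}
  {e : T → RSpace d → CSpace N} {v : CSpace N} {D : Set (CSpace N)} {F : CSpace N → ℂ} {τ₀ C : ℝ}
  {l : ℕ} {ψ : T → RSpace d → ℂ}

theorem IsEdgeFamily.exists_norm_edgePairing_le (h : IsEdgeFamily B ι e v D F τ₀ C l)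
    (hK : IsCompact K) (hKB : K ⊆ B) (hψ : IsTestFamily B K ψ) :
    ∃ C' : ℝ, ∀ t, ∀ τ ∈ Ioo 0 τ₀, ‖edgePairing e v F ψ t τ‖ ≤ C' * (τ ^ l)⁻¹ := by
  obtain ⟨Cψ, -, hCψ⟩ := (hψ.bdd 0).bdd
  refine ⟨Cψ * C * volume.real K, fun t τ hτ => ?_⟩
  have h1 : edgePairing e v F ψ t τ = ∫ x in K, ψ t x * F (e t x + τ • v) := by
    rw [edgePairing, setIntegral_eq_integral_of_forall_compl_eq_zero]
    intro x hx
    rw [hψ.supp t x hx, zero_mul]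
  rw [h1]
  refine (norm_setIntegral_le_of_norm_le_const (C := Cψ * (C * (τ ^ l)⁻¹)) hK.measure_lt_top
    fun x hx => ?_).trans (by ring_nf; rfl)
  rw [norm_mul]
  have h2 := hCψ t x (hKB hx)
  exact mul_le_mul h2 (h.growth t x (hKB hx) τ hτ) (norm_nonneg _) ((norm_nonneg _).trans h2)

theorem IsEdgeFamily.hasDerivAt_edgePairing_sq (h : IsEdgeFamily B ι e v D F τ₀ C l)
    (hK : IsCompact K) (hKB : K ⊆ B) (hψ : IsTestFamily B K ψ) (t : T) {σ : ℝ}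
    (hσ : σ ^ 2 ∈ Ioo 0 τ₀) :
    HasDerivAt (fun s : ℝ => edgePairing e v F ψ t (s ^ 2))
      ((2 * σ) • edgePairing e v F (edgeAdjoint ι e v ψ) t (σ ^ 2)) σ := by
  have h1 := h.hasDerivAt_edgePairing hK hKB hψ t hσ
  have h2 : HasDerivAt (fun s : ℝ => s ^ 2) (2 * σ) σ := by simpa using hasDerivAt_pow 2 σ
  exact HasDerivAt.scomp (h := fun s : ℝ => s ^ 2) σ h1 h2

/-- An estimate by `|σ| ^ (-(2j + 3))` for all test families improves to one by `|σ| ^ (-(2j + 1))`: the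
derivative of the pairing at height `σ ^ 2` is `2σ` times such a pairing, and an integration gains
another power. The exponents are odd, so that no logarithm occurs. -/
theorem IsEdgeFamily.edgePairing_sq_improve (h : IsEdgeFamily B ι e v D F τ₀ C l)
    (hK : IsCompact K) (hKB : K ⊆ B) {σ₀ : ℝ} (hσ₀ : 0 < σ₀) (hσ₀' : σ₀ ^ 2 ≤ τ₀) {j : ℕ}
    (hS : ∀ ψ : T → RSpace d → ℂ, IsTestFamily B K ψ → ∃ C' : ℝ, ∀ t, ∀ σ ∈ Ioo (-σ₀) 0,
      ‖edgePairing e v F ψ t (σ ^ 2)‖ ≤ C' * (|σ| ^ (2 * j + 3))⁻¹)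
    (hψ : IsTestFamily B K ψ) : ∃ C' : ℝ, ∀ t, ∀ σ ∈ Ioo (-σ₀) 0,
      ‖edgePairing e v F ψ t (σ ^ 2)‖ ≤ C' * (|σ| ^ (2 * j + 1))⁻¹ := by
  -- Negative `σ` is used, in order to integrate from a fixed height down to the edge.
  obtain ⟨C₁, hC₁⟩ := hS ψ hψ
  obtain ⟨C₂, hC₂⟩ := hS _ (hψ.edgeAdjoint h hK)
  have hsq : ∀ σ ∈ Ioo (-σ₀) 0, σ ^ 2 ∈ Ioo 0 τ₀ := fun σ hσ =>
    ⟨by have := hσ.2.ne; positivity, by nlinarith [hσ.1, hσ.2]⟩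
  set r := σ₀ / 2 with hr
  have hr0 : 0 < r := by positivity
  set K₁ := |C₁| * (r ^ (2 * j + 3))⁻¹ with hK₁
  have hK₁0 : 0 ≤ K₁ := by positivity
  have hC₁' : ∀ t, ∀ σ ∈ Ioc (-σ₀) (-r), σ < 0 → ‖edgePairing e v F ψ t (σ ^ 2)‖ ≤ K₁ := by
    intro t σ hσ hσ0
    refine (hC₁ t σ ⟨hσ.1, hσ0⟩).trans ?_
    refine (mul_le_mul_of_nonneg_right (le_abs_self _) (by positivity)).trans ?_
    refine mul_le_mul_of_nonneg_left ?_ (abs_nonneg _)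
    refine inv_anti₀ (by positivity) (pow_le_pow_left₀ hr0.le ?_ _)
    rw [abs_of_neg hσ0]
    linarith [hσ.2]
  have hbig : ∀ σ ∈ Ioo (-σ₀) 0, K₁ ≤ K₁ * σ₀ ^ (2 * j + 1) * (|σ| ^ (2 * j + 1))⁻¹ := by
    intro σ hσ
    have h0 : 0 < |σ| := abs_pos.2 hσ.2.ne
    have h1 : |σ| ^ (2 * j + 1) ≤ σ₀ ^ (2 * j + 1) :=
      pow_le_pow_left₀ h0.le (by rw [abs_of_neg hσ.2]; linarith [hσ.1]) _
    rw [mul_assoc]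
    refine le_mul_of_one_le_right hK₁0 ?_
    rw [← div_eq_mul_inv, one_le_div (by positivity)]
    exact h1
  refine ⟨K₁ * σ₀ ^ (2 * j + 1) + 2 * |C₂|, fun t σ hσ => ?_⟩
  have h0 : 0 < |σ| := abs_pos.2 hσ.2.ne
  rw [add_mul]
  by_cases hσr : σ ≤ -r
  · refine (hC₁' t σ ⟨hσ.1, hσr⟩ hσ.2).trans ((hbig σ hσ).trans (le_add_of_nonneg_right ?_))
    positivity
  push Not at hσr
  have hmem : ∀ s ∈ Icc (-r) σ, s ∈ Ioo (-σ₀) 0 := fun s hs =>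
    ⟨by linarith [hs.1], hs.2.trans_lt hσ.2⟩
  have hder : ∀ s ∈ Icc (-r) σ, HasDerivAt (fun s : ℝ => edgePairing e v F ψ t (s ^ 2))
      ((2 * s) • edgePairing e v F (edgeAdjoint ι e v ψ) t (s ^ 2)) s := fun s hs =>
    h.hasDerivAt_edgePairing_sq hK hKB hψ t (hsq s (hmem s hs))
  have hB : ∀ s ∈ Icc (-r) σ, HasDerivAt (fun s : ℝ => K₁ - 2 * |C₂| * (s ^ (2 * j + 1))⁻¹)
      (2 * |C₂| * ((2 * j + 1) * s ^ (2 * j) / (s ^ (2 * j + 1)) ^ 2)) s := by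
    intro s hs
    have hs0 : s ≠ 0 := (hmem s hs).2.ne
    have h1 := (((hasDerivAt_pow (2 * j + 1) s).fun_inv (pow_ne_zero _ hs0)).const_mul
      (2 * |C₂|)).const_sub K₁
    refine h1.congr_deriv ?_
    rw [Nat.add_sub_cancel]
    push_cast
    ring
  have key := image_norm_le_of_norm_deriv_right_le_deriv_boundary'
    (f := fun s : ℝ => edgePairing e v F ψ t (s ^ 2)) (a := -r) (b := σ)
    (fun s hs => (hder s hs).continuousAt.continuousWithinAt)
    (fun s hs => (hder s ⟨hs.1, hs.2.le⟩).hasDerivWithinAt)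
    (B := fun s : ℝ => K₁ - 2 * |C₂| * (s ^ (2 * j + 1))⁻¹)
    (by
      refine (hC₁' t (-r) ⟨by linarith, le_rfl⟩ (by linarith)).trans ?_
      rw [Odd.neg_pow ⟨j, rfl⟩, inv_neg]
      have : 0 ≤ 2 * |C₂| * (r ^ (2 * j + 1))⁻¹ := by positivity
      linarith)
    (fun s hs => (hB s hs).continuousAt.continuousWithinAt)
    (fun s hs => (hB s ⟨hs.1, hs.2.le⟩).hasDerivWithinAt)
    (fun s hs => by
      have hs' := hmem s ⟨hs.1, hs.2.le⟩
      have hs0 : 0 < |s| := abs_pos.2 hs'.2.ne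
      rw [norm_smul]
      have h1 := hC₂ t s hs'
      have h2 : s ^ (2 * j) = |s| ^ (2 * j) := by rw [pow_mul, pow_mul, sq_abs]
      have h3 : (s ^ (2 * j + 1)) ^ 2 = (|s| ^ (2 * j + 1)) ^ 2 := by
        rw [← abs_pow, sq_abs]
      rw [h2, h3, Real.norm_eq_abs, abs_mul, abs_two]
      calc 2 * |s| * ‖edgePairing e v F (edgeAdjoint ι e v ψ) t (s ^ 2)‖
          ≤ 2 * |s| * (|C₂| * (|s| ^ (2 * j + 3))⁻¹) := by
            refine mul_le_mul_of_nonneg_left (h1.trans ?_) (by positivity)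
            exact mul_le_mul_of_nonneg_right (le_abs_self _) (by positivity)
        _ = 2 * |C₂| * (|s| ^ (2 * j) / (|s| ^ (2 * j + 1)) ^ 2) := by
            field_simp
            ring
        _ ≤ _ := by
            refine mul_le_mul_of_nonneg_left ?_ (by positivity)
            refine div_le_div_of_nonneg_right ?_ (by positivity)
            refine le_mul_of_one_le_left (by positivity) ?_
            have : (0 : ℝ) ≤ j := Nat.cast_nonneg j
            linarith) (right_mem_Icc.2 hσr.le)
  refine key.trans ?_
  have h3 : (σ ^ (2 * j + 1))⁻¹ = -(|σ| ^ (2 * j + 1))⁻¹ := by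
    rw [abs_of_neg hσ.2, Odd.neg_pow ⟨j, rfl⟩, inv_neg, neg_neg]
  rw [h3]
  have := hbig σ hσ
  linarith

/-- The pairings with a slowly growing holomorphic function are Lipschitz in the square root of the
distance to the edge, uniformly in the family. -/
theorem IsEdgeFamily.exists_lipschitz_edgePairing_sq (h : IsEdgeFamily B ι e v D F τ₀ C l)
    (hK : IsCompact K) (hKB : K ⊆ B) {σ₀ : ℝ} (hσ₀ : 0 < σ₀) (hσ₁ : σ₀ ≤ 1) (hσ₀' : σ₀ ^ 2 ≤ τ₀)
    (hψ : IsTestFamily B K ψ) : ∃ C' : ℝ, ∀ t, ∀ σ ∈ Ioo 0 σ₀, ∀ σ' ∈ Ioo 0 σ₀,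
      ‖edgePairing e v F ψ t (σ ^ 2) - edgePairing e v F ψ t (σ' ^ 2)‖ ≤ C' * |σ - σ'| := by
  have hsq : ∀ σ ∈ Ioo (-σ₀) 0, σ ^ 2 ∈ Ioo 0 τ₀ := fun σ hσ =>
    ⟨by have := hσ.2.ne; positivity, by nlinarith [hσ.1, hσ.2]⟩
  have hstart : ∀ ψ : T → RSpace d → ℂ, IsTestFamily B K ψ → ∃ C' : ℝ, ∀ t, ∀ σ ∈ Ioo (-σ₀) 0,
      ‖edgePairing e v F ψ t (σ ^ 2)‖ ≤ C' * (|σ| ^ (2 * l + 1))⁻¹ := by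
    intro ψ hψ
    obtain ⟨C', hC'⟩ := h.exists_norm_edgePairing_le hK hKB hψ
    refine ⟨|C'|, fun t σ hσ => (hC' t _ (hsq σ hσ)).trans ?_⟩
    have h0 : 0 < |σ| := abs_pos.2 hσ.2.ne
    have h1 : |σ| ≤ 1 := by rw [abs_of_neg hσ.2]; linarith [hσ.1]
    refine mul_le_mul (le_abs_self _) ?_ (by positivity) (abs_nonneg _)
    rw [← sq_abs, ← pow_mul]
    exact inv_anti₀ (by positivity) (pow_le_pow_of_le_one h0.le h1 (by omega))
  have hfinish : ∀ j : ℕ, (∀ ψ : T → RSpace d → ℂ, IsTestFamily B K ψ → ∃ C' : ℝ, ∀ t,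
      ∀ σ ∈ Ioo (-σ₀) 0, ‖edgePairing e v F ψ t (σ ^ 2)‖ ≤ C' * (|σ| ^ (2 * j + 1))⁻¹) →
      ∀ ψ : T → RSpace d → ℂ, IsTestFamily B K ψ → ∃ C' : ℝ, ∀ t,
      ∀ σ ∈ Ioo (-σ₀) 0, ‖edgePairing e v F ψ t (σ ^ 2)‖ ≤ C' * |σ|⁻¹ := by
    intro j
    induction j with
    | zero => simp
    | succ j ih => exact fun hS => ih fun ψ hψ => h.edgePairing_sq_improve hK hKB hσ₀ hσ₀' hS hψ
  obtain ⟨C', hC'⟩ := hfinish l hstart _ (hψ.edgeAdjoint h hK)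
  refine ⟨2 * C', fun t σ hσ σ' hσ' => ?_⟩
  have := (convex_Ioo 0 σ₀).norm_image_sub_le_of_norm_hasDerivWithin_le
    (f := fun s : ℝ => edgePairing e v F ψ t (s ^ 2)) (C := 2 * C')
    (fun s hs => (h.hasDerivAt_edgePairing_sq hK hKB hψ t (σ := s)
      (by have := hsq (-s) ⟨by linarith [hs.2], by linarith [hs.1]⟩
          rwa [neg_sq] at this)).hasDerivWithinAt) (fun s hs => by
      have h1 := hC' t (-s) ⟨by linarith [hs.2], by linarith [hs.1]⟩
      rw [neg_sq, abs_neg, abs_of_pos hs.1] at h1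
      have hs0 : 0 < s := hs.1
      rw [norm_smul, Real.norm_eq_abs, abs_mul, abs_two, abs_of_pos hs.1]
      calc 2 * s * ‖edgePairing e v F (edgeAdjoint ι e v ψ) t (s ^ 2)‖ ≤ 2 * s * (C' * s⁻¹) :=
            mul_le_mul_of_nonneg_left h1 (by positivity)
        _ = 2 * C' := by field_simp) hσ' hσ
  simpa [Real.norm_eq_abs] using this

end Family

/-- Interchange of the limits `σ → 0⁺` and `t → 0⁺` under a Lipschitz condition in `σ` which is
uniform in `t`. -/
theorem tendsto_of_lipschitz_of_tendsto {T : Type} {lT : Filter T} {J : T → ℝ → ℂ}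
    {J₀ : ℝ → ℂ} {j : T → ℂ} {L : ℂ} {C σ₀ : ℝ} (hσ₀ : 0 < σ₀)
    (hJ : ∀ t, ∀ σ ∈ Ioo 0 σ₀, ∀ σ' ∈ Ioo 0 σ₀, ‖J t σ - J t σ'‖ ≤ C * |σ - σ'|)
    (hJ₀ : ∀ σ ∈ Ioo 0 σ₀, ∀ σ' ∈ Ioo 0 σ₀, ‖J₀ σ - J₀ σ'‖ ≤ C * |σ - σ'|)
    (hj : ∀ᶠ t in lT, Tendsto (J t) (𝓝[>] 0) (𝓝 (j t))) (hL : Tendsto J₀ (𝓝[>] 0) (𝓝 L))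
    (ht : ∀ σ ∈ Ioo 0 σ₀, Tendsto (fun t => J t σ) lT (𝓝 (J₀ σ))) : Tendsto j lT (𝓝 L) := by
  have hlim : ∀ {J : ℝ → ℂ} {j : ℂ}, (∀ σ ∈ Ioo 0 σ₀, ∀ σ' ∈ Ioo 0 σ₀,
      ‖J σ - J σ'‖ ≤ C * |σ - σ'|) → Tendsto J (𝓝[>] 0) (𝓝 j) → ∀ σ ∈ Ioo 0 σ₀,
      ‖J σ - j‖ ≤ C * σ := by
    intro J j hJ hj σ hσ
    have h1 : Tendsto (fun σ' => ‖J σ - J σ'‖) (𝓝[>] 0) (𝓝 ‖J σ - j‖) :=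
      (tendsto_const_nhds.sub hj).norm
    have h2 : Tendsto (fun σ' : ℝ => C * |σ - σ'|) (𝓝[>] 0) (𝓝 (C * |σ - 0|)) :=
      tendsto_nhdsWithin_of_tendsto_nhds (Continuous.tendsto (by fun_prop) 0)
    rw [sub_zero, abs_of_pos hσ.1] at h2
    exact le_of_tendsto_of_tendsto h1 h2 (eventually_of_mem (Ioo_mem_nhdsGT hσ₀)
      fun σ' hσ' => hJ σ hσ σ' hσ')
  refine Metric.tendsto_nhds.2 fun ε hε => ?_
  obtain ⟨σ, hσ, hσε⟩ : ∃ σ ∈ Ioo 0 σ₀, |C| * σ < ε / 3 := by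
    refine ⟨min (σ₀ / 2) (ε / (6 * (|C| + 1))), ⟨lt_min (by positivity) (by positivity),
      (min_le_left _ _).trans_lt (by linarith)⟩, ?_⟩
    calc |C| * min (σ₀ / 2) (ε / (6 * (|C| + 1))) ≤ (|C| + 1) * (ε / (6 * (|C| + 1))) :=
          mul_le_mul (by linarith) (min_le_right _ _) (by positivity) (by positivity)
      _ = ε / 6 := by field_simp
      _ < ε / 3 := by linarith
  have hCσ : C * σ ≤ |C| * σ := mul_le_mul_of_nonneg_right (le_abs_self C) hσ.1.le
  filter_upwards [hj, Metric.tendsto_nhds.1 (ht σ hσ) (ε / 3) (by positivity)] with t htj hts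
  have h1 := hlim (hJ t) htj σ hσ
  have h2 := hlim hJ₀ hL σ hσ
  rw [dist_eq_norm] at hts ⊢
  calc ‖j t - L‖ = ‖(J t σ - J₀ σ) + (J₀ σ - L) - (J t σ - j t)‖ := by congr 1; ring
    _ ≤ ‖J t σ - J₀ σ‖ + ‖J₀ σ - L‖ + ‖J t σ - j t‖ :=
      (norm_sub_le _ _).trans (add_le_add_left (norm_add_le _ _) _)
    _ < ε := by linarith

theorem continuousOn_prod_univ_of_eq_zero {X Y G : Type} [TopologicalSpace X] [TopologicalSpace Y]
    [T2Space Y] [TopologicalSpace G] [Zero G] {S : Set X} {B K : Set Y} {k : X → Y → G} (hB : IsOpen B)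
    (hK : IsCompact K) (hKB : K ⊆ B) (hk : ContinuousOn (fun q : X × Y => k q.1 q.2) (S ×ˢ B))
    (hk0 : ∀ a, ∀ x ∉ K, k a x = 0) : ContinuousOn (fun q : X × Y => k q.1 q.2) (S ×ˢ univ) := by
  intro q hq
  by_cases hqB : q.2 ∈ B
  · refine (hk q ⟨hq.1, hqB⟩).mono_of_mem_nhdsWithin ?_
    refine mem_nhdsWithin.2 ⟨univ ×ˢ B, isOpen_univ.prod hB, ⟨mem_univ _, hqB⟩, fun q' hq' => ?_⟩
    exact ⟨hq'.2.1, hq'.1.2⟩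
  · have : (fun q : X × Y => k q.1 q.2) =ᶠ[𝓝 q] fun _ => 0 :=
      eventually_of_mem ((isOpen_univ.prod hK.isClosed.isOpen_compl).mem_nhds
        ⟨mem_univ _, fun h' => hqB (hKB h')⟩) fun q' hq' => hk0 _ _ hq'.2
    exact (continuousAt_const.congr this.symm).continuousWithinAt

theorem continuous_of_continuousOn_of_eq_zero {Y G : Type} [TopologicalSpace Y]
    [T2Space Y] [TopologicalSpace G] [Zero G] {B K : Set Y} {k : Y → G} (hB : IsOpen B)
    (hK : IsCompact K) (hKB : K ⊆ B) (hk : ContinuousOn k B) (hk0 : ∀ x ∉ K, k x = 0) :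
    Continuous k := by
  have := continuousOn_prod_univ_of_eq_zero (X := Unit) (S := univ) (k := fun _ => k) hB hK hKB
    (hk.comp continuousOn_snd fun q hq => hq.2) fun _ => hk0
  exact continuousOn_univ.1 (this.comp (f := fun x => ((), x)) (by fun_prop)
    fun x _ => ⟨mem_univ _, mem_univ _⟩)

section Family

variable {d N : ℕ} {B K : Set (RSpace d)} {ι : RSpace N →L[ℝ] RSpace d}
  {v : CSpace N} {D : Set (CSpace N)} {F : CSpace N → ℂ} {τ₀ C : ℝ} {l : ℕ}

/-- The boundary value of a slowly growing holomorphic function may be computed along any perturbation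
`e t` of the edge which is bounded in `C^∞` and tends to the edge pointwise. -/
theorem IsEdgeFamily.tendsto_integral {t₀ : ℝ} {e : Ico 0 t₀ → RSpace d → CSpace N}
    {γ : RSpace d → CSpace N} {φ : RSpace d → ℂ} {L : ℂ}
    (h : IsEdgeFamily B ι e v D F τ₀ C l) (hτ₀ : 0 < τ₀) (hK : IsCompact K) (hKB : K ⊆ B)
    (hφ : IsTestFamily B K fun _ : Ico 0 t₀ => φ) (ht₀ : 0 < t₀)
    (he : ∀ t : Ico 0 t₀, 0 < t.1 → ∀ x ∈ B, e t x ∈ D)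
    (heγ : ∀ x ∈ B, e ⟨0, left_mem_Ico.2 ht₀⟩ x = γ x)
    (hlim : ∀ x ∈ B, Tendsto (fun t => e t x) (comap (↑) (𝓝[>] (0 : ℝ))) (𝓝 (γ x)))
    (hL : Tendsto (fun τ : ℝ => ∫ x, φ x * F (γ x + τ • v)) (𝓝[>] 0) (𝓝 L)) :
    Tendsto (fun t => ∫ x, φ x * F (e t x)) (comap (↑) (𝓝[>] (0 : ℝ))) (𝓝 L) := by
  set σ₀ := min 1 τ₀ with hσ₀
  have hσ0 : 0 < σ₀ := lt_min one_pos hτ₀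
  have hσ1 : σ₀ ≤ 1 := min_le_left _ _
  have hσ2 : σ₀ ^ 2 ≤ τ₀ := by
    have : σ₀ ≤ τ₀ := min_le_right _ _
    nlinarith
  obtain ⟨C', hC'⟩ := h.exists_lipschitz_edgePairing_sq hK hKB hσ0 hσ1 hσ2 hφ
  set z : Ico 0 t₀ := ⟨0, left_mem_Ico.2 ht₀⟩ with hz
  have hec : ∀ t, ContinuousOn (e t) B := fun t x hx =>
    ((h.bdd 1).differentiableAt hx).continuousAt.continuousWithinAt
  have hφc : ContinuousOn φ B := fun x hx =>
    ((hφ.bdd 1).differentiableAt (t := z) hx).continuousAt.continuousWithinAt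
  have hφ0 : ∀ x ∉ K, φ x = 0 := fun x hx => hφ.supp z x hx
  have hsq : Tendsto (fun σ : ℝ => σ ^ 2) (𝓝[>] 0) (𝓝[>] 0) := by
    refine tendsto_nhdsWithin_iff.2 ⟨?_, eventually_of_mem self_mem_nhdsWithin fun σ hσ => ?_⟩
    · refine tendsto_nhdsWithin_of_tendsto_nhds ?_
      have : Continuous fun σ : ℝ => σ ^ 2 := by fun_prop
      simpa using this.tendsto 0
    · have : 0 < σ := hσ
      exact pow_pos this 2
  refine tendsto_of_lipschitz_of_tendsto (J := fun t σ => edgePairing e v F (fun _ => φ) t (σ ^ 2))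
    (J₀ := fun σ => edgePairing e v F (fun _ => φ) z (σ ^ 2)) hσ0 hC' (hC' z) ?_ ?_ ?_
  · -- For `t > 0` the function `F` is continuous up to the perturbed edge.
    have hpos : ∀ᶠ t : Ico 0 t₀ in comap (↑) (𝓝[>] (0 : ℝ)), 0 < t.1 :=
      preimage_mem_comap self_mem_nhdsWithin
    filter_upwards [hpos] with t ht
    have hmaps : MapsTo (fun q : ℝ × RSpace d => e t q.2 + q.1 • v) (Ico 0 τ₀ ×ˢ B) D := by
      rintro ⟨τ, x⟩ ⟨hτ, hx⟩
      rcases hτ.1.eq_or_lt with h0 | h0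
      · simp only at h0
        simpa [← h0] using he t ht x hx
      · exact h.mem t x hx τ ⟨h0, hτ.2⟩
    have hcmap : ContinuousOn (fun q : ℝ × RSpace d => e t q.2 + q.1 • v) (Ico 0 τ₀ ×ˢ B) :=
      ((hec t).comp continuousOn_snd fun q hq => hq.2).add (continuousOn_fst.smul continuousOn_const)
    have hk := continuousOn_prod_univ_of_eq_zero (k := fun τ x => φ x * F (e t x + τ • v)) h.isOpen hK
      hKB ((hφc.comp continuousOn_snd fun q hq => hq.2).mul
        (h.holomorphic.continuousOn.comp hcmap hmaps)) fun τ x hx => by rw [hφ0 x hx, zero_mul]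
    have hint := continuousOn_integral_of_compact_support (μ := (volume : Measure (RSpace d)))
      (f := fun τ x => φ x * F (e t x + τ • v)) hK hk
      fun τ x _ hx => by rw [hφ0 x hx, zero_mul]
    have h0 := (hint 0 (left_mem_Ico.2 hτ₀)).tendsto
    simp only [zero_smul, add_zero] at h0
    have hle : (𝓝[>] (0 : ℝ)) ≤ 𝓝[Ico 0 τ₀] 0 :=
      nhdsWithin_le_iff.2 (mem_of_superset (Ioo_mem_nhdsGT hτ₀) Ioo_subset_Ico_self)
    exact (h0.mono_left hle).comp hsq
  · have : ∀ τ : ℝ, edgePairing e v F (fun _ => φ) z τ = ∫ x, φ x * F (γ x + τ • v) := by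
      intro τ
      refine integral_congr_ae (Eventually.of_forall fun x => ?_)
      beta_reduce
      by_cases hx : x ∈ B
      · rw [heγ x hx]
      · rw [hφ0 x fun h' => hx (hKB h'), zero_mul, zero_mul]
    simp_rw [this]
    exact hL.comp hsq
  · intro σ hσ
    have hτ : σ ^ 2 ∈ Ioo 0 τ₀ := ⟨pow_pos hσ.1 2, by nlinarith [hσ.1, hσ.2]⟩
    obtain ⟨Cφ, -, hCφ⟩ := (hφ.bdd 0).bdd
    have hFc : ContinuousOn F D := h.holomorphic.continuousOn
    have hsh : ∀ t, ContinuousOn (fun x => e t x + σ ^ 2 • v) B := fun t =>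
      (hec t).add continuousOn_const
    refine tendsto_integral_filter_of_dominated_convergence
      (K.indicator fun _ => Cφ * (C * ((σ ^ 2) ^ l)⁻¹)) ?_ ?_ ?_ ?_
    · refine Eventually.of_forall fun t => Continuous.aestronglyMeasurable ?_
      exact continuous_of_continuousOn_of_eq_zero (k := fun x => φ x * F (e t x + σ ^ 2 • v)) h.isOpen
        hK hKB (hφc.mul (hFc.comp (hsh t) fun x hx => h.mem t x hx _ hτ))
        fun x hx => by rw [hφ0 x hx, zero_mul]
    · refine Eventually.of_forall fun t => Eventually.of_forall fun x => ?_
      by_cases hx : x ∈ K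
      · rw [indicator_of_mem hx, norm_mul]
        have h2 := hCφ t x (hKB hx)
        exact mul_le_mul h2 (h.growth t x (hKB hx) _ hτ) (norm_nonneg _) ((norm_nonneg _).trans h2)
      · rw [indicator_of_notMem hx]
        beta_reduce
        rw [hφ0 x hx, zero_mul, norm_zero]
    · exact (integrable_indicator_iff hK.measurableSet).2 (integrableOn_const hK.measure_lt_top.ne)
    · refine Eventually.of_forall fun x => ?_
      by_cases hx : x ∈ B
      · rw [heγ x hx]
        refine Tendsto.const_mul _ ?_
        have hD : γ x + σ ^ 2 • v ∈ D := by rw [← heγ x hx]; exact h.mem z x hx _ hτ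
        exact (hFc.continuousAt (h.isOpen_dom.mem_nhds hD)).tendsto.comp
          ((hlim x hx).add tendsto_const_nhds)
      · simp_rw [hφ0 x fun h' => hx (hKB h'), zero_mul]
        exact tendsto_const_nhds

end Family

/-- `F` is holomorphic on `D`, which contains the part of height `η` of the cone of directions `u + w`,
`‖w‖ < r`, over each point of the edge `γ(B)`; and `F` grows slowly there, at the rate `s⁻ˡ`. -/
structure IsWedgeGrowth {d N : ℕ} (γ : RSpace d → CSpace N) (B : Set (RSpace d)) (u : CSpace N)
    (D : Set (CSpace N)) (F : CSpace N → ℂ) (r η C : ℝ) (l : ℕ) : Prop where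
  isOpen_dom : IsOpen D
  holomorphic : DifferentiableOn ℂ F D
  nonneg : 0 ≤ C
  mem : ∀ x ∈ B, ∀ s ∈ Ioo 0 η, ∀ w, ‖w‖ < r → γ x + s • (u + w) ∈ D
  growth : ∀ x ∈ B, ∀ s ∈ Ioo 0 η, ∀ w, ‖w‖ < r → ‖F (γ x + s • (u + w))‖ ≤ C * (s ^ l)⁻¹

/-- The translate of a point of the wedge in the direction `u` by the scale function lies in the cone
around `u` over the same point of the edge. -/
theorem exists_scale_translate_eq {N : ℕ} {Λ θ a r : ℝ} (hΛ : 0 < Λ) (ha : a ≤ 1)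
    {u v p z : CSpace N}
    (hr : (‖v‖ + 1) / Λ + θ * ‖u‖ < r) {ζ : ℂ} {s τ : ℝ}
    (hs : 0 < s) (hτ : 0 ≤ τ) (hp : ‖p - z - s • v‖ < a * s)
    (hζ : ‖ζ - (Λ * s : ℝ)‖ ≤ θ * (Λ * s)) :
    ∃ w, ‖w‖ < r ∧ p + ζ • u + τ • u = z + (Λ * s + τ) • (u + w) := by
  have hS : 0 < Λ * s + τ := by positivity
  set y : CSpace N := (p - z) + (ζ - (Λ * s : ℝ)) • u with hy
  have hyn : ‖y‖ ≤ (Λ * s + τ) * ((‖v‖ + 1) / Λ + θ * ‖u‖) := by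
    have h1 : ‖p - z‖ ≤ s * (‖v‖ + 1) := by
      have : p - z = (p - z - s • v) + s • v := by abel
      rw [this]
      refine (norm_add_le _ _).trans ?_
      rw [norm_smul, Real.norm_eq_abs, abs_of_pos hs]
      nlinarith
    have h2 : ‖y‖ ≤ s * (‖v‖ + 1) + θ * (Λ * s) * ‖u‖ := by
      refine (norm_add_le _ _).trans (add_le_add h1 ?_)
      rw [norm_smul]
      exact mul_le_mul_of_nonneg_right hζ (norm_nonneg _)
    have h3 : 0 ≤ (‖v‖ + 1) / Λ + θ * ‖u‖ := by
      have h4 : 0 ≤ θ := by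
        have := (norm_nonneg _).trans hζ
        by_contra h5
        push Not at h5
        nlinarith [mul_pos hΛ hs]
      positivity
    have h4 : s * (‖v‖ + 1) + θ * (Λ * s) * ‖u‖ = Λ * s * ((‖v‖ + 1) / Λ + θ * ‖u‖) := by
      field_simp
    rw [h4] at h2
    nlinarith
  refine ⟨(Λ * s + τ)⁻¹ • y, ?_, ?_⟩
  · rw [norm_smul, norm_inv, Real.norm_eq_abs, abs_of_pos hS, inv_mul_lt_iff₀ hS]
    exact hyn.trans_lt (mul_lt_mul_of_pos_left hr hS)
  · rw [smul_add, smul_inv_smul₀ hS.ne', hy, sub_smul, add_smul, Complex.coe_smul]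
    abel

section Pullback

variable {d N : ℕ} {W : Type} [NormedAddCommGroup W] [NormedSpace ℂ W]
  {ι : RSpace N →L[ℝ] RSpace d} {γ : RSpace d → CSpace N} {φ : RSpace d → W} {x₀ : RSpace d}
  {H : CSpace N × ℂ → W} {A : RSpace d → CSpace N →L[ℂ] W} {v : CSpace N × W}
  {Λ θ δ a ε C : ℝ} {g : CSpace N × W → ℂ}

/-- Near a point with invertible frame all frames, and all maps close to them, are invertible with a
uniformly bounded inverse. -/
theorem exists_frame_bound (hc : ContinuousAt (frame ι γ) x₀) (hu : IsUnit (frame ι γ x₀)) :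
    ∃ δ > 0, ∃ η > 0, ∃ C : ℝ, ∀ x ∈ Metric.ball x₀ δ, ∀ Z : CSpace N →L[ℂ] CSpace N,
      ‖Z - frame ι γ x‖ < η → IsUnit Z ∧ ‖Ring.inverse Z‖ ≤ C := by
  obtain ⟨U, hU⟩ := hu
  have h1 : ContinuousAt Ring.inverse (frame ι γ x₀) := by
    rw [← hU]; exact NormedRing.inverse_continuousAt U
  have h0 : ∀ᶠ Z in 𝓝 (frame ι γ x₀), IsUnit Z := Units.isOpen.mem_nhds ⟨U, hU⟩
  have h2 : ∀ᶠ Z in 𝓝 (frame ι γ x₀), IsUnit Z ∧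
      ‖Ring.inverse Z‖ < ‖Ring.inverse (frame ι γ x₀)‖ + 1 :=
    h0.and (h1.norm.eventually_lt_const (lt_add_one _))
  obtain ⟨η, hη, hη'⟩ := Metric.eventually_nhds_iff.1 h2
  obtain ⟨δ, hδ, hδ'⟩ := Metric.continuousAt_iff.1 hc (η / 2) (by positivity)
  refine ⟨δ, hδ, η / 2, by positivity, ‖Ring.inverse (frame ι γ x₀)‖ + 1, fun x hx Z hZ => ?_⟩
  have h3 := hδ' (Metric.mem_ball.1 hx)
  have h4 : dist Z (frame ι γ x₀) < η := by
    rw [← dist_eq_norm] at hZ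
    linarith [dist_triangle Z (frame ι γ x) (frame ι γ x₀)]
  exact ⟨(hη' h4).1, (hη' h4).2.le⟩

/-- The edge translated by `t y`, and then by the scale function in the direction `u`. For `t = 0` it
is the original edge; the value `t₀ / 2` is put in place of `t = 0` in the argument of `g`, where it is
irrelevant, in order to stay in the domain of `g`. -/
def shiftedEdge (γ : RSpace d → CSpace N) (φ : RSpace d → W) (g : CSpace N × W → ℂ)
    (y : CSpace N × W) (u : CSpace N) (t₀ : ℝ) (t : Ico 0 t₀) (x : RSpace d) : CSpace N :=
  γ x + (t.1 • y.1 + ((if t.1 = 0 then 0 else 1 : ℂ) *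
    g ((γ x, φ x) + (if t.1 = 0 then t₀ / 2 else t.1) • y)) • u)

/-- The boundary value of `F`, holomorphic in a wedge of direction `u`, is also that of the function
`(z, w) ↦ F (z + g (z, w) u)`, where `g` is the scale function. -/
theorem ScaleFunEstimates.tendsto_integral [CompleteSpace W]
    (hE : ScaleFunEstimates γ φ x₀ H A v Λ θ δ a ε C g) (hε : 0 < ε) (hΛ : 0 < Λ) (hθ : 0 < θ)
    (ha : a ≤ 1) (hC : 0 < C) {Ω : Set (RSpace d)} (hΩ : IsOpen Ω) (hγ : ContDiffOn ℝ ∞ γ Ω)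
    (hφ : ContDiffOn ℝ ∞ φ Ω) {δ₁ : ℝ} (hδ₁ : δ₁ ≤ δ) (hΩδ : Metric.closedBall x₀ δ₁ ⊆ Ω)
    (htan : ∀ x ∈ Metric.ball x₀ δ, ∀ ξ, fderiv ℝ φ x ξ = A x (fderiv ℝ γ x ξ)) {η₁ C₁ : ℝ}
    (hη₁ : 0 < η₁) (hfr : ∀ x ∈ Metric.ball x₀ δ₁, ∀ Z : CSpace N →L[ℂ] CSpace N,
      ‖Z - frame ι γ x‖ < η₁ → IsUnit Z ∧ ‖Ring.inverse Z‖ ≤ C₁)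
    {u : CSpace N} {D : Set (CSpace N)} {F : CSpace N → ℂ} {r η C₂ : ℝ} {l : ℕ} (hη : 0 < η)
    (hF : IsWedgeGrowth γ (Metric.ball x₀ δ₁) u D F r η C₂ l)
    (hr : (‖v.1‖ + 1) / Λ + θ * ‖u‖ < r) {y : CSpace N × W} {s₀ : ℝ} (hs₀ : 0 < s₀)
    (hy : ‖y - s₀ • v‖ < a * s₀) {ψ : RSpace d → ℂ} (hψ : ContDiff ℝ ∞ ψ) {K : Set (RSpace d)}
    (hK : IsCompact K) (hKB : K ⊆ Metric.ball x₀ δ₁) (hψK : ∀ x ∉ K, ψ x = 0) {L : ℂ}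
    (hL : Tendsto (fun τ : ℝ => ∫ x, ψ x * F (γ x + τ • u)) (𝓝[>] 0) (𝓝 L)) :
    Tendsto (fun t : ℝ => ∫ x, ψ x * F (((γ x, φ x) + t • y).1 + g ((γ x, φ x) + t • y) • u))
      (𝓝[>] 0) (𝓝 L) := by
  set B := Metric.ball x₀ δ₁ with hB
  have hBδ : B ⊆ Metric.ball x₀ δ := Metric.ball_subset_ball hδ₁
  have hBc : B ⊆ Metric.closedBall x₀ δ₁ := Metric.ball_subset_closedBall
  have hγd : ∀ x ∈ B, DifferentiableAt ℝ γ x := fun x hx =>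
    (hγ.contDiffAt (hΩ.mem_nhds (hΩδ (hBc hx)))).differentiableAt (by simp)
  have hφd : ∀ x ∈ B, DifferentiableAt ℝ φ x := fun x hx =>
    (hφ.contDiffAt (hΩ.mem_nhds (hΩδ (hBc hx)))).differentiableAt (by simp)
  have hγbdd : ∀ (T : Type) (r : ℕ), HasBddDerivs ℝ (fun _ : T => B) r fun _ => γ := fun T r =>
    (HasBddDerivs.of_contDiffOn hΩ hγ (isCompact_closedBall x₀ δ₁) hΩδ).subset fun _ => hBc
  have hφbdd : ∀ (T : Type) (r : ℕ), HasBddDerivs ℝ (fun _ : T => B) r fun _ => φ := fun T r =>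
    (HasBddDerivs.of_contDiffOn hΩ hφ (isCompact_closedBall x₀ δ₁) hΩδ).subset fun _ => hBc
  obtain ⟨Cγ, hCγ0, hCγ⟩ := ((hγbdd Unit 1).fderiv fun _ => Metric.isOpen_ball).bdd
  set M := ‖complexify (W := CSpace N) ι‖ * (C * s₀ * Cγ * ‖u‖) with hM
  have hM0 : 0 ≤ M := by positivity
  -- A bound on `t` which keeps the edge within the wedges and its frame invertible.
  obtain ⟨t₀, ht₀, ht₀ε, ht₀η, ht₀M⟩ : ∃ t₀ > 0, t₀ * s₀ < ε ∧ Λ * (t₀ * s₀) < η / 2 ∧ t₀ * M < η₁ := by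
    have h1 : ∀ c : ℝ, Tendsto (fun t : ℝ => t * c) (𝓝[>] 0) (𝓝 0) := fun c =>
      tendsto_nhdsWithin_of_tendsto_nhds (by
        have : Continuous fun t : ℝ => t * c := by fun_prop
        simpa using this.tendsto 0)
    have h2 := ((h1 s₀).eventually_lt_const hε).and (((h1 (s₀ * Λ)).eventually_lt_const
      (half_pos hη)).and ((h1 M).eventually_lt_const hη₁))
    obtain ⟨t, ht, ht0⟩ := (h2.and self_mem_nhdsWithin).exists
    exact ⟨t, ht0, ht.1, by rw [mul_comm, mul_assoc]; exact ht.2.1, ht.2.2⟩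
  set e := shiftedEdge γ φ g y u t₀ with he
  have hwedge : ∀ x, ∀ t : ℝ, 0 < t →
      ‖(γ x, φ x) + t • y - (γ x, φ x) - (t * s₀) • v‖ < a * (t * s₀) := by
    intro x t ht
    rw [add_sub_cancel_left, mul_smul, ← smul_sub, norm_smul, Real.norm_eq_abs, abs_of_pos ht]
    nlinarith
  have hsmem : ∀ t : ℝ, 0 < t → t ≤ t₀ → t * s₀ ∈ Ioo 0 ε := fun t h0 h1 =>
    ⟨by positivity, (mul_le_mul_of_nonneg_right h1 hs₀.le).trans_lt ht₀ε⟩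
  have hpos : ∀ t : Ico 0 t₀, 0 < (if t.1 = 0 then t₀ / 2 else t.1) ∧
      (if t.1 = 0 then t₀ / 2 else t.1) ≤ t₀ := by
    intro t
    split_ifs with h
    · exact ⟨by positivity, by linarith⟩
    · exact ⟨t.2.1.lt_of_ne' h, t.2.2.le⟩
  have hepos : ∀ t : Ico 0 t₀, 0 < t.1 → ∀ x,
      e t x = ((γ x, φ x) + t.1 • y).1 + g ((γ x, φ x) + t.1 • y) • u := by
    intro t ht x
    simp only [he, shiftedEdge, if_neg ht.ne', one_mul, Prod.fst_add, Prod.smul_fst, add_assoc]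
  have hezero : ∀ t : Ico 0 t₀, t.1 = 0 → ∀ x, e t x = γ x := by
    intro t ht x
    simp [he, shiftedEdge, ht]
  have hcases : ∀ t : Ico 0 t₀, t.1 = 0 ∨ 0 < t.1 := fun t => t.2.1.eq_or_lt'
  -- The position of the shifted edge in the wedge of `F`.
  have hpoint : ∀ t : Ico 0 t₀, ∀ x ∈ B, ∀ τ, 0 ≤ τ → τ < η / 2 → (t.1 ≠ 0 ∨ 0 < τ) →
      ∃ s w, s ∈ Ioo 0 η ∧ τ ≤ s ∧ ‖w‖ < r ∧ e t x + τ • u = γ x + s • (u + w) := by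
    intro t x hx τ hτ0 hτ hor
    have hr0 : 0 < r := lt_of_le_of_lt (by positivity) hr
    rcases hcases t with ht | ht
    · rw [ht] at hor
      have hτ1 : 0 < τ := by simpa using hor
      exact ⟨τ, 0, ⟨hτ1, by linarith⟩, le_rfl, by simpa using hr0, by
        rw [hezero t ht, add_zero]⟩
    · have hs := hsmem t ht t.2.2.le
      have hp := hwedge x t ht
      obtain ⟨w, hw, hweq⟩ := exists_scale_translate_eq hΛ ha hr hs.1 hτ0 (z := γ x)
        (p := ((γ x, φ x) + t.1 • y).1) ((norm_fst_le _).trans_lt hp) (hE.near x (hBδ hx) _ hs _ hp)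
      refine ⟨Λ * (t.1 * s₀) + τ, w, ⟨by have := hs.1; positivity, ?_⟩, ?_, hw, by rw [hepos t ht]; exact hweq⟩
      · have : Λ * (t.1 * s₀) ≤ Λ * (t₀ * s₀) :=
          mul_le_mul_of_nonneg_left (mul_le_mul_of_nonneg_right t.2.2.le hs₀.le) hΛ.le
        linarith
      · have := hs.1
        have : 0 ≤ Λ * (t.1 * s₀) := by positivity
        linarith
  have hbddg : ∀ r, HasBddDerivs ℝ (fun _ : Ico 0 t₀ => B) r fun t x =>
      g ((γ x, φ x) + (if t.1 = 0 then t₀ / 2 else t.1) • y) := by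
    intro r
    have h1 := ((hE.bdd r).restrictScalars).comp_param (fun _ : Ico 0 t₀ => ())
    have h2 : HasBddDerivs ℝ (fun _ : Ico 0 t₀ => B) r fun t x =>
        (γ x, φ x) + (if t.1 = 0 then t₀ / 2 else t.1) • y :=
      ((hγbdd _ r).prodMk (hφbdd _ r)).add (HasBddDerivs.const ⟨t₀ * ‖y‖, fun t _ => by
        rw [norm_smul, Real.norm_eq_abs, abs_of_pos (hpos t).1]
        exact mul_le_mul_of_nonneg_right (hpos t).2 (norm_nonneg _)⟩)
    exact h1.comp h2 fun t x hx => ⟨x, hBδ hx, _, hsmem _ (hpos t).1 (hpos t).2,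
      hwedge x _ (hpos t).1⟩
  have hbdde : ∀ r, HasBddDerivs ℝ (fun _ : Ico 0 t₀ => B) r e := by
    intro r
    have h1 : HasBddDerivs ℝ (fun _ : Ico 0 t₀ => B) r fun t x =>
        (if t.1 = 0 then 0 else 1 : ℂ) * g ((γ x, φ x) + (if t.1 = 0 then t₀ / 2 else t.1) • y) :=
      HasBddDerivs.bilin (ContinuousLinearMap.mul ℝ ℂ) (HasBddDerivs.const ⟨1, fun t _ => by
        split_ifs <;> simp⟩) (hbddg r)
    have h2 := h1.clm_comp ((ContinuousLinearMap.toSpanSingleton ℂ u).restrictScalars ℝ)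
    refine (hγbdd _ r).add ((HasBddDerivs.const ⟨t₀ * ‖y.1‖, fun t _ => ?_⟩).add h2)
    rw [norm_smul, Real.norm_eq_abs, abs_of_nonneg t.2.1]
    exact mul_le_mul_of_nonneg_right t.2.2.le (norm_nonneg _)
  -- The tangential derivatives of the scale function are small, hence so is the change of the frame.
  have hframe : ∀ t : Ico 0 t₀, ∀ x ∈ B, ‖frame ι (e t) x - frame ι γ x‖ < η₁ := by
    intro t x hx
    rcases hcases t with ht | ht
    · rw [show e t = γ from funext (hezero t ht), sub_self, norm_zero]
      exact hη₁
    · have hs := hsmem t ht t.2.2.le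
      have hp := hwedge x t ht
      have hgd : HasFDerivAt g (fderiv ℂ g ((γ x, φ x) + t.1 • y)) ((γ x, φ x) + t.1 • y) :=
        ((hE.bdd 1).differentiableAt (t := ()) ⟨x, hBδ hx, _, hs, hp⟩).hasFDerivAt
      have hed : HasFDerivAt (fun x => (γ x, φ x) + t.1 • y)
          ((fderiv ℝ γ x).prod (fderiv ℝ φ x)) x :=
        ((hγd x hx).hasFDerivAt.prodMk (hφd x hx).hasFDerivAt).add_const _
      set g' := (fderiv ℂ g ((γ x, φ x) + t.1 • y)).comp
        ((ContinuousLinearMap.id ℂ (CSpace N)).prod (A x)) with hg'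
      have hcomp : HasFDerivAt (fun x => g ((γ x, φ x) + t.1 • y))
          ((g'.restrictScalars ℝ).comp (fderiv ℝ γ x)) x := by
        refine ((hgd.restrictScalars ℝ).comp x hed).congr_fderiv ?_
        ext ξ
        simp [hg', htan x (hBδ hx)]
      set R := ((ContinuousLinearMap.toSpanSingleton ℂ u).restrictScalars ℝ).comp
        ((g'.restrictScalars ℝ).comp (fderiv ℝ γ x)) with hR
      have hee : HasFDerivAt (e t) (fderiv ℝ γ x + R) x := by
        have h1 : HasFDerivAt (fun x => t.1 • y.1 + g ((γ x, φ x) + t.1 • y) • u) R x :=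
          (((ContinuousLinearMap.toSpanSingleton ℂ u).restrictScalars ℝ).hasFDerivAt.comp x
            hcomp).const_add _
        refine ((hγd x hx).hasFDerivAt.fun_add h1).congr_of_eventuallyEq
          (Eventually.of_forall fun x => ?_)
        rw [hepos t ht, Prod.fst_add, Prod.smul_fst, add_assoc]
      rw [frame, hee.fderiv, frame, map_add, add_sub_cancel_left]
      have hRn : ‖R‖ ≤ t.1 * (C * s₀ * Cγ * ‖u‖) := by
        refine ContinuousLinearMap.opNorm_le_bound _ (by have := ht.le; positivity) fun ξ => ?_
        have h1 : R ξ = g' (fderiv ℝ γ x ξ) • u := rfl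
        rw [h1, norm_smul]
        have h2 : ‖g' (fderiv ℝ γ x ξ)‖ ≤ C * (t.1 * s₀) * (Cγ * ‖ξ‖) :=
          (g'.le_opNorm _).trans (mul_le_mul (hE.tangential x (hBδ hx) _ hs _ hp)
            ((fderiv ℝ γ x).le_of_opNorm_le (hCγ () x hx) ξ) (norm_nonneg _)
            (by have := ht.le; positivity))
        calc _ ≤ C * (t.1 * s₀) * (Cγ * ‖ξ‖) * ‖u‖ := mul_le_mul_of_nonneg_right h2 (norm_nonneg _)
          _ = _ := by ring
      calc ‖complexify ι R‖ ≤ ‖complexify (W := CSpace N) ι‖ * ‖R‖ :=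
            ContinuousLinearMap.le_opNorm _ _
        _ ≤ ‖complexify (W := CSpace N) ι‖ * (t.1 * (C * s₀ * Cγ * ‖u‖)) :=
            mul_le_mul_of_nonneg_left hRn (ContinuousLinearMap.opNorm_nonneg _)
        _ = t.1 * M := by rw [hM]; ring
        _ ≤ t₀ * M := mul_le_mul_of_nonneg_right t.2.2.le hM0
        _ < η₁ := ht₀M
  have hfam : IsEdgeFamily B ι e u D F (η / 2) C₂ l :=
    { isOpen := Metric.isOpen_ball
      bdd := hbdde
      isUnit := fun t x hx => (hfr x hx _ (hframe t x hx)).1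
      bdd_coframe := ⟨C₁, fun t x hx => (hfr x hx _ (hframe t x hx)).2⟩
      isOpen_dom := hF.isOpen_dom
      holomorphic := hF.holomorphic
      mem := fun t x hx τ hτ => by
        obtain ⟨s, w, hs, _, hw, h⟩ := hpoint t x hx τ hτ.1.le hτ.2 (Or.inr hτ.1)
        rw [h]
        exact hF.mem x hx s hs w hw
      growth := fun t x hx τ hτ => by
        obtain ⟨s, w, hs, hle, hw, h⟩ := hpoint t x hx τ hτ.1.le hτ.2 (Or.inr hτ.1)
        rw [h]
        refine (hF.growth x hx s hs w hw).trans (mul_le_mul_of_nonneg_left ?_ hF.nonneg)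
        have := hτ.1
        exact inv_anti₀ (by positivity) (pow_le_pow_left₀ this.le hle l) }
  have htest : IsTestFamily B K fun _ : Ico 0 t₀ => ψ :=
    { bdd := fun r => (HasBddDerivs.of_contDiffOn isOpen_univ hψ.contDiffOn
        (isCompact_closedBall x₀ δ₁) (subset_univ _)).subset fun _ => hBc
      supp := fun _ => hψK }
  have key := hfam.tendsto_integral (γ := γ) (L := L) (half_pos hη) hK hKB htest ht₀
    (fun t ht x hx => by
      obtain ⟨s, w, hs, _, hw, h⟩ := hpoint t x hx 0 le_rfl (half_pos hη) (Or.inl ht.ne')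
      rw [zero_smul, add_zero] at h
      rw [h]
      exact hF.mem x hx s hs w hw) (fun x _ => hezero _ rfl x) (fun x hx => by
      have hIco : ∀ᶠ t : Ico 0 t₀ in comap (↑) (𝓝[>] (0 : ℝ)), 0 < t.1 :=
        preimage_mem_comap self_mem_nhdsWithin
      have hcoe : Tendsto (fun t : Ico 0 t₀ => t.1) (comap (↑) (𝓝[>] (0 : ℝ))) (𝓝 0) :=
        tendsto_comap.mono_right nhdsWithin_le_nhds
      have hlin : Tendsto (fun t : Ico 0 t₀ => t.1 * (‖y.1‖ + (1 + θ) * (Λ * s₀) * ‖u‖))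
          (comap (↑) (𝓝[>] (0 : ℝ))) (𝓝 0) := by
        simpa using hcoe.mul_const (‖y.1‖ + (1 + θ) * (Λ * s₀) * ‖u‖)
      rw [tendsto_iff_norm_sub_tendsto_zero]
      refine squeeze_zero' (Eventually.of_forall fun _ => norm_nonneg _) ?_ hlin
      filter_upwards [hIco] with t ht
      rw [hepos t ht, Prod.fst_add, Prod.smul_fst, add_assoc, add_sub_cancel_left]
      have h1 := hE.near x (hBδ hx) _ (hsmem t ht t.2.2.le) _ (hwedge x t ht)
      have h2 : ‖g ((γ x, φ x) + t.1 • y)‖ ≤ (1 + θ) * (Λ * (t.1 * s₀)) := by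
        have h3 := norm_le_norm_add_norm_sub' (g ((γ x, φ x) + t.1 • y))
          ((Λ * (t.1 * s₀) : ℝ) : ℂ)
        rw [Complex.norm_real, Real.norm_eq_abs, abs_of_pos (by positivity)] at h3
        linarith
      refine (norm_add_le _ _).trans ?_
      rw [norm_smul, norm_smul, Real.norm_eq_abs, abs_of_pos ht]
      have h3 := mul_le_mul_of_nonneg_right h2 (norm_nonneg u)
      calc _ ≤ t.1 * ‖y.1‖ + (1 + θ) * (Λ * (t.1 * s₀)) * ‖u‖ := by gcongr
        _ = _ := by ring) hL
  have hrange : range ((↑) : Ico 0 t₀ → ℝ) ∈ 𝓝[>] (0 : ℝ) := by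
    rw [Subtype.range_coe]
    exact mem_of_superset (Ioo_mem_nhdsGT ht₀) Ioo_subset_Ico_self
  rw [← tendsto_comap'_iff hrange]
  refine key.congr' ?_
  have hIco : ∀ᶠ t : Ico 0 t₀ in comap (↑) (𝓝[>] (0 : ℝ)), 0 < t.1 :=
    preimage_mem_comap self_mem_nhdsWithin
  filter_upwards [hIco] with t ht
  simp_rw [hepos t ht]
  rfl

end Pullback

/-! ### Transversality -/

section Cone

variable {E : Type} [NormedAddCommGroup E] [NormedSpace ℝ E]

/-- The open cone of directions close to `v`, with aperture `a`. -/
def coneAbout (v : E) (a : ℝ) : Set E := {y | ∃ s > 0, ‖y - s • v‖ < a * s}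

theorem mem_coneAbout_self {v : E} {a : ℝ} (ha : 0 < a) : v ∈ coneAbout v a :=
  ⟨1, one_pos, by simpa using ha⟩

end Cone

theorem isOpenConvexCone_coneAbout {E : Type} [NormedAddCommGroup E] [NormedSpace ℂ E] {v : E} {a : ℝ}
    (ha : 0 < a) : IsOpenConvexCone (coneAbout v a) where
  nonempty := ⟨v, mem_coneAbout_self ha⟩
  isOpen := by
    have : coneAbout v a = ⋃ s ∈ Ioi (0 : ℝ), {y | ‖y - s • v‖ < a * s} := by
      ext y; simp [coneAbout]
    rw [this]
    exact isOpen_biUnion fun s _ => isOpen_lt (by fun_prop) continuous_const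
  convex := by
    refine convex_iff_forall_pos.2 ?_
    rintro y ⟨s, hs, hy⟩ y' ⟨s', hs', hy'⟩ b b' hb hb' -
    refine ⟨b * s + b' * s', by positivity, ?_⟩
    have h1 : b • y + b' • y' - (b * s + b' * s') • v = b • (y - s • v) + b' • (y' - s' • v) := by
      rw [smul_sub, smul_sub, add_smul, mul_smul, mul_smul]; abel
    rw [h1]
    refine (norm_add_le _ _).trans_lt ?_
    rw [norm_smul, norm_smul, Real.norm_eq_abs, Real.norm_eq_abs, abs_of_pos hb, abs_of_pos hb']
    have h2 := mul_lt_mul_of_pos_left hy hb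
    have h3 := mul_lt_mul_of_pos_left hy' hb'
    linarith
  smul_mem t ht y hy := by
    obtain ⟨s, hs, hy⟩ := hy
    refine ⟨t * s, by positivity, ?_⟩
    rw [mul_smul, ← smul_sub, norm_smul, Real.norm_eq_abs, abs_of_pos ht]
    have := mul_lt_mul_of_pos_left hy ht
    linarith

/-- An edge and a transversal direction are independent, quantitatively and uniformly near the given
point. -/
theorem exists_transversal_estimate {d : ℕ} {E : Type} [NormedAddCommGroup E] [NormedSpace ℝ E]
    {e : RSpace d → E} {e' : RSpace d →L[ℝ] E} {x₀ : RSpace d} {v : E}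
    (he : HasStrictFDerivAt e e' x₀) (hinj : Function.Injective e') (hv : v ∉ range e') :
    ∃ c > 0, ∃ δ > 0, ∃ a > 0, ∀ x ∈ Metric.ball x₀ δ, ∀ x₁ ∈ Metric.ball x₀ δ, ∀ s : ℝ, 0 ≤ s →
      ∀ y, ‖y - s • v‖ ≤ a * s → c * s ≤ ‖e x + y - e x₁‖ ∧ c * ‖x - x₁‖ ≤ ‖e x + y - e x₁‖ := by
  set L : RSpace d × ℝ →ₗ[ℝ] E := (e'.coprod (ContinuousLinearMap.toSpanSingleton ℝ v)).toLinearMap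
    with hL
  have hLa : ∀ ξ s, L (ξ, s) = e' ξ + s • v := fun ξ s => by simp [hL]
  have hker : LinearMap.ker L = ⊥ := by
    rw [LinearMap.ker_eq_bot']
    rintro ⟨ξ, s⟩ h
    rw [hLa] at h
    have hs : s = 0 := by
      by_contra hs
      refine hv ⟨-(s⁻¹ • ξ), ?_⟩
      rw [map_neg, map_smul, eq_neg_of_add_eq_zero_left h, smul_neg, neg_neg, inv_smul_smul₀ hs]
    subst hs
    rw [zero_smul, add_zero] at h
    rw [hinj (h.trans (map_zero e').symm)]
    rfl
  obtain ⟨K, hK, hKL⟩ := L.exists_antilipschitzWith hker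
  have hK0 : (0 : ℝ) < K := hK
  have hlow : ∀ ξ s, ‖(ξ, s)‖ ≤ K * ‖e' ξ + s • v‖ := fun ξ s => by
    rw [← hLa]
    simpa using hKL.le_mul_dist (ξ, s) 0
  set c : ℝ := (3 * K)⁻¹ with hc
  have hc0 : 0 < c := by positivity
  have h1 := he.isLittleO.def hc0
  obtain ⟨δ, hδ, hδ'⟩ := Metric.eventually_nhds_iff.1 h1
  refine ⟨c, hc0, δ, hδ, c, hc0, fun x hx x₁ hx₁ s hs y hy => ?_⟩
  have h2 := hδ' (y := (x, x₁)) (by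
    rw [Prod.dist_eq]; exact max_lt (Metric.mem_ball.1 hx) (Metric.mem_ball.1 hx₁))
  simp only at h2
  set ξ := x - x₁ with hξ
  set m := ‖(ξ, s)‖ with hm
  have hm1 : ‖ξ‖ ≤ m := norm_fst_le (ξ, s)
  have hm2 : s ≤ m := (le_abs_self s).trans (norm_snd_le (ξ, s))
  have h3 : 3 * c * m ≤ ‖e' ξ + s • v‖ := by
    have h5 := hlow ξ s
    have h6 : 3 * c = (K : ℝ)⁻¹ := by rw [hc]; field_simp
    rw [h6, inv_mul_le_iff₀ hK0]
    exact h5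
  have h4 : ‖e' ξ + s • v‖ ≤ ‖e x + y - e x₁‖ + c * ‖ξ‖ + c * s := by
    have : e' ξ + s • v = (e x + y - e x₁) - (e x - e x₁ - e' ξ) - (y - s • v) := by abel
    rw [this]
    exact (norm_sub_le _ _).trans (add_le_add ((norm_sub_le _ _).trans
      (add_le_add le_rfl h2)) hy)
  have h7 : c * ‖ξ‖ ≤ c * m := mul_le_mul_of_nonneg_left hm1 hc0.le
  have h8 : c * s ≤ c * m := mul_le_mul_of_nonneg_left hm2 hc0.le
  exact ⟨by linarith, by linarith⟩

theorem exists_mem_ball_of_isInducing {X E : Type} [PseudoMetricSpace X] [NormedAddCommGroup E]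
    {S : Set X} {f : X → E} (hf : IsInducing fun x : S => f x) {x₀ : X} (hx₀ : x₀ ∈ S) {δ : ℝ}
    (hδ : 0 < δ) : ∃ ρ > 0, ∀ x ∈ S, ‖f x - f x₀‖ < ρ → x ∈ Metric.ball x₀ δ := by
  have h1 := hf.nhds_eq_comap ⟨x₀, hx₀⟩
  have h2 : (fun x : S => x.1) ⁻¹' Metric.ball x₀ δ ∈ 𝓝 (⟨x₀, hx₀⟩ : S) :=
    (Metric.isOpen_ball.preimage continuous_subtype_val).mem_nhds (Metric.mem_ball_self hδ)
  rw [h1, mem_comap] at h2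
  obtain ⟨t, ht, htδ⟩ := h2
  obtain ⟨ρ, hρ, hρt⟩ := Metric.mem_nhds_iff.1 ht
  refine ⟨ρ, hρ, fun x hx hxρ => ?_⟩
  have h3 : (⟨x, hx⟩ : S) ∈ (fun x : S => f x) ⁻¹' t := hρt (mem_ball_iff_norm.2 hxρ)
  exact htδ h3

section LocalParam

variable {d : ℕ} {V : Type} [NormedAddCommGroup V] [NormedSpace ℂ V] {M : Set V}
  {Ω : Opens (RSpace d)} {γ : RSpace d → V} {x₀ : RSpace d}

theorem IsLocalParam.hasStrictFDerivAt (hγ : IsLocalParam M Ω γ) (hx₀ : x₀ ∈ Ω) :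
    HasStrictFDerivAt γ (fderiv ℝ γ x₀) x₀ :=
  (hγ.smooth.contDiffAt (Ω.isOpen.mem_nhds hx₀)).hasStrictFDerivAt (by simp)

/-- Parameters of points close to `γ x₀` are close to `x₀`. -/
theorem IsLocalParam.exists_mem_ball (hγ : IsLocalParam M Ω γ) (hx₀ : x₀ ∈ Ω) {δ : ℝ} (hδ : 0 < δ) :
    ∃ ρ > 0, ∀ x ∈ Ω, ‖γ x - γ x₀‖ < ρ → x ∈ Metric.ball x₀ δ :=
  exists_mem_ball_of_isInducing (S := (Ω : Set (RSpace d))) hγ.embedding.isInducing hx₀ hδ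

/-- The tangent space does not depend on the local parametrization. -/
theorem IsLocalParam.range_fderiv_subset (hγ : IsLocalParam M Ω γ) (hx₀ : x₀ ∈ Ω) {d' : ℕ}
    {Ω' : Opens (RSpace d')} {γ' : RSpace d' → V} {x' : RSpace d'} (hγ' : IsLocalParam M Ω' γ')
    (hx' : x' ∈ Ω') (heq : γ' x' = γ x₀) :
    range (fderiv ℝ γ' x') ⊆ range (fderiv ℝ γ x₀) := by
  rintro _ ⟨ξ, rfl⟩
  -- Otherwise the curve in the direction `ξ` would leave the submanifold, by transversality.
  by_contra hu
  obtain ⟨c, hc, δ, hδ, a, ha, hest⟩ := exists_transversal_estimate (hγ.hasStrictFDerivAt hx₀)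
    (hγ.immersion x₀ hx₀) hu
  obtain ⟨ρ, hρ, hball⟩ := hγ.exists_mem_ball hx₀ hδ
  obtain ⟨O, hO, hOM⟩ := hγ.image_open
  obtain ⟨O', hO', hOM'⟩ := hγ'.image_open
  -- Points of the second parametrization in the direction `ξ` are reached by the first one.
  have hd := (hγ'.hasStrictFDerivAt hx').hasFDerivAt
  have hline : Tendsto (fun s : ℝ => x' + s • ξ) (𝓝[>] 0) (𝓝 x') := by
    have : Continuous fun s : ℝ => x' + s • ξ := by fun_prop
    exact tendsto_nhdsWithin_of_tendsto_nhds (by simpa using this.tendsto 0)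
  have hO0 : γ x₀ ∈ O := by
    have : γ x₀ ∈ M ∩ O := hOM ▸ mem_image_of_mem γ hx₀
    exact this.2
  have h1 : ∀ᶠ s : ℝ in 𝓝[>] 0, γ' (x' + s • ξ) ∈ O ∩ Metric.ball (γ x₀) ρ := by
    have h2 : Tendsto (fun s : ℝ => γ' (x' + s • ξ)) (𝓝[>] 0) (𝓝 (γ x₀)) := by
      rw [← heq]; exact hd.continuousAt.tendsto.comp hline
    exact h2 ((hO.inter Metric.isOpen_ball).mem_nhds ⟨hO0, Metric.mem_ball_self hρ⟩)
  have h2 : ∀ᶠ s : ℝ in 𝓝[>] 0, x' + s • ξ ∈ Ω' := hline (Ω'.isOpen.mem_nhds hx')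
  have h3 : ∀ᶠ s : ℝ in 𝓝[>] 0, ‖γ' (x' + s • ξ) - γ' x' - s • fderiv ℝ γ' x' ξ‖ ≤ a * s := by
    have h4 : HasDerivAt (fun s : ℝ => γ' (x' + s • ξ)) (fderiv ℝ γ' x' ξ) 0 := by
      have h5 : HasDerivAt (fun s : ℝ => x' + s • ξ) ξ 0 := by
        simpa using ((hasDerivAt_id (0 : ℝ)).smul_const ξ).const_add x'
      have h6 : HasFDerivAt γ' (fderiv ℝ γ' x') (x' + (0 : ℝ) • ξ) := by simpa using hd
      exact h6.comp_hasDerivAt 0 h5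
    have h7 := (hasDerivAt_iff_isLittleO.1 h4).def ha
    filter_upwards [h7.filter_mono nhdsWithin_le_nhds, self_mem_nhdsWithin] with s hs hs0
    have hs0 : 0 < s := hs0
    simpa [abs_of_pos hs0] using hs
  obtain ⟨s, ⟨⟨h1, h2⟩, h3⟩, hs⟩ := ((h1.and h2).and h3 |>.and self_mem_nhdsWithin).exists
  have hs : 0 < s := hs
  have hMO : γ' (x' + s • ξ) ∈ γ '' Ω := by
    rw [hOM]
    refine ⟨?_, h1.1⟩
    have : γ' (x' + s • ξ) ∈ M ∩ O' := hOM' ▸ mem_image_of_mem γ' h2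
    exact this.1
  obtain ⟨x₁, hx₁, hx₁eq⟩ := hMO
  have hx₁b : x₁ ∈ Metric.ball x₀ δ := hball x₁ hx₁ (by
    rw [hx₁eq, ← mem_ball_iff_norm]; exact h1.2)
  have := (hest x₀ (Metric.mem_ball_self hδ) x₁ hx₁b s hs.le _ h3).1
  rw [heq, hx₁eq, add_sub_cancel, sub_self, norm_zero] at this
  have := mul_pos hc hs
  linarith

end LocalParam

theorem IsGenericSubmanifold.complexTangentSpan_eq_top {k m : ℕ} {M : Set (CSpace (k + m))}
    (hM : IsGenericSubmanifold k m M) {Ω : Opens (RSpace (2 * k + m))}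
    {γ : RSpace (2 * k + m) → CSpace (k + m)} (hγ : IsLocalParam M Ω γ) {x₀ : RSpace (2 * k + m)}
    (hx₀ : x₀ ∈ Ω) : complexTangentSpan γ x₀ = ⊤ := by
  obtain ⟨O, -, hOM⟩ := hγ.image_open
  have hp : γ x₀ ∈ M ∩ O := hOM ▸ mem_image_of_mem γ hx₀
  obtain ⟨Ω', γ', hγ', ⟨x', hx', heq⟩, hspan⟩ := hM _ hp.1
  rw [eq_top_iff, ← hspan x' hx']
  exact Submodule.span_mono (hγ.range_fderiv_subset hx₀ hγ' hx' heq)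

/-- A vector which is complex transversal to a graph does not belong to the graph of the complex linear
extension of the differential. -/
theorem exists_clm_eq_one_of_notMem {d N : ℕ} {W : Type} [NormedAddCommGroup W] [NormedSpace ℂ W]
    {γ : RSpace d → CSpace N} {φ : RSpace d → W} {x₀ : RSpace d} {A : CSpace N →L[ℂ] W}
    (hγ : DifferentiableAt ℝ γ x₀) (hφ : DifferentiableAt ℝ φ x₀)
    (htan : ∀ ξ, fderiv ℝ φ x₀ ξ = A (fderiv ℝ γ x₀ ξ)) (hspan : complexTangentSpan γ x₀ = ⊤)
    {v : CSpace N × W} (hv : v ∉ complexTangentSpan (fun x => (γ x, φ x)) x₀) :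
    ∃ ℓ : W →L[ℂ] ℂ, ℓ (v.2 - A v.1) = 1 := by
  refine SeparatingDual.exists_eq_one fun h0 => hv ?_
  set L : CSpace N →ₗ[ℂ] CSpace N × W := LinearMap.prod LinearMap.id A.toLinearMap with hL
  have hvL : v = L v.1 := Prod.ext rfl (sub_eq_zero.1 h0)
  have h1 : L v.1 ∈ (complexTangentSpan γ x₀).map L :=
    Submodule.mem_map_of_mem (hspan ▸ Submodule.mem_top)
  rw [hvL]
  rw [complexTangentSpan, Submodule.map_span] at h1
  refine Submodule.span_mono ?_ h1
  rintro _ ⟨_, ⟨ξ, rfl⟩, rfl⟩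
  refine ⟨ξ, ?_⟩
  rw [(hγ.hasFDerivAt.prodMk hφ.hasFDerivAt).fderiv]
  exact Prod.ext rfl (htan ξ)

theorem isOpen_wedge {d : ℕ} {V : Type} [NormedAddCommGroup V] [NormedSpace ℂ V] {e : RSpace d → V}
    {U : Set (RSpace d)} {Γ : Set V} {ε : ℝ} (hΓ : IsOpen Γ) : IsOpen (wedge e U Γ ε) := by
  have : wedge e U Γ ε = ⋃ x ∈ U, {z | z - e x ∈ Γ ∧ ‖z - e x‖ < ε} := by
    ext z
    simp only [wedge, mem_ofPred_eq, mem_iUnion, exists_prop]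
    refine exists_congr fun x => and_congr_right fun _ => ⟨?_, fun h => ⟨_, h.1, h.2, by abel⟩⟩
    rintro ⟨y, hy, hyε, rfl⟩
    rw [add_sub_cancel_left]
    exact ⟨hy, hyε⟩
  rw [this]
  refine isOpen_biUnion fun x _ => IsOpen.inter ?_
    (isOpen_lt (continuous_id.sub continuous_const).norm continuous_const)
  exact hΓ.preimage (continuous_id.sub continuous_const)

/-- A function of slow growth in a wedge grows slowly along suitable directions of the wedge. If the
edge is open, the function is in fact holomorphic near the edge. -/
theorem IsWedgeExtension.exists_isWedgeGrowth {d N : ℕ} {M : Set (CSpace N)} {Ω U : Opens (RSpace d)}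
    {γ : RSpace d → CSpace N} {x₀ : RSpace d} {Γ : Set (CSpace N)} {ε : ℝ} {u' : 𝓓'(U, ℂ)}
    {F : CSpace N → ℂ} (hF : IsWedgeExtension γ U Γ ε u' F) (hΓ : IsOpenConvexCone Γ) (hε : 0 < ε)
    (hγ : IsLocalParam M Ω γ) (hUΩ : U ≤ Ω) (hx₀ : x₀ ∈ U) :
    ∃ u ∈ Γ, ∃ δ > 0, ∃ r > 0, ∃ η > 0, ∃ C l,
      IsWedgeGrowth γ (Metric.ball x₀ δ) u (wedge γ U Γ ε) F r η C l := by
  have hx₀Ω : x₀ ∈ Ω := hUΩ hx₀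
  have hst := hγ.hasStrictFDerivAt hx₀Ω
  have hopen : IsOpen (wedge γ U Γ ε) := isOpen_wedge hΓ.isOpen
  obtain ⟨δ₁, hδ₁, hδ₁U⟩ := Metric.isOpen_iff.1 U.isOpen x₀ hx₀
  have hcone : ∀ u r : _, Metric.ball u r ⊆ Γ → ∀ w, ‖w‖ < r → ∀ s : ℝ, 0 < s → s • (u + w) ∈ Γ :=
    fun u r hr w hw s hs => hΓ.smul_mem s hs _ (hr (by simpa [mem_ball_iff_norm] using hw))
  have hnorm : ∀ u w : CSpace N, ∀ r s : ℝ, ‖w‖ < r → 0 < s →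
      ‖s • (u + w)‖ ≤ s * (‖u‖ + r) := fun u w r s hw hs => by
    rw [norm_smul, Real.norm_eq_abs, abs_of_pos hs]
    exact mul_le_mul_of_nonneg_left ((norm_add_le _ _).trans (by linarith)) hs.le
  by_cases htop : LinearMap.range (fderiv ℝ γ x₀).toLinearMap = ⊤
  · -- The edge is open, and `γ x₀` belongs to the wedge.
    have hmap := hst.map_nhds_eq_of_surj htop
    obtain ⟨u, hu⟩ := hΓ.nonempty
    obtain ⟨r, hr, hrΓ⟩ := Metric.isOpen_iff.1 hΓ.isOpen u hu
    have himg : γ '' U ∈ 𝓝 (γ x₀) := hmap ▸ image_mem_map (U.isOpen.mem_nhds hx₀)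
    have h1 : Tendsto (fun s : ℝ => γ x₀ - s • u) (𝓝[>] 0) (𝓝 (γ x₀)) := by
      have : Continuous fun s : ℝ => γ x₀ - s • u := by fun_prop
      exact tendsto_nhdsWithin_of_tendsto_nhds (by simpa using this.tendsto 0)
    have h2 : Tendsto (fun s : ℝ => ‖s • u‖) (𝓝[>] 0) (𝓝 0) := by
      have : Continuous fun s : ℝ => ‖s • u‖ := by fun_prop
      exact tendsto_nhdsWithin_of_tendsto_nhds (by simpa using this.tendsto 0)
    have h1' : ∀ᶠ s : ℝ in 𝓝[>] 0, γ x₀ - s • u ∈ γ '' U := h1 himg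
    obtain ⟨s, ⟨hs1, hs2⟩, hs⟩ := (h1'.and (h2.eventually_lt_const hε)
      |>.and self_mem_nhdsWithin).exists
    obtain ⟨x, hx, hxs⟩ := hs1
    have hmem : γ x₀ ∈ wedge γ U Γ ε := ⟨x, hx, s • u, hΓ.smul_mem s hs u hu, hs2, by
      rw [hxs, sub_add_cancel]⟩
    have hc := (hF.holomorphic.continuousOn.continuousAt (hopen.mem_nhds hmem)).norm
    have h3 : ∀ᶠ z in 𝓝 (γ x₀), z ∈ wedge γ U Γ ε ∧ ‖F z‖ < ‖F (γ x₀)‖ + 1 :=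
      (eventually_of_mem (hopen.mem_nhds hmem) fun z hz => hz).and
        (hc.eventually_lt_const (lt_add_one _))
    obtain ⟨ρ, hρ, hρ'⟩ := Metric.eventually_nhds_iff.1 h3
    obtain ⟨δ₂, hδ₂, hδ₂'⟩ := Metric.continuousAt_iff.1 hst.continuousAt (ρ / 2) (by positivity)
    have h4 : ∀ x ∈ Metric.ball x₀ δ₂, ∀ s ∈ Ioo 0 (ρ / (2 * (‖u‖ + r))), ∀ w, ‖w‖ < r →
        dist (γ x + s • (u + w)) (γ x₀) < ρ := by
      intro x hx s hs w hw
      have h5 := hδ₂' (Metric.mem_ball.1 hx)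
      rw [dist_eq_norm] at h5 ⊢
      have h6 := hnorm u w r s hw hs.1
      have h7 : s * (‖u‖ + r) < ρ / 2 := by
        have := hs.2
        rw [lt_div_iff₀ (by positivity)] at this
        linarith
      rw [show γ x + s • (u + w) - γ x₀ = (γ x - γ x₀) + s • (u + w) by abel]
      exact (norm_add_le _ _).trans_lt (by linarith)
    refine ⟨u, hu, δ₂, hδ₂, r, hr, ρ / (2 * (‖u‖ + r)), by positivity, ‖F (γ x₀)‖ + 1, 0,
      hopen, hF.holomorphic, by positivity, fun x hx s hs w hw => (hρ' (h4 x hx s hs w hw)).1,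
      fun x hx s hs w hw => ?_⟩
    simpa using (hρ' (h4 x hx s hs w hw)).2.le
  · -- The distance to the edge is comparable with the height.
    obtain ⟨u, hu, hur⟩ : ∃ u ∈ Γ, u ∉ range (fderiv ℝ γ x₀) := by
      by_contra! hall
      refine htop (Submodule.eq_top_of_nonempty_interior' _ ?_)
      obtain ⟨u, hu⟩ := hΓ.nonempty
      exact ⟨u, mem_interior.2 ⟨Γ, fun y hy => hall y hy, hΓ.isOpen, hu⟩⟩
    obtain ⟨c, hc, δ, hδ, a, ha, hest⟩ := exists_transversal_estimate hst
      (hγ.immersion x₀ hx₀Ω) hur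
    obtain ⟨ρ, hρ, hball⟩ := hγ.exists_mem_ball hx₀Ω hδ
    obtain ⟨r₀, hr₀, hrΓ⟩ := Metric.isOpen_iff.1 hΓ.isOpen u hu
    obtain ⟨δ₂, hδ₂, hδ₂'⟩ := Metric.continuousAt_iff.1 hst.continuousAt (ρ / 3) (by positivity)
    obtain ⟨C, l, -, hC⟩ := hF.slowGrowth
    set r := min r₀ a with hr
    have hr0 : 0 < r := lt_min hr₀ ha
    have hrΓ' : Metric.ball u r ⊆ Γ := (Metric.ball_subset_ball (min_le_left _ _)).trans hrΓ
    set η := min (min ε (ρ / 3) / (‖u‖ + r)) (ρ / (3 * c)) with hη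
    have hη0 : 0 < η := by positivity
    have hsη : ∀ s ∈ Ioo 0 η, s * (‖u‖ + r) < ε ∧ s * (‖u‖ + r) < ρ / 3 ∧ c * s ≤ ρ / 3 := by
      intro s hs
      have h1 := hs.2.trans_le (min_le_left _ _)
      rw [lt_div_iff₀ (by positivity)] at h1
      have h2 := hs.2.trans_le (min_le_right _ _)
      rw [lt_div_iff₀ (by positivity)] at h2
      exact ⟨h1.trans_le (min_le_left _ _), h1.trans_le (min_le_right _ _), by linarith⟩
    have hmem : ∀ x ∈ Metric.ball x₀ (min δ₁ (min δ δ₂)), ∀ s ∈ Ioo 0 η, ∀ w, ‖w‖ < r →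
        γ x + s • (u + w) ∈ wedge γ U Γ ε := fun x hx s hs w hw =>
      ⟨x, hδ₁U (Metric.ball_subset_ball (min_le_left _ _) hx), s • (u + w),
        hcone u r hrΓ' w hw s hs.1, (hnorm u w r s hw hs.1).trans_lt (hsη s hs).1, rfl⟩
    refine ⟨u, hu, min δ₁ (min δ δ₂), by positivity, r, hr0, η, hη0, max C 0 / c ^ l, l, hopen,
      hF.holomorphic, by positivity, hmem, fun x hx s hs w hw => ?_⟩
    have hxδ : x ∈ Metric.ball x₀ δ := Metric.ball_subset_ball
      ((min_le_right _ _).trans (min_le_left _ _)) hx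
    have hxδ₂ : x ∈ Metric.ball x₀ δ₂ := Metric.ball_subset_ball
      ((min_le_right _ _).trans (min_le_right _ _)) hx
    have hs0 : 0 < s := hs.1
    have hdist : c * s ≤ Metric.infDist (γ x + s • (u + w)) (γ '' U) := by
      refine (Metric.le_infDist ⟨_, mem_image_of_mem γ hx₀⟩).2 ?_
      rintro _ ⟨x₁, hx₁, rfl⟩
      rw [dist_eq_norm]
      by_cases hx₁δ : x₁ ∈ Metric.ball x₀ δ
      · refine (hest x hxδ x₁ hx₁δ s hs0.le _ ?_).1
        rw [smul_add, add_sub_cancel_left, norm_smul, Real.norm_eq_abs, abs_of_pos hs0, mul_comm]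
        exact mul_le_mul_of_nonneg_right (hw.le.trans (min_le_right _ _)) hs0.le
      · have h1 : ρ ≤ ‖γ x₁ - γ x₀‖ := by
          by_contra! h
          exact hx₁δ (hball x₁ (hUΩ hx₁) h)
        have h2 := hδ₂' (Metric.mem_ball.1 hxδ₂)
        rw [dist_eq_norm] at h2
        have h3 := (hnorm u w r s hw hs0).trans_lt (hsη s hs).2.1
        have h4 : ‖γ x₁ - γ x₀‖ ≤ ‖γ x + s • (u + w) - γ x₁‖ + ‖γ x - γ x₀‖ + ‖s • (u + w)‖ := by
          have : γ x₁ - γ x₀ = -(γ x + s • (u + w) - γ x₁) + (γ x - γ x₀) + s • (u + w) := by abel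
          rw [this]
          refine (norm_add_le _ _).trans (add_le_add_left ((norm_add_le _ _).trans ?_) _)
          rw [norm_neg]
        linarith [(hsη s hs).2.2]
    have h5 := hC _ (hmem x hx s hs w hw)
    have h6 : ‖F (γ x + s • (u + w))‖ * (c * s) ^ l ≤ max C 0 :=
      (mul_le_mul_of_nonneg_left (pow_le_pow_left₀ (by positivity) hdist l)
        (norm_nonneg _)).trans (h5.trans (le_max_left _ _))
    rw [mul_pow] at h6
    rw [← div_eq_mul_inv, div_div, le_div_iff₀ (by positivity)]
    exact h6

/-! ### Holomorphic functions on the wedge over the graph -/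

section Vanishing

variable {d N : ℕ} {W : Type} [NormedAddCommGroup W] [NormedSpace ℂ W] {γ : RSpace d → CSpace N}
  {φ : RSpace d → W} {x₀ : RSpace d} {H : CSpace N × ℂ → W} {A : RSpace d → CSpace N →L[ℂ] W}
  {v : CSpace N × W} {Λ θ δ δ' κ a ε C : ℝ} {g : CSpace N × W → ℂ}

theorem IsApproxExtension.mono (h : IsApproxExtension γ φ x₀ δ κ H A) (hδ : δ' ≤ δ) :
    IsApproxExtension γ φ x₀ δ' κ H A where
  bdd r := (h.bdd r).subset fun _ p hp => by
    obtain ⟨x, hx, hp⟩ := hp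
    exact ⟨x, Metric.ball_subset_ball hδ hx, hp⟩
  approx := by
    obtain ⟨C, hC, h⟩ := h.approx
    exact ⟨C, hC, fun x hx => h x (Metric.ball_subset_ball hδ hx)⟩
  continuousOn := h.continuousOn.mono (Metric.ball_subset_ball hδ)
  tangent x hx := h.tangent x (Metric.ball_subset_ball hδ hx)

/-- The set `D` consists of points over the edge `e(B)` which lie in the cone around `v` up to the
height `ε`, and both the height and the base point are controlled by distances to the edge. -/
structure IsControlledWedge {E : Type} [NormedAddCommGroup E] [NormedSpace ℝ E] (e : RSpace d → E)
    (B : Set (RSpace d)) (v : E) (a ε c : ℝ) (D : Set E) : Prop where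
  pos : 0 < c
  exists_base : ∀ p ∈ D, ∃ x ∈ B, ∃ s ∈ Ioo 0 ε, ‖p - e x - s • v‖ < a * s ∧
    ‖p - e x‖ ≤ s * (‖v‖ + 1) ∧
    ∀ x₁ ∈ B, c * s ≤ ‖p - e x₁‖ ∧ c * ‖x - x₁‖ ≤ ‖p - e x₁‖

/-- Along the wedge, the base points and the heights converge as the points tend to the edge. -/
theorem IsControlledWedge.exists_choice {E : Type} [NormedAddCommGroup E] [NormedSpace ℝ E]
    {e : RSpace d → E} {B : Set (RSpace d)} {v : E} {a ε c : ℝ} {D : Set E}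
    (h : IsControlledWedge e B v a ε c D) : ∃ (X : E → RSpace d) (S : E → ℝ),
      (∀ p ∈ D, X p ∈ B ∧ S p ∈ Ioo 0 ε ∧ ‖p - e (X p) - S p • v‖ < a * S p) ∧
      ∀ x₁ ∈ B, Tendsto X (𝓝[D] (e x₁)) (𝓝 x₁) ∧ Tendsto S (𝓝[D] (e x₁)) (𝓝 0) := by
  choose! X hX S hS h1 _ h3 using h.exists_base
  refine ⟨X, S, fun p hp => ⟨hX p hp, hS p hp, h1 p hp⟩, fun x₁ hx₁ => ?_⟩
  have hlim : Tendsto (fun p => c⁻¹ * ‖p - e x₁‖) (𝓝[D] (e x₁)) (𝓝 0) := by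
    have : Continuous fun p : E => c⁻¹ * ‖p - e x₁‖ :=
      continuous_const.mul (continuous_id.sub continuous_const).norm
    exact tendsto_nhdsWithin_of_tendsto_nhds (by simpa using this.tendsto (e x₁))
  have hle : ∀ {b m : ℝ}, c * b ≤ m → b ≤ c⁻¹ * m := fun {b m} hb => by
    rwa [le_inv_mul_iff₀ h.pos]
  constructor
  · rw [tendsto_iff_norm_sub_tendsto_zero]
    refine squeeze_zero' (Eventually.of_forall fun _ => norm_nonneg _) ?_ hlim
    filter_upwards [self_mem_nhdsWithin] with p hp
    exact hle (h3 p hp x₁ hx₁).2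
  · refine squeeze_zero' ?_ ?_ hlim
    · filter_upwards [self_mem_nhdsWithin] with p hp
      exact (hS p hp).1.le
    · filter_upwards [self_mem_nhdsWithin] with p hp
      exact hle (h3 p hp x₁ hx₁).1

end Vanishing

section Graph

variable {d N n : ℕ} {γ : RSpace d → CSpace N} {φ : RSpace d → CSpace n} {x₀ : RSpace d}
  {H : CSpace N × ℂ → CSpace n} {A : RSpace d → CSpace N →L[ℂ] CSpace n}
  {v : CSpace N × CSpace n} {Λ θ δ δ₁ a ε ε₁ c C : ℝ} {g : CSpace N × CSpace n → ℂ}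
  {D : Set (CSpace N × CSpace n)}

theorem ScaleFunEstimates.hasFDerivAt_component (hE : ScaleFunEstimates γ φ x₀ H A v Λ θ δ a ε C g)
    {p : CSpace N × CSpace n} (hp : p ∈ thinWedge (fun x => (γ x, φ x)) x₀ δ v a ε) (l : Fin n) :
    HasFDerivAt (fun p : CSpace N × CSpace n => (p.2 - H (p.1, g p)) l)
      ((EuclideanSpace.proj l : CSpace n →L[ℂ] ℂ).comp
        (fderiv ℂ (fun p : CSpace N × CSpace n => p.2 - H (p.1, g p)) p)) p :=
  (EuclideanSpace.proj l : CSpace n →L[ℂ] ℂ).hasFDerivAt.comp p (hE.differentiableAt p hp).hasFDerivAt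

theorem IsControlledWedge.subset_thinWedge
    (hD : IsControlledWedge (fun x => (γ x, φ x)) (Metric.ball x₀ δ₁) v a ε₁ c D) (hδ : δ₁ ≤ δ)
    (hε : ε₁ ≤ ε) : D ⊆ thinWedge (fun x => (γ x, φ x)) x₀ δ v a ε := by
  intro p hp
  obtain ⟨x, hx, s, hs, h, -⟩ := hD.exists_base p hp
  exact ⟨x, Metric.ball_subset_ball hδ hx, s, ⟨hs.1, hs.2.trans_le hε⟩, h⟩

/-- The components of `w - H (z, g (z, w))` vanish to first order on the edge. -/
theorem ScaleFunEstimates.vanishesToOrderOne (hE : ScaleFunEstimates γ φ x₀ H A v Λ θ δ a ε C g)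
    (hD : IsControlledWedge (fun x => (γ x, φ x)) (Metric.ball x₀ δ₁) v a ε₁ c D) (hδ : δ₁ ≤ δ)
    (hε : ε₁ ≤ ε) (hA : ContinuousOn A (Metric.ball x₀ δ)) (l : Fin n) :
    VanishesToOrderOne D ((fun x => (γ x, φ x)) '' Metric.ball x₀ δ₁)
      (fun p : CSpace N × CSpace n => (p.2 - H (p.1, g p)) l) := by
  obtain ⟨X, S, hXS, hlim⟩ := hD.exists_choice
  rintro _ ⟨x₁, hx₁, rfl⟩
  obtain ⟨hX, hS⟩ := hlim x₁ hx₁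
  have hCS : Tendsto (fun p => C * S p) (𝓝[D] (γ x₁, φ x₁)) (𝓝 0) := by
    simpa using hS.const_mul C
  have hmem : ∀ p ∈ D, X p ∈ Metric.ball x₀ δ ∧ S p ∈ Ioo 0 ε := fun p hp =>
    ⟨Metric.ball_subset_ball hδ (hXS p hp).1, (hXS p hp).2.1.1, (hXS p hp).2.1.2.trans_le hε⟩
  have hproj : ∀ w : CSpace n, ‖w l‖ ≤ ‖w‖ := fun w => PiLp.norm_apply_le w l
  set R : RSpace d → CSpace N × CSpace n →L[ℂ] CSpace n := fun x =>
    ContinuousLinearMap.snd ℂ (CSpace N) (CSpace n) -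
      (A x).comp (ContinuousLinearMap.fst ℂ (CSpace N) (CSpace n)) with hR
  refine ⟨?_, (EuclideanSpace.proj l : CSpace n →L[ℂ] ℂ).comp (R x₁), fun h0 => ?_, ?_⟩
  · rw [tendsto_zero_iff_norm_tendsto_zero]
    refine squeeze_zero' (Eventually.of_forall fun _ => norm_nonneg _) ?_ hCS
    filter_upwards [self_mem_nhdsWithin] with p hp
    exact (hproj _).trans (hE.norm_le _ (hmem p hp).1 _ (hmem p hp).2 p (hXS p hp).2.2)
  · have := congrArg (fun L : CSpace N × CSpace n →L[ℂ] ℂ => L (0, EuclideanSpace.single l 1)) h0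
    simp [hR] at this
  · have hAc : ContinuousAt A x₁ := hA.continuousAt
      (Metric.isOpen_ball.mem_nhds (Metric.ball_subset_ball hδ hx₁))
    have hRX : Tendsto (fun p => R (X p)) (𝓝[D] (γ x₁, φ x₁)) (𝓝 (R x₁)) :=
      tendsto_const_nhds.sub (((ContinuousLinearMap.compL ℂ (CSpace N × CSpace n) (CSpace N)
        (CSpace n)).flip (ContinuousLinearMap.fst ℂ (CSpace N) (CSpace n))).continuous.continuousAt.tendsto.comp
          (hAc.tendsto.comp hX))
    have hdiff : Tendsto (fun p =>
        fderiv ℂ (fun p : CSpace N × CSpace n => p.2 - H (p.1, g p)) p - R (X p))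
        (𝓝[D] (γ x₁, φ x₁)) (𝓝 0) := by
      rw [tendsto_zero_iff_norm_tendsto_zero]
      refine squeeze_zero' (Eventually.of_forall fun _ => norm_nonneg _) ?_ hCS
      filter_upwards [self_mem_nhdsWithin] with p hp
      exact hE.fderiv_sub_le _ (hmem p hp).1 _ (hmem p hp).2 p (hXS p hp).2.2
    have hsum := hdiff.add hRX
    simp only [sub_add_cancel, zero_add] at hsum
    have hcomp := ((ContinuousLinearMap.compL ℂ (CSpace N × CSpace n) (CSpace n) ℂ
      (EuclideanSpace.proj l : CSpace n →L[ℂ] ℂ)).continuous.tendsto (R x₁)).comp hsum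
    refine hcomp.congr' ?_
    filter_upwards [self_mem_nhdsWithin] with p hp
    exact (hE.hasFDerivAt_component (hD.subset_thinWedge hδ hε hp) l).fderiv.symm

/-- Where the differential of `w - H (z, g (z, w))` is close to that of the defining function
`w - A z` of the complex tangent space, its components are independent. -/
theorem ScaleFunEstimates.linearIndependent (hE : ScaleFunEstimates γ φ x₀ H A v Λ θ δ a ε C g)
    (hD : IsControlledWedge (fun x => (γ x, φ x)) (Metric.ball x₀ δ₁) v a ε₁ c D) (hδ : δ₁ ≤ δ)
    (hε : ε₁ ≤ ε) (hC : 0 ≤ C) (hCε : C * ε₁ ≤ 1 / 2) {p : CSpace N × CSpace n} (hp : p ∈ D) :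
    LinearIndependent ℂ fun l : Fin n =>
      fderiv ℂ (fun p : CSpace N × CSpace n => (p.2 - H (p.1, g p)) l) p := by
  obtain ⟨x, hx, s, hs, hps, -⟩ := hD.exists_base p hp
  set Φ := fderiv ℂ (fun p : CSpace N × CSpace n => p.2 - H (p.1, g p)) p with hΦ
  have hΦn := (hE.fderiv_sub_le x (Metric.ball_subset_ball hδ hx) s ⟨hs.1, hs.2.trans_le hε⟩ p
    hps).trans ((mul_le_mul_of_nonneg_left hs.2.le hC).trans hCε)
  rw [Fintype.linearIndependent_iff]
  intro b hb
  set L : CSpace n →L[ℂ] ℂ := ∑ l, b l • (EuclideanSpace.proj l : CSpace n →L[ℂ] ℂ) with hL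
  have hLΦ : ∀ q, L (Φ q) = 0 := by
    intro q
    have h1 := congrArg (fun T : CSpace N × CSpace n →L[ℂ] ℂ => T q) hb
    simp_rw [fun l => (hE.hasFDerivAt_component (hD.subset_thinWedge hδ hε hp) l).fderiv] at h1
    simpa [hL, _root_.sum_apply] using h1
  have hL0 : L = 0 := by
    have h2 : ‖L‖ ≤ ‖L‖ * (1 / 2) := by
      refine ContinuousLinearMap.opNorm_le_bound _ (by positivity) fun w => ?_
      have h3 := ContinuousLinearMap.le_of_opNorm_le _ hΦn ((0 : CSpace N), w)
      have h4 : ‖((0 : CSpace N), w)‖ = ‖w‖ := by simp [Prod.norm_def]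
      rw [h4] at h3
      have h5 : (Φ - (ContinuousLinearMap.snd ℂ (CSpace N) (CSpace n) -
          (A x).comp (ContinuousLinearMap.fst ℂ (CSpace N) (CSpace n)))) ((0 : CSpace N), w) =
          Φ (0, w) - w := by simp
      rw [h5] at h3
      have h6 : L w = -L (Φ (0, w) - w) := by rw [map_sub, hLΦ, zero_sub, neg_neg]
      rw [h6, norm_neg]
      refine (L.le_opNorm _).trans ?_
      rw [mul_assoc]
      exact mul_le_mul_of_nonneg_left h3 (norm_nonneg _)
    have h3 := norm_nonneg L
    exact norm_eq_zero.1 (by linarith)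
  intro l
  have := congrArg (fun T : CSpace n →L[ℂ] ℂ => T (EuclideanSpace.single l 1)) hL0
  simpa [hL, _root_.sum_apply, Pi.single_apply] using this

end Graph

theorem monoCLM_apply_of_le {d : ℕ} {U Ω : Opens (RSpace d)} (h : U ≤ Ω) (φ : 𝓓(U, ℝ)) (x : RSpace d) :
    (TestFunction.monoCLM ℝ φ : 𝓓(Ω, ℝ)) x = φ x := by
  rw [TestFunction.monoCLM_apply, if_pos ⟨le_rfl, h⟩]

theorem restrictDist_apply_eq_sum {d : ℕ} {U U₀ Ω : Opens (RSpace d)} (hU : U ≤ U₀) (hU₀ : U₀ ≤ Ω)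
    {f : 𝓓'(Ω, ℂ)} {K : ℕ} {u : Fin K → 𝓓'(U₀, ℂ)} (h : restrictDist f U₀ = ∑ j, u j) (φ : 𝓓(U, ℝ)) :
    restrictDist f U φ = ∑ j, u j (TestFunction.monoCLM ℝ φ : 𝓓(U₀, ℝ)) := by
  have h1 : (TestFunction.monoCLM ℝ φ : 𝓓(Ω, ℝ)) =
      TestFunction.monoCLM ℝ (TestFunction.monoCLM ℝ φ : 𝓓(U₀, ℝ)) := by
    ext x
    rw [monoCLM_apply_of_le (hU.trans hU₀), monoCLM_apply_of_le hU₀, monoCLM_apply_of_le hU]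
  have h2 : restrictDist f U φ = restrictDist f U₀ (TestFunction.monoCLM ℝ φ : 𝓓(U₀, ℝ)) :=
    congrArg f h1
  rw [h2, h]
  simp

theorem IsWedgeGrowth.mono {d N : ℕ} {γ : RSpace d → CSpace N} {B B' : Set (RSpace d)} {u : CSpace N}
    {D : Set (CSpace N)} {F : CSpace N → ℂ} {r η C : ℝ} {l : ℕ}
    (h : IsWedgeGrowth γ B u D F r η C l) (hB : B' ⊆ B) : IsWedgeGrowth γ B' u D F r η C l :=
  ⟨h.isOpen_dom, h.holomorphic, h.nonneg, fun x hx => h.mem x (hB hx), fun x hx => h.growth x (hB hx)⟩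

/-- Wedges of direction `v`, with a narrow cone and small height, are controlled. The bound by
`‖v‖ / 2` on the aperture bounds the height by a multiple of the distance. -/
theorem isControlledWedge_wedge {d : ℕ} {E : Type} [NormedAddCommGroup E] [NormedSpace ℂ E]
    {e : RSpace d → E} {x₀ : RSpace d} {v : E} {a a' a₀ c δ₀ δ₁ ε₁ : ℝ} (hv : 0 < ‖v‖) (hc : 0 < c)
    (ha : a' ≤ a) (ha₀ : a' ≤ a₀) (ha1 : a' ≤ 1) (hav : a' ≤ ‖v‖ / 2) (hδ : δ₁ ≤ δ₀)
    (hest : ∀ x ∈ Metric.ball x₀ δ₀, ∀ x₁ ∈ Metric.ball x₀ δ₀, ∀ s : ℝ, 0 ≤ s →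
      ∀ y, ‖y - s • v‖ ≤ a₀ * s → c * s ≤ ‖e x + y - e x₁‖ ∧ c * ‖x - x₁‖ ≤ ‖e x + y - e x₁‖) :
    IsControlledWedge e (Metric.ball x₀ δ₁) v a ε₁ c
      (wedge e (Metric.ball x₀ δ₁) (coneAbout v a') (‖v‖ / 2 * ε₁)) where
  pos := hc
  exists_base := by
    rintro _ ⟨x, hx, y, ⟨s, hs, hys⟩, hyε, rfl⟩
    have h1 : ‖y‖ ≤ ‖y - s • v‖ + s * ‖v‖ := by
      have := norm_add_le (y - s • v) (s • v)
      rwa [sub_add_cancel, norm_smul, Real.norm_eq_abs, abs_of_pos hs] at this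
    have h2 : s * ‖v‖ ≤ ‖y‖ + ‖y - s • v‖ := by
      have := norm_sub_le y (y - s • v)
      rwa [sub_sub_cancel, norm_smul, Real.norm_eq_abs, abs_of_pos hs] at this
    refine ⟨x, hx, s, ⟨hs, ?_⟩, ?_, ?_,
      fun x₁ hx₁ => hest x (Metric.ball_subset_ball hδ hx) x₁ (Metric.ball_subset_ball hδ hx₁) s hs.le y
        (hys.le.trans (mul_le_mul_of_nonneg_right ha₀ hs.le))⟩
    · have h3 : a' * s ≤ ‖v‖ / 2 * s := mul_le_mul_of_nonneg_right hav hs.le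
      have h4 : ‖v‖ / 2 * s < ‖v‖ / 2 * ε₁ := by linarith
      exact lt_of_mul_lt_mul_left h4 (by positivity)
    · rw [add_sub_cancel_left]
      exact hys.trans_le (mul_le_mul_of_nonneg_right ha hs.le)
    · rw [add_sub_cancel_left]
      have h3 : a' * s ≤ 1 * s := mul_le_mul_of_nonneg_right ha1 hs.le
      linarith

section Sum

variable {d N : ℕ} {W : Type} [NormedAddCommGroup W] [NormedSpace ℂ W]
  {ι : RSpace N →L[ℝ] RSpace d} {γ : RSpace d → CSpace N} {φ : RSpace d → W} {x₀ : RSpace d}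
  {H : CSpace N × ℂ → W} {A : RSpace d → CSpace N →L[ℂ] W} {v : CSpace N × W}
  {Λ θ δ a ε C : ℝ} {g : CSpace N × W → ℂ} {δ₁ ε₁ c : ℝ} {D : Set (CSpace N × W)}

/-- Over a controlled wedge, the translate of a point by the scale function lies in the wedge of a
holomorphic function of slow growth. -/
theorem ScaleFunEstimates.exists_mem_growth (hE : ScaleFunEstimates γ φ x₀ H A v Λ θ δ a ε C g)
    (hD : IsControlledWedge (fun x => (γ x, φ x)) (Metric.ball x₀ δ₁) v a ε₁ c D) (hδ : δ₁ ≤ δ)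
    (hε : ε₁ ≤ ε) (hΛ : 0 < Λ) (ha : a ≤ 1) {u : CSpace N} {D' : Set (CSpace N)} {F : CSpace N → ℂ}
    {r η C₂ : ℝ} {l : ℕ} (hF : IsWedgeGrowth γ (Metric.ball x₀ δ₁) u D' F r η C₂ l)
    (hr : (‖v.1‖ + 1) / Λ + θ * ‖u‖ < r) (hη : Λ * ε₁ < η) {p : CSpace N × W} (hp : p ∈ D) :
    p.1 + g p • u ∈ D' ∧ ∃ x ∈ Metric.ball x₀ δ₁, ∃ s ∈ Ioo 0 ε₁,
      ‖p - (γ x, φ x)‖ ≤ s * (‖v‖ + 1) ∧ ‖F (p.1 + g p • u)‖ ≤ C₂ * ((Λ * s) ^ l)⁻¹ := by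
  obtain ⟨x, hx, s, hs, hps, hpn, -⟩ := hD.exists_base p hp
  have hs0 : 0 < s := hs.1
  obtain ⟨w, hw, hweq⟩ := exists_scale_translate_eq hΛ ha hr hs0 le_rfl (p := p.1) (z := γ x)
    ((norm_fst_le (p - (γ x, φ x) - s • v)).trans_lt hps)
    (hE.near x (Metric.ball_subset_ball hδ hx) s ⟨hs0, hs.2.trans_le hε⟩ p hps)
  rw [zero_smul, add_zero, add_zero] at hweq
  have hΛs : Λ * s ∈ Ioo 0 η :=
    ⟨by positivity, (mul_le_mul_of_nonneg_left hs.2.le hΛ.le).trans_lt hη⟩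
  rw [hweq]
  exact ⟨hF.mem x hx _ hΛs w hw, x, hx, s, hs, hpn, hF.growth x hx _ hΛs w hw⟩

theorem ScaleFunEstimates.differentiableAt_comp (hE : ScaleFunEstimates γ φ x₀ H A v Λ θ δ a ε C g)
    (hD : IsControlledWedge (fun x => (γ x, φ x)) (Metric.ball x₀ δ₁) v a ε₁ c D) (hδ : δ₁ ≤ δ)
    (hε : ε₁ ≤ ε) (hΛ : 0 < Λ) (ha : a ≤ 1) {u : CSpace N} {D' : Set (CSpace N)} {F : CSpace N → ℂ}
    {r η C₂ : ℝ} {l : ℕ} (hF : IsWedgeGrowth γ (Metric.ball x₀ δ₁) u D' F r η C₂ l)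
    (hr : (‖v.1‖ + 1) / Λ + θ * ‖u‖ < r) (hη : Λ * ε₁ < η) {p : CSpace N × W} (hp : p ∈ D) :
    DifferentiableAt ℂ (fun p : CSpace N × W => F (p.1 + g p • u)) p := by
  obtain ⟨x, hx, s, hs, hps, -⟩ := hD.exists_base p hp
  have hg : DifferentiableAt ℂ g p := (hE.bdd 1).differentiableAt (t := ())
    ⟨x, Metric.ball_subset_ball hδ hx, s, ⟨hs.1, hs.2.trans_le hε⟩, hps⟩
  have h1 := hF.holomorphic.differentiableAt (hF.isOpen_dom.mem_nhds
    (hE.exists_mem_growth hD hδ hε hΛ ha hF hr hη hp).1)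
  exact DifferentiableAt.comp (g := F) p h1 (differentiableAt_fst.add (hg.smul_const u))

/-- A finite sum of boundary values extends to the wedge over the graph. -/
theorem ScaleFunEstimates.isWedgeExtension_sum [CompleteSpace W]
    (hE : ScaleFunEstimates γ φ x₀ H A v Λ θ δ a ε C g) (hε0 : 0 < ε₁) (hε1 : ε₁ ≤ 1) (hΛ : 0 < Λ)
    (hθ : 0 < θ) (ha : a ≤ 1) (hC : 0 < C) {Ω : Set (RSpace d)} (hΩ : IsOpen Ω)
    (hγ : ContDiffOn ℝ ∞ γ Ω) (hφ : ContDiffOn ℝ ∞ φ Ω) (hδ : δ₁ ≤ δ) (hε : ε₁ ≤ ε)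
    (hΩδ : Metric.closedBall x₀ δ₁ ⊆ Ω)
    (htan : ∀ x ∈ Metric.ball x₀ δ, ∀ ξ, fderiv ℝ φ x ξ = A x (fderiv ℝ γ x ξ)) {η₁ C₁ : ℝ}
    (hη₁ : 0 < η₁) (hfr : ∀ x ∈ Metric.ball x₀ δ₁, ∀ Z : CSpace N →L[ℂ] CSpace N,
      ‖Z - frame ι γ x‖ < η₁ → IsUnit Z ∧ ‖Ring.inverse Z‖ ≤ C₁)
    {U : Opens (RSpace d)} (hU : (U : Set (RSpace d)) = Metric.ball x₀ δ₁) {a' ε' : ℝ} (ha' : a' ≤ a)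
    (hε' : 0 < ε')
    (hD : IsControlledWedge (fun x => (γ x, φ x)) (Metric.ball x₀ δ₁) v a ε₁ c
      (wedge (fun x => (γ x, φ x)) U (coneAbout v a') ε'))
    {K : ℕ} {u : Fin K → CSpace N} {D' : Fin K → Set (CSpace N)} {F : Fin K → CSpace N → ℂ}
    {r η C₂ : Fin K → ℝ} {l : Fin K → ℕ}
    (hF : ∀ j, IsWedgeGrowth γ (Metric.ball x₀ δ₁) (u j) (D' j) (F j) (r j) (η j) (C₂ j) (l j))
    (hr : ∀ j, (‖v.1‖ + 1) / Λ + θ * ‖u j‖ < r j) (hη : ∀ j, Λ * ε₁ < η j) {T : 𝓓'(U, ℂ)}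
    {L : Fin K → 𝓓(U, ℝ) → ℂ} (hT : ∀ ψ, T ψ = ∑ j, L j ψ)
    (hL : ∀ j, ∀ ψ : 𝓓(U, ℝ), Tendsto (fun τ : ℝ => ∫ x, ψ x • F j (γ x + τ • u j)) (𝓝[>] 0)
      (𝓝 (L j ψ))) :
    IsWedgeExtension (fun x => (γ x, φ x)) U (coneAbout v a') ε' T
      (fun p : CSpace N × W => ∑ j, F j (p.1 + g p • u j)) where
  holomorphic p hp := (DifferentiableAt.fun_sum fun j _ => hE.differentiableAt_comp hD hδ hε hΛ ha
    (hF j) (hr j) (hη j) hp).differentiableWithinAt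
  slowGrowth := by
    -- The exponent has to be positive, and at least each of the `l j`.
    set l' := 1 + ∑ j, l j with hl'
    refine ⟨∑ j, C₂ j * (Λ ^ l j)⁻¹ * (‖v‖ + 1) ^ l', l', by omega, fun p hp => ?_⟩
    refine (mul_le_mul_of_nonneg_right (norm_sum_le _ _)
      (pow_nonneg Metric.infDist_nonneg _)).trans ?_
    rw [Finset.sum_mul]
    refine Finset.sum_le_sum fun j _ => ?_
    obtain ⟨-, x, hx, s, hs, hps, hg⟩ :=
      hE.exists_mem_growth hD hδ hε hΛ ha (hF j) (hr j) (hη j) hp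
    have hs0 : 0 < s := hs.1
    have hdist : Metric.infDist p ((fun x => (γ x, φ x)) '' U) ≤ s * (‖v‖ + 1) :=
      (Metric.infDist_le_dist_of_mem (mem_image_of_mem _ (hU ▸ hx))).trans
        (by rw [dist_eq_norm]; exact hps)
    have hlj : l j ≤ l' := (Finset.single_le_sum (fun i _ => Nat.zero_le (l i))
      (Finset.mem_univ j)).trans (by omega)
    have hC₂ := (hF j).nonneg
    calc _ ≤ C₂ j * ((Λ * s) ^ l j)⁻¹ * (s * (‖v‖ + 1)) ^ l' :=
          mul_le_mul hg (pow_le_pow_left₀ Metric.infDist_nonneg hdist _)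
            (pow_nonneg Metric.infDist_nonneg _) (by positivity)
      _ = C₂ j * (Λ ^ l j)⁻¹ * (‖v‖ + 1) ^ l' * (s ^ l' / s ^ l j) := by
          rw [mul_pow, mul_pow, mul_inv]
          field_simp
      _ ≤ C₂ j * (Λ ^ l j)⁻¹ * (‖v‖ + 1) ^ l' * 1 := by
          refine mul_le_mul_of_nonneg_left ?_ (by positivity)
          rw [div_le_one (by positivity)]
          exact pow_le_pow_of_le_one hs0.le (hs.2.le.trans hε1) hlj
      _ = _ := mul_one _
  boundaryValue := by
    rintro y hy ψ
    obtain ⟨s₀, hs₀, hys⟩ := id hy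
    set K' := tsupport ψ with hK'
    have hK'c : IsCompact K' := ψ.hasCompactSupport
    have hK'B : K' ⊆ Metric.ball x₀ δ₁ := hU ▸ ψ.tsupport_subset
    have hψ0 : ∀ x ∉ K', ((ψ x : ℝ) : ℂ) = 0 := fun x hx => by
      rw [image_eq_zero_of_notMem_tsupport hx, Complex.ofReal_zero]
    have hψc : ContDiff ℝ ∞ fun x => ((ψ x : ℝ) : ℂ) := Complex.ofRealCLM.contDiff.comp ψ.contDiff
    have hys' : ‖y - s₀ • v‖ < a * s₀ := hys.trans_le (mul_le_mul_of_nonneg_right ha' hs₀.le)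
    have hterm := fun j => hE.tendsto_integral (hε0.trans_le hε) hΛ hθ ha hC hΩ hγ hφ hδ hΩδ htan hη₁
      hfr ((mul_pos hΛ hε0).trans (hη j)) (hF j) (hr j) hs₀ hys' hψc hK'c hK'B hψ0
      (L := L j ψ) (by simpa only [Complex.real_smul] using hL j ψ)
    rw [hT]
    refine (tendsto_finsetSum _ fun j _ => hterm j).congr' ?_
    -- The integrals of the summands converge, once the shifted edge lies in the wedge.
    have h1 : Tendsto (fun t : ℝ => ‖t • y‖) (𝓝[>] 0) (𝓝 0) := by
      have : Continuous fun t : ℝ => ‖t • y‖ := by fun_prop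
      exact tendsto_nhdsWithin_of_tendsto_nhds (by simpa using this.tendsto 0)
    filter_upwards [h1.eventually_lt_const hε', self_mem_nhdsWithin] with t ht ht0
    have ht0 : 0 < t := ht0
    have hmem : ∀ x ∈ Metric.ball x₀ δ₁, (γ x, φ x) + t • y ∈
        wedge (fun x => (γ x, φ x)) U (coneAbout v a') ε' := fun x hx =>
      ⟨x, hU ▸ hx, t • y, ⟨t * s₀, by positivity, by
        rw [mul_smul, ← smul_sub, norm_smul, Real.norm_eq_abs, abs_of_pos ht0]
        nlinarith⟩, ht, rfl⟩
    have hsub : Metric.ball x₀ δ₁ ⊆ Ω := Metric.ball_subset_closedBall.trans hΩδ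
    have hcont : ContinuousOn (fun x => (γ x, φ x) + t • y) (Metric.ball x₀ δ₁) :=
      ((hγ.continuousOn.mono hsub).prodMk (hφ.continuousOn.mono hsub)).add continuousOn_const
    have hint : ∀ j, Integrable fun x => ((ψ x : ℝ) : ℂ) *
        F j (((γ x, φ x) + t • y).1 + g ((γ x, φ x) + t • y) • u j) := by
      intro j
      have hc : ContinuousOn (fun p : CSpace N × W => F j (p.1 + g p • u j))
          (wedge (fun x => (γ x, φ x)) U (coneAbout v a') ε') := fun p hp =>
        (hE.differentiableAt_comp hD hδ hε hΛ ha (hF j) (hr j) (hη j)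
          hp).continuousAt.continuousWithinAt
      have hcF := hc.comp hcont hmem
      refine Continuous.integrable_of_hasCompactSupport ?_
        (HasCompactSupport.intro hK'c fun x hx => by rw [hψ0 x hx, zero_mul])
      exact continuous_of_continuousOn_of_eq_zero Metric.isOpen_ball hK'c hK'B
        (hψc.continuous.continuousOn.mul hcF) fun x hx => by
          show ((ψ x : ℝ) : ℂ) * _ = 0
          rw [hψ0 x hx, zero_mul]
    simp only [Complex.real_smul, Finset.mul_sum]
    exact (integral_finsetSum _ fun j _ => hint j).symm

end Sum

end

theorem theorem1p2 (k m n : ℕ)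
    -- the generic submanifold, the CR map, and the point at the base
    (M : Set (CSpace (k + m))) (hM : IsGenericSubmanifold k m M)
    (h : CSpace (k + m) → CSpace n) (hCR : IsCRMap (2 * k + m) M h)
    (Ω : Opens (RSpace (2 * k + m))) (γ : RSpace (2 * k + m) → CSpace (k + m))
    (hγ : IsLocalParam M Ω γ)
    (x₀ : RSpace (2 * k + m)) (hx₀ : x₀ ∈ Ω)
    -- each component of `h` is decomposable at the base point
    (hdec : ∀ l : Fin n, IsDecomposableAt γ (distOfFun Ω (fun x => h (γ x) l)) x₀)
    -- a vector which is complex transversal to the graph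
    (v : CSpace (k + m) × CSpace n)
    (hv : v ∉ complexTangentSpan (graphParam γ h) x₀)
    -- a decomposable CR distribution
    (f : 𝓓'(Ω, ℂ)) (hfCR : IsCRDistribution γ f) (hf : IsDecomposableAt γ f x₀) :
    ∃ (U : Opens (RSpace (2 * k + m))) (Γ : Set (CSpace (k + m) × CSpace n)) (ε : ℝ),
      U ≤ Ω ∧ x₀ ∈ U ∧ IsOpenConvexCone Γ ∧ v ∈ Γ ∧ 0 < ε ∧
      (∃ F : CSpace (k + m) × CSpace n → ℂ,
        IsWedgeExtension (graphParam γ h) U Γ ε (restrictDist f U) F) ∧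
      ∃ G : Fin n → (CSpace (k + m) × CSpace n → ℂ),
        (∀ l, DifferentiableOn ℂ (G l) (wedge (graphParam γ h) U Γ ε)) ∧
        (∀ z ∈ wedge (graphParam γ h) U Γ ε,
          LinearIndependent ℂ (fun l => fderiv ℂ (G l) z)) ∧
        ∀ l, VanishesToOrderOne (wedge (graphParam γ h) U Γ ε)
          (graphParam γ h '' U) (G l) := by
  have hge : graphParam γ h = fun x => (γ x, h (γ x)) := rfl
  rw [hge] at hv ⊢
  obtain ⟨hφ, hφCR⟩ := hCR Ω γ hγ
  set φ : RSpace (2 * k + m) → CSpace n := fun x => h (γ x) with hφ_def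
  have hspan := hM.complexTangentSpan_eq_top hγ hx₀
  have hstγ := hγ.hasStrictFDerivAt hx₀
  have hstφ : HasStrictFDerivAt φ (fderiv ℝ φ x₀) x₀ :=
    (hφ.contDiffAt (Ω.isOpen.mem_nhds hx₀)).hasStrictFDerivAt (by simp)
  have hfd := (hstγ.hasFDerivAt.prodMk hstφ.hasFDerivAt).fderiv
  have hv_range : v ∉ range ((fderiv ℝ γ x₀).prod (fderiv ℝ φ x₀)) := by
    intro hv'
    rw [← hfd] at hv'
    exact hv (Submodule.subset_span hv')
  have hv0 : 0 < ‖v‖ := norm_pos_iff.2 fun h0 => hv (h0 ▸ Submodule.zero_mem _)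
  -- The approximate extension of `h ∘ γ`, and the transversal functional.
  obtain ⟨δA, hδA, κ, hκ, hκ1, hδAΩ, H, A, hHA⟩ :=
    exists_isApproxExtension Ω.isOpen hγ.smooth hφ hx₀ hspan hφCR
  have hHA' := hHA.mono (half_le_self hδA.le)
  have hcb : Metric.closedBall x₀ (δA / 2) ⊆ Ω :=
    (Metric.closedBall_subset_ball (by linarith)).trans hδAΩ
  have hγb : ∃ B : ℝ, ∀ x ∈ Metric.ball x₀ (δA / 2), ‖γ x‖ ≤ B := by
    obtain ⟨B, hB⟩ := (isCompact_closedBall x₀ (δA / 2)).exists_bound_of_continuousOn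
      (hγ.smooth.continuousOn.mono hcb)
    exact ⟨B, fun x hx => hB x (Metric.ball_subset_closedBall hx)⟩
  obtain ⟨ℓ, hℓ⟩ := exists_clm_eq_one_of_notMem hstγ.differentiableAt hstφ.differentiableAt
    (hHA.tangent x₀ (Metric.mem_ball_self hδA)) hspan hv
  -- The summands of `f`.
  obtain ⟨U₀, hU₀Ω, hx₀U₀, K, u', hsum, hdec'⟩ := hf
  choose hCR' Γ ε F hΓ hε hF using hdec'
  choose u hu δF hδF r hr η hη C₂ l hgrowth using fun j =>
    (hF j).exists_isWedgeGrowth (hΓ j) (hε j) hγ hU₀Ω hx₀U₀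
  -- A large `Λ` makes `v'` negligible in comparison with the translation by `g u j`.
  obtain ⟨Λ, hΛ, hΛκ, hΛr⟩ : ∃ Λ > 0, ‖v.1‖ + 1 < κ * Λ ∧ ∀ j, (‖v.1‖ + 1) / Λ < r j / 2 := by
    have h1 : Tendsto (fun Λ : ℝ => κ * Λ) atTop atTop := tendsto_id.const_mul_atTop hκ
    have h2 : Tendsto (fun Λ : ℝ => (‖v.1‖ + 1) / Λ) atTop (𝓝 0) :=
      tendsto_const_nhds.div_atTop tendsto_id
    obtain ⟨Λ, ⟨h3, h4⟩, h5⟩ := ((h1.eventually_gt_atTop (‖v.1‖ + 1)).and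
      (eventually_all.2 fun j => h2.eventually_lt_const (half_pos (hr j))) |>.and
      (eventually_gt_atTop 0)).exists
    exact ⟨Λ, h5, h3, h4⟩
  have hlin : ∀ c : ℝ, Tendsto (fun t : ℝ => t * c) (𝓝[>] 0) (𝓝 0) := fun c => by
    have : Continuous fun t : ℝ => t * c := by fun_prop
    exact tendsto_nhdsWithin_of_tendsto_nhds (by simpa using this.tendsto 0)
  have hid : Tendsto (fun t : ℝ => t) (𝓝[>] 0) (𝓝 0) := nhdsWithin_le_nhds
  obtain ⟨θ, hθ, hθκ, hθr⟩ : ∃ θ > 0, θ < κ ∧ ∀ j, θ * ‖u j‖ < r j / 2 := by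
    obtain ⟨θ, ⟨h3, h4⟩, h5⟩ := ((hid.eventually_lt_const hκ).and
      (eventually_all.2 fun j => (hlin ‖u j‖).eventually_lt_const (half_pos (hr j))) |>.and
      self_mem_nhdsWithin).exists
    exact ⟨θ, h5, h3, h4⟩
  obtain ⟨δ, hδ, a, ha, ε₀, hε₀, C, hC, g, hE⟩ := hHA'.exists_scaleFunEstimates (half_pos hδA) hκ
    (by linarith) hγb hℓ hΛ hΛκ hθ hθκ
  obtain ⟨ι, hι⟩ := exists_isUnit_frame hspan
  have hfc : ContinuousAt (frame ι γ) x₀ := by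
    have h1 : ContinuousAt (fderiv ℝ γ) x₀ :=
      (hγ.smooth.contDiffAt (Ω.isOpen.mem_nhds hx₀)).continuousAt_fderiv (by simp)
    exact (complexify ι).continuous.continuousAt.comp h1
  obtain ⟨δf, hδf, η₁, hη₁, C₁, hfr⟩ := exists_frame_bound hfc hι
  obtain ⟨c, hc, δt, hδt, a₀, ha₀, hest⟩ := exists_transversal_estimate
    (hstγ.prodMk hstφ) (fun ξ ξ' hξ => hγ.immersion x₀ hx₀ (congrArg Prod.fst hξ)) hv_range
  obtain ⟨δU, hδU, hδU₀⟩ := Metric.isOpen_iff.1 U₀.isOpen x₀ hx₀U₀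
  -- The size of the edge and the height of the wedge.
  obtain ⟨δ₁, hδ₁, h1δ, h1U, h1f, h1t, h1F⟩ : ∃ δ₁ > 0, δ₁ < δ ∧ δ₁ < δU ∧ δ₁ < δf ∧ δ₁ < δt ∧
      ∀ j, δ₁ < δF j := by
    obtain ⟨δ₁, ⟨⟨⟨⟨h1, h2⟩, h3⟩, h4⟩, h5⟩, h6⟩ := ((hid.eventually_lt_const hδ.1).and
      (hid.eventually_lt_const hδU) |>.and (hid.eventually_lt_const hδf) |>.and
      (hid.eventually_lt_const hδt) |>.and
      (eventually_all.2 fun j => hid.eventually_lt_const (hδF j)) |>.and self_mem_nhdsWithin).exists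
    exact ⟨δ₁, h6, h1, h2, h3, h4, h5⟩
  obtain ⟨ε₁, hε₁, h1ε, h1C, h1η⟩ : ∃ ε₁ > 0, ε₁ < ε₀ ∧ ε₁ * C < 1 / 2 ∧ ∀ j, ε₁ * Λ < η j := by
    obtain ⟨ε₁, ⟨⟨h1, h2⟩, h3⟩, h4⟩ := ((hid.eventually_lt_const hε₀.1).and
      ((hlin C).eventually_lt_const one_half_pos) |>.and
      (eventually_all.2 fun j => (hlin Λ).eventually_lt_const (hη j)) |>.and
      self_mem_nhdsWithin).exists
    exact ⟨ε₁, h4, h1, h2, h3⟩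
  set a' := min (min a a₀) (‖v‖ / 2) with ha'
  have ha'0 : 0 < a' := lt_min (lt_min ha.1 ha₀) (half_pos hv0)
  have ha'a : a' ≤ a := (min_le_left _ _).trans (min_le_left _ _)
  have hD := isControlledWedge_wedge (ε₁ := ε₁) hv0 hc ha'a
    ((min_le_left _ _).trans (min_le_right a a₀)) (ha'a.trans ha.2.le) (min_le_right _ _) h1t.le hest
  set U : Opens (RSpace (2 * k + m)) := ⟨Metric.ball x₀ δ₁, Metric.isOpen_ball⟩ with hU
  have hUU₀ : U ≤ U₀ := fun x hx => hδU₀ (Metric.ball_subset_ball h1U.le hx)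
  have hε' : 0 < ‖v‖ / 2 * ε₁ := by positivity
  have htan : ∀ x ∈ Metric.ball x₀ δ, ∀ ξ, fderiv ℝ φ x ξ = A x (fderiv ℝ γ x ξ) := fun x hx =>
    hHA'.tangent x (Metric.ball_subset_ball hδ.2 hx)
  have hcont : ContinuousOn A (Metric.ball x₀ δ) :=
    hHA'.continuousOn.mono (Metric.ball_subset_ball hδ.2)
  refine ⟨U, coneAbout v a', ‖v‖ / 2 * ε₁, hUU₀.trans hU₀Ω, Metric.mem_ball_self hδ₁,
    isOpenConvexCone_coneAbout ha'0, mem_coneAbout_self ha'0, hε',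
    ⟨fun p => ∑ j, F j (p.1 + g p • u j), ?_⟩,
    fun l p => (p.2 - H (p.1, g p)) l, fun l p hp => ?_, fun p hp => ?_, fun l => ?_⟩
  · refine hE.isWedgeExtension_sum (ι := ι) hε₁ (h1ε.le.trans hε₀.2.le) hΛ hθ ha.2.le hC Ω.isOpen
      hγ.smooth hφ h1δ.le h1ε.le ((Metric.closedBall_subset_closedBall (h1δ.le.trans hδ.2)).trans hcb)
      htan hη₁ (fun x hx => hfr x (Metric.ball_subset_ball h1f.le hx)) rfl ha'a hε' hD
      (fun j => (hgrowth j).mono (Metric.ball_subset_ball (h1F j).le)) (fun j => ?_)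
      (fun j => by rw [mul_comm]; exact h1η j)
      (fun ψ => restrictDist_apply_eq_sum hUU₀ hU₀Ω hsum ψ) fun j ψ => ?_
    · linarith [hΛr j, hθr j]
    · have := (hF j).boundaryValue (u j) (hu j) (TestFunction.monoCLM ℝ ψ : 𝓓(U₀, ℝ))
      simpa only [monoCLM_apply_of_le hUU₀] using this
  · exact (hE.hasFDerivAt_component (hD.subset_thinWedge h1δ.le h1ε.le hp)
      l).differentiableAt.differentiableWithinAt
  · exact hE.linearIndependent hD h1δ.le h1ε.le hC.le (by rw [mul_comm]; exact h1C.le) hp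
  · exact hE.vanishesToOrderOne hD h1δ.le h1ε.le hcont l
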